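/- Let $(\Omega,\mathcal A,\mathbb P)$ be a probability space carrying a strictly stationary sequence $(Y_i)_{i\in\mathbb Z}$ of real random variables and a sequence $(\delta_i)_{i\in\mathbb Z}$ of independent random variables, uniformly distributed over $[0,1]$, independent of $(Y_i)_{i\in\mathbb Z}$. Let $\mathcal F_0=\sigma((Y_k,\delta_k):k\le 0)$ and write $Z^{(0)}=Z-\mathbb E(Z)$. Set $\alpha(0)=1$ and, for $n\ge1$, $$\alpha(n)=\max_{1\le l\le 2}\ \sup_{n\le i_1\le\dots\le i_l}\ \sup_{x\in\mathbb R^l}\Big\|\,\mathbb E\Big(\prod_{j=1}^l(\mathbf 1_{Y_{i_j}\le x_j})^{(0)}\Big|\mathcal F_0\Big)^{(0)}\Big\|_1 .$$ For a nonnegative random variable $X$ let $Q_X(u)=\inf\{t\ge0:\mathbb P(X>t)\le u\}$, $u\in[0,1]$ (with $\inf\emptyset=\infty$). Let $Q$ be an integrable quantile function, that is, $Q=Q_X$ on $[0,1]$ for some nonnegative random variable $X$, and $\int_0^1Q(u)\,du<\infty$. Let $\widetilde{\mathrm{Mon}}(Q,P_{Y_0})$ be the set of functions $g:\mathbb R\to\mathbb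 R$ that are monotonic on some open interval and null elsewhere and satisfy $Q_{|g(Y_0)|}\le Q$, and let $\widetilde{\mathcal F}(Q,P_{Y_0})$ be the closure in $\mathbb L^1(P_{Y_0})$ of the set of finite sums $\sum_{\ell=1}^La_\ell f_\ell$ with $\sum_{\ell=1}^L|a_\ell|\le1$ and $f_\ell\in\widetilde{\mathrm{Mon}}(Q,P_{Y_0})$. Put $\alpha^{-1}(x)=\min\{q\in\mathbb N:\alpha(q)\le x\}$ (with $\min\emptyset=\infty$), $R(x)=\alpha^{-1}(x)\,(Q(x)\vee1)$ and $$M_{2,\alpha}(Q)=\int_0^1R(u)Q(u)\,du,\qquad M_{3,\alpha}(Q,\lambda)=\int_0^1Q(u)R(u)\,(R(u)\wedge\lambda)\,du\quad(\lambda>0),$$ with the convention $0\cdot\infty=0$. There exist positive universal constants $c_1,c_2,c_3,c_4$ such that the following holds for all such $(\Omega,\mathcal A,\mathbb P)$, $(Y_i)$, $(\delta_i)$ and $Q$ and for every $f\in\widetilde{\mathcal F}(Q,P_{Y_0})$. Let $X_i=f(Y_i)-\mathbb E(f(Y_i))$, $S_k=\sum_{i=1}^kX_i$ and $S_n^*=\max_{1\le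 k\le n}|S_k|$. If $M_{2,\alpha}(Q)<\infty$, then the variables $X_0X_k$ $(k\ge0)$ are integrable, the series $\mathbb E(X_0^2)+2\sum_{k\ge1}\mathbb E(X_0X_k)$ converges to some nonnegative real $\sigma^2$ (with $\sigma\ge0$) and, for every integer $n\ge1$ and every real $\lambda>0$, $$\mathbb P(S_n^*\ge5\lambda)\le c_1\exp\Big(-\frac{\lambda^2}{c_2n\sigma^2}\Big)+c_3\,n\lambda^{-3}M_{3,\alpha}(Q,\lambda)+c_4\,n\sigma^3\lambda^{-3},$$ where the first term on the right-hand side is read as $0$ if $\sigma^2=0$. -/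

import Mathlib

open MeasureTheory ProbabilityTheory Filter Topology
open scoped NNReal ENNReal

noncomputable section

/-- The upper tail quantile function `Q_X(u) = inf {t ≥ 0 : P(X > t) ≤ u}`, with values in
`[0, ∞]` (the infimum of the empty set is `∞`, which can only occur at `u ≤ 0`). -/
def upperQuantile {Ω : Type*} [MeasurableSpace Ω] (μ : Measure Ω) (X : Ω → ℝ) (u : ℝ) : ℝ≥0∞ :=
  ⨅ (t : ℝ≥0) (_ : μ {ω | (t : ℝ) < X ω} ≤ ENNReal.ofReal u), (t : ℝ≥0∞)

/-- `Q` is, on `[0, 1]`, the upper tail quantile function of some nonnegative random variable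
(here represented by its law `ν`). -/
def IsQuantileFunction (Q : ℝ → ℝ≥0∞) : Prop :=
  ∃ ν : Measure ℝ, IsProbabilityMeasure ν ∧ (∀ᵐ x ∂ν, 0 ≤ x) ∧
    ∀ u ∈ Set.Icc (0 : ℝ) 1, Q u = upperQuantile ν (fun x => x) u

/-- The class `Mon~(Q, μ)`: functions that are monotonic on some open interval of `ℝ` and null
elsewhere, with `Q_{|g(X)|} ≤ Q` on `[0, 1]` when `X` has law `μ`. -/
def monClass (Q : ℝ → ℝ≥0∞) (μ : Measure ℝ) : Set (ℝ → ℝ) :=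
  {g | (∃ I : Set ℝ, IsOpen I ∧ I.OrdConnected ∧ (MonotoneOn g I ∨ AntitoneOn g I) ∧
          ∀ x, x ∉ I → g x = 0) ∧
        ∀ u ∈ Set.Icc (0 : ℝ) 1, upperQuantile μ (fun x => |g x|) u ≤ Q u}

/-- Finite combinations `∑ a_l f_l` with `∑ |a_l| ≤ 1` and every `f_l` in `Mon~(Q, μ)`. -/
def monHull (Q : ℝ → ℝ≥0∞) (μ : Measure ℝ) : Set (ℝ → ℝ) :=
  {h | ∃ (L : ℕ) (a : Fin L → ℝ) (g : Fin L → ℝ → ℝ),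
        (∑ l, |a l|) ≤ 1 ∧ (∀ l, g l ∈ monClass Q μ) ∧ h = fun x => ∑ l, a l * g l x}

/-- The class `F~(Q, μ)`: the closure of `monHull Q μ` in `L¹(μ)`. -/
def closedClass (Q : ℝ → ℝ≥0∞) (μ : Measure ℝ) : Set (ℝ → ℝ) :=
  {f | MemLp f 1 μ ∧ ∀ ε : ℝ≥0∞, 0 < ε → ∃ h ∈ monHull Q μ, eLpNorm (f - h) 1 μ < ε}

/-- `X^{(0)} = X - E(X)`. -/
def centered {Ω : Type*} [MeasurableSpace Ω] (μ : Measure Ω) (X : Ω → ℝ) : Ω → ℝ :=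
  fun ω => X ω - ∫ ω', X ω' ∂μ

/-- The σ-algebra `F_n = σ((Y_k, δ_k) : k ≤ n)`. -/
abbrev pastSigma {Ω : Type*} (Y δ : ℤ → Ω → ℝ) (n : ℤ) : MeasurableSpace Ω :=
  ⨆ (k : ℤ) (_ : k ≤ n), MeasurableSpace.comap (fun ω => (Y k ω, δ k ω)) inferInstance

/-- The coefficient
`α(m, (Z_1, …, Z_l)) = sup_x ‖ E( ∏_j (1_{Z_j ≤ x_j})^{(0)} | m )^{(0)} ‖₁`. -/
def depCoef {Ω : Type*} (m : MeasurableSpace Ω) {mΩ : MeasurableSpace Ω} (μ : Measure Ω)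
    {l : ℕ} (Z : Fin l → Ω → ℝ) : ℝ≥0∞ :=
  ⨆ x : Fin l → ℝ,
    eLpNorm (centered μ
      (μ[fun ω => ∏ j, centered μ (Set.indicator {ω' | Z j ω' ≤ x j} (fun _ => (1 : ℝ))) ω | m]))
      1 μ

/-- `α_{k,Y}(0) = 1` and, for `n > 0`, `α_{k,Y}(n)` is the maximum over `1 ≤ l ≤ k` of the
supremum over `n ≤ i_1 ≤ … ≤ i_l` of `α(F_0, (Y_{i_1}, …, Y_{i_l}))`. -/
def alphaCoef {Ω : Type*} [MeasurableSpace Ω] (μ : Measure Ω) (Y δ : ℤ → Ω → ℝ)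
    (k n : ℕ) : ℝ≥0∞ :=
  if n = 0 then 1
  else
    ⨆ (l : ℕ) (_ : 1 ≤ l ∧ l ≤ k) (i : Fin l → ℤ) (_ : Monotone i ∧ ∀ j, (n : ℤ) ≤ i j),
      depCoef (pastSigma Y δ 0) μ (fun j => Y (i j))

/-- `α⁻¹_{2,Y}(x) = min {q ∈ ℕ : α_{2,Y}(q) ≤ x}`, equal to `∞` if there is no such `q`. -/
def alphaInv {Ω : Type*} [MeasurableSpace Ω] (μ : Measure Ω) (Y δ : ℤ → Ω → ℝ)
    (x : ℝ) : ℝ≥0∞ :=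
  ⨅ (q : ℕ) (_ : alphaCoef μ Y δ 2 q ≤ ENNReal.ofReal x), (q : ℝ≥0∞)

/-- `R(x) = α⁻¹_{2,Y}(x) (Q(x) ∨ 1)`. -/
def RFun {Ω : Type*} [MeasurableSpace Ω] (μ : Measure Ω) (Y δ : ℤ → Ω → ℝ)
    (Q : ℝ → ℝ≥0∞) (x : ℝ) : ℝ≥0∞ :=
  alphaInv μ Y δ x * max (Q x) 1

/-- `M_{2,α}(Q) = ∫_0^1 R(u) Q(u) du`. -/
def M2 {Ω : Type*} [MeasurableSpace Ω] (μ : Measure Ω) (Y δ : ℤ → Ω → ℝ)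
    (Q : ℝ → ℝ≥0∞) : ℝ≥0∞ :=
  ∫⁻ u in Set.Icc (0 : ℝ) 1, RFun μ Y δ Q u * Q u

/-- `M_{3,α}(Q, lam) = ∫_0^1 Q(u) R(u) (R(u) ∧ lam) du`. -/
def M3 {Ω : Type*} [MeasurableSpace Ω] (μ : Measure Ω) (Y δ : ℤ → Ω → ℝ)
    (Q : ℝ → ℝ≥0∞) (lam : ℝ) : ℝ≥0∞ :=
  ∫⁻ u in Set.Icc (0 : ℝ) 1,
    Q u * RFun μ Y δ Q u * min (RFun μ Y δ Q u) (ENNReal.ofReal lam)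

/-- Strict stationarity: the law of the whole process on `ℤ` is invariant under every shift. -/
def IsStrictlyStationary {Ω : Type*} [MeasurableSpace Ω] (μ : Measure Ω)
    (Y : ℤ → Ω → ℝ) : Prop :=
  ∀ s : ℤ, μ.map (fun ω (i : ℤ) => Y (i + s) ω) = μ.map (fun ω (i : ℤ) => Y i ω)

/-- The centered variables `X_i = f(Y_i) - E(f(Y_i))`. -/
def XVar {Ω : Type*} [MeasurableSpace Ω] (μ : Measure Ω) (Y : ℤ → Ω → ℝ) (f : ℝ → ℝ)
    (i : ℤ) : Ω → ℝ :=
  centered μ (fun ω => f (Y i ω))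

/-- The partial sums `S_k = X_1 + ⋯ + X_k`. -/
def partialSum {Ω : Type*} [MeasurableSpace Ω] (μ : Measure Ω) (Y : ℤ → Ω → ℝ) (f : ℝ → ℝ)
    (k : ℕ) (ω : Ω) : ℝ :=
  ∑ i ∈ Finset.Icc 1 k, XVar μ Y f (i : ℤ) ω

end

/-! The proof is a stopped Lindeberg replacement for a truncated process. Rescale by `lam`, so that
the event concerns partial sums leaving (-2, 2), and let F be a smooth function equal to 0 on [-1,
1] and to 1 off (-2, 2). Write φ_j(x, V) = E F^(j)(x + N(0, V)) and let V_k be the variance of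
X_{k+1} + ... + X_n. If the variables were independent, φ_0(S_k, V_k) would be nearly a martingale,
because φ_0 solves the heat equation. Under dependence two correctors are added: φ_1(S_k, V_k) times
A_k, the sum of the next q variables, and φ_2(S_k, V_k) times B_k, the sum of the next q centered
quadratic forms (`quadForm`). When k becomes k + 1 both windows slide. The departing terms cancel
the first and second order terms of the Taylor expansion. What is left consists of third order
terms, terms at distance more than q from the past, and the covariances of lag greater than q
(`WeakDep.integral_potential_sub_le`).

If q times the bound on the variables is small, the correctors are at most 1/4 in absolute value,
while φ_0 is at least 1/2 as soon as |S_k| ≥ 2. Summing the increments up to the exit time therefore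
controls the probability of exit by 4 E(φ_0(0, V_0)), a Gaussian tail, plus the accumulated error
(`WeakDep.real_exists_two_le`). This already handles the maximum, so no separate maximal inequality
is needed.

The errors are covariances between a function of the past and one or two future values. A function
that is monotone on an interval and null elsewhere has intervals as level sets, so by the layer cake
formula its covariances reduce to those of indicators of half-lines, which α controls. Clipping at
the level ψ(α(i)), where ψ is the dominating tail function, then gives bounds of the form ∫_0^{α(i)}
ψ^d (`PathMixing.abs_covInt_le`). Domination is expressed by excess moments E(|Z|^k - T^k)_+, which
pass to absolutely convex combinations by convexity and to the L¹ closure by Fatou's lemma.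

The truncation is dictated by R. Put θ = η lam with η small and depending only on F. Let v be the
point where R falls below θ, let q be the first index with α(q) ≤ v, and truncate at θ/q. To the
left of v one has R > θ, and to the right Q ≤ θ/q. Every error (third order terms, far covariances,
the cost of truncation) is then dominated pointwise by Q R (R ∧ lam), the integrand of `M3`, up to
powers of lam.

Finally, the variance of the truncated sum differs from n σ² by at most lam² times a multiple of
x^{2/3}, where x is the total cubic error (`IsHull.real_exists_two_le_of_variance`). If nσ²
dominates, the Gaussian tail is the exponential term of the theorem. Otherwise the exponential is at
most a constant times x^{4/3}, which is at most a constant times x when x ≤ 1. -/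

/-! ### The smooth cutoff and its Taylor expansions. -/

/-- A smooth function vanishing on `[-1, 1]` and equal to `1` off `(-2, 2)`, together with its
successive derivatives, the first four of which are bounded by `K`. -/
structure IsSmoothCutoff (F : ℕ → ℝ → ℝ) (K : ℝ) : Prop where
  pos : 0 < K
  deriv : ∀ j x, HasDerivAt (F j) (F (j + 1) x) x
  bound : ∀ j ≤ 4, ∀ x, |F j x| ≤ K
  nonneg : ∀ x, 0 ≤ F 0 x
  le_one : ∀ x, F 0 x ≤ 1
  eq_zero : ∀ x, |x| ≤ 1 → F 0 x = 0
  eq_one : ∀ x, 2 ≤ |x| → F 0 x = 1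

theorem exists_isSmoothCutoff : ∃ F K, IsSmoothCutoff F K := by
  let f : ContDiffBump (0 : ℝ) := ⟨1, 2, one_pos, one_lt_two⟩
  let g : ℝ → ℝ := fun x => 1 - f x
  have hg : ContDiff ℝ (⊤ : ℕ∞) g := contDiff_const.sub (f.contDiff (n := (⊤ : ℕ∞)))
  have hcs : ∀ j, HasCompactSupport (iteratedDeriv j (f : ℝ → ℝ)) := by
    intro j
    induction j with
    | zero => simpa using f.hasCompactSupport
    | succ j ih => rw [iteratedDeriv_succ]; exact ih.deriv
  have hb : ∀ j, ∃ C, ∀ x, |iteratedDeriv j (f : ℝ → ℝ) x| ≤ C := by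
    intro j
    have hc : Continuous (iteratedDeriv j (f : ℝ → ℝ)) :=
      (f.contDiff (n := (⊤ : ℕ∞))).continuous_iteratedDeriv j (by exact_mod_cast le_top)
    exact hc.bounded_above_of_compact_support (hcs j)
  choose C hC using hb
  have hfg : ∀ j x, |iteratedDeriv j g x| ≤ 1 + C j := by
    intro j x
    rcases j with _ | j
    · have h0 := hC 0 x
      simp only [iteratedDeriv_zero] at h0 ⊢
      exact (abs_sub _ _).trans (by simpa using h0)
    · have h1 : iteratedDeriv (j + 1) g x = - iteratedDeriv (j + 1) (f : ℝ → ℝ) x := by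
        rw [iteratedDeriv_succ', iteratedDeriv_succ']
        have : deriv g = fun x => - deriv f x := by
          funext y
          exact deriv_const_sub 1
        rw [this]
        exact iteratedDeriv_fun_neg j _ x
      rw [h1, abs_neg]
      linarith [hC (j + 1) x]
  refine ⟨fun j => iteratedDeriv j g, ∑ j ∈ Finset.range 5, (1 + C j), ?_, ?_, ?_, ?_, ?_, ?_, ?_⟩
  · refine Finset.sum_pos (fun j _ => ?_) ⟨0, by simp⟩
    linarith [(abs_nonneg _).trans (hC j 0)]
  · intro j x
    have hd : DifferentiableAt ℝ (iteratedDeriv j g) x :=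
      (hg.differentiable_iteratedDeriv j (by exact_mod_cast WithTop.coe_lt_top _)) x
    simpa [iteratedDeriv_succ] using hd.hasDerivAt
  · intro j hj x
    refine (hfg j x).trans ?_
    refine Finset.single_le_sum (f := fun j => 1 + C j) (fun i _ => ?_) (by simp; omega)
    linarith [(abs_nonneg _).trans (hC i 0)]
  · intro x
    simpa [g] using f.le_one
  · intro x
    simpa [g] using f.nonneg
  · intro x hx
    have : f x = 1 := f.one_of_mem_closedBall (by simpa [f] using hx)
    simp [g, this]
  · intro x hx
    have : f x = 0 := f.zero_of_le_dist (by simpa [f] using hx)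
    simp [g, this]

/-- Mean value inequality with a derivative bound that may depend on |y|. The derivative of a Taylor
remainder is the remainder of one order less, so iterating this yields all the Taylor bounds below;
constants are not optimized by factorials. -/
theorem abs_sub_le_of_hasDerivAt {g g' : ℝ → ℝ} (h : ∀ t, HasDerivAt g (g' t) t) {y C : ℝ}
    (hb : ∀ t, |t| ≤ |y| → |g' t| ≤ C) : |g y - g 0| ≤ C * |y| := by
  have := (convex_uIcc (0 : ℝ) y).norm_image_sub_le_of_norm_hasDerivWithin_le
    (fun t _ => (h t).hasDerivWithinAt) (C := C) (fun t ht => hb t ?_)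
    Set.left_mem_uIcc Set.right_mem_uIcc
  · simpa using this
  · simpa using Set.abs_sub_left_of_mem_uIcc ht

namespace IsSmoothCutoff

variable {F : ℕ → ℝ → ℝ} {K : ℝ}

theorem abs_diff_le (h : IsSmoothCutoff F K) {j : ℕ} (hj : j ≤ 3) (x y : ℝ) :
    |F j (x + y) - F j x| ≤ K * |y| := by
  have := abs_sub_le_of_hasDerivAt (g := fun t => F j (x + t)) (g' := fun t => F (j + 1) (x + t))
    (fun t => (h.deriv j (x + t)).comp_const_add x t) (y := y) (C := K)
    (fun t _ => h.bound _ (by omega) _)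
  simpa using this

theorem abs_taylor_one_le (h : IsSmoothCutoff F K) {j : ℕ} (hj : j ≤ 2) (x y : ℝ) :
    |F j (x + y) - F j x - F (j + 1) x * y| ≤ K * |y| ^ 2 := by
  have := abs_sub_le_of_hasDerivAt (g := fun t => F j (x + t) - F j x - F (j + 1) x * t)
    (g' := fun t => F (j + 1) (x + t) - F (j + 1) x)
    (fun t => by
      simpa using (((h.deriv j (x + t)).comp_const_add x t).sub_const (F j x)).fun_sub
        ((hasDerivAt_id t).const_mul (F (j + 1) x))) (y := y) (C := K * |y|)
    (fun t ht => (h.abs_diff_le (by omega) x t).trans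
      (mul_le_mul_of_nonneg_left ht h.pos.le))
  simpa [pow_two, mul_assoc] using this

theorem abs_taylor_two_le (h : IsSmoothCutoff F K) {j : ℕ} (hj : j ≤ 1) (x y : ℝ) :
    |F j (x + y) - F j x - F (j + 1) x * y - F (j + 2) x * (y ^ 2 / 2)| ≤ K * |y| ^ 3 := by
  have := abs_sub_le_of_hasDerivAt
    (g := fun t => F j (x + t) - F j x - F (j + 1) x * t - F (j + 2) x * (t ^ 2 / 2))
    (g' := fun t => F (j + 1) (x + t) - F (j + 1) x - F (j + 2) x * t)
    (fun t => by
      have h2 : HasDerivAt (fun t : ℝ => t ^ 2 / 2) t t := by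
        simpa using ((hasDerivAt_pow 2 t).div_const 2)
      simpa using ((((h.deriv j (x + t)).comp_const_add x t).sub_const (F j x)).fun_sub
        ((hasDerivAt_id t).const_mul (F (j + 1) x))).fun_sub (h2.const_mul (F (j + 2) x)))
    (y := y) (C := K * |y| ^ 2)
    (fun t ht => (h.abs_taylor_one_le (by omega) x t).trans
      (mul_le_mul_of_nonneg_left (by gcongr) h.pos.le))
  simpa [pow_succ, mul_assoc] using this

theorem abs_taylor_three_le (h : IsSmoothCutoff F K) (x y : ℝ) :
    |F 0 (x + y) - F 0 x - F 1 x * y - F 2 x * (y ^ 2 / 2) - F 3 x * (y ^ 3 / 6)|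
      ≤ K * |y| ^ 4 := by
  have := abs_sub_le_of_hasDerivAt
    (g := fun t => F 0 (x + t) - F 0 x - F 1 x * t - F 2 x * (t ^ 2 / 2) - F 3 x * (t ^ 3 / 6))
    (g' := fun t => F 1 (x + t) - F 1 x - F 2 x * t - F 3 x * (t ^ 2 / 2))
    (fun t => by
      have h2 : HasDerivAt (fun t : ℝ => t ^ 2 / 2) t t := by
        simpa using ((hasDerivAt_pow 2 t).div_const 2)
      have h3 : HasDerivAt (fun t : ℝ => t ^ 3 / 6) (t ^ 2 / 2) t := by
        exact ((hasDerivAt_pow 3 t).div_const 6).congr_deriv (by norm_num; ring)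
      simpa using (((((h.deriv 0 (x + t)).comp_const_add x t).sub_const (F 0 x)).fun_sub
        ((hasDerivAt_id t).const_mul (F 1 x))).fun_sub (h2.const_mul (F 2 x))).fun_sub
        (h3.const_mul (F 3 x)))
    (y := y) (C := K * |y| ^ 3)
    (fun t ht => (h.abs_taylor_two_le (by omega) x t).trans
      (mul_le_mul_of_nonneg_left (by gcongr) h.pos.le))
  simpa [pow_succ, mul_assoc] using this

theorem continuous (h : IsSmoothCutoff F K) (j : ℕ) : Continuous (F j) :=
  continuous_iff_continuousAt.2 fun x => (h.deriv j x).continuousAt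

end IsSmoothCutoff

/-! ### Gaussian smoothing: Taylor bounds in space and the heat equation in the variance. -/

theorem MeasureTheory.Integrable.sub_fun {Ω : Type*} {mΩ : MeasurableSpace Ω} {μ : Measure Ω}
    {f g : Ω → ℝ} (hf : Integrable f μ) (hg : Integrable g μ) :
    Integrable (fun ω => f ω - g ω) μ := hf.sub hg

/-- The Gaussian smoothing of `f` with variance `V`. -/
noncomputable def gaussSmooth (f : ℝ → ℝ) (x : ℝ) (V : ℝ≥0) : ℝ :=
  ∫ y, f (x + y) ∂gaussianReal 0 V

/-- The fourth moment of the standard Gaussian law. -/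
noncomputable def gaussFourth : ℝ := ∫ y, y ^ 4 ∂gaussianReal 0 1

theorem gaussFourth_nonneg : 0 ≤ gaussFourth := integral_nonneg fun y => by positivity

theorem integrable_pow_gaussianReal (V : ℝ≥0) (k : ℕ) :
    Integrable (fun y : ℝ => y ^ k) (gaussianReal 0 V) := by
  have := (memLp_id_gaussianReal (μ := 0) (v := V) k).integrable_norm_pow'
  refine this.mono' (by fun_prop) (Eventually.of_forall fun y => by simp)

theorem integral_sq_gaussianReal (V : ℝ≥0) : ∫ y, y ^ 2 ∂gaussianReal 0 V = V := by
  have h := variance_fun_id_gaussianReal (μ := 0) (v := V)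
  rw [variance_eq_integral (by fun_prop)] at h
  simpa using h

theorem integral_cube_gaussianReal (V : ℝ≥0) : ∫ y, y ^ 3 ∂gaussianReal 0 V = 0 := by
  have h : ∫ y, y ^ 3 ∂gaussianReal 0 V = ∫ y, (-y) ^ 3 ∂gaussianReal 0 V := by
    conv_lhs => rw [← neg_zero, ← gaussianReal_map_neg]
    rw [integral_map (by fun_prop) (by fun_prop)]
  have h2 : ∫ y, (-y) ^ 3 ∂gaussianReal 0 V = - ∫ y, y ^ 3 ∂gaussianReal 0 V := by
    rw [← integral_neg]; congr 1; ext y; ring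
  linarith

theorem integral_fourth_gaussianReal (V : ℝ≥0) :
    ∫ y, y ^ 4 ∂gaussianReal 0 V = gaussFourth * V ^ 2 := by
  have h : gaussianReal 0 V = (gaussianReal 0 1).map (fun y => √(V : ℝ) * y) := by
    rw [gaussianReal_map_const_mul]
    congr 1
    · simp
    · ext; simp
  rw [h, integral_map (by fun_prop) (by fun_prop), gaussFourth, ← integral_mul_const]
  congr 1; ext y
  have e : √(V : ℝ) ^ 4 = V ^ 2 := by
    rw [show (4 : ℕ) = 2 * 2 from rfl, pow_mul, Real.sq_sqrt V.coe_nonneg]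
  rw [mul_pow, e]
  ring

theorem integrable_comp_add_of_bound {f : ℝ → ℝ} (hc : Continuous f) {C : ℝ}
    (hb : ∀ x, |f x| ≤ C) (μ : Measure ℝ) [IsFiniteMeasure μ] (x : ℝ) :
    Integrable (fun y => f (x + y)) μ :=
  Integrable.of_bound (by fun_prop) C (Eventually.of_forall fun y => by simpa using hb (x + y))

namespace IsSmoothCutoff

variable {F : ℕ → ℝ → ℝ} {K : ℝ}

theorem integrable (h : IsSmoothCutoff F K) {j : ℕ} (hj : j ≤ 4) (x : ℝ) (V : ℝ≥0) :
    Integrable (fun y => F j (x + y)) (gaussianReal 0 V) :=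
  integrable_comp_add_of_bound (h.continuous j) (h.bound j hj) _ x

theorem smooth_bound (h : IsSmoothCutoff F K) {j : ℕ} (hj : j ≤ 4) (x : ℝ) (V : ℝ≥0) :
    |gaussSmooth (F j) x V| ≤ K := by
  have := norm_integral_le_of_norm_le_const (μ := gaussianReal 0 V)
    (f := fun y => F j (x + y)) (C := K) (Eventually.of_forall fun _ => h.bound j hj _)
  simpa [gaussSmooth] using this

theorem smooth_diff_le (h : IsSmoothCutoff F K) {j : ℕ} (hj : j ≤ 3) (x z : ℝ) (V : ℝ≥0) :
    |gaussSmooth (F j) (x + z) V - gaussSmooth (F j) x V| ≤ K * |z| := by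
  have e : gaussSmooth (F j) (x + z) V - gaussSmooth (F j) x V
      = ∫ y, (F j ((x + y) + z) - F j (x + y)) ∂gaussianReal 0 V := by
    rw [integral_sub _ (h.integrable (by omega) x V)]
    · simp only [gaussSmooth]; congr 2; ext y; ring_nf
    · have := h.integrable (show j ≤ 4 by omega) (x + z) V
      convert this using 2; ring_nf
  rw [e]
  have := norm_integral_le_of_norm_le_const (μ := gaussianReal 0 V)
    (f := fun y => F j ((x + y) + z) - F j (x + y)) (C := K * |z|)
    (Eventually.of_forall fun y => h.abs_diff_le hj _ _)
  simpa using this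

theorem smooth_taylor_one_le (h : IsSmoothCutoff F K) {j : ℕ} (hj : j ≤ 2) (x z : ℝ) (V : ℝ≥0) :
    |gaussSmooth (F j) (x + z) V - gaussSmooth (F j) x V - gaussSmooth (F (j + 1)) x V * z|
      ≤ K * |z| ^ 2 := by
  have i1 : Integrable (fun y => F j ((x + y) + z)) (gaussianReal 0 V) := by
    have := h.integrable (show j ≤ 4 by omega) (x + z) V
    convert this using 2; ring_nf
  have e : gaussSmooth (F j) (x + z) V - gaussSmooth (F j) x V - gaussSmooth (F (j + 1)) x V * z
      = ∫ y, (F j ((x + y) + z) - F j (x + y) - F (j + 1) (x + y) * z) ∂gaussianReal 0 V := by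
    rw [integral_sub (i1.sub_fun (h.integrable (by omega) x V))
      ((h.integrable (by omega) x V).mul_const z), integral_sub i1 (h.integrable (by omega) x V),
      integral_mul_const]
    simp only [gaussSmooth]; congr 3; ext y; ring_nf
  rw [e]
  have := norm_integral_le_of_norm_le_const (μ := gaussianReal 0 V)
    (f := fun y => F j ((x + y) + z) - F j (x + y) - F (j + 1) (x + y) * z) (C := K * |z| ^ 2)
    (Eventually.of_forall fun y => h.abs_taylor_one_le hj _ _)
  simpa using this

theorem smooth_taylor_two_le (h : IsSmoothCutoff F K) (x z : ℝ) (V : ℝ≥0) :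
    |gaussSmooth (F 0) (x + z) V - gaussSmooth (F 0) x V - gaussSmooth (F 1) x V * z
      - gaussSmooth (F 2) x V * (z ^ 2 / 2)| ≤ K * |z| ^ 3 := by
  have i1 : Integrable (fun y => F 0 ((x + y) + z)) (gaussianReal 0 V) := by
    have := h.integrable (show 0 ≤ 4 by omega) (x + z) V
    convert this using 2; ring_nf
  have i0 := h.integrable (show 0 ≤ 4 by omega) x V
  have i2 := h.integrable (show 1 ≤ 4 by omega) x V
  have i3 := h.integrable (show 2 ≤ 4 by omega) x V
  have e : gaussSmooth (F 0) (x + z) V - gaussSmooth (F 0) x V - gaussSmooth (F 1) x V * z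
      - gaussSmooth (F 2) x V * (z ^ 2 / 2)
      = ∫ y, (F 0 ((x + y) + z) - F 0 (x + y) - F 1 (x + y) * z - F 2 (x + y) * (z ^ 2 / 2))
        ∂gaussianReal 0 V := by
    rw [integral_sub ((i1.sub_fun i0).sub_fun (i2.mul_const z)) (i3.mul_const _),
      integral_sub (i1.sub_fun i0) (i2.mul_const z), integral_sub i1 i0,
      integral_mul_const, integral_mul_const]
    simp only [gaussSmooth]; congr 4; ext y; ring_nf
  rw [e]
  have := norm_integral_le_of_norm_le_const (μ := gaussianReal 0 V)
    (f := fun y => F 0 ((x + y) + z) - F 0 (x + y) - F 1 (x + y) * z - F 2 (x + y) * (z ^ 2 / 2))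
    (C := K * |z| ^ 3) (Eventually.of_forall fun y => h.abs_taylor_two_le (by omega) _ _)
  simpa using this

/-- Semigroup property: a centered Gaussian of variance V + D is the sum of two independent ones. -/
theorem smooth_add (h : IsSmoothCutoff F K) {j : ℕ} (hj : j ≤ 4) (x : ℝ) (V D : ℝ≥0) :
    gaussSmooth (F j) x (V + D)
      = ∫ y, ∫ z, F j ((x + y) + z) ∂gaussianReal 0 D ∂gaussianReal 0 V := by
  have hc : gaussianReal 0 (V + D) = gaussianReal 0 V ∗ gaussianReal 0 D := by
    rw [gaussianReal_conv_gaussianReal]; simp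
  rw [gaussSmooth, hc, Measure.conv, integral_map (by fun_prop)
    (by have := h.continuous j; fun_prop),
    integral_prod]
  · simp only [add_assoc]
  · refine Integrable.of_bound
      (((h.continuous j).comp (by fun_prop)).aestronglyMeasurable) K
      (Eventually.of_forall fun y => by simpa using h.bound j hj _)

theorem integrable_inner (h : IsSmoothCutoff F K) {j : ℕ} (hj : j ≤ 4) (x : ℝ) (V D : ℝ≥0) :
    Integrable (fun y => ∫ z, F j ((x + y) + z) ∂gaussianReal 0 D) (gaussianReal 0 V) := by
  have : Integrable (fun p : ℝ × ℝ => F j ((x + p.1) + p.2))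
      ((gaussianReal 0 V).prod (gaussianReal 0 D)) :=
    Integrable.of_bound
      (((h.continuous j).comp (by fun_prop)).aestronglyMeasurable) K
      (Eventually.of_forall fun y => by simpa using h.bound j hj _)
  exact this.integral_prod_left

theorem smooth_time_le (h : IsSmoothCutoff F K) {j : ℕ} (hj : j ≤ 2) (x : ℝ) (V D : ℝ≥0) :
    |gaussSmooth (F j) x (V + D) - gaussSmooth (F j) x V| ≤ K * D := by
  have e : gaussSmooth (F j) x (V + D) - gaussSmooth (F j) x V
      = ∫ y, ((∫ z, F j ((x + y) + z) ∂gaussianReal 0 D) - F j (x + y)) ∂gaussianReal 0 V := by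
    rw [integral_sub (h.integrable_inner (by omega) x V D) (h.integrable (by omega) x V),
      h.smooth_add (by omega)]
    rfl
  have key : ∀ w, |(∫ z, F j (w + z) ∂gaussianReal 0 D) - F j w| ≤ K * D := by
    intro w
    have i1 := h.integrable (show j ≤ 4 by omega) w D
    have i2 := integrable_pow_gaussianReal D 1
    simp only [pow_one] at i2
    have e2 : (∫ z, F j (w + z) ∂gaussianReal 0 D) - F j w
        = ∫ z, (F j (w + z) - F j w - F (j + 1) w * z) ∂gaussianReal 0 D := by
      rw [integral_sub (i1.sub_fun (integrable_const _)) (i2.const_mul _),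
        integral_sub i1 (integrable_const _), integral_const_mul, integral_id_gaussianReal]
      simp
    rw [e2]
    refine (abs_integral_le_integral_abs).trans ?_
    calc _ ≤ ∫ z, K * z ^ 2 ∂gaussianReal 0 D := by
          refine integral_mono ((i1.sub_fun (integrable_const _)).sub_fun (i2.const_mul _)).abs
            ((integrable_pow_gaussianReal D 2).const_mul K) fun z => ?_
          simpa using h.abs_taylor_one_le hj w z
      _ = K * D := by rw [integral_const_mul, integral_sq_gaussianReal]
  rw [e]
  have := norm_integral_le_of_norm_le_const (μ := gaussianReal 0 V)
    (f := fun y => (∫ z, F j ((x + y) + z) ∂gaussianReal 0 D) - F j (x + y)) (C := K * D)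
    (Eventually.of_forall fun y => key _)
  simpa using this

/-- Quantitative form of ∂_V φ_0 = φ_2 / 2. Expanding to third order in the added Gaussian
increment, the first and third moments vanish and the second gives D/2, so the remainder is of
fourth order in the increment, that is, of order D². -/
theorem smooth_heat_le (h : IsSmoothCutoff F K) (x : ℝ) (V D : ℝ≥0) :
    |gaussSmooth (F 0) x (V + D) - gaussSmooth (F 0) x V - D / 2 * gaussSmooth (F 2) x V|
      ≤ K * gaussFourth * D ^ 2 := by
  have iI := h.integrable_inner (show 0 ≤ 4 by omega) x V D
  have i0 := h.integrable (show 0 ≤ 4 by omega) x V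
  have i2 := h.integrable (show 2 ≤ 4 by omega) x V
  have e : gaussSmooth (F 0) x (V + D) - gaussSmooth (F 0) x V - D / 2 * gaussSmooth (F 2) x V
      = ∫ y, ((∫ z, F 0 ((x + y) + z) ∂gaussianReal 0 D) - F 0 (x + y) - D / 2 * F 2 (x + y))
        ∂gaussianReal 0 V := by
    rw [integral_sub (iI.sub_fun i0) (i2.const_mul _), integral_sub iI i0,
      h.smooth_add (by omega), integral_const_mul]
    rfl
  have key : ∀ w, |(∫ z, F 0 (w + z) ∂gaussianReal 0 D) - F 0 w - D / 2 * F 2 w|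
      ≤ K * gaussFourth * D ^ 2 := by
    intro w
    have j1 := h.integrable (show 0 ≤ 4 by omega) w D
    have k1 := integrable_pow_gaussianReal D 1
    simp only [pow_one] at k1
    have k2 := integrable_pow_gaussianReal D 2
    have k3 := integrable_pow_gaussianReal D 3
    have e2 : (∫ z, F 0 (w + z) ∂gaussianReal 0 D) - F 0 w - D / 2 * F 2 w
        = ∫ z, (F 0 (w + z) - F 0 w - F 1 w * z - F 2 w * (z ^ 2 / 2) - F 3 w * (z ^ 3 / 6))
          ∂gaussianReal 0 D := by
      rw [integral_sub (((j1.sub_fun (integrable_const _)).sub_fun (k1.const_mul _)).sub_fun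
          ((k2.div_const 2).const_mul _)) ((k3.div_const 6).const_mul _),
        integral_sub ((j1.sub_fun (integrable_const _)).sub_fun (k1.const_mul _))
          ((k2.div_const 2).const_mul _),
        integral_sub (j1.sub_fun (integrable_const _)) (k1.const_mul _),
        integral_sub j1 (integrable_const _), integral_const_mul, integral_const_mul,
        integral_const_mul, integral_div, integral_div, integral_id_gaussianReal,
        integral_sq_gaussianReal, integral_cube_gaussianReal]
      simp
      ring
    rw [e2]
    refine (abs_integral_le_integral_abs).trans ?_
    calc _ ≤ ∫ z, K * z ^ 4 ∂gaussianReal 0 D := by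
          refine integral_mono ((((j1.sub_fun (integrable_const _)).sub_fun (k1.const_mul _)).sub_fun
            ((k2.div_const 2).const_mul _)).sub_fun ((k3.div_const 6).const_mul _)).abs
            ((integrable_pow_gaussianReal D 4).const_mul K) fun z => ?_
          have := h.abs_taylor_three_le w z
          rwa [show |z| ^ 4 = z ^ 4 from by rw [← abs_pow, abs_of_nonneg (by positivity)]] at this
      _ = _ := by rw [integral_const_mul, integral_fourth_gaussianReal]; ring
  rw [e]
  have := norm_integral_le_of_norm_le_const (μ := gaussianReal 0 V)
    (f := fun y => (∫ z, F 0 ((x + y) + z) ∂gaussianReal 0 D) - F 0 (x + y) - D / 2 * F 2 (x + y))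
    (C := K * gaussFourth * D ^ 2) (Eventually.of_forall fun y => key _)
  simpa using this

theorem smooth_time_abs_le (h : IsSmoothCutoff F K) {j : ℕ} (hj : j ≤ 2) (x : ℝ) (V W : ℝ≥0) :
    |gaussSmooth (F j) x V - gaussSmooth (F j) x W| ≤ K * |(V : ℝ) - W| := by
  rcases le_total W V with hw | hw
  · obtain ⟨D, rfl⟩ := exists_add_of_le hw
    simpa using h.smooth_time_le hj x W D
  · obtain ⟨D, rfl⟩ := exists_add_of_le hw
    rw [abs_sub_comm]
    simpa using h.smooth_time_le hj x V D

theorem smooth_heat_abs_le (h : IsSmoothCutoff F K) (x : ℝ) (V W : ℝ≥0) :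
    |gaussSmooth (F 0) x V - gaussSmooth (F 0) x W - ((V : ℝ) - W) / 2 * gaussSmooth (F 2) x W|
      ≤ K * (gaussFourth + 1) * |(V : ℝ) - W| ^ 2 := by
  rcases le_total W V with hw | hw
  · obtain ⟨D, rfl⟩ := exists_add_of_le hw
    have h1 := h.smooth_heat_le x W D
    have h2 : 0 ≤ K * (D : ℝ) ^ 2 := by have := h.pos; positivity
    simp only [NNReal.coe_add, add_sub_cancel_left, NNReal.abs_eq]
    linarith
  -- Here V ≤ W while the expansion is based at W. Moving the second derivative from V to W costs at
  -- most K D²/2, which the extra 1 in `gaussFourth + 1` absorbs.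
  · obtain ⟨D, rfl⟩ := exists_add_of_le hw
    have h1 := h.smooth_heat_le x V D
    have h3 := h.smooth_time_le (show 2 ≤ 2 by omega) x V D
    have h2 : 0 ≤ K * (D : ℝ) ^ 2 := by have := h.pos; positivity
    have e : ((V : ℝ) - (V + D : ℝ≥0)) = -(D : ℝ) := by push_cast; ring
    rw [e, abs_neg, NNReal.abs_eq]
    have e2 : gaussSmooth (F 0) x V - gaussSmooth (F 0) x (V + D)
        - -(D : ℝ) / 2 * gaussSmooth (F 2) x (V + D)
        = -(gaussSmooth (F 0) x (V + D) - gaussSmooth (F 0) x V - D / 2 * gaussSmooth (F 2) x V)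
          + D / 2 * (gaussSmooth (F 2) x (V + D) - gaussSmooth (F 2) x V) := by ring
    rw [e2]
    refine (abs_add_le _ _).trans ?_
    rw [abs_neg, abs_mul, abs_of_nonneg (show (0 : ℝ) ≤ D / 2 by positivity)]
    nlinarith [mul_le_mul_of_nonneg_left h3 (show (0 : ℝ) ≤ D / 2 by positivity)]

theorem smooth_nonneg (h : IsSmoothCutoff F K) (x : ℝ) (V : ℝ≥0) :
    0 ≤ gaussSmooth (F 0) x V := integral_nonneg fun _ => h.nonneg _

/-- The half-line of increments having the sign of x has Gaussian mass at least 1/2 by symmetry, and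
on it |x + y| stays at least 2. -/
theorem half_le_smooth (h : IsSmoothCutoff F K) {x : ℝ} (hx : 2 ≤ |x|) (V : ℝ≥0) :
    1 / 2 ≤ gaussSmooth (F 0) x V := by
  have hsym : (gaussianReal 0 V).real (Set.Iic 0) = (gaussianReal 0 V).real (Set.Ici 0) := by
    conv_lhs => rw [← neg_zero, ← gaussianReal_map_neg]
    rw [map_measureReal_apply (by fun_prop) measurableSet_Iic]
    congr 1; ext y; simp
  have hone : 1 ≤ (gaussianReal 0 V).real (Set.Iic 0) + (gaussianReal 0 V).real (Set.Ici 0) := by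
    have := measureReal_union_le (μ := gaussianReal 0 V) (Set.Iic (0 : ℝ)) (Set.Ici 0)
    rw [Set.Iic_union_Ici] at this
    simpa using this
  have key : ∀ s : Set ℝ, MeasurableSet s → (∀ y ∈ s, 2 ≤ |x + y|) →
      (gaussianReal 0 V).real s ≤ gaussSmooth (F 0) x V := by
    intro s hs hxs
    rw [← integral_indicator_one hs]
    refine integral_mono ((integrable_const 1).indicator hs) (h.integrable (by omega) x V)
      fun y => ?_
    by_cases hy : y ∈ s
    · simp [hy, h.eq_one _ (hxs y hy)]
    · simpa [hy] using h.nonneg _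
  rcases le_abs.1 hx with hx | hx
  · have := key (Set.Ici 0) measurableSet_Ici fun y hy => le_abs.2 (Or.inl (by
      have : (0 : ℝ) ≤ y := hy
      linarith))
    linarith
  · have := key (Set.Iic 0) measurableSet_Iic fun y hy => le_abs.2 (Or.inr (by
      have : y ≤ (0 : ℝ) := hy
      linarith))
    linarith

/-- Chernoff's bound at the exponent 1/W: the cutoff lives on |y| > 1, where e^{-1/W}(e^{y/W} +
e^{-y/W}) is at least 1. -/
theorem smooth_zero_le (h : IsSmoothCutoff F K) {V : ℝ≥0} {W : ℝ} (hW : 0 < W) (hV : V ≤ W) :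
    gaussSmooth (F 0) 0 V ≤ 2 * Real.exp (-(1 / (2 * W))) := by
  have hm : ∀ t, ∫ y, Real.exp (t * y) ∂gaussianReal 0 V = Real.exp (V * t ^ 2 / 2) := by
    intro t
    have := mgf_gaussianReal (p := gaussianReal 0 V) (X := id) (μ := 0) (v := V) (by simp) t
    simpa [mgf] using this
  have hi : ∀ t, Integrable (fun y => Real.exp (t * y)) (gaussianReal 0 V) := fun t =>
    integrable_exp_mul_gaussianReal t
  calc gaussSmooth (F 0) 0 V
      ≤ ∫ y, Real.exp (-(1 / W)) * (Real.exp (1 / W * y) + Real.exp (-(1 / W) * y))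
          ∂gaussianReal 0 V := by
        refine integral_mono (h.integrable (by omega) 0 V) (((hi _).add (hi _)).const_mul _)
          fun y => ?_
        simp only [zero_add]
        by_cases hy : |y| ≤ 1
        · rw [h.eq_zero y hy]; positivity
        · refine (h.le_one y).trans ?_
          rw [mul_add, ← Real.exp_add, ← Real.exp_add]
          have hw : 0 < 1 / W := by positivity
          rcases lt_abs.1 (not_le.1 hy) with h1 | h1
          · have : 1 ≤ Real.exp (-(1 / W) + 1 / W * y) := Real.one_le_exp (by nlinarith)
            linarith [Real.exp_pos (-(1 / W) + -(1 / W) * y)]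
          · have : 1 ≤ Real.exp (-(1 / W) + -(1 / W) * y) := Real.one_le_exp (by nlinarith)
            linarith [Real.exp_pos (-(1 / W) + 1 / W * y)]
    _ = 2 * Real.exp (-(1 / W) + V * (1 / W) ^ 2 / 2) := by
        rw [integral_const_mul, integral_add (hi _) (hi _), hm, hm, Real.exp_add]
        ring_nf
    _ ≤ _ := by
        gcongr
        have : V * (1 / W) ^ 2 / 2 ≤ W * (1 / W) ^ 2 / 2 := by gcongr
        have e : W * (1 / W) ^ 2 / 2 = 1 / (2 * W) := by field_simp
        have e2 : 1 / W = 2 * (1 / (2 * W)) := by field_simp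
        linarith

end IsSmoothCutoff

/-! ### Stability of bounded measurable functions, used to discharge integrability. -/

/-- Bounded measurable real functions. -/
def BddMeas {Ω : Type*} [MeasurableSpace Ω] (f : Ω → ℝ) : Prop :=
  Measurable f ∧ ∃ C, ∀ ω, |f ω| ≤ C

namespace BddMeas

variable {Ω : Type*} [MeasurableSpace Ω] {f g : Ω → ℝ}

theorem integrable (hf : BddMeas f) (P : Measure Ω) [IsFiniteMeasure P] : Integrable f P :=
  let ⟨C, hC⟩ := hf.2
  Integrable.of_bound hf.1.aestronglyMeasurable C (Eventually.of_forall hC)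

theorem const (c : ℝ) : BddMeas (fun _ : Ω => c) := ⟨measurable_const, |c|, fun _ => le_rfl⟩

theorem add (hf : BddMeas f) (hg : BddMeas g) : BddMeas (fun ω => f ω + g ω) := by
  obtain ⟨C, hC⟩ := hf.2
  obtain ⟨D, hD⟩ := hg.2
  exact ⟨hf.1.add hg.1, C + D, fun ω => (abs_add_le _ _).trans (add_le_add (hC ω) (hD ω))⟩

theorem sub (hf : BddMeas f) (hg : BddMeas g) : BddMeas (fun ω => f ω - g ω) := by
  obtain ⟨C, hC⟩ := hf.2
  obtain ⟨D, hD⟩ := hg.2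
  exact ⟨hf.1.sub hg.1, C + D, fun ω => (abs_sub _ _).trans (add_le_add (hC ω) (hD ω))⟩

theorem mul (hf : BddMeas f) (hg : BddMeas g) : BddMeas (fun ω => f ω * g ω) := by
  obtain ⟨C, hC⟩ := hf.2
  obtain ⟨D, hD⟩ := hg.2
  exact ⟨hf.1.mul hg.1, C * D, fun ω => by
    rw [abs_mul]
    exact mul_le_mul (hC ω) (hD ω) (abs_nonneg _) ((abs_nonneg _).trans (hC ω))⟩

theorem const_mul (hf : BddMeas f) (c : ℝ) : BddMeas (fun ω => c * f ω) := (const c).mul hf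

theorem div_const (hf : BddMeas f) (c : ℝ) : BddMeas (fun ω => f ω / c) := by
  simpa [div_eq_mul_inv] using hf.mul (const c⁻¹)

theorem pow (hf : BddMeas f) (k : ℕ) : BddMeas (fun ω => f ω ^ k) := by
  induction k with
  | zero => simpa using const 1
  | succ k ih => simpa [pow_succ] using ih.mul hf

theorem abs (hf : BddMeas f) : BddMeas (fun ω => |f ω|) :=
  ⟨hf.1.norm, by simpa using hf.2⟩

theorem sum {ι : Type*} {s : Finset ι} {f : ι → Ω → ℝ} (hf : ∀ i ∈ s, BddMeas (f i)) :
    BddMeas (fun ω => ∑ i ∈ s, f i ω) := by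
  classical
  induction s using Finset.induction_on with
  | empty => simpa using const 0
  | insert a s ha ih =>
    simp only [Finset.sum_insert ha]
    exact (hf a (by simp)).add (ih fun i hi => hf i (by simp [hi]))

end BddMeas

/-! ### Weakly dependent bounded sequences and the window sums that serve as correctors. -/

section Core

set_option linter.unusedSectionVars false

variable {Ω : Type*} [mΩ : MeasurableSpace Ω]

/-- The covariance `E (X_j X_{j+l})` of centered variables. -/
noncomputable def lagCov (P : Measure Ω) (X : ℕ → Ω → ℝ) (j l : ℕ) : ℝ :=
  ∫ ω, X j ω * X (j + l) ω ∂P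

/-- `X_1 + ⋯ + X_k`. -/
def sumTo (X : ℕ → Ω → ℝ) (k : ℕ) (ω : Ω) : ℝ := ∑ j ∈ Finset.range k, X (j + 1) ω

/-- `X_{k+1} + ⋯ + X_{k+q}`. -/
def sumFrom (X : ℕ → Ω → ℝ) (q k : ℕ) (ω : Ω) : ℝ := ∑ i ∈ Finset.range q, X (k + (i + 1)) ω

/-- The centered quadratic form `(X_j² - E X_j²) / 2 + ∑_{l ≤ q} (X_j X_{j+l} - E X_j X_{j+l})`. -/
noncomputable def quadForm (P : Measure Ω) (X : ℕ → Ω → ℝ) (q j : ℕ) (ω : Ω) : ℝ :=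
  (X j ω * X (j + 0) ω - lagCov P X j 0) / 2 +
    ∑ l ∈ Finset.range q, (X j ω * X (j + (l + 1)) ω - lagCov P X j (l + 1))

/-- A bounded centered sequence adapted to `𝓖` whose conditional moments of order one and two are
controlled by the numerical sequences `κ₁, κ₂, κ₃`. -/
structure WeakDep (P : Measure Ω) (𝓖 : ℕ → MeasurableSpace Ω) (X : ℕ → Ω → ℝ) (C : ℝ)
    (κ₁ κ₂ κ₃ : ℕ → ℝ) : Prop where
  mono : Monotone 𝓖
  le : ∀ j, 𝓖 j ≤ mΩ
  adapted : ∀ j, Measurable[𝓖 j] (X j)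
  bound : ∀ j ω, |X j ω| ≤ C
  centered : ∀ j, ∫ ω, X j ω ∂P = 0
  one_le : ∀ j i, 1 ≤ i → ∀ B : Ω → ℝ, Measurable[𝓖 j] B → ∀ c : ℝ, (∀ ω, |B ω| ≤ c) →
    |∫ ω, B ω * X (j + i) ω ∂P| ≤ c * κ₁ i
  three_le : ∀ j i, 1 ≤ i → ∀ B : Ω → ℝ, Measurable[𝓖 j] B → ∀ c : ℝ, 0 ≤ c →
    (∀ ω, |B ω| ≤ c * |X j ω| ^ 2) → |∫ ω, B ω * X (j + i) ω ∂P| ≤ c * κ₃ i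
  pair_two_le : ∀ j i, 1 ≤ i → ∀ l, ∀ B : Ω → ℝ, Measurable[𝓖 j] B → ∀ c : ℝ,
    (∀ ω, |B ω| ≤ c) →
    |∫ ω, B ω * (X (j + i) ω * X (j + i + l) ω - lagCov P X (j + i) l) ∂P| ≤ c * κ₂ i
  pair_three_le : ∀ j i, 1 ≤ i → ∀ l, ∀ B : Ω → ℝ, Measurable[𝓖 j] B → ∀ c : ℝ, 0 ≤ c →
    (∀ ω, |B ω| ≤ c * |X j ω|) →
    |∫ ω, B ω * (X (j + i) ω * X (j + i + l) ω - lagCov P X (j + i) l) ∂P| ≤ c * κ₃ (max i l)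
  cov_le : ∀ j l, |lagCov P X j l| ≤ κ₂ l
  moment_le : ∀ j, ∫ ω, |X j ω| ^ 3 ∂P ≤ κ₃ 0

namespace WeakDep

variable {P : Measure Ω} [IsProbabilityMeasure P] {𝓖 : ℕ → MeasurableSpace Ω} {X : ℕ → Ω → ℝ}
  {C : ℝ} {κ₁ κ₂ κ₃ : ℕ → ℝ}

theorem bdd (h : WeakDep P 𝓖 X C κ₁ κ₂ κ₃) (j : ℕ) : BddMeas (X j) :=
  ⟨(h.adapted j).mono (h.le j) le_rfl, C, h.bound j⟩

theorem bdd_sumTo (h : WeakDep P 𝓖 X C κ₁ κ₂ κ₃) (k : ℕ) : BddMeas (sumTo X k) :=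
  BddMeas.sum fun _ _ => h.bdd _

theorem bdd_sumFrom (h : WeakDep P 𝓖 X C κ₁ κ₂ κ₃) (q k : ℕ) : BddMeas (sumFrom X q k) :=
  BddMeas.sum fun _ _ => h.bdd _

theorem bdd_pair (h : WeakDep P 𝓖 X C κ₁ κ₂ κ₃) (j l : ℕ) :
    BddMeas (fun ω => X j ω * X (j + l) ω - lagCov P X j l) :=
  ((h.bdd _).mul (h.bdd _)).sub (BddMeas.const _)

theorem bdd_quadForm (h : WeakDep P 𝓖 X C κ₁ κ₂ κ₃) (q j : ℕ) : BddMeas (quadForm P X q j) :=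
  ((h.bdd_pair j 0).div_const 2).add (BddMeas.sum fun _ _ => h.bdd_pair _ _)

theorem bdd_sumFrom_quadForm (h : WeakDep P 𝓖 X C κ₁ κ₂ κ₃) (q k : ℕ) :
    BddMeas (sumFrom (quadForm P X q) q k) :=
  BddMeas.sum fun _ _ => h.bdd_quadForm _ _

theorem measurable_sumTo (h : WeakDep P 𝓖 X C κ₁ κ₂ κ₃) {k m : ℕ} (hkm : k ≤ m) :
    Measurable[𝓖 m] (sumTo X k) := by
  refine Finset.measurable_sum (m := 𝓖 m) _ fun j hj => ?_
  have : j < k := by simpa using hj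
  exact (h.adapted (j + 1)).mono (h.mono (by omega)) le_rfl

theorem integral_lagCov_sub (h : WeakDep P 𝓖 X C κ₁ κ₂ κ₃) (j l : ℕ) :
    ∫ ω, (X j ω * X (j + l) ω - lagCov P X j l) ∂P = 0 := by
  rw [integral_sub (((h.bdd j).mul (h.bdd _)).integrable P) (integrable_const _)]
  simp [lagCov]

theorem integral_quadForm (h : WeakDep P 𝓖 X C κ₁ κ₂ κ₃) (q j : ℕ) :
    ∫ ω, quadForm P X q j ω ∂P = 0 := by
  unfold quadForm
  rw [integral_add (((h.bdd_pair j 0).div_const 2).integrable P)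
    ((BddMeas.sum fun _ _ => h.bdd_pair _ _).integrable P), integral_div, h.integral_lagCov_sub,
    integral_finsetSum _ fun _ _ => (h.bdd_pair _ _).integrable P]
  simp [h.integral_lagCov_sub]

theorem integral_sumFrom (h : WeakDep P 𝓖 X C κ₁ κ₂ κ₃) (q k : ℕ) :
    ∫ ω, sumFrom X q k ω ∂P = 0 := by
  unfold sumFrom
  rw [integral_finsetSum _ fun _ _ => (h.bdd _).integrable P]
  simp [h.centered]

theorem integral_sumFrom_quadForm (h : WeakDep P 𝓖 X C κ₁ κ₂ κ₃) (q k : ℕ) :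
    ∫ ω, sumFrom (quadForm P X q) q k ω ∂P = 0 := by
  unfold sumFrom
  rw [integral_finsetSum _ fun _ _ => (h.bdd_quadForm _ _).integrable P]
  simp [h.integral_quadForm]

theorem nonneg_bound (h : WeakDep P 𝓖 X C κ₁ κ₂ κ₃) : 0 ≤ C := by
  obtain ⟨ω⟩ := P.nonempty_of_neZero
  exact (abs_nonneg _).trans (h.bound 0 ω)

theorem abs_sumFrom_le (h : WeakDep P 𝓖 X C κ₁ κ₂ κ₃) (q k : ℕ) (ω : Ω) :
    |sumFrom X q k ω| ≤ q * C := by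
  refine (Finset.abs_sum_le_sum_abs _ _).trans ?_
  refine (Finset.sum_le_card_nsmul _ _ C fun i _ => h.bound _ _).trans ?_
  simp

theorem abs_pair_le (h : WeakDep P 𝓖 X C κ₁ κ₂ κ₃) (j l : ℕ) (ω : Ω) :
    |X j ω * X (j + l) ω - lagCov P X j l| ≤ 2 * C ^ 2 := by
  have hC := h.nonneg_bound
  have hp : ∀ ω, |X j ω * X (j + l) ω| ≤ C ^ 2 := fun ω => by
    rw [abs_mul, pow_two]
    exact mul_le_mul (h.bound _ _) (h.bound _ _) (abs_nonneg _) hC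
  have hc : |lagCov P X j l| ≤ C ^ 2 := by
    have := norm_integral_le_of_norm_le_const (μ := P)
      (f := fun ω => X j ω * X (j + l) ω) (Eventually.of_forall hp)
    simpa [lagCov] using this
  refine (abs_sub _ _).trans ?_
  linarith [hp ω]

theorem abs_sumFrom_quadForm_le (h : WeakDep P 𝓖 X C κ₁ κ₂ κ₃) {q : ℕ} (hq : 1 ≤ q) (k : ℕ)
    (ω : Ω) : |sumFrom (quadForm P X q) q k ω| ≤ 3 * (q * C) ^ 2 := by
  have hC := h.nonneg_bound
  have hq' : (1 : ℝ) ≤ q := by exact_mod_cast hq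
  have h1 : ∀ j, |quadForm P X q j ω| ≤ 3 * q * C ^ 2 := by
    intro j
    refine (abs_add_le _ _).trans ?_
    have h2 : |∑ l ∈ Finset.range q, (X j ω * X (j + (l + 1)) ω - lagCov P X j (l + 1))|
        ≤ q * (2 * C ^ 2) := by
      refine (Finset.abs_sum_le_sum_abs _ _).trans ?_
      refine (Finset.sum_le_card_nsmul _ _ _ fun i _ => h.abs_pair_le _ _ _).trans ?_
      simp
    rw [abs_div, abs_two]
    have h3 := h.abs_pair_le j 0 ω
    nlinarith [sq_nonneg C, mul_le_mul_of_nonneg_right hq' (sq_nonneg C)]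
  refine (Finset.abs_sum_le_sum_abs _ _).trans ?_
  refine (Finset.sum_le_card_nsmul _ _ _ fun i _ => h1 _).trans ?_
  simp only [Finset.card_range, nsmul_eq_mul]
  exact le_of_eq (by ring)

theorem sumFrom_le_one (h : WeakDep P 𝓖 X C κ₁ κ₂ κ₃) (q j : ℕ)
    {B : Ω → ℝ} (hB : Measurable[𝓖 j] B) {c : ℝ} (hc : ∀ ω, |B ω| ≤ c) :
    |∫ ω, B ω * sumFrom X q j ω ∂P| ≤ c * ∑ i ∈ Finset.range q, κ₁ (i + 1) := by
  have hb : BddMeas B := ⟨hB.mono (h.le j) le_rfl, c, hc⟩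
  simp only [sumFrom, Finset.mul_sum]
  rw [integral_finsetSum _ fun _ _ => (hb.mul (h.bdd _)).integrable P]
  refine (Finset.abs_sum_le_sum_abs _ _).trans (Finset.sum_le_sum fun i _ => ?_)
  exact h.one_le j (i + 1) (by omega) B hB c hc

theorem sumFrom_le_three (h : WeakDep P 𝓖 X C κ₁ κ₂ κ₃) (q j : ℕ)
    {B : Ω → ℝ} (hB : Measurable[𝓖 j] B) {c : ℝ} (hc0 : 0 ≤ c) (hc : ∀ ω, |B ω| ≤ c * |X j ω| ^ 2)
    (hb : BddMeas B) :
    |∫ ω, B ω * sumFrom X q j ω ∂P| ≤ c * ∑ i ∈ Finset.range q, κ₃ (i + 1) := by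
  simp only [sumFrom, Finset.mul_sum]
  rw [integral_finsetSum _ fun _ _ => (hb.mul (h.bdd _)).integrable P]
  refine (Finset.abs_sum_le_sum_abs _ _).trans (Finset.sum_le_sum fun i _ => ?_)
  exact h.three_le j (i + 1) (by omega) B hB c hc0 hc

/-- Linearity; the factor 1/2 on the diagonal term is simply discarded. -/
theorem integral_mul_quadForm (h : WeakDep P 𝓖 X C κ₁ κ₂ κ₃) (q j : ℕ) {B : Ω → ℝ}
    (hb : BddMeas B) :
    |∫ ω, B ω * quadForm P X q j ω ∂P| ≤
      |∫ ω, B ω * (X j ω * X (j + 0) ω - lagCov P X j 0) ∂P| +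
      ∑ l ∈ Finset.range q,
        |∫ ω, B ω * (X j ω * X (j + (l + 1)) ω - lagCov P X j (l + 1)) ∂P| := by
  have e : ∫ ω, B ω * quadForm P X q j ω ∂P =
      (∫ ω, B ω * (X j ω * X (j + 0) ω - lagCov P X j 0) ∂P) / 2 +
      ∑ l ∈ Finset.range q,
        ∫ ω, B ω * (X j ω * X (j + (l + 1)) ω - lagCov P X j (l + 1)) ∂P := by
    rw [← integral_finsetSum _ fun _ _ => (hb.mul (h.bdd_pair _ _)).integrable P,
      ← integral_div, ← integral_add (((hb.mul (h.bdd_pair _ _)).div_const 2).integrable P)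
      ((BddMeas.sum fun _ _ => hb.mul (h.bdd_pair _ _)).integrable P)]
    congr 1; ext ω
    simp only [quadForm, mul_add, Finset.mul_sum]
    ring
  rw [e]
  refine (abs_add_le _ _).trans (add_le_add ?_ (Finset.abs_sum_le_sum_abs _ _))
  rw [abs_div, abs_two]
  linarith [abs_nonneg (∫ ω, B ω * (X j ω * X (j + 0) ω - lagCov P X j 0) ∂P)]

theorem quadForm_le_two (h : WeakDep P 𝓖 X C κ₁ κ₂ κ₃) (q j : ℕ) {i : ℕ} (hi : 1 ≤ i)
    {B : Ω → ℝ} (hB : Measurable[𝓖 j] B) {c : ℝ} (hc : ∀ ω, |B ω| ≤ c) :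
    |∫ ω, B ω * quadForm P X q (j + i) ω ∂P| ≤ c * ((q + 1) * κ₂ i) := by
  have hb : BddMeas B := ⟨hB.mono (h.le j) le_rfl, c, hc⟩
  refine (h.integral_mul_quadForm q (j + i) hb).trans ?_
  refine (add_le_add (h.pair_two_le j i hi 0 B hB c hc) (Finset.sum_le_card_nsmul _ _ _
    fun l _ => h.pair_two_le j i hi (l + 1) B hB c hc)).trans ?_
  simp only [Finset.card_range, nsmul_eq_mul]
  exact le_of_eq (by ring)

theorem quadForm_le_three (h : WeakDep P 𝓖 X C κ₁ κ₂ κ₃) (q j : ℕ) {i : ℕ} (hi : 1 ≤ i)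
    {B : Ω → ℝ} (hB : Measurable[𝓖 j] B) {c : ℝ} (hc0 : 0 ≤ c) (hc : ∀ ω, |B ω| ≤ c * |X j ω|)
    (hb : BddMeas B) :
    |∫ ω, B ω * quadForm P X q (j + i) ω ∂P| ≤
      c * (κ₃ i + ∑ l ∈ Finset.range q, κ₃ (max i (l + 1))) := by
  refine (h.integral_mul_quadForm q (j + i) hb).trans ?_
  rw [mul_add, Finset.mul_sum]
  refine add_le_add ?_ (Finset.sum_le_sum fun l _ => h.pair_three_le j i hi (l + 1) B hB c hc0 hc)
  simpa using h.pair_three_le j i hi 0 B hB c hc0 hc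

theorem sumFrom_quadForm_le_two (h : WeakDep P 𝓖 X C κ₁ κ₂ κ₃) (q j : ℕ)
    {B : Ω → ℝ} (hB : Measurable[𝓖 j] B) {c : ℝ} (hc : ∀ ω, |B ω| ≤ c) :
    |∫ ω, B ω * sumFrom (quadForm P X q) q j ω ∂P| ≤
      c * ∑ i ∈ Finset.range q, (q + 1) * κ₂ (i + 1) := by
  have hb : BddMeas B := ⟨hB.mono (h.le j) le_rfl, c, hc⟩
  simp only [sumFrom, Finset.mul_sum]
  rw [integral_finsetSum _ fun _ _ => (hb.mul (h.bdd_quadForm _ _)).integrable P]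
  refine (Finset.abs_sum_le_sum_abs _ _).trans (Finset.sum_le_sum fun i _ => ?_)
  exact h.quadForm_le_two q j (by omega) hB hc

theorem sumFrom_quadForm_le_three (h : WeakDep P 𝓖 X C κ₁ κ₂ κ₃) (q j : ℕ)
    {B : Ω → ℝ} (hB : Measurable[𝓖 j] B) {c : ℝ} (hc0 : 0 ≤ c) (hc : ∀ ω, |B ω| ≤ c * |X j ω|)
    (hb : BddMeas B) :
    |∫ ω, B ω * sumFrom (quadForm P X q) q j ω ∂P| ≤
      c * ∑ i ∈ Finset.range q, (κ₃ (i + 1) + ∑ l ∈ Finset.range q, κ₃ (max (i + 1) (l + 1))) := by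
  simp only [sumFrom, Finset.mul_sum]
  rw [integral_finsetSum _ fun _ _ => (hb.mul (h.bdd_quadForm _ _)).integrable P]
  refine (Finset.abs_sum_le_sum_abs _ _).trans (Finset.sum_le_sum fun i _ => ?_)
  exact h.quadForm_le_three q j (by omega) hB hc0 hc hb

end WeakDep

/-- Both sides are X_{k+1} + ... + X_{k+1+q}. This is the sliding of the window: A_{k+1} - A_k =
X_{k+1+q} - X_{k+1}. -/
theorem sumFrom_eq_add (X : ℕ → Ω → ℝ) (q k : ℕ) (ω : Ω) :
    sumFrom X q k ω + X (k + 1 + q) ω = X (k + 1) ω + sumFrom X q (k + 1) ω := by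
  have h1 := Finset.sum_range_succ (fun i => X (k + (i + 1)) ω) q
  have h2 := Finset.sum_range_succ' (fun i => X (k + (i + 1)) ω) q
  rw [h1] at h2
  simp only [sumFrom]
  rw [show k + 1 + q = k + (q + 1) by ring, h2, add_comm]
  congr 1
  refine Finset.sum_congr rfl fun i _ => ?_
  rw [show k + (i + 1 + 1) = k + 1 + (i + 1) by ring]

/-- The variance of `X_{k+1} + ⋯ + X_{k+n}` for centered variables. -/
noncomputable def varFrom (P : Measure Ω) (X : ℕ → Ω → ℝ) (n k : ℕ) : ℝ≥0 :=
  ⟨∫ ω, sumFrom X n k ω ^ 2 ∂P, integral_nonneg fun _ => sq_nonneg _⟩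

/-- Since the variables vanish after time n, a window of fixed length n always covers the whole
remaining sum, so passing from k to k + 1 removes exactly X_{k+1} from it. -/
theorem WeakDep.varFrom_sub {P : Measure Ω} [IsProbabilityMeasure P] {𝓖 : ℕ → MeasurableSpace Ω}
    {X : ℕ → Ω → ℝ} {C : ℝ} {κ₁ κ₂ κ₃ : ℕ → ℝ} (h : WeakDep P 𝓖 X C κ₁ κ₂ κ₃) {n : ℕ}
    (hn : ∀ j, n < j → ∀ ω, X j ω = 0) (k : ℕ) :
    (varFrom P X n k : ℝ) - varFrom P X n (k + 1) =
      lagCov P X (k + 1) 0 + 2 * ∑ l ∈ Finset.range n, lagCov P X (k + 1) (l + 1) := by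
  have e : ∀ ω, sumFrom X n k ω = X (k + 1) ω + sumFrom X n (k + 1) ω := fun ω => by
    rw [← sumFrom_eq_add, hn (k + 1 + n) (by omega), add_zero]
  have b1 := h.bdd (k + 1)
  have b2 := h.bdd_sumFrom n (k + 1)
  have e1 : ∑ l ∈ Finset.range n, lagCov P X (k + 1) (l + 1)
      = ∫ ω, X (k + 1) ω * sumFrom X n (k + 1) ω ∂P := by
    simp only [lagCov, sumFrom, Finset.mul_sum]
    rw [integral_finsetSum _ fun _ _ => (b1.mul (h.bdd _)).integrable P]
  rw [e1]
  change (∫ ω, sumFrom X n k ω ^ 2 ∂P) - ∫ ω, sumFrom X n (k + 1) ω ^ 2 ∂P = _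
  simp only [e]
  rw [lagCov, ← integral_const_mul, ← integral_add ((b1.mul (h.bdd _)).integrable P)
    (((b1.mul b2).const_mul 2).integrable P),
    ← integral_sub (((b1.add b2).pow 2).integrable P) ((b2.pow 2).integrable P)]
  congr 1; ext ω; simp only [add_zero]; ring

end Core

/-! ### The Lindeberg step and the stopped sum of its increments. -/

section Stopping

variable {Ω : Type*} [mΩ : MeasurableSpace Ω]

/-- The total error of one step in the Lindeberg replacement. -/
noncomputable def stepError (κ₁ κ₂ κ₃ : ℕ → ℝ) (n q : ℕ) (D : ℝ) : ℝ :=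
  κ₃ 0 + (gaussFourth + 1) * D ^ 2 + ∑ i ∈ Finset.range q, κ₃ (i + 1) + κ₁ (q + 1)
    + D * ∑ i ∈ Finset.range q, κ₁ (i + 1)
    + ∑ i ∈ Finset.range q, (κ₃ (i + 1) + ∑ l ∈ Finset.range q, κ₃ (max (i + 1) (l + 1)))
    + (q + 1) * κ₂ (q + 1) + D * ∑ i ∈ Finset.range q, (q + 1) * κ₂ (i + 1)
    + ∑ l ∈ Finset.Ico q n, κ₂ (l + 1)

/-- The corrected smoothed potential at time `k`. -/
noncomputable def potential (P : Measure Ω) (X : ℕ → Ω → ℝ) (F : ℕ → ℝ → ℝ) (n q k : ℕ)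
    (ω : Ω) : ℝ :=
  gaussSmooth (F 0) (sumTo X k ω) (varFrom P X n k)
    + gaussSmooth (F 1) (sumTo X k ω) (varFrom P X n k) * sumFrom X q k ω
    + gaussSmooth (F 2) (sumTo X k ω) (varFrom P X n k) * sumFrom (quadForm P X q) q k ω

theorem IsSmoothCutoff.measurable_smooth {F : ℕ → ℝ → ℝ} {K : ℝ} (hF : IsSmoothCutoff F K)
    {j : ℕ} (hj : j ≤ 3) (V : ℝ≥0) : Measurable fun x => gaussSmooth (F j) x V := by
  have : LipschitzWith (Real.toNNReal K) fun x => gaussSmooth (F j) x V :=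
    LipschitzWith.of_dist_le_mul fun x y => by
      have := hF.smooth_diff_le hj y (x - y) V
      rw [add_sub_cancel] at this
      rwa [Real.dist_eq, Real.dist_eq, Real.coe_toNNReal _ hF.pos.le]
  exact this.continuous.measurable

namespace WeakDep

variable {P : Measure Ω} [IsProbabilityMeasure P] {𝓖 : ℕ → MeasurableSpace Ω} {X : ℕ → Ω → ℝ}
  {C : ℝ} {κ₁ κ₂ κ₃ : ℕ → ℝ} {F : ℕ → ℝ → ℝ} {K : ℝ}

theorem bdd_smooth (h : WeakDep P 𝓖 X C κ₁ κ₂ κ₃) (hF : IsSmoothCutoff F K) {j : ℕ} (hj : j ≤ 3)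
    (k : ℕ) (V : ℝ≥0) : BddMeas fun ω => gaussSmooth (F j) (sumTo X k ω) V :=
  ⟨(hF.measurable_smooth hj V).comp (h.bdd_sumTo k).1, K, fun _ => hF.smooth_bound (by omega) _ _⟩

theorem bdd_potential (h : WeakDep P 𝓖 X C κ₁ κ₂ κ₃) (hF : IsSmoothCutoff F K) (n q k : ℕ) :
    BddMeas (potential P X F n q k) :=
  ((h.bdd_smooth hF (by omega) k _).add ((h.bdd_smooth hF (by omega) k _).mul
    (h.bdd_sumFrom q k))).add ((h.bdd_smooth hF (by omega) k _).mul (h.bdd_sumFrom_quadForm q k))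

/-- With x = X_{k+1}, the sliding of A removes φ_1 x from the Taylor expansion and contributes the
cross term φ_2 x A_{k+1}. Together with φ_2 x²/2 and the heat term it forms φ_2 times the quadratic
form at k + 1, up to long-range covariances, and the sliding of B removes that. The weight H, later
the indicator that no exit has occurred, is harmless because the dependence bounds allow any bounded
factor from the past. -/
theorem integral_potential_sub_le (h : WeakDep P 𝓖 X C κ₁ κ₂ κ₃) (hF : IsSmoothCutoff F K)
    {n q : ℕ} (hqn : q ≤ n) (hn : ∀ j, n < j → ∀ ω, X j ω = 0) {D : ℝ}
    (hD : κ₂ 0 + 2 * ∑ l ∈ Finset.range n, κ₂ (l + 1) ≤ D) (k : ℕ) {H : Ω → ℝ}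
    (hH : Measurable[𝓖 k] H) (hH1 : ∀ ω, |H ω| ≤ 1) :
    ∫ ω, H ω * (potential P X F n q (k + 1) ω - potential P X F n q k ω) ∂P
      ≤ K * stepError κ₁ κ₂ κ₃ n q D := by
  have hK := hF.pos
  set V := varFrom P X n k with hV
  set U := varFrom P X n (k + 1) with hU
  set S := sumTo X k with hS
  have hS1 : ∀ ω, sumTo X (k + 1) ω = S ω + X (k + 1) ω := fun ω => Finset.sum_range_succ _ _
  set x := X (k + 1) with hx
  set A := sumFrom X q k
  set A' := sumFrom X q (k + 1)
  set W := quadForm P X q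
  set B := sumFrom W q k
  set B' := sumFrom W q (k + 1)
  set Δ : ℝ := (V : ℝ) - U with hΔ
  set c : ℕ → ℝ := fun l => lagCov P X (k + 1) l with hc
  have hVU : Δ = c 0 + 2 * ∑ l ∈ Finset.range n, c (l + 1) := h.varFrom_sub hn k
  have hΔD : |Δ| ≤ D := by
    rw [hVU]
    refine le_trans ((abs_add_le _ _).trans (add_le_add (h.cov_le _ _) ?_)) hD
    rw [abs_mul, abs_two]
    gcongr
    exact (Finset.abs_sum_le_sum_abs _ _).trans (Finset.sum_le_sum fun l _ => h.cov_le _ _)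
  have hD0 : 0 ≤ D := (abs_nonneg _).trans hΔD
  have hA : ∀ ω, A' ω - A ω = X (k + 1 + q) ω - x ω := fun ω => by
    linarith [sumFrom_eq_add X q k ω]
  have hB : ∀ ω, B' ω - B ω = W (k + 1 + q) ω - W (k + 1) ω := fun ω => by
    linarith [sumFrom_eq_add W q k ω]
  let ψ : ℕ → ℝ → ℝ := fun j y => gaussSmooth (F j) y U
  let θ : ℕ → ℝ → ℝ := fun j y => gaussSmooth (F j) y V
  have mψ : ∀ j, j ≤ 3 → Measurable (ψ j) := fun j hj => hF.measurable_smooth hj U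
  have mθ : ∀ j, j ≤ 3 → Measurable (θ j) := fun j hj => hF.measurable_smooth hj V
  have mSk : Measurable[𝓖 k] S := h.measurable_sumTo le_rfl
  have mSk' : Measurable[𝓖 (k + 1)] S := h.measurable_sumTo (by omega)
  have mx : Measurable[𝓖 (k + 1)] x := h.adapted _
  have hH' : Measurable[𝓖 (k + 1)] H := hH.mono (h.mono (by omega)) le_rfl
  have bH : BddMeas H := ⟨hH.mono (h.le k) le_rfl, 1, hH1⟩
  have bx : BddMeas x := h.bdd _
  have bA : BddMeas A := h.bdd_sumFrom _ _
  have bA' : BddMeas A' := h.bdd_sumFrom _ _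
  have bB : BddMeas B := h.bdd_sumFrom_quadForm _ _
  have bB' : BddMeas B' := h.bdd_sumFrom_quadForm _ _
  have bW : ∀ j, BddMeas (W j) := fun j => h.bdd_quadForm _ _
  have bψ : ∀ j, j ≤ 3 → BddMeas fun ω => ψ j (S ω) := fun j hj => h.bdd_smooth hF hj k U
  have bθ : ∀ j, j ≤ 3 → BddMeas fun ω => θ j (S ω) := fun j hj => h.bdd_smooth hF hj k V
  have bψ' : ∀ j, j ≤ 3 → BddMeas fun ω => ψ j (S ω + x ω) := fun j hj => by
    have := h.bdd_smooth hF hj (k + 1) U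
    simpa only [hS1] using this
  -- the nine terms of the expansion
  let r₁ : Ω → ℝ := fun ω => H ω * (ψ 0 (S ω + x ω) - ψ 0 (S ω) - ψ 1 (S ω) * x ω
    - ψ 2 (S ω) * (x ω ^ 2 / 2))
  let r₂ : Ω → ℝ := fun ω => H ω * (θ 0 (S ω) - ψ 0 (S ω) - Δ / 2 * ψ 2 (S ω))
  let b₃ : Ω → ℝ := fun ω => H ω * (ψ 1 (S ω + x ω) - ψ 1 (S ω) - ψ 2 (S ω) * x ω)
  let b₄ : Ω → ℝ := fun ω => H ω * ψ 1 (S ω)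
  let b₅ : Ω → ℝ := fun ω => H ω * (θ 1 (S ω) - ψ 1 (S ω))
  let b₆ : Ω → ℝ := fun ω => H ω * (ψ 2 (S ω + x ω) - ψ 2 (S ω))
  let b₇ : Ω → ℝ := fun ω => H ω * ψ 2 (S ω)
  let b₈ : Ω → ℝ := fun ω => H ω * (θ 2 (S ω) - ψ 2 (S ω))
  let t : ℝ := ∑ l ∈ Finset.Ico q n, c (l + 1)
  have B1 : BddMeas r₁ := bH.mul ((((bψ' 0 (by omega)).sub (bψ 0 (by omega))).sub
    ((bψ 1 (by omega)).mul bx)).sub ((bψ 2 (by omega)).mul ((bx.pow 2).div_const 2)))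
  have B2 : BddMeas r₂ := bH.mul (((bθ 0 (by omega)).sub (bψ 0 (by omega))).sub
    ((bψ 2 (by omega)).const_mul _))
  have B3 : BddMeas b₃ := bH.mul (((bψ' 1 (by omega)).sub (bψ 1 (by omega))).sub
    ((bψ 2 (by omega)).mul bx))
  have B4 : BddMeas b₄ := bH.mul (bψ 1 (by omega))
  have B5 : BddMeas b₅ := bH.mul ((bθ 1 (by omega)).sub (bψ 1 (by omega)))
  have B6 : BddMeas b₆ := bH.mul ((bψ' 2 (by omega)).sub (bψ 2 (by omega)))
  have B7 : BddMeas b₇ := bH.mul (bψ 2 (by omega))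
  have B8 : BddMeas b₈ := bH.mul ((bθ 2 (by omega)).sub (bψ 2 (by omega)))
  have expand : ∀ ω, H ω * (potential P X F n q (k + 1) ω - potential P X F n q k ω)
      = r₁ ω - r₂ ω + b₃ ω * A' ω + b₄ ω * X (k + (1 + q)) ω - b₅ ω * A ω + b₆ ω * B' ω
        + b₇ ω * W (k + (1 + q)) ω - b₈ ω * B ω - b₇ ω * t := by
    intro ω
    have e1 : potential P X F n q (k + 1) ω = ψ 0 (S ω + x ω) + ψ 1 (S ω + x ω) * A' ω
        + ψ 2 (S ω + x ω) * B' ω := by simp only [potential, hS1]; rfl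
    have e2 : potential P X F n q k ω = θ 0 (S ω) + θ 1 (S ω) * A ω + θ 2 (S ω) * B ω := rfl
    -- The quadratic form subtracts covariances of lag at most q, whereas the decrease Δ of the
    -- variance involves lags up to n; t is the sum of those of lag greater than q.
    have e3 : W (k + 1) ω = x ω ^ 2 / 2 + x ω * A' ω - Δ / 2 + t := by
      have s1 : ∑ l ∈ Finset.range n, c (l + 1) = ∑ l ∈ Finset.range q, c (l + 1) + t :=
        (Finset.sum_range_add_sum_Ico _ hqn).symm
      have s2 : x ω * A' ω = ∑ l ∈ Finset.range q, x ω * X (k + 1 + (l + 1)) ω :=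
        Finset.mul_sum _ _ _
      have s3 : W (k + 1) ω = (x ω * x ω - c 0) / 2
          + ∑ l ∈ Finset.range q, (x ω * X (k + 1 + (l + 1)) ω - c (l + 1)) := rfl
      rw [s3, s2, hVU, s1, Finset.sum_sub_distrib]
      ring
    have e4 := hA ω
    have e5 := hB ω
    rw [e1, e2, ← add_assoc k 1 q]
    simp only [r₁, r₂, b₃, b₄, b₅, b₆, b₇, b₈]
    have e6 : X (k + 1 + q) ω = A' ω - A ω + x ω := by linarith
    have e7 : W (k + 1 + q) ω = B' ω - B ω + (x ω ^ 2 / 2 + x ω * A' ω - Δ / 2 + t) := by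
      linarith
    rw [e6, e7]
    ring
  have i1 := B1.integrable P
  have i2 := B2.integrable P
  have i3 := (B3.mul bA').integrable P
  have i4 := (B4.mul (h.bdd (k + (1 + q)))).integrable P
  have i5 := (B5.mul bA).integrable P
  have i6 := (B6.mul bB').integrable P
  have i7 := (B7.mul (bW (k + (1 + q)))).integrable P
  have i8 := (B8.mul bB).integrable P
  have i9 := (B7.mul (BddMeas.const t)).integrable P
  simp only [expand]
  rw [integral_sub (((((((i1.sub_fun i2).fun_add i3).fun_add i4).sub_fun i5).fun_add i6).fun_add
      i7).sub_fun i8) i9,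
    integral_sub ((((((i1.sub_fun i2).fun_add i3).fun_add i4).sub_fun i5).fun_add i6).fun_add i7) i8,
    integral_add (((((i1.sub_fun i2).fun_add i3).fun_add i4).sub_fun i5).fun_add i6) i7,
    integral_add ((((i1.sub_fun i2).fun_add i3).fun_add i4).sub_fun i5) i6,
    integral_sub (((i1.sub_fun i2).fun_add i3).fun_add i4) i5,
    integral_add ((i1.sub_fun i2).fun_add i3) i4, integral_add (i1.sub_fun i2) i3,
    integral_sub i1 i2]
  have one_mul_le : ∀ {a b : ℝ} (ω : Ω), |a| ≤ b → |H ω * a| ≤ b := fun {a b} ω hab => by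
    rw [abs_mul]
    calc |H ω| * |a| ≤ 1 * |a| := by gcongr; exact hH1 ω
      _ ≤ b := by rwa [one_mul]
  have E1 : |∫ ω, r₁ ω ∂P| ≤ K * κ₃ 0 := by
    refine abs_integral_le_integral_abs.trans ?_
    refine (integral_mono i1.abs (((bx.abs.pow 3).const_mul K).integrable P) fun ω =>
      one_mul_le ω (hF.smooth_taylor_two_le _ _ _)).trans ?_
    rw [integral_const_mul]
    exact mul_le_mul_of_nonneg_left (h.moment_le _) hK.le
  have E2 : |∫ ω, r₂ ω ∂P| ≤ K * ((gaussFourth + 1) * D ^ 2) := by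
    have := norm_integral_le_of_norm_le_const (μ := P) (f := r₂)
      (C := K * ((gaussFourth + 1) * D ^ 2)) (Eventually.of_forall fun ω =>
      one_mul_le ω ((hF.smooth_heat_abs_le (S ω) V U).trans (by
        rw [mul_assoc]
        have := gaussFourth_nonneg
        gcongr)))
    simpa using this
  have E3 : |∫ ω, b₃ ω * A' ω ∂P| ≤ K * ∑ i ∈ Finset.range q, κ₃ (i + 1) :=
    h.sumFrom_le_three q (k + 1) (hH'.mul ((((mψ 1 (by omega)).comp (mSk'.add mx)).sub
      ((mψ 1 (by omega)).comp mSk')).sub (((mψ 2 (by omega)).comp mSk').mul mx))) hK.le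
      (fun ω => one_mul_le ω (hF.smooth_taylor_one_le (by omega) _ _ _)) B3
  -- The factor `b₄` depends on times at most k only, so the entering variable X_{k+1+q} is
  -- separated from it by q + 1. The same gap is used for the entering quadratic form in `E7`.
  have E4 : |∫ ω, b₄ ω * X (k + (1 + q)) ω ∂P| ≤ K * κ₁ (1 + q) :=
    h.one_le k (1 + q) (by omega) _ (hH.mul ((mψ 1 (by omega)).comp mSk)) K
      fun ω => one_mul_le ω (hF.smooth_bound (by omega) _ _)
  have E5 : |∫ ω, b₅ ω * A ω ∂P| ≤ K * D * ∑ i ∈ Finset.range q, κ₁ (i + 1) :=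
    h.sumFrom_le_one q k (hH.mul (((mθ 1 (by omega)).comp mSk).sub ((mψ 1 (by omega)).comp mSk)))
      fun ω => one_mul_le ω ((hF.smooth_time_abs_le (by omega) _ V U).trans (by gcongr))
  have E6 := h.sumFrom_quadForm_le_three q (k + 1) (B := b₆) (c := K)
      (hH'.mul (((mψ 2 (by omega)).comp (mSk'.add mx)).sub ((mψ 2 (by omega)).comp mSk'))) hK.le
      (fun ω => one_mul_le ω (hF.smooth_diff_le (by omega) _ _ _)) B6
  have E7 : |∫ ω, b₇ ω * W (k + (1 + q)) ω ∂P| ≤ K * ((q + 1) * κ₂ (1 + q)) :=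
    h.quadForm_le_two q k (by omega) (hH.mul ((mψ 2 (by omega)).comp mSk))
      fun ω => one_mul_le ω (hF.smooth_bound (by omega) _ _)
  have E8 : |∫ ω, b₈ ω * B ω ∂P| ≤ K * D * ∑ i ∈ Finset.range q, (q + 1) * κ₂ (i + 1) :=
    h.sumFrom_quadForm_le_two q k
      (hH.mul (((mθ 2 (by omega)).comp mSk).sub ((mψ 2 (by omega)).comp mSk)))
      fun ω => one_mul_le ω ((hF.smooth_time_abs_le (by omega) _ V U).trans (by gcongr))
  have E9 : |∫ ω, b₇ ω * t ∂P| ≤ K * ∑ l ∈ Finset.Ico q n, κ₂ (l + 1) := by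
    rw [integral_mul_const, abs_mul]
    have h1 : |∫ ω, b₇ ω ∂P| ≤ K := by
      have := norm_integral_le_of_norm_le_const (μ := P) (f := b₇) (C := K)
        (Eventually.of_forall fun ω => one_mul_le ω (hF.smooth_bound (by omega) _ _))
      simpa using this
    have h2 : |t| ≤ ∑ l ∈ Finset.Ico q n, κ₂ (l + 1) :=
      (Finset.abs_sum_le_sum_abs _ _).trans (Finset.sum_le_sum fun l _ => h.cov_le _ _)
    exact mul_le_mul h1 h2 (abs_nonneg _) hK.le
  rw [stepError]
  rw [add_comm 1 q] at E4 E7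
  rw [abs_le] at E1 E2 E3 E4 E5 E6 E7 E8 E9
  rw [add_comm 1 q]
  simp only [mul_add K]
  rw [← mul_assoc K D, ← mul_assoc K D]
  linarith [E1.2, E2.1, E3.2, E4.2, E5.1, E6.2, E7.2, E8.1, E9.1]

/-- The maximal inequality obtained by stopping the Lindeberg replacement. -/
theorem real_exists_two_le (h : WeakDep P 𝓖 X C κ₁ κ₂ κ₃) (hF : IsSmoothCutoff F K)
    {n q : ℕ} (hq : 1 ≤ q) (hqn : q ≤ n) (hn : ∀ j, n < j → ∀ ω, X j ω = 0) {D : ℝ}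
    (hD : κ₂ 0 + 2 * ∑ l ∈ Finset.range n, κ₂ (l + 1) ≤ D)
    (hsmall : K * (q * C) + K * (3 * (q * C) ^ 2) ≤ 1 / 4) {v : ℝ} (hv : 0 < v)
    (hvar : ∫ ω, sumTo X n ω ^ 2 ∂P ≤ v) :
    P.real {ω | ∃ k ≤ n, 2 ≤ |sumTo X k ω|} ≤
      8 * Real.exp (-(1 / (2 * v))) + 4 * n * (K * stepError κ₁ κ₂ κ₃ n q D) := by
  classical
  set G := potential P X F n q with hG
  let alive : ℕ → Set Ω := fun k => {ω | ∀ j ≤ k, |sumTo X j ω| < 2}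
  have malive : ∀ k, MeasurableSet[𝓖 k] (alive k) := by
    intro k
    have : alive k = ⋂ j, ⋂ (_ : j ≤ k), {ω | |sumTo X j ω| < 2} := by ext; simp [alive]
    rw [this]
    refine MeasurableSet.iInter fun j => MeasurableSet.iInter fun hj => ?_
    have hs : MeasurableSet {x : ℝ | |x| < 2} := measurableSet_lt measurable_norm measurable_const
    exact h.measurable_sumTo hj hs
  let H : ℕ → Ω → ℝ := fun k => (alive k).indicator 1
  have mH : ∀ k, Measurable[𝓖 k] (H k) := fun k =>
    Measurable.indicator (m := 𝓖 k) (@measurable_const ℝ Ω _ (𝓖 k) 1) (malive k)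
  have hH1 : ∀ k ω, |H k ω| ≤ 1 := fun k ω => by
    by_cases hω : ω ∈ alive k <;> simp [H, hω]
  have bH : ∀ k, BddMeas (H k) := fun k => ⟨(mH k).mono (h.le k) le_rfl, 1, hH1 k⟩
  have bG : ∀ k, BddMeas (G k) := fun k => h.bdd_potential hF n q k
  have hquarter : ∀ k ω, 2 ≤ |sumTo X k ω| → 1 / 4 ≤ G k ω := by
    intro k ω hk
    have h1 := hF.half_le_smooth hk (varFrom P X n k)
    have h2 : |gaussSmooth (F 1) (sumTo X k ω) (varFrom P X n k) * sumFrom X q k ω|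
        ≤ K * (q * C) := by
      rw [abs_mul]
      exact mul_le_mul (hF.smooth_bound (by omega) _ _) (h.abs_sumFrom_le q k ω) (abs_nonneg _)
        hF.pos.le
    have h3 : |gaussSmooth (F 2) (sumTo X k ω) (varFrom P X n k) *
        sumFrom (quadForm P X q) q k ω| ≤ K * (3 * (q * C) ^ 2) := by
      rw [abs_mul]
      exact mul_le_mul (hF.smooth_bound (by omega) _ _) (h.abs_sumFrom_quadForm_le hq k ω)
        (abs_nonneg _) hF.pos.le
    simp only [hG, potential]
    linarith [(abs_le.1 h2).1, (abs_le.1 h3).1]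
  -- All variables after time n are zero, so both correctors vanish at time n and only the
  -- nonnegative smoothed cutoff remains.
  have hend : ∀ ω, 0 ≤ G n ω := by
    intro ω
    have z1 : sumFrom X q n ω = 0 := Finset.sum_eq_zero fun i _ => hn _ (by omega) _
    have z2 : sumFrom (quadForm P X q) q n ω = 0 := by
      refine Finset.sum_eq_zero fun i _ => ?_
      have z : ∀ l, lagCov P X (n + (i + 1)) l = 0 := fun l => by
        simp [lagCov, hn (n + (i + 1)) (by omega)]
      simp [quadForm, z, hn (n + (i + 1)) (by omega)]
    simp only [hG, potential, z1, z2, mul_zero, add_zero]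
    exact hF.smooth_nonneg _ _
  -- The right side is the potential stopped at the exit time. Before exit it equals G m; from the
  -- exit on it is frozen at a value which is at least 1/4 by `hquarter`.
  have hpath : ∀ m ω, (1 - H m ω) * (1 / 4) + H m ω * G m ω ≤
      G 0 ω + ∑ k ∈ Finset.range m, H k ω * (G (k + 1) ω - G k ω) := by
    intro m ω
    induction m with
    | zero =>
      have : ω ∈ alive 0 := fun j hj => by
        obtain rfl : j = 0 := by omega
        simp [sumTo]
      simp [H, this]
    | succ m ih =>
      rw [Finset.sum_range_succ, ← add_assoc]
      by_cases hm : ω ∈ alive m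
      · by_cases hm' : ω ∈ alive (m + 1)
        · simp only [H, Set.indicator_of_mem hm, Set.indicator_of_mem hm', Pi.one_apply] at ih ⊢
          linarith
        · have : 2 ≤ |sumTo X (m + 1) ω| := by
            by_contra hlt
            refine hm' fun j hj => ?_
            rcases Nat.lt_or_ge j (m + 1) with hj' | hj'
            · exact hm j (by omega)
            · obtain rfl : j = m + 1 := by omega
              exact not_le.1 hlt
          have := hquarter _ _ this
          simp only [H, Set.indicator_of_mem hm, Set.indicator_of_notMem hm', Pi.one_apply] at ih ⊢
          linarith
      · have hm' : ω ∉ alive (m + 1) := fun hh => hm fun j hj => hh j (by omega)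
        simp only [H, Set.indicator_of_notMem hm, Set.indicator_of_notMem hm'] at ih ⊢
        linarith
  have hset : {ω | ∃ k ≤ n, 2 ≤ |sumTo X k ω|} = (alive n)ᶜ := by
    ext ω; simp [alive]
  have mal : MeasurableSet (alive n) := h.le n _ (malive n)
  have hprob : P.real {ω | ∃ k ≤ n, 2 ≤ |sumTo X k ω|} = ∫ ω, (1 - H n ω) ∂P := by
    rw [hset, integral_sub (integrable_const _) ((bH n).integrable P), measureReal_compl mal]
    simp [H, integral_indicator_one mal]
  have hsum : (∫ ω, (1 - H n ω) ∂P) * (1 / 4) ≤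
      (∫ ω, G 0 ω ∂P) + ∑ k ∈ Finset.range n, ∫ ω, H k ω * (G (k + 1) ω - G k ω) ∂P := by
    have bs : ∀ k, BddMeas fun ω => H k ω * (G (k + 1) ω - G k ω) := fun k =>
      (bH k).mul ((bG (k + 1)).sub (bG k))
    rw [← integral_mul_const, ← integral_finsetSum _ fun k _ => (bs k).integrable P,
      ← integral_add ((bG 0).integrable P) ((BddMeas.sum fun k _ => bs k).integrable P)]
    refine integral_mono ((((BddMeas.const 1).sub (bH n)).mul (BddMeas.const _)).integrable P)
      (((bG 0).add (BddMeas.sum fun k _ => bs k)).integrable P) fun ω => ?_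
    have h0 : 0 ≤ H n ω * G n ω :=
      mul_nonneg (Set.indicator_nonneg (fun _ _ => zero_le_one) _) (hend ω)
    linarith [hpath n ω]
  -- Since S_0 = 0 the coefficients at time 0 are constants, so the centered correctors integrate to
  -- zero and only φ_0(0, V_0) is left.
  have hG0 : ∫ ω, G 0 ω ∂P ≤ 2 * Real.exp (-(1 / (2 * v))) := by
    have e : ∀ ω, G 0 ω = gaussSmooth (F 0) 0 (varFrom P X n 0)
        + gaussSmooth (F 1) 0 (varFrom P X n 0) * sumFrom X q 0 ω
        + gaussSmooth (F 2) 0 (varFrom P X n 0) * sumFrom (quadForm P X q) q 0 ω := fun ω => by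
      simp [hG, potential, sumTo]
    simp only [e]
    rw [integral_add ((integrable_const _).fun_add (((h.bdd_sumFrom q 0).const_mul _).integrable P))
      (((h.bdd_sumFrom_quadForm q 0).const_mul _).integrable P),
      integral_add (integrable_const _) (((h.bdd_sumFrom q 0).const_mul _).integrable P),
      integral_const_mul, integral_const_mul, h.integral_sumFrom, h.integral_sumFrom_quadForm]
    simp only [integral_const, probReal_univ, smul_eq_mul, one_mul, mul_zero, add_zero]
    refine hF.smooth_zero_le hv (le_trans (le_of_eq ?_) hvar)
    change ∫ ω, sumFrom X n 0 ω ^ 2 ∂P = _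
    simp [sumFrom, sumTo]
  have hinc : ∑ k ∈ Finset.range n, ∫ ω, H k ω * (G (k + 1) ω - G k ω) ∂P
      ≤ n * (K * stepError κ₁ κ₂ κ₃ n q D) := by
    refine (Finset.sum_le_card_nsmul _ _ _ fun k _ =>
      h.integral_potential_sub_le hF hqn hn hD k (mH k) (hH1 k)).trans ?_
    simp
  rw [hprob]
  linarith

end WeakDep

end Stopping

/-! ### Functions whose level sets are intervals, and clipping. -/

/-- Functions whose superlevel sets above `0` and sublevel sets below `0` are intervals. -/
def LevelConvex (g : ℝ → ℝ) : Prop :=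
  ∀ t, 0 ≤ t → {x | t < g x}.OrdConnected ∧ {x | g x < -t}.OrdConnected

/-- Truncation to `[-T, T]`. -/
def clip (T x : ℝ) : ℝ := max (-T) (min T x)

theorem abs_clip {T : ℝ} (hT : 0 ≤ T) (x : ℝ) : |clip T x| = min |x| T := by
  unfold clip
  rcases le_total T x with h1 | h1
  · rw [min_eq_left h1, max_eq_right (by linarith), abs_of_nonneg hT,
      abs_of_nonneg (hT.trans h1), min_eq_right h1]
  · rw [min_eq_right h1]
    rcases le_total x (-T) with h2 | h2
    · rw [max_eq_left h2, abs_neg, abs_of_nonneg hT, abs_of_nonpos (by linarith),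
        min_eq_right (by linarith)]
    · rw [max_eq_right h2, min_eq_left (abs_le.2 ⟨h2, h1⟩)]

/-- Clipping multiplies x by a factor in [0, 1]. This preserves signs, so the errors of clipped
products can be computed exactly. -/
theorem exists_clip_eq {T : ℝ} (hT : 0 ≤ T) (x : ℝ) : ∃ s, 0 ≤ s ∧ s ≤ 1 ∧ clip T x = s * x := by
  rcases eq_or_ne x 0 with rfl | hx
  · exact ⟨1, zero_le_one, le_rfl, by simp [clip, hT]⟩
  · refine ⟨clip T x / x, ?_, ?_, by field_simp⟩
    · unfold clip
      rcases lt_or_gt_of_ne hx with h | h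
      · refine div_nonneg_of_nonpos (max_le (by linarith) ?_) h.le
        exact (min_le_right _ _).trans h.le
      · exact div_nonneg (le_max_of_le_right (le_min hT h.le)) h.le
    · refine (le_abs_self _).trans ?_
      rw [abs_div, abs_clip hT]
      exact div_le_one_of_le₀ (min_le_left _ _) (abs_nonneg _)

theorem measurable_clip (T : ℝ) : Measurable (clip T) :=
  (measurable_const).max (measurable_const.min measurable_id)

theorem abs_sub_clip {T : ℝ} (hT : 0 ≤ T) (x : ℝ) : |x - clip T x| = max (|x| - T) 0 := by
  obtain ⟨s, h0, h1, hs⟩ := exists_clip_eq hT x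
  have h2 := abs_clip hT x
  rw [hs, abs_mul, abs_of_nonneg h0] at h2
  rw [hs, show x - s * x = (1 - s) * x by ring, abs_mul, abs_of_nonneg (by linarith), sub_mul,
    one_mul, h2]
  rcases le_total |x| T with h | h
  · rw [min_eq_left h, max_eq_right (by linarith)]; ring
  · rw [min_eq_right h, max_eq_left (by linarith)]

namespace LevelConvex

variable {g : ℝ → ℝ}

/-- Below height T the level sets are unchanged, and from T on they are empty. -/
theorem clip (hg : LevelConvex g) {T : ℝ} (hT : 0 ≤ T) : LevelConvex fun x => clip T (g x) := by
  intro t ht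
  have e1 : {x | t < _root_.clip T (g x)} = if t < T then {x | t < g x} else ∅ := by
    ext x
    split_ifs with h
    · simp only [_root_.clip, Set.mem_ofPred_eq, lt_max_iff, lt_min_iff]
      constructor
      · rintro (h | h)
        · linarith
        · exact h.2
      · exact fun h' => Or.inr ⟨h, h'⟩
    · simp only [_root_.clip, Set.mem_ofPred_eq, lt_max_iff, lt_min_iff, Set.mem_empty_iff_false,
        iff_false]
      rintro (h' | h')
      · linarith
      · exact h h'.1
  have e2 : {x | _root_.clip T (g x) < -t} = if t < T then {x | g x < -t} else ∅ := by
    ext x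
    split_ifs with h
    · simp only [_root_.clip, Set.mem_ofPred_eq, max_lt_iff, min_lt_iff]
      constructor
      · rintro ⟨_, h | h⟩
        · linarith
        · exact h
      · exact fun h' => ⟨by linarith, Or.inr h'⟩
    · simp only [_root_.clip, Set.mem_ofPred_eq, max_lt_iff, min_lt_iff, Set.mem_empty_iff_false,
        iff_false]
      rintro ⟨h', _⟩
      exact h (by linarith)
  rw [e1, e2]
  split_ifs
  · exact hg t ht
  · exact ⟨Set.ordConnected_empty, Set.ordConnected_empty⟩

theorem measurable (hg : LevelConvex g) : Measurable g := by
  have h1 : Measurable fun x => max (g x) 0 := by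
    refine measurable_of_Ioi fun t => ?_
    rcases le_or_gt 0 t with ht | ht
    · convert (hg t ht).1.measurableSet using 1
      ext x; simp [ht]
    · convert MeasurableSet.univ using 1
      ext x; simp [ht]
  have h2 : Measurable fun x => max (-g x) 0 := by
    refine measurable_of_Ioi fun t => ?_
    rcases le_or_gt 0 t with ht | ht
    · convert (hg t ht).2.measurableSet using 1
      ext x; simp [ht, lt_neg]
    · convert MeasurableSet.univ using 1
      ext x; simp [ht]
  convert h1.sub h2 using 1
  ext x
  rcases le_total 0 (g x) with h | h
  · simp [h]
  · simp [h]

theorem one : LevelConvex fun _ => 1 := by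
  intro t ht
  refine ⟨?_, ?_⟩
  · rcases lt_or_ge t 1 with h | h
    · simp [h, Set.ordConnected_univ]
    · simp [h.not_gt, Set.ordConnected_empty]
  · have : ¬ (1 : ℝ) < -t := by linarith
    simp [this, Set.ordConnected_empty]

/-- A point where g exceeds t ≥ 0 or lies below -t must belong to I, since g is null elsewhere;
inside I monotonicity and the order-connectedness of I fill the gaps. -/
theorem of_monotoneOn {I : Set ℝ} (hI : I.OrdConnected) (h : MonotoneOn g I)
    (h0 : ∀ x, x ∉ I → g x = 0) : LevelConvex g := by
  intro t ht
  refine ⟨⟨fun x hx z hz y hy => ?_⟩, ⟨fun x hx z hz y hy => ?_⟩⟩ <;>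
  simp only [Set.mem_ofPred_eq] at hx hz ⊢
  all_goals
    have hxI : x ∈ I := by by_contra hh; linarith [h0 x hh]
    have hzI : z ∈ I := by by_contra hh; linarith [h0 z hh]
    have hyI := hI.out hxI hzI hy
  · exact hx.trans_le (h hxI hyI hy.1)
  · exact (h hyI hzI hy.2).trans_lt hz

theorem neg (hg : LevelConvex g) : LevelConvex fun x => -g x := by
  intro t ht
  obtain ⟨h1, h2⟩ := hg t ht
  refine ⟨?_, ?_⟩
  · convert h2 using 1; ext x
    simp only [Set.mem_ofPred_eq, lt_neg]
  · convert h1 using 1; ext x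
    simp only [Set.mem_ofPred_eq, neg_lt_neg_iff]

theorem of_antitoneOn {I : Set ℝ} (hI : I.OrdConnected) (h : AntitoneOn g I)
    (h0 : ∀ x, x ∉ I → g x = 0) : LevelConvex g := by
  have := (of_monotoneOn hI h.neg fun x hx => by simp [h0 x hx]).neg
  simpa using this

end LevelConvex

/-- A lower set of the line is empty, everything, or an open or closed half-line; each is a
pointwise limit of closed half-lines, the only sets that α sees. -/
theorem exists_tendsto_indicator_Iic {L : Set ℝ} (hL : IsLowerSet L) :
    ∃ x : ℕ → ℝ, ∀ t, Tendsto (fun n => (Set.Iic (x n)).indicator (1 : ℝ → ℝ) t) atTop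
      (𝓝 (L.indicator 1 t)) := by
  classical
  rcases L.eq_empty_or_nonempty with rfl | hne
  · refine ⟨fun n => -n, fun t => tendsto_const_nhds.congr' ?_⟩
    obtain ⟨N, hN⟩ := exists_nat_gt (-t)
    filter_upwards [eventually_ge_atTop N] with n hn
    have : (N : ℝ) ≤ n := by exact_mod_cast hn
    rw [Set.indicator_of_notMem (by simp), Set.indicator_of_notMem]
    simp only [Set.mem_Iic]; linarith
  by_cases hb : BddAbove L
  · by_cases hs : sSup L ∈ L
    · refine ⟨fun _ => sSup L, fun t => ?_⟩
      have : L = Set.Iic (sSup L) := by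
        ext y; exact ⟨fun hy => le_csSup hb hy, fun hy => hL hy hs⟩
      simp only [← this]; exact tendsto_const_nhds
    · refine ⟨fun n => sSup L - 1 / (n + 1), fun t => tendsto_const_nhds.congr' ?_⟩
      by_cases ht : t ∈ L
      · have hlt : t < sSup L := lt_of_le_of_ne (le_csSup hb ht) fun h => hs (h ▸ ht)
        filter_upwards [tendsto_one_div_add_atTop_nhds_zero_nat.eventually_lt_const
          (sub_pos.2 hlt)] with n hn
        rw [Set.indicator_of_mem ht, Set.indicator_of_mem]
        simp only [Set.mem_Iic]; linarith
      · refine Eventually.of_forall fun n => ?_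
        have h1 : sSup L ≤ t := csSup_le hne fun y hy => by
          by_contra hh
          exact ht (hL (not_le.1 hh).le hy)
        have h2 : (0 : ℝ) < 1 / (n + 1) := by positivity
        have h3 : t ∉ Set.Iic (sSup L - 1 / ((n : ℝ) + 1)) := by
          simp only [Set.mem_Iic, not_le]; linarith
        exact (Set.indicator_of_notMem ht _).trans (Set.indicator_of_notMem h3 _).symm
  · have hu : L = Set.univ := by
      refine Set.eq_univ_of_forall fun y => ?_
      obtain ⟨z, hz, hyz⟩ := not_bddAbove_iff.1 hb y
      exact hL hyz.le hz
    refine ⟨fun n => n, fun t => tendsto_const_nhds.congr' ?_⟩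
    obtain ⟨N, hN⟩ := exists_nat_gt t
    filter_upwards [eventually_ge_atTop N] with n hn
    have : (N : ℝ) ≤ n := by exact_mod_cast hn
    rw [hu, Set.indicator_of_mem (Set.mem_univ _), Set.indicator_of_mem]
    simp only [Set.mem_Iic]; linarith

/-! ### From half-lines to level-convex functions in the form E(B u(U) w(V)). -/

section PairInt

set_option linter.unusedSectionVars false

variable {Ω : Type*} [mΩ : MeasurableSpace Ω]

/-- The bilinear form `E (B u(U) w(V))`. -/
noncomputable def pairInt (ν : Measure Ω) (B U V : Ω → ℝ) (u w : ℝ → ℝ) : ℝ :=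
  ∫ ω, B ω * (u (U ω) * w (V ω)) ∂ν

variable {ν : Measure Ω} [IsFiniteMeasure ν] {B U V : Ω → ℝ}

theorem BddMeas.comp {u : ℝ → ℝ} (hu : BddMeas u) (hU : Measurable U) :
    BddMeas fun ω => u (U ω) :=
  ⟨hu.1.comp hU, hu.2.imp fun _ h _ => h _⟩

theorem BddMeas.indicator {J : Set ℝ} (hJ : MeasurableSet J) :
    BddMeas (J.indicator (1 : ℝ → ℝ)) :=
  ⟨measurable_one.indicator hJ, 1, fun x => by by_cases h : x ∈ J <;> simp [h]⟩

theorem integrable_pair (hB : BddMeas B) (hU : Measurable U) (hV : Measurable V) {u w : ℝ → ℝ}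
    (hu : BddMeas u) (hw : BddMeas w) : Integrable (fun ω => B ω * (u (U ω) * w (V ω))) ν :=
  (hB.mul ((hu.comp hU).mul (hw.comp hV))).integrable ν

theorem pairInt_sub_left (hB : BddMeas B) (hU : Measurable U) (hV : Measurable V)
    {u u' w : ℝ → ℝ} (hu : BddMeas u) (hu' : BddMeas u') (hw : BddMeas w) :
    pairInt ν B U V (fun x => u x - u' x) w = pairInt ν B U V u w - pairInt ν B U V u' w := by
  unfold pairInt
  rw [← integral_sub (integrable_pair hB hU hV hu hw) (integrable_pair hB hU hV hu' hw)]
  congr 1; ext ω; ring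

theorem pairInt_sub_right (hB : BddMeas B) (hU : Measurable U) (hV : Measurable V)
    {u w w' : ℝ → ℝ} (hu : BddMeas u) (hw : BddMeas w) (hw' : BddMeas w') :
    pairInt ν B U V u (fun x => w x - w' x) = pairInt ν B U V u w - pairInt ν B U V u w' := by
  unfold pairInt
  rw [← integral_sub (integrable_pair hB hU hV hu hw) (integrable_pair hB hU hV hu hw')]
  congr 1; ext ω; ring

theorem pairInt_sum_left {ι : Type*} (s : Finset ι) (hB : BddMeas B) (hU : Measurable U)
    (hV : Measurable V) {u : ι → ℝ → ℝ} {w : ℝ → ℝ} (hu : ∀ i ∈ s, BddMeas (u i))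
    (hw : BddMeas w) :
    pairInt ν B U V (fun x => ∑ i ∈ s, u i x) w = ∑ i ∈ s, pairInt ν B U V (u i) w := by
  unfold pairInt
  rw [← integral_finsetSum _ fun i hi => integrable_pair hB hU hV (hu i hi) hw]
  congr 1; ext ω; rw [Finset.sum_mul, Finset.mul_sum]

theorem pairInt_sum_right {ι : Type*} (s : Finset ι) (hB : BddMeas B) (hU : Measurable U)
    (hV : Measurable V) {w : ι → ℝ → ℝ} {u : ℝ → ℝ} (hu : BddMeas u)
    (hw : ∀ i ∈ s, BddMeas (w i)) :
    pairInt ν B U V u (fun x => ∑ i ∈ s, w i x) = ∑ i ∈ s, pairInt ν B U V u (w i) := by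
  unfold pairInt
  rw [← integral_finsetSum _ fun i hi => integrable_pair hB hU hV hu (hw i hi)]
  congr 1; ext ω; rw [Finset.mul_sum, Finset.mul_sum]

theorem pairInt_const_mul_left (c : ℝ) (u w : ℝ → ℝ) :
    pairInt ν B U V (fun x => c * u x) w = c * pairInt ν B U V u w := by
  unfold pairInt
  rw [← integral_const_mul]
  congr 1; ext ω; ring

theorem pairInt_const_mul_right (c : ℝ) (u w : ℝ → ℝ) :
    pairInt ν B U V u (fun x => c * w x) = c * pairInt ν B U V u w := by
  unfold pairInt
  rw [← integral_const_mul]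
  congr 1; ext ω; ring

theorem tendsto_pairInt (hB : BddMeas B) (hU : Measurable U) (hV : Measurable V)
    {u w : ℕ → ℝ → ℝ} {u' w' : ℝ → ℝ} {C D : ℝ} (hu : ∀ n, Measurable (u n))
    (hw : ∀ n, Measurable (w n)) (huC : ∀ n x, |u n x| ≤ C) (hwD : ∀ n x, |w n x| ≤ D)
    (hu' : ∀ x, Tendsto (fun n => u n x) atTop (𝓝 (u' x)))
    (hw' : ∀ x, Tendsto (fun n => w n x) atTop (𝓝 (w' x))) :
    Tendsto (fun n => pairInt ν B U V (u n) (w n)) atTop (𝓝 (pairInt ν B U V u' w')) := by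
  obtain ⟨K, hK⟩ := hB.2
  refine tendsto_integral_of_dominated_convergence (fun _ => K * (C * D)) (fun n => ?_)
    (integrable_const _) (fun n => Eventually.of_forall fun ω => ?_)
    (Eventually.of_forall fun ω => ?_)
  · exact (hB.1.mul (((hu n).comp hU).mul ((hw n).comp hV))).aestronglyMeasurable
  · rw [Real.norm_eq_abs, abs_mul, abs_mul]
    exact mul_le_mul (hK ω) (mul_le_mul (huC _ _) (hwD _ _) (abs_nonneg _)
      ((abs_nonneg _).trans (huC n 0))) (by positivity) ((abs_nonneg _).trans (hK ω))
  · exact tendsto_const_nhds.mul ((hu' _).mul (hw' _))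

theorem abs_pairInt_lowerSet_le (hB : BddMeas B) (hU : Measurable U) (hV : Measurable V) {κ : ℝ}
    (h : ∀ x y, |pairInt ν B U V ((Set.Iic x).indicator 1) ((Set.Iic y).indicator 1)| ≤ κ)
    {L M : Set ℝ} (hL : IsLowerSet L) (hM : IsLowerSet M) :
    |pairInt ν B U V (L.indicator 1) (M.indicator 1)| ≤ κ := by
  obtain ⟨x, hx⟩ := exists_tendsto_indicator_Iic hL
  obtain ⟨y, hy⟩ := exists_tendsto_indicator_Iic hM
  have hb : ∀ z t : ℝ, |(Set.Iic z).indicator (1 : ℝ → ℝ) t| ≤ 1 := fun z t => by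
    by_cases ht : t ∈ Set.Iic z <;> simp [ht]
  have := tendsto_pairInt (ν := ν) hB hU hV
    (fun n => measurable_one.indicator (measurableSet_Iic (a := x n)))
    (fun n => measurable_one.indicator (measurableSet_Iic (a := y n)))
    (fun n t => hb _ t) (fun n t => hb _ t) hx hy
  exact le_of_tendsto this.abs (Eventually.of_forall fun n => h _ _)

/-- An interval is its lower closure minus the points of that closure lying below the interval, and
these again form a lower set. -/
theorem indicator_eq_sub_of_ordConnected {J : Set ℝ} (hJ : J.OrdConnected) :
    ∃ L M : Set ℝ, IsLowerSet L ∧ IsLowerSet M ∧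
      J.indicator (1 : ℝ → ℝ) = fun x => L.indicator 1 x - M.indicator 1 x := by
  refine ⟨lowerClosure J, (lowerClosure J : Set ℝ) \ J, (lowerClosure J).lower, ?_, ?_⟩
  · rintro a b hba ⟨ha, haJ⟩
    refine ⟨(lowerClosure J).lower hba ha, fun hb => haJ ?_⟩
    obtain ⟨c, hc, hac⟩ := mem_lowerClosure.1 ha
    exact hJ.out hb hc ⟨hba, hac⟩
  · ext x
    by_cases hx : x ∈ J
    · have : x ∈ (lowerClosure J : Set ℝ) := subset_lowerClosure hx
      simp [hx, this]
    · by_cases hx' : x ∈ (lowerClosure J : Set ℝ)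
      · rw [Set.indicator_of_notMem hx, Set.indicator_of_mem hx',
          Set.indicator_of_mem (s := (lowerClosure J : Set ℝ) \ J) ⟨hx', hx⟩]
        simp
      · rw [Set.indicator_of_notMem hx, Set.indicator_of_notMem hx',
          Set.indicator_of_notMem (s := (lowerClosure J : Set ℝ) \ J) fun h => hx' h.1]
        simp

/-- Each interval is a difference of two lower sets, and bilinearity leaves four terms. -/
theorem abs_pairInt_ordConnected_le (hB : BddMeas B) (hU : Measurable U) (hV : Measurable V)
    {κ : ℝ}
    (h : ∀ x y, |pairInt ν B U V ((Set.Iic x).indicator 1) ((Set.Iic y).indicator 1)| ≤ κ)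
    {I J : Set ℝ} (hI : I.OrdConnected) (hJ : J.OrdConnected) :
    |pairInt ν B U V (I.indicator 1) (J.indicator 1)| ≤ 4 * κ := by
  obtain ⟨L, M, hL, hM, e⟩ := indicator_eq_sub_of_ordConnected hI
  obtain ⟨L', M', hL', hM', e'⟩ := indicator_eq_sub_of_ordConnected hJ
  have bd : ∀ {S : Set ℝ}, IsLowerSet S → BddMeas (S.indicator (1 : ℝ → ℝ)) := fun hS =>
    BddMeas.indicator hS.ordConnected.measurableSet
  rw [e, e', pairInt_sub_left hB hU hV (bd hL) (bd hM) ((bd hL').sub (bd hM')),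
    pairInt_sub_right hB hU hV (bd hL) (bd hL') (bd hM'),
    pairInt_sub_right hB hU hV (bd hM) (bd hL') (bd hM')]
  have h1 := abs_le.1 (abs_pairInt_lowerSet_le hB hU hV h hL hL')
  have h2 := abs_le.1 (abs_pairInt_lowerSet_le hB hU hV h hL hM')
  have h3 := abs_le.1 (abs_pairInt_lowerSet_le hB hU hV h hM hL')
  have h4 := abs_le.1 (abs_pairInt_lowerSet_le hB hU hV h hM hM')
  rw [abs_le]
  constructor <;> linarith [h1.1, h1.2, h2.1, h2.2, h3.1, h3.2, h4.1, h4.2]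

/-- The approximation of the positive part of `g` by `N` equally weighted superlevel sets. -/
noncomputable def stepApprox (T : ℝ) (g : ℝ → ℝ) (N : ℕ) (x : ℝ) : ℝ :=
  ∑ k ∈ Finset.range N, T / N * ({y | k * T / N < g y}).indicator (1 : ℝ → ℝ) x

/-- The number of levels kT/N lying strictly below g(x) is the ceiling of g(x)⁺N/T, hence a uniform
error of one step. -/
theorem abs_stepApprox_sub_le {T : ℝ} (hT : 0 ≤ T) {g : ℝ → ℝ} (hg : ∀ x, |g x| ≤ T) {N : ℕ}
    (hN : 0 < N) (x : ℝ) : |stepApprox T g N x - max (g x) 0| ≤ T / N := by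
  classical
  have hN' : (0 : ℝ) < N := by exact_mod_cast hN
  rcases hT.eq_or_lt with rfl | hT
  · have : g x = 0 := abs_eq_zero.1 (le_antisymm (hg x) (abs_nonneg _))
    simp [stepApprox, this]
  set y := max (g x) 0 * N / T with hy
  have hyT : max (g x) 0 = T / N * y := by rw [hy]; field_simp
  have hy0 : 0 ≤ y := by positivity
  have hyN : y ≤ N := by
    rw [hy, div_le_iff₀ hT, mul_comm]
    gcongr
    exact max_le ((le_abs_self _).trans (hg x)) hT.le
  have hcard : stepApprox T g N x = T / N * ⌈y⌉₊ := by
    have hcond : ∀ k : ℕ, x ∈ {y | k * T / N < g y} ↔ k < ⌈y⌉₊ := by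
      intro k
      rw [Nat.lt_ceil, hy, lt_div_iff₀ hT, Set.mem_ofPred_eq, div_lt_iff₀ hN', max_mul_of_nonneg _ _
        hN'.le, lt_max_iff]
      constructor
      · exact Or.inl
      · rintro (h | h)
        · exact h
        · have : (0 : ℝ) ≤ k * T := by positivity
          linarith
    simp only [stepApprox, ← Finset.mul_sum, Set.indicator_apply, hcond, Pi.one_apply]
    rw [Finset.sum_boole]
    congr 2
    have : (Finset.range N).filter (fun k => k < ⌈y⌉₊) = Finset.range ⌈y⌉₊ := by
      ext k
      have : ⌈y⌉₊ ≤ N := Nat.ceil_le.2 hyN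
      simp only [Finset.mem_filter, Finset.mem_range]
      omega
    rw [this, Finset.card_range]
  rw [hcard, hyT, ← mul_sub, abs_mul, abs_of_nonneg (by positivity)]
  have h1 := Nat.le_ceil y
  have h2 := Nat.ceil_lt_add_one hy0
  calc T / N * |(⌈y⌉₊ : ℝ) - y| ≤ T / N * 1 := by
        gcongr
        rw [abs_le]; constructor <;> linarith
    _ = T / N := mul_one _

theorem LevelConvex.bdd_stepApprox {T : ℝ} (hT : 0 ≤ T) {g : ℝ → ℝ} (hg : LevelConvex g) (N : ℕ) :
    BddMeas (stepApprox T g N) :=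
  BddMeas.sum fun k _ => (BddMeas.indicator
    ((hg (k * T / N) (by positivity)).1.measurableSet)).const_mul _

theorem tendsto_stepApprox {T : ℝ} (hT : 0 ≤ T) {g : ℝ → ℝ} (hg : ∀ x, |g x| ≤ T) (x : ℝ) :
    Tendsto (fun N => stepApprox T g (N + 1) x) atTop (𝓝 (max (g x) 0)) := by
  rw [tendsto_iff_dist_tendsto_zero]
  have h0 : Tendsto (fun N : ℕ => T / ((N + 1 : ℕ) : ℝ)) atTop (𝓝 0) :=
    (tendsto_const_div_atTop_nhds_zero_nat T).comp (tendsto_add_atTop_nat 1)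
  refine squeeze_zero (fun _ => dist_nonneg) (fun N => ?_) h0
  exact abs_stepApprox_sub_le hT hg (Nat.succ_pos N) x

/-- Layer cake: the positive part is approximated by N superlevel indicators of weight T/N. The
total weight is T whatever N is, so the bound for intervals survives the limit. -/
theorem abs_pairInt_posPart_le (hB : BddMeas B) (hU : Measurable U) (hV : Measurable V)
    {κ : ℝ}
    (h : ∀ x y, |pairInt ν B U V ((Set.Iic x).indicator 1) ((Set.Iic y).indicator 1)| ≤ κ)
    {g g' : ℝ → ℝ} {T T' : ℝ} (hT : 0 ≤ T) (hT' : 0 ≤ T') (hg : LevelConvex g)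
    (hg' : LevelConvex g') (hgT : ∀ x, |g x| ≤ T) (hgT' : ∀ x, |g' x| ≤ T') :
    |pairInt ν B U V (fun x => max (g x) 0) (fun x => max (g' x) 0)| ≤ T * T' * (4 * κ) := by
  have hb : ∀ {g : ℝ → ℝ} {T : ℝ}, 0 ≤ T → (∀ x, |g x| ≤ T) → ∀ (N : ℕ) x,
      |stepApprox T g (N + 1) x| ≤ 2 * T := by
    intro g T hT hg N x
    have h1 := abs_le.1 (abs_stepApprox_sub_le hT hg (Nat.succ_pos N) x)
    have h2 : T / ((N + 1 : ℕ) : ℝ) ≤ T := div_le_self hT (by simp)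
    have h3 : max (g x) 0 ≤ T := max_le ((le_abs_self _).trans (hg x)) hT
    have h4 : 0 ≤ max (g x) 0 := le_max_right _ _
    rw [abs_le]; constructor <;> linarith [h1.1, h1.2]
  have lim := tendsto_pairInt (ν := ν) hB hU hV (fun N => (hg.bdd_stepApprox hT (N + 1)).1)
    (fun N => (hg'.bdd_stepApprox hT' (N + 1)).1) (hb hT hgT) (hb hT' hgT')
    (tendsto_stepApprox hT hgT) (tendsto_stepApprox hT' hgT')
  refine le_of_tendsto lim.abs (Eventually.of_forall fun N => ?_)
  have hi : ∀ {g : ℝ → ℝ} {T : ℝ}, 0 ≤ T → LevelConvex g → ∀ k : ℕ,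
      BddMeas ({y | k * T / (N + 1 : ℕ) < g y}.indicator (1 : ℝ → ℝ)) := fun hT hg k =>
    BddMeas.indicator ((hg _ (by positivity)).1.measurableSet)
  unfold stepApprox
  rw [pairInt_sum_left _ hB hU hV (fun k _ => (hi hT hg k).const_mul _)
    (BddMeas.sum fun k _ => (hi hT' hg' k).const_mul _)]
  have hNT : ∀ S : ℝ, ((N + 1 : ℕ) : ℝ) * (S / (N + 1 : ℕ)) = S := fun S => by
    field_simp
  refine (Finset.abs_sum_le_sum_abs _ _).trans ((Finset.sum_le_card_nsmul _ _
    (T / (N + 1 : ℕ) * (T' * (4 * κ))) fun k _ => ?_).trans (le_of_eq ?_))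
  · rw [pairInt_const_mul_left, abs_mul, abs_of_nonneg (by positivity)]
    gcongr
    rw [pairInt_sum_right _ hB hU hV (hi hT hg k) (fun k _ => (hi hT' hg' k).const_mul _)]
    refine (Finset.abs_sum_le_sum_abs _ _).trans ((Finset.sum_le_card_nsmul _ _
      (T' / (N + 1 : ℕ) * (4 * κ)) fun l _ => ?_).trans (le_of_eq ?_))
    · rw [pairInt_const_mul_right, abs_mul, abs_of_nonneg (by positivity)]
      gcongr
      exact abs_pairInt_ordConnected_le hB hU hV h (hg _ (by positivity)).1
        (hg' _ (by positivity)).1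
    · rw [Finset.card_range, nsmul_eq_mul, ← mul_assoc, hNT]
  · rw [Finset.card_range, nsmul_eq_mul, ← mul_assoc, hNT, mul_assoc]

/-- Splitting each function into positive and negative parts gives four forms, each bounded with the
constant 4. -/
theorem abs_pairInt_levelConvex_le (hB : BddMeas B) (hU : Measurable U) (hV : Measurable V)
    {κ : ℝ}
    (h : ∀ x y, |pairInt ν B U V ((Set.Iic x).indicator 1) ((Set.Iic y).indicator 1)| ≤ κ)
    {g g' : ℝ → ℝ} {T T' : ℝ} (hT : 0 ≤ T) (hT' : 0 ≤ T') (hg : LevelConvex g)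
    (hg' : LevelConvex g') (hgT : ∀ x, |g x| ≤ T) (hgT' : ∀ x, |g' x| ≤ T') :
    |pairInt ν B U V g g'| ≤ 16 * κ * (T * T') := by
  have bp : ∀ {g : ℝ → ℝ} {T : ℝ}, LevelConvex g → (∀ x, |g x| ≤ T) →
      BddMeas fun x => max (g x) 0 := fun hg hgT =>
    ⟨hg.measurable.max measurable_const, _, fun x => (abs_max_le_max_abs_abs.trans (by
      rw [abs_zero]; exact max_le ((hgT x)) ((abs_nonneg _).trans (hgT 0))))⟩
  have nT : ∀ {g : ℝ → ℝ} {T : ℝ}, (∀ x, |g x| ≤ T) → ∀ x, |-g x| ≤ T := fun h x => by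
    rw [abs_neg]; exact h x
  have e : ∀ g : ℝ → ℝ, g = fun x => max (g x) 0 - max (-g x) 0 := fun g => by
    ext x
    rcases le_total 0 (g x) with h | h <;> simp [h]
  have b1 := bp hg hgT
  have b2 := bp hg.neg (nT hgT)
  have b3 := bp hg' hgT'
  have b4 := bp hg'.neg (nT hgT')
  have key : pairInt ν B U V g g' =
      pairInt ν B U V (fun x => max (g x) 0) (fun x => max (g' x) 0)
      - pairInt ν B U V (fun x => max (g x) 0) (fun x => max (-g' x) 0)
      - (pairInt ν B U V (fun x => max (-g x) 0) (fun x => max (g' x) 0)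
      - pairInt ν B U V (fun x => max (-g x) 0) (fun x => max (-g' x) 0)) := by
    conv_lhs => rw [e g, e g']
    rw [pairInt_sub_left hB hU hV b1 b2 (b3.sub b4), pairInt_sub_right hB hU hV b1 b3 b4,
      pairInt_sub_right hB hU hV b2 b3 b4]
  have h1 := abs_le.1 (abs_pairInt_posPart_le hB hU hV h hT hT' hg hg' hgT hgT')
  have h2 := abs_le.1 (abs_pairInt_posPart_le hB hU hV h hT hT' hg hg'.neg hgT (nT hgT'))
  have h3 := abs_le.1 (abs_pairInt_posPart_le hB hU hV h hT hT' hg.neg hg' (nT hgT) hgT')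
  have h4 := abs_le.1 (abs_pairInt_posPart_le hB hU hV h hT hT' hg.neg hg'.neg (nT hgT) (nT hgT'))
  rw [key, abs_le]
  constructor <;> linarith [h1.1, h1.2, h2.1, h2.2, h3.1, h3.2, h4.1, h4.2]

end PairInt

/-! ### Excess over a truncation level, and the cost of truncating products. -/

/-- The uniform measure on `[0, 1]`. -/
noncomputable def unitMeasure : Measure ℝ := volume.restrict (Set.Icc 0 1)

instance : IsProbabilityMeasure unitMeasure := ⟨by simp [unitMeasure]⟩

/-- The excess `(|x|^k - T^k)₊`. -/
def excess (k : ℕ) (T x : ℝ) : ℝ := max (|x| ^ k - T ^ k) 0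

theorem excess_nonneg (k : ℕ) (T x : ℝ) : 0 ≤ excess k T x := le_max_right _ _

theorem excess_mono {k : ℕ} {T x y : ℝ} (h : |x| ≤ |y|) : excess k T x ≤ excess k T y :=
  max_le_max (by gcongr) le_rfl

theorem excess_le_pow {k : ℕ} {T : ℝ} (hT : 0 ≤ T) (x : ℝ) : excess k T x ≤ |x| ^ k :=
  max_le (by have := pow_nonneg hT k; linarith) (by positivity)

theorem measurable_excess (k : ℕ) (T : ℝ) : Measurable (excess k T) := by
  unfold excess
  exact ((measurable_norm.pow_const k).sub_const _).max measurable_const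

theorem BddMeas.excess {Ω : Type*} [MeasurableSpace Ω] {f : Ω → ℝ} (hf : BddMeas f) (k : ℕ)
    (T : ℝ) : BddMeas fun ω => excess k T (f ω) := by
  obtain ⟨C, hC⟩ := hf.2
  refine ⟨(measurable_excess k T).comp hf.1, _root_.excess k T C, fun ω => ?_⟩
  rw [abs_of_nonneg (excess_nonneg _ _ _)]
  exact excess_mono ((hC ω).trans (le_abs_self _))

/-- The map x ↦ min(x, b) is nondecreasing and 1-Lipschitz, so the truncation error of a product
grows with each factor. This allows a factor to be replaced by an upper bound. -/
theorem mul_sub_min_mono {x y b p p' : ℝ} (hxy : x ≤ y) (hp : 0 ≤ p') (hpp : p' ≤ p) :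
    x * p - min x b * p' ≤ y * p - min y b * p' := by
  have h1 : min y b - min x b ≤ y - x := by
    rcases le_total x b with h | h
    · rw [min_eq_left h]; linarith [min_le_left y b]
    · rw [min_eq_right h]; linarith [min_le_right y b]
  have h2 : min x b ≤ min y b := min_le_min hxy le_rfl
  nlinarith [mul_nonneg (sub_nonneg.2 h2) (sub_nonneg.2 hpp), mul_nonneg (sub_nonneg.2 h1) hp,
    mul_nonneg (sub_nonneg.2 hxy) (sub_nonneg.2 hpp)]

theorem pow_sub_min_pow (k : ℕ) {T m : ℝ} (hm : 0 ≤ m) :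
    m ^ k - min m T ^ k ≤ excess k T m := by
  unfold excess
  rw [abs_of_nonneg hm]
  rcases le_total m T with h | h
  · rw [min_eq_left h, sub_self]; exact le_max_right _ _
  · rw [min_eq_right h]; exact le_max_left _ _

/-- Raising both factors to the larger one only increases the error, and for a square the error is
at most the excess. The variables become separated, so the bound can be integrated under the joint
law or under the product law. -/
theorem mul_sub_min_mul_le {x y T : ℝ} (hx : 0 ≤ x) (hy : 0 ≤ y) (hT : 0 ≤ T) :
    x * y - min x T * min y T ≤ excess 2 T x + excess 2 T y := by
  have hm : ∀ {z : ℝ}, 0 ≤ z → 0 ≤ min z T := fun hz => le_min hz hT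
  wlog hxy : x ≤ y generalizing x y
  · have := this hy hx (le_of_not_ge hxy)
    linarith
  have h1 := mul_sub_min_mono (b := T) hxy (hm hy) (min_le_left y T)
  have h2 := pow_sub_min_pow 2 (T := T) hy
  have := excess_nonneg 2 T x
  nlinarith

/-- Same argument for three factors: raise them one after the other to the maximum m, then bound the
excess of m by the sum of the three excesses. -/
theorem mul_mul_sub_min_le {x y z T : ℝ} (hx : 0 ≤ x) (hy : 0 ≤ y) (hz : 0 ≤ z) (hT : 0 ≤ T) :
    x * (y * z) - min x T * (min y T * min z T) ≤ excess 3 T x + excess 3 T y + excess 3 T z := by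
  have hm : ∀ {z : ℝ}, 0 ≤ z → 0 ≤ min z T := fun hz => le_min hz hT
  set m := max x (max y z) with hmdef
  have hxm : x ≤ m := le_max_left _ _
  have hym : y ≤ m := (le_max_left _ _).trans (le_max_right _ _)
  have hzm : z ≤ m := (le_max_right _ _).trans (le_max_right _ _)
  have hm0 : 0 ≤ m := hx.trans hxm
  have hmul : ∀ {a b : ℝ}, 0 ≤ a → 0 ≤ b → min a T * min b T ≤ a * b := fun ha hb =>
    mul_le_mul (min_le_left _ _) (min_le_left _ _) (hm hb) ha
  have h1 := mul_sub_min_mono (b := T) hxm (mul_nonneg (hm hy) (hm hz)) (hmul hy hz)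
  have h2 := mul_sub_min_mono (b := T) hym (mul_nonneg (hm hm0) (hm hz)) (hmul hm0 hz)
  have h3 := mul_sub_min_mono (b := T) hzm (mul_nonneg (hm hm0) (hm hm0)) (hmul hm0 hm0)
  have h4 := pow_sub_min_pow 3 (T := T) hm0
  have h5 : excess 3 T m ≤ excess 3 T x + excess 3 T y + excess 3 T z := by
    have hx' := excess_nonneg 3 T x
    have hy' := excess_nonneg 3 T y
    have hz' := excess_nonneg 3 T z
    rcases max_choice x (max y z) with h | h <;> rw [hmdef, h]
    · linarith
    · rcases max_choice y z with h | h <;> rw [h] <;> linarith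
  calc _ ≤ m ^ 3 - min m T ^ 3 := by nlinarith
    _ ≤ _ := h4.trans h5

/-! ### Covariances of clipped and unclipped variables. -/

section Clip

variable {Ω : Type*} [mΩ : MeasurableSpace Ω] {ν : Measure Ω} [IsProbabilityMeasure ν]

/-- The covariance of two random variables. -/
noncomputable def covInt (ν : Measure Ω) (B Z : Ω → ℝ) : ℝ :=
  ∫ ω, B ω * Z ω ∂ν - (∫ ω, B ω ∂ν) * ∫ ω, Z ω ∂ν

theorem covInt_eq_pairInt {B U V : Ω → ℝ} (hB : BddMeas B) (hU : Measurable U) (hV : Measurable V)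
    {u w : ℝ → ℝ} (hu : BddMeas u) (hw : BddMeas w) :
    covInt ν B (fun ω => u (U ω) * w (V ω)) =
      pairInt ν (fun ω => B ω - ∫ ω', B ω' ∂ν) U V u w := by
  unfold covInt pairInt
  have hz := (hu.comp hU).mul (hw.comp hV)
  rw [← integral_const_mul, ← integral_sub ((hB.mul hz).integrable ν)
    ((hz.const_mul _).integrable ν)]
  congr 1; ext ω; ring

/-- All clipping factors lie in [0, 1], so the clipped product is a fraction of the original one
with the same sign. -/
theorem abs_mul_sub_clip_mul {B b g T g' T' : ℝ} (hb : 0 ≤ b) (hT : 0 ≤ T) (hT' : 0 ≤ T') :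
    |B * (g * g') - clip b B * (clip T g * clip T' g')| =
      |B| * (|g| * |g'|) - min |B| b * (min |g| T * min |g'| T') := by
  obtain ⟨s, s0, s1, hs⟩ := exists_clip_eq hb B
  obtain ⟨t, t0, t1, ht⟩ := exists_clip_eq hT g
  obtain ⟨r, r0, r1, hr⟩ := exists_clip_eq hT' g'
  rw [← abs_clip hb, ← abs_clip hT, ← abs_clip hT', hs, ht, hr]
  have h1 : s * (t * r) ≤ 1 := mul_le_one₀ s1 (by positivity) (mul_le_one₀ t1 r0 r1)
  rw [show B * (g * g') - s * B * (t * g * (r * g')) = (1 - s * (t * r)) * (B * (g * g')) by ring,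
    abs_mul, abs_of_nonneg (by linarith)]
  simp only [abs_mul, abs_of_nonneg s0, abs_of_nonneg t0, abs_of_nonneg r0]
  ring

theorem BddMeas.clip {f : Ω → ℝ} (hf : BddMeas f) {T : ℝ} (hT : 0 ≤ T) :
    BddMeas fun ω => clip T (f ω) :=
  ⟨(measurable_clip T).comp hf.1, T, fun ω => by rw [abs_clip hT]; exact min_le_right _ _⟩

/-- The clipped covariance is bounded through level sets. The pointwise error bound is required for
independent arguments ω and ω', because it is integrated once on the diagonal, for E(BZ), and once
under the product law, for E(B)E(Z); hence the factor 2. -/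
theorem abs_covInt_le_of_clip {B U V : Ω → ℝ} (hB : BddMeas B) (hU : Measurable U)
    (hV : Measurable V) {κ b : ℝ} (hb : 0 ≤ b)
    (h : ∀ x y, |covInt ν (fun ω => clip b (B ω)) (fun ω => (Set.Iic x).indicator 1 (U ω) *
      (Set.Iic y).indicator 1 (V ω))| ≤ b * κ)
    {g g' : ℝ → ℝ} {T T' : ℝ} (hT : 0 ≤ T) (hT' : 0 ≤ T') (hg : LevelConvex g)
    (hg' : LevelConvex g') (bg : BddMeas g) (bg' : BddMeas g') {e₀ e₁ : Ω → ℝ}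
    (he₀ : BddMeas e₀) (he₁ : BddMeas e₁)
    (hpt : ∀ ω ω', |B ω| * (|g (U ω')| * |g' (V ω')|) -
      min |B ω| b * (min |g (U ω')| T * min |g' (V ω')| T') ≤ e₀ ω + e₁ ω') :
    |covInt ν B (fun ω => g (U ω) * g' (V ω))| ≤
      16 * κ * (b * (T * T')) + 2 * (∫ ω, e₀ ω ∂ν + ∫ ω, e₁ ω ∂ν) := by
  have bB' : BddMeas fun ω => clip b (B ω) := hB.clip hb
  have bc : BddMeas fun x => clip T (g x) := bg.clip hT
  have bc' : BddMeas fun x => clip T' (g' x) := bg'.clip hT'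
  have main : |covInt ν (fun ω => clip b (B ω))
      (fun ω => clip T (g (U ω)) * clip T' (g' (V ω)))| ≤ 16 * κ * (b * (T * T')) := by
    rw [covInt_eq_pairInt (u := fun x => clip T (g x)) (w := fun x => clip T' (g' x))
      bB' hU hV bc bc']
    refine (abs_pairInt_levelConvex_le (κ := b * κ) (bB'.sub (BddMeas.const _)) hU hV
      (fun x y => ?_) hT hT' (hg.clip hT) (hg'.clip hT') (fun x => ?_) (fun x => ?_)).trans
      (le_of_eq (by ring))
    · rw [← covInt_eq_pairInt bB' hU hV (BddMeas.indicator measurableSet_Iic)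
        (BddMeas.indicator measurableSet_Iic)]
      exact h x y
    · rw [abs_clip hT]; exact min_le_right _ _
    · rw [abs_clip hT']; exact min_le_right _ _
  set Z : Ω → ℝ := fun ω => g (U ω) * g' (V ω)
  set Z' : Ω → ℝ := fun ω => clip T (g (U ω)) * clip T' (g' (V ω))
  set B' : Ω → ℝ := fun ω => clip b (B ω)
  have bZ : BddMeas Z := (bg.comp hU).mul (bg'.comp hV)
  have bZ' : BddMeas Z' := (bc.comp hU).mul (bc'.comp hV)
  have hpt' : ∀ ω ω', |B ω * Z ω' - B' ω * Z' ω'| ≤ e₀ ω + e₁ ω' := fun ω ω' => by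
    rw [abs_mul_sub_clip_mul hb hT hT']; exact hpt ω ω'
  have d1 : |∫ ω, B ω * Z ω ∂ν - ∫ ω, B' ω * Z' ω ∂ν| ≤ ∫ ω, e₀ ω ∂ν + ∫ ω, e₁ ω ∂ν := by
    rw [← integral_sub ((hB.mul bZ).integrable ν) ((bB'.mul bZ').integrable ν),
      ← integral_add (he₀.integrable ν) (he₁.integrable ν)]
    refine abs_integral_le_integral_abs.trans (integral_mono
      (((hB.mul bZ).sub (bB'.mul bZ')).abs.integrable ν) ((he₀.add he₁).integrable ν)
      fun ω => hpt' ω ω)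
  have d2 : |(∫ ω, B ω ∂ν) * ∫ ω, Z ω ∂ν - (∫ ω, B' ω ∂ν) * ∫ ω, Z' ω ∂ν|
      ≤ ∫ ω, e₀ ω ∂ν + ∫ ω, e₁ ω ∂ν := by
    have inner : ∀ ω, |B ω * ∫ ω', Z ω' ∂ν - B' ω * ∫ ω', Z' ω' ∂ν| ≤ e₀ ω + ∫ ω', e₁ ω' ∂ν := by
      intro ω
      rw [← integral_const_mul, ← integral_const_mul, ← integral_sub
        ((bZ.const_mul _).integrable ν) ((bZ'.const_mul _).integrable ν)]
      refine abs_integral_le_integral_abs.trans ((integral_mono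
        (((bZ.const_mul _).sub (bZ'.const_mul _)).abs.integrable ν)
        (((BddMeas.const (e₀ ω)).add he₁).integrable ν) fun ω' => hpt' ω ω').trans (le_of_eq ?_))
      rw [integral_add (integrable_const _) (he₁.integrable ν)]
      simp
    rw [← integral_mul_const, ← integral_mul_const, ← integral_sub
      ((hB.mul (BddMeas.const _)).integrable ν) ((bB'.mul (BddMeas.const _)).integrable ν)]
    refine abs_integral_le_integral_abs.trans ((integral_mono
      (((hB.mul (BddMeas.const _)).sub (bB'.mul (BddMeas.const _))).abs.integrable ν)
      ((he₀.add (BddMeas.const _)).integrable ν) inner).trans (le_of_eq ?_))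
    rw [integral_add (he₀.integrable ν) (integrable_const _)]
    simp
  have hdef : covInt ν B Z = covInt ν B' Z' + ((∫ ω, B ω * Z ω ∂ν - ∫ ω, B' ω * Z' ω ∂ν)
      - ((∫ ω, B ω ∂ν) * ∫ ω, Z ω ∂ν - (∫ ω, B' ω ∂ν) * ∫ ω, Z' ω ∂ν)) := by
    unfold covInt; ring
  rw [hdef]
  refine (abs_add_le _ _).trans (add_le_add main ((abs_sub _ _).trans ?_))
  linarith

end Clip

/-! ### Domination by a tail function, and partial integrals of its powers. -/

section Dominated

variable {Ω : Type*} [mΩ : MeasurableSpace Ω] {ν : Measure Ω} [IsProbabilityMeasure ν]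

/-- `Z` is dominated by `ψ` in the sense of excess moments. -/
def MomDom (ν : Measure Ω) (Z : Ω → ℝ) (ψ : ℝ → ℝ) : Prop :=
  ∀ (k : ℕ) (T : ℝ), 1 ≤ k → 0 ≤ T →
    ∫ ω, excess k T (Z ω) ∂ν ≤ ∫ u, excess k T (ψ u) ∂unitMeasure

/-- A bounded nonnegative nonincreasing function. -/
structure IsTail (ψ : ℝ → ℝ) : Prop where
  anti : Antitone ψ
  nonneg : ∀ u, 0 ≤ ψ u
  bdd : ∃ C, ∀ u, ψ u ≤ C

/-- `∫_0^a ψ(u)^k du`. -/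
noncomputable def tailInt (ψ : ℝ → ℝ) (k : ℕ) (a : ℝ) : ℝ :=
  ∫ u, (Set.Iio a).indicator (fun u => ψ u ^ k) u ∂unitMeasure

namespace IsTail

variable {ψ : ℝ → ℝ}

theorem bddMeas (h : IsTail ψ) : BddMeas ψ :=
  ⟨h.anti.measurable, h.bdd.imp fun C hC u => by rw [abs_of_nonneg (h.nonneg u)]; exact hC u⟩

theorem bdd_indicator (h : IsTail ψ) (k : ℕ) (a : ℝ) :
    BddMeas ((Set.Iio a).indicator (fun u => ψ u ^ k)) := by
  obtain ⟨C, hC⟩ := (h.bddMeas.pow k).2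
  refine ⟨(h.bddMeas.pow k).1.indicator measurableSet_Iio, C, fun u => ?_⟩
  by_cases hu : u ∈ Set.Iio a
  · rw [Set.indicator_of_mem hu]; exact hC u
  · rw [Set.indicator_of_notMem hu, abs_zero]; exact (abs_nonneg _).trans (hC u)

theorem tailInt_nonneg (h : IsTail ψ) (k : ℕ) (a : ℝ) : 0 ≤ tailInt ψ k a :=
  integral_nonneg fun u => Set.indicator_nonneg (fun u _ => pow_nonneg (h.nonneg u) k) u

theorem tailInt_mono (h : IsTail ψ) (k : ℕ) {a b : ℝ} (hab : a ≤ b) :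
    tailInt ψ k a ≤ tailInt ψ k b :=
  integral_mono ((h.bdd_indicator k a).integrable _) ((h.bdd_indicator k b).integrable _)
    (Set.indicator_le_indicator_of_subset (Set.Iio_subset_Iio hab)
      fun u => pow_nonneg (h.nonneg u) k)

theorem tailInt_one (ψ : ℝ → ℝ) (k : ℕ) :
    tailInt ψ k 1 = ∫ u, ψ u ^ k ∂unitMeasure := by
  refine integral_congr_ae ?_
  have : ∀ᵐ u ∂unitMeasure, u ≠ 1 ∧ u ∈ Set.Icc (0 : ℝ) 1 := by
    refine Filter.Eventually.and ?_ (ae_restrict_mem measurableSet_Icc)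
    exact ae_restrict_of_ae (Measure.ae_ne _ _)
  filter_upwards [this] with u hu
  have hu1 : u ∈ Set.Iio (1 : ℝ) := lt_of_le_of_ne hu.2.2 hu.1
  exact Set.indicator_of_mem hu1 (fun u => ψ u ^ k)

/-- The two pieces of a covariance estimate at the threshold `T = ψ(a)`. -/
theorem threshold_le (h : IsTail ψ) (k : ℕ) {a : ℝ} (ha0 : 0 ≤ a) (ha1 : a ≤ 1) :
    a * ψ a ^ k ≤ tailInt ψ k a ∧ ∫ u, excess k (ψ a) (ψ u) ∂unitMeasure ≤ tailInt ψ k a := by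
  constructor
  · have e : a * ψ a ^ k
        = ∫ u, (Set.Iio a).indicator (fun _ => ψ a ^ k) u ∂unitMeasure := by
      rw [integral_indicator_const _ measurableSet_Iio, unitMeasure, measureReal_def,
        Measure.restrict_apply measurableSet_Iio]
      have : Set.Iio a ∩ Set.Icc (0 : ℝ) 1 = Set.Ico 0 a := by
        ext u
        simp only [Set.mem_inter_iff, Set.mem_Iio, Set.mem_Icc, Set.mem_Ico]
        constructor
        · rintro ⟨h1, h2, h3⟩; exact ⟨h2, h1⟩
        · rintro ⟨h1, h2⟩; exact ⟨h2, h1, by linarith⟩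
      rw [this, Real.volume_Ico, ENNReal.toReal_ofReal (by linarith)]
      simp
    rw [e]
    refine integral_mono ((integrable_const _).indicator measurableSet_Iio)
      ((h.bdd_indicator k a).integrable _) fun u => ?_
    by_cases hu : u ∈ Set.Iio a
    · rw [Set.indicator_of_mem hu, Set.indicator_of_mem hu]
      have := h.anti (le_of_lt hu)
      have := h.nonneg a
      gcongr
    · rw [Set.indicator_of_notMem hu, Set.indicator_of_notMem hu]
  · refine integral_mono ((h.bddMeas.excess k _).integrable _)
      ((h.bdd_indicator k a).integrable _) fun u => ?_
    by_cases hu : u ∈ Set.Iio a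
    · rw [Set.indicator_of_mem hu]
      refine (excess_le_pow (h.nonneg a) _).trans (le_of_eq ?_)
      rw [abs_of_nonneg (h.nonneg u)]
    · rw [Set.indicator_of_notMem hu]
      refine max_le ?_ le_rfl
      rw [abs_of_nonneg (h.nonneg u), sub_nonpos]
      exact pow_le_pow_left₀ (h.nonneg u) (h.anti (not_lt.1 hu)) k

theorem two_mul (h : IsTail ψ) : IsTail fun u => 2 * ψ u := by
  refine ⟨fun a b hab => ?_, fun u => ?_, h.bdd.imp' (fun C => 2 * C) fun C hC u => ?_⟩
  · have := h.anti hab; linarith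
  · have := h.nonneg u; linarith
  · have := hC u; linarith

end IsTail

/-- Chebyshev's association inequality for comonotone functions. -/
theorem integral_mul_integral_le_of_monovary {P : Measure ℝ} [IsProbabilityMeasure P]
    {f g : ℝ → ℝ} (hf : BddMeas f) (hg : BddMeas g)
    (h : ∀ u v, 0 ≤ (f u - f v) * (g u - g v)) :
    (∫ u, f u ∂P) * ∫ u, g u ∂P ≤ ∫ u, f u * g u ∂P := by
  have h1 : ∀ v, 0 ≤ (∫ u, f u * g u ∂P) - f v * ∫ u, g u ∂P - (∫ u, f u ∂P) * g v
      + f v * g v := by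
    intro v
    have : ∫ u, (f u - f v) * (g u - g v) ∂P = (∫ u, f u * g u ∂P) - f v * ∫ u, g u ∂P
        - (∫ u, f u ∂P) * g v + f v * g v := by
      rw [← integral_const_mul, ← integral_mul_const, ← integral_sub ((hf.mul hg).integrable P)
        ((hg.const_mul _).integrable P), ← integral_sub
        (((hf.mul hg).sub (hg.const_mul _)).integrable P) ((hf.mul (BddMeas.const _)).integrable P)]
      have e : f v * g v = ∫ _, f v * g v ∂P := by simp
      rw [e, ← integral_add ((((hf.mul hg).sub (hg.const_mul _)).sub
        (hf.mul (BddMeas.const _))).integrable P) (integrable_const _)]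
      congr 1; ext u; ring
    rw [← this]
    exact integral_nonneg fun u => h u v
  have h2 := integral_nonneg (μ := P) (f := fun v => (∫ u, f u * g u ∂P) - f v * ∫ u, g u ∂P
    - (∫ u, f u ∂P) * g v + f v * g v) h1
  rw [integral_add ((((BddMeas.const _).sub (hf.mul (BddMeas.const _))).sub
      ((BddMeas.const _).mul hg)).integrable P) ((hf.mul hg).integrable P),
    integral_sub (((BddMeas.const _).sub (hf.mul (BddMeas.const _))).integrable P)
      (((BddMeas.const _).mul hg).integrable P),
    integral_sub (integrable_const _) ((hf.mul (BddMeas.const _)).integrable P),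
    integral_mul_const, integral_const_mul] at h2
  simp only [integral_const, probReal_univ, smul_eq_mul, one_mul] at h2
  linarith

/-- Both factors are nonincreasing in u, so Chebyshev's association inequality applies. It serves to
absorb a mean times a lower order estimate into an estimate of the next order. -/
theorem IsTail.tailInt_mul_le {ψ : ℝ → ℝ} (h : IsTail ψ) (k : ℕ) (a : ℝ) :
    (∫ u, ψ u ∂unitMeasure) * tailInt ψ k a ≤ tailInt ψ (k + 1) a := by
  refine (integral_mul_integral_le_of_monovary h.bddMeas (h.bdd_indicator k a) ?_).trans
    (le_of_eq ?_)
  · have hanti : Antitone ((Set.Iio a).indicator (fun u => ψ u ^ k)) := by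
      intro u v huv
      by_cases hv : v ∈ Set.Iio a
      · rw [Set.indicator_of_mem hv, Set.indicator_of_mem (show u ∈ Set.Iio a from lt_of_le_of_lt huv hv)]
        exact pow_le_pow_left₀ (h.nonneg v) (h.anti huv) k
      · rw [Set.indicator_of_notMem hv]
        exact Set.indicator_nonneg (fun u _ => pow_nonneg (h.nonneg u) k) u
    intro u v
    rcases le_total u v with huv | huv
    · exact mul_nonneg (sub_nonneg.2 (h.anti huv)) (sub_nonneg.2 (hanti huv))
    · exact mul_nonneg_of_nonpos_of_nonpos (sub_nonpos.2 (h.anti huv))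
        (sub_nonpos.2 (hanti huv))
  · unfold tailInt
    congr 1; ext u
    by_cases hu : u ∈ Set.Iio a
    · simp only [Set.indicator_of_mem hu]; ring
    · simp only [Set.indicator_of_notMem hu, mul_zero]

end Dominated

/-! ### Covariance inequalities on the path space. -/

/-- The σ-algebra of the coordinates up to `k` on the path space. -/
abbrev pastPath (k : ℤ) : MeasurableSpace (ℤ → ℝ) :=
  ⨆ (i : ℤ) (_ : i ≤ k), MeasurableSpace.comap (fun ω => ω i) inferInstance

theorem measurable_coord (j : ℤ) : Measurable fun ω : ℤ → ℝ => ω j := measurable_pi_apply j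

theorem pastPath_mono : Monotone pastPath := fun _ _ h =>
  iSup₂_le fun i hi => le_iSup₂_of_le i (hi.trans h) le_rfl

theorem pastPath_le (k : ℤ) : pastPath k ≤ MeasurableSpace.pi :=
  iSup₂_le fun i _ => (measurable_pi_apply i).comap_le

theorem measurable_pastPath {i k : ℤ} (h : i ≤ k) :
    Measurable[pastPath k] fun ω : ℤ → ℝ => ω i :=
  measurable_iff_comap_le.2 (le_iSup₂_of_le i h le_rfl)

/-- A law on the path space with marginal `μ` and mixing rate `a`. -/
structure PathMixing (ν : Measure (ℤ → ℝ)) (μ : Measure ℝ) (a : ℕ → ℝ) : Prop where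
  anti : Antitone a
  nonneg : ∀ i, 0 ≤ a i
  zero : a 0 = 1
  marginal : ∀ k, ν.map (fun ω => ω k) = μ
  mix : ∀ (k : ℤ) (i l : ℕ), 1 ≤ i → ∀ B : (ℤ → ℝ) → ℝ, Measurable[pastPath k] B → ∀ c : ℝ,
    (∀ ω, |B ω| ≤ c) → ∀ x y : ℝ,
    |covInt ν B (fun ω => (Set.Iic x).indicator 1 (ω (k + i)) *
      (Set.Iic y).indicator 1 (ω (k + i + l)))| ≤ c * (6 * a i)

section PathCov

set_option linter.unusedSectionVars false

variable {ν : Measure (ℤ → ℝ)} [IsProbabilityMeasure ν] {μ : Measure ℝ} [IsProbabilityMeasure μ]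
  {a : ℕ → ℝ} {ψ : ℝ → ℝ}

theorem PathMixing.le_one (hm : PathMixing ν μ a) (i : ℕ) : a i ≤ 1 :=
  hm.zero ▸ hm.anti (Nat.zero_le i)

theorem PathMixing.integral_comp (hm : PathMixing ν μ a) {f : ℝ → ℝ} (hf : Measurable f) (k : ℤ) :
    ∫ ω, f (ω k) ∂ν = ∫ x, f x ∂μ := by
  rw [← hm.marginal k, integral_map (measurable_coord k).aemeasurable hf.aestronglyMeasurable]

theorem PathMixing.momDom (hm : PathMixing ν μ a) {g : ℝ → ℝ} (hg : Measurable g)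
    (h : MomDom μ g ψ) (k : ℤ) : MomDom ν (fun ω => g (ω k)) ψ := fun d T hd hT => by
  have := hm.integral_comp (f := fun x => excess d T (g x)) ((measurable_excess d T).comp hg) k
  exact this.trans_le (h d T hd hT)

/-- Clip at levels whose product is c ψ(a_i)^d. The clipped covariance contributes 16 · 6 · a_i
ψ(a_i)^d and the clipping error 2 · 3 excess integrals; each of these quantities is at most
∫_0^{a_i} ψ^d, whence 102 = 96 + 6. -/
theorem PathMixing.abs_covInt_le (hm : PathMixing ν μ a) (hψ : IsTail ψ) {k : ℤ} {i l d : ℕ}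
    (hi : 1 ≤ i) {B : (ℤ → ℝ) → ℝ} (hB : Measurable[pastPath k] B)
    (bB : BddMeas B) {g g' : ℝ → ℝ} (hg : LevelConvex g) (hg' : LevelConvex g') (bg : BddMeas g)
    (bg' : BddMeas g') {c b T T' : ℝ} (hc : 0 ≤ c) (hb : 0 ≤ b) (hT : 0 ≤ T) (hT' : 0 ≤ T')
    (hbT : b * (T * T') = c * ψ (a i) ^ d) {e₀ e₁ : (ℤ → ℝ) → ℝ} (he₀ : BddMeas e₀)
    (he₁ : BddMeas e₁)
    (hpt : ∀ ω ω', |B ω| * (|g (ω' (k + i))| * |g' (ω' (k + i + l))|) -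
      min |B ω| b * (min |g (ω' (k + i))| T * min |g' (ω' (k + i + l))| T') ≤ e₀ ω + e₁ ω')
    (hint : ∫ ω, e₀ ω ∂ν + ∫ ω, e₁ ω ∂ν ≤
      c * (3 * ∫ u, excess d (ψ (a i)) (ψ u) ∂unitMeasure)) :
    |covInt ν B (fun ω => g (ω (k + i)) * g' (ω (k + i + l)))| ≤
      c * (102 * tailInt ψ d (a i)) := by
  have mclip : Measurable[pastPath k] fun ω => clip b (B ω) := (measurable_clip b).comp hB
  have h1 := abs_covInt_le_of_clip (ν := ν) (κ := 6 * a i) bB (measurable_coord (k + i))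
    (measurable_coord (k + i + l)) hb (fun x y => hm.mix k i l hi _ mclip b
      (fun ω => by rw [abs_clip hb]; exact min_le_right _ _) x y) hT hT' hg hg' bg bg' he₀ he₁ hpt
  obtain ⟨t1, t2⟩ := hψ.threshold_le d (hm.nonneg i) (hm.le_one i)
  rw [hbT] at h1
  have t1' := mul_le_mul_of_nonneg_left t1 hc
  have t2' := mul_le_mul_of_nonneg_left t2 hc
  refine h1.trans ?_
  linarith

theorem PathMixing.abs_cov_one (hm : PathMixing ν μ a) (hψ : IsTail ψ) {k : ℤ} {i : ℕ}
    (hi : 1 ≤ i) {B : (ℤ → ℝ) → ℝ} (hB : Measurable[pastPath k] B) {c : ℝ} (hc : 0 ≤ c)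
    (hBc : ∀ ω, |B ω| ≤ c) {g : ℝ → ℝ} (hg : LevelConvex g) (bg : BddMeas g)
    (hd : MomDom μ g ψ) :
    |covInt ν B (fun ω => g (ω (k + i)))| ≤ c * (102 * tailInt ψ 1 (a i)) := by
  have bB : BddMeas B := ⟨hB.mono (pastPath_le k) le_rfl, c, hBc⟩
  have hE := (hm.momDom bg.1 hd (k + i)) 1 (ψ (a i)) le_rfl (hψ.nonneg _)
  -- A single future variable is treated as a pair whose second function is the constant 1. The same
  -- device is used in the next two lemmas.
  have := hm.abs_covInt_le hψ (l := 0) (d := 1) hi hB bB hg LevelConvex.one bg (BddMeas.const 1) hc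
    hc (hψ.nonneg (a i)) zero_le_one (by ring) (e₀ := fun _ => 0)
    (e₁ := fun ω => c * excess 1 (ψ (a i)) (g (ω (k + i)))) (BddMeas.const 0)
    (((bg.comp (measurable_coord (k + i))).excess 1 _).const_mul c) (fun ω ω' => ?_) ?_
  · simpa using this
  · rw [min_eq_left (hBc ω), abs_one, min_self, mul_one, mul_one, ← mul_sub, zero_add]
    have h1 := pow_sub_min_pow 1 (T := ψ (a i)) (abs_nonneg (g (ω' (k + i))))
    rw [pow_one, pow_one] at h1
    have h2 : excess 1 (ψ (a i)) |g (ω' (k + i))| = excess 1 (ψ (a i)) (g (ω' (k + i))) := by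
      simp [excess]
    rw [h2] at h1
    exact mul_le_mul (hBc ω) h1 (sub_nonneg.2 (min_le_left _ _)) hc
  · rw [integral_const_mul]
    simp only [integral_zero, zero_add]
    refine mul_le_mul_of_nonneg_left ?_ hc
    have : 0 ≤ ∫ u, excess 1 (ψ (a i)) (ψ u) ∂unitMeasure :=
      integral_nonneg fun _ => excess_nonneg _ _ _
    linarith

theorem excess_abs (k : ℕ) (T x : ℝ) : excess k T |x| = excess k T x := by simp [excess]

/-- The past factor now carries one power of size, so it is clipped at c ψ(a_i) instead of c, and
the order of the estimate rises from 1 to 2. -/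
theorem PathMixing.abs_cov_two (hm : PathMixing ν μ a) (hψ : IsTail ψ) {k : ℤ} {i : ℕ}
    (hi : 1 ≤ i) {B N : (ℤ → ℝ) → ℝ} (hB : Measurable[pastPath k] B) {c : ℝ} (hc : 0 ≤ c)
    (bB : BddMeas B) (bN : BddMeas N) (hBc : ∀ ω, |B ω| ≤ c * |N ω|) (hN : MomDom ν N ψ)
    {g : ℝ → ℝ} (hg : LevelConvex g) (bg : BddMeas g) (hd : MomDom μ g ψ) :
    |covInt ν B (fun ω => g (ω (k + i)))| ≤ c * (102 * tailInt ψ 2 (a i)) := by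
  have hT := hψ.nonneg (a i)
  have hE := (hm.momDom bg.1 hd (k + i)) 2 (ψ (a i)) one_le_two hT
  have hE' := hN 2 (ψ (a i)) one_le_two hT
  have bE := (bg.comp (measurable_coord (k + i))).excess 2 (ψ (a i))
  have bE' := bN.excess 2 (ψ (a i))
  have := hm.abs_covInt_le hψ (l := 0) (d := 2) hi hB bB hg LevelConvex.one bg (BddMeas.const 1) hc
    (mul_nonneg hc hT) hT zero_le_one (by ring)
    (e₀ := fun ω => c * excess 2 (ψ (a i)) (N ω))
    (e₁ := fun ω => c * excess 2 (ψ (a i)) (g (ω (k + i)))) (bE'.const_mul c)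
    (bE.const_mul c) (fun ω ω' => ?_) ?_
  · simpa using this
  · rw [abs_one, min_self, mul_one, mul_one]
    refine (mul_sub_min_mono (hBc ω) (le_min (abs_nonneg _) hT) (min_le_left _ _)).trans ?_
    have h1 := mul_sub_min_mul_le (abs_nonneg (N ω)) (abs_nonneg (g (ω' (k + i)))) hT
    rw [excess_abs, excess_abs] at h1
    rw [← mul_min_of_nonneg _ _ hc, mul_assoc, mul_assoc, ← mul_sub, ← mul_add]
    exact mul_le_mul_of_nonneg_left h1 hc
  · rw [integral_const_mul, integral_const_mul, ← mul_add]
    refine mul_le_mul_of_nonneg_left ?_ hc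
    have : 0 ≤ ∫ u, excess 2 (ψ (a i)) (ψ u) ∂unitMeasure :=
      integral_nonneg fun _ => excess_nonneg _ _ _
    linarith

theorem PathMixing.abs_cov_three (hm : PathMixing ν μ a) (hψ : IsTail ψ) {k : ℤ} {i : ℕ}
    (hi : 1 ≤ i) {B N N' : (ℤ → ℝ) → ℝ} (hB : Measurable[pastPath k] B) {c : ℝ} (hc : 0 ≤ c)
    (bB : BddMeas B) (bN : BddMeas N) (bN' : BddMeas N')
    (hBc : ∀ ω, |B ω| ≤ c * (|N ω| * |N' ω|)) (hN : MomDom ν N ψ) (hN' : MomDom ν N' ψ)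
    {g : ℝ → ℝ} (hg : LevelConvex g) (bg : BddMeas g) (hd : MomDom μ g ψ) :
    |covInt ν B (fun ω => g (ω (k + i)))| ≤ c * (102 * tailInt ψ 3 (a i)) := by
  have hT := hψ.nonneg (a i)
  have hE := (hm.momDom bg.1 hd (k + i)) 3 (ψ (a i)) (by norm_num) hT
  have hE' := hN 3 (ψ (a i)) (by norm_num) hT
  have hE'' := hN' 3 (ψ (a i)) (by norm_num) hT
  have bE := (bg.comp (measurable_coord (k + i))).excess 3 (ψ (a i))
  have bE' := bN.excess 3 (ψ (a i))
  have bE'' := bN'.excess 3 (ψ (a i))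
  have := hm.abs_covInt_le hψ (l := 0) (d := 3) hi hB bB hg LevelConvex.one bg (BddMeas.const 1) hc
    (b := c * ψ (a i) ^ 2) (by positivity) hT zero_le_one (by ring)
    (e₀ := fun ω => c * (excess 3 (ψ (a i)) (N ω) + excess 3 (ψ (a i)) (N' ω)))
    (e₁ := fun ω => c * excess 3 (ψ (a i)) (g (ω (k + i)))) ((bE'.add bE'').const_mul c)
    (bE.const_mul c) (fun ω ω' => ?_) ?_
  · simpa using this
  · rw [abs_one, min_self, mul_one, mul_one]
    set x := |N ω|
    set y := |N' ω|
    set z := |g (ω' (k + i))|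
    have hx : 0 ≤ x := abs_nonneg _
    have hy : 0 ≤ y := abs_nonneg _
    have hz : 0 ≤ z := abs_nonneg _
    have hzT : 0 ≤ min z (ψ (a i)) := le_min hz hT
    refine (mul_sub_min_mono (hBc ω) hzT (min_le_left _ _)).trans ?_
    have h1 := mul_mul_sub_min_le hx hy hz hT
    have e1 : excess 3 (ψ (a i)) x = excess 3 (ψ (a i)) (N ω) := excess_abs _ _ _
    have e2 : excess 3 (ψ (a i)) y = excess 3 (ψ (a i)) (N' ω) := excess_abs _ _ _
    have e3 : excess 3 (ψ (a i)) z = excess 3 (ψ (a i)) (g (ω' (k + i))) := excess_abs _ _ _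
    rw [e1, e2, e3] at h1
    -- The past factor is clipped only as a whole, at c ψ(a_i)²; this dominates clipping each of its
    -- two factors at ψ(a_i), which is what the three-factor bound requires.
    have h2 : min x (ψ (a i)) * min y (ψ (a i)) ≤ min (x * y) (ψ (a i) ^ 2) := by
      refine le_min (mul_le_mul (min_le_left _ _) (min_le_left _ _) (le_min hy hT) hx) ?_
      rw [pow_two]
      exact mul_le_mul (min_le_right _ _) (min_le_right _ _) (le_min hy hT) hT
    have h3 := mul_le_mul_of_nonneg_right h2 hzT
    rw [← mul_min_of_nonneg _ _ hc, mul_assoc, mul_assoc c (min _ _), ← mul_sub, ← mul_add]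
    refine mul_le_mul_of_nonneg_left ?_ hc
    linarith
  · rw [integral_const_mul, integral_const_mul, ← mul_add,
      integral_add (bE'.integrable ν) (bE''.integrable ν)]
    refine mul_le_mul_of_nonneg_left ?_ hc
    linarith

theorem PathMixing.abs_cov_pair_two (hm : PathMixing ν μ a) (hψ : IsTail ψ) {k : ℤ} {i : ℕ}
    (hi : 1 ≤ i) (l : ℕ) {B : (ℤ → ℝ) → ℝ} (hB : Measurable[pastPath k] B) {c : ℝ} (hc : 0 ≤ c)
    (hBc : ∀ ω, |B ω| ≤ c) {g g' : ℝ → ℝ} (hg : LevelConvex g) (bg : BddMeas g)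
    (hd : MomDom μ g ψ) (hg' : LevelConvex g') (bg' : BddMeas g') (hd' : MomDom μ g' ψ) :
    |covInt ν B (fun ω => g (ω (k + i)) * g' (ω (k + i + l)))| ≤
      c * (102 * tailInt ψ 2 (a i)) := by
  have bB : BddMeas B := ⟨hB.mono (pastPath_le k) le_rfl, c, hBc⟩
  have hT := hψ.nonneg (a i)
  have hE := (hm.momDom bg.1 hd (k + i)) 2 (ψ (a i)) one_le_two hT
  have hE' := (hm.momDom bg'.1 hd' (k + i + l)) 2 (ψ (a i)) one_le_two hT
  have bE := (bg.comp (measurable_coord (k + i))).excess 2 (ψ (a i))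
  have bE' := (bg'.comp (measurable_coord (k + i + l))).excess 2 (ψ (a i))
  refine hm.abs_covInt_le hψ (d := 2) hi hB bB hg hg' bg bg' hc hc hT hT (by ring)
    (e₀ := fun _ => 0)
    (e₁ := fun ω => c * (excess 2 (ψ (a i)) (g (ω (k + i)))
      + excess 2 (ψ (a i)) (g' (ω (k + i + l))))) (BddMeas.const 0)
    ((bE.add bE').const_mul c) (fun ω ω' => ?_) ?_
  · rw [min_eq_left (hBc ω), ← mul_sub, zero_add]
    have h1 := mul_sub_min_mul_le (abs_nonneg (g (ω' (k + i)))) (abs_nonneg (g' (ω' (k + i + l)))) hT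
    rw [excess_abs, excess_abs] at h1
    refine mul_le_mul (hBc ω) h1 (sub_nonneg.2 ?_) hc
    exact mul_le_mul (min_le_left _ _) (min_le_left _ _) (le_min (abs_nonneg _) hT) (abs_nonneg _)
  · rw [integral_const_mul, integral_add (bE.integrable ν) (bE'.integrable ν)]
    simp only [integral_zero, zero_add]
    refine mul_le_mul_of_nonneg_left ?_ hc
    have : 0 ≤ ∫ u, excess 2 (ψ (a i)) (ψ u) ∂unitMeasure :=
      integral_nonneg fun _ => excess_nonneg _ _ _
    linarith

theorem PathMixing.abs_cov_pair_three (hm : PathMixing ν μ a) (hψ : IsTail ψ) {k : ℤ} {i : ℕ}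
    (hi : 1 ≤ i) (l : ℕ) {B N : (ℤ → ℝ) → ℝ} (hB : Measurable[pastPath k] B) {c : ℝ} (hc : 0 ≤ c)
    (bB : BddMeas B) (bN : BddMeas N) (hBc : ∀ ω, |B ω| ≤ c * |N ω|) (hN : MomDom ν N ψ)
    {g g' : ℝ → ℝ} (hg : LevelConvex g) (bg : BddMeas g)
    (hd : MomDom μ g ψ) (hg' : LevelConvex g') (bg' : BddMeas g') (hd' : MomDom μ g' ψ) :
    |covInt ν B (fun ω => g (ω (k + i)) * g' (ω (k + i + l)))| ≤
      c * (102 * tailInt ψ 3 (a i)) := by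
  have hT := hψ.nonneg (a i)
  have hE := (hm.momDom bg.1 hd (k + i)) 3 (ψ (a i)) (by norm_num) hT
  have hE' := (hm.momDom bg'.1 hd' (k + i + l)) 3 (ψ (a i)) (by norm_num) hT
  have hE'' := hN 3 (ψ (a i)) (by norm_num) hT
  have bE := (bg.comp (measurable_coord (k + i))).excess 3 (ψ (a i))
  have bE' := (bg'.comp (measurable_coord (k + i + l))).excess 3 (ψ (a i))
  refine hm.abs_covInt_le hψ (d := 3) hi hB bB hg hg' bg bg' hc (mul_nonneg hc hT) hT hT (by ring)
    (e₀ := fun ω => c * excess 3 (ψ (a i)) (N ω))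
    (e₁ := fun ω => c * (excess 3 (ψ (a i)) (g (ω (k + i)))
      + excess 3 (ψ (a i)) (g' (ω (k + i + l))))) ((bN.excess 3 _).const_mul c)
    ((bE.add bE').const_mul c) (fun ω ω' => ?_) ?_
  · have h1 := mul_mul_sub_min_le (abs_nonneg (N ω)) (abs_nonneg (g (ω' (k + i))))
      (abs_nonneg (g' (ω' (k + i + l)))) hT
    rw [excess_abs, excess_abs, excess_abs] at h1
    have hm0 : ∀ x : ℝ, 0 ≤ min |x| (ψ (a i)) := fun x => le_min (abs_nonneg _) hT
    refine (mul_sub_min_mono (hBc ω) (mul_nonneg (hm0 _) (hm0 _))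
      (mul_le_mul (min_le_left _ _) (min_le_left _ _) (hm0 _) (abs_nonneg _))).trans ?_
    rw [← mul_min_of_nonneg _ _ hc, mul_assoc, mul_assoc c (min _ _), ← mul_sub, ← mul_add]
    refine mul_le_mul_of_nonneg_left ?_ hc
    linarith
  · rw [integral_const_mul, integral_const_mul, integral_add (bE.integrable ν) (bE'.integrable ν),
      ← mul_add]
    refine mul_le_mul_of_nonneg_left ?_ hc
    linarith

end PathCov

/-! ### Convexity of the excess: stability of domination under combinations and centering. -/

theorem convexOn_excess (k : ℕ) (T : ℝ) : ConvexOn ℝ Set.univ (excess k T) := by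
  have h1 : ConvexOn ℝ Set.univ (fun x : ℝ => |x| ^ k) := by
    exact (convexOn_univ_norm (E := ℝ)).pow (fun x _ => norm_nonneg x) k
  have h2 := (h1.add_const (-T ^ k)).sup (convexOn_const 0 convex_univ)
  refine h2.congr fun x _ => ?_
  simp [excess, sub_eq_add_neg]

theorem continuous_excess (k : ℕ) (T : ℝ) : Continuous (excess k T) := by
  unfold excess; fun_prop

theorem excess_zero {k : ℕ} (hk : 1 ≤ k) {T : ℝ} (hT : 0 ≤ T) : excess k T 0 = 0 := by
  have := pow_nonneg hT k
  simp [excess, zero_pow (by omega : k ≠ 0), this]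

/-- Convexity, with signs absorbed because the excess is even, and the missing mass 1 - ∑|w_i|
placed at 0 where the excess vanishes. -/
theorem excess_sum_le {ι : Type*} [Fintype ι] {w x : ι → ℝ} (hw : ∑ i, |w i| ≤ 1) {k : ℕ}
    (hk : 1 ≤ k) {T : ℝ} (hT : 0 ≤ T) :
    excess k T (∑ i, w i * x i) ≤ ∑ i, |w i| * excess k T (x i) := by
  have h := (convexOn_excess k T).map_add_sum_le (t := Finset.univ) (w := fun i => |w i|)
    (p := fun i => if 0 ≤ w i then x i else -x i) (v := 1 - ∑ i, |w i|) (q := 0)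
    (fun _ _ => abs_nonneg _) (by ring) (fun _ _ => Set.mem_univ _) (by linarith)
    (Set.mem_univ _)
  simp only [smul_eq_mul, mul_zero, zero_add, excess_zero hk hT] at h
  have e1 : ∀ i, |w i| * (if 0 ≤ w i then x i else -x i) = w i * x i := fun i => by
    split_ifs with hi
    · rw [abs_of_nonneg hi]
    · rw [abs_of_neg (not_le.1 hi)]; ring
  have e2 : ∀ i, excess k T (if 0 ≤ w i then x i else -x i) = excess k T (x i) := fun i => by
    split_ifs
    · rfl
    · simp [excess]
  simpa only [e1, e2] using h

theorem excess_two_mul (k : ℕ) (T x : ℝ) :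
    excess k T (2 * x) = 2 ^ k * excess k (T / 2) x := by
  unfold excess
  rw [mul_max_of_nonneg _ _ (by positivity), mul_zero, abs_mul, abs_two, mul_sub, mul_pow,
    ← mul_pow 2 (T / 2), mul_div_cancel₀ T two_ne_zero]

section Domination

set_option linter.unusedSectionVars false

variable {Ω : Type*} [mΩ : MeasurableSpace Ω] {ν : Measure Ω} [IsProbabilityMeasure ν]
  {φ : ℝ → ℝ}

theorem MomDom.two_mul {Z : Ω → ℝ} (h : MomDom ν Z φ) :
    MomDom ν (fun ω => 2 * Z ω) fun u => 2 * φ u := fun k T hk hT => by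
  simp only [excess_two_mul, integral_const_mul]
  exact mul_le_mul_of_nonneg_left (h k (T / 2) hk (by positivity)) (by positivity)

/-- This stability is the reason for comparing excess moments rather than quantile functions, whose
pointwise domination is not preserved by convex combinations. -/
theorem MomDom.sum {ι : Type*} [Fintype ι] {w : ι → ℝ} {Z : ι → Ω → ℝ} (hw : ∑ i, |w i| ≤ 1)
    (bZ : ∀ i, BddMeas (Z i)) (h : ∀ i, MomDom ν (Z i) φ) :
    MomDom ν (fun ω => ∑ i, w i * Z i ω) φ := fun k T hk hT => by
  have b1 : ∀ i, BddMeas fun ω => |w i| * excess k T (Z i ω) := fun i =>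
    ((bZ i).excess k T).const_mul _
  have b2 : BddMeas fun ω => ∑ i, w i * Z i ω := BddMeas.sum fun i _ => (bZ i).const_mul _
  have hφ : 0 ≤ ∫ u, excess k T (φ u) ∂unitMeasure := integral_nonneg fun _ => excess_nonneg _ _ _
  calc ∫ ω, excess k T (∑ i, w i * Z i ω) ∂ν
      ≤ ∫ ω, ∑ i, |w i| * excess k T (Z i ω) ∂ν :=
        integral_mono ((b2.excess k T).integrable ν)
          ((BddMeas.sum fun i _ => b1 i).integrable ν) fun ω => excess_sum_le hw hk hT
    _ = ∑ i, |w i| * ∫ ω, excess k T (Z i ω) ∂ν := by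
        rw [integral_finsetSum _ fun i _ => (b1 i).integrable ν]
        simp only [integral_const_mul]
    _ ≤ ∑ i, |w i| * ∫ u, excess k T (φ u) ∂unitMeasure :=
        Finset.sum_le_sum fun i _ => mul_le_mul_of_nonneg_left (h i k T hk hT) (abs_nonneg _)
    _ ≤ _ := by rw [← Finset.sum_mul]; exact mul_le_of_le_one_left hφ hw

theorem MomDom.mono {Z : Ω → ℝ} (h : MomDom ν Z φ) {ψ : ℝ → ℝ} (hφ : IsTail φ) (hψ : IsTail ψ)
    (hle : ∀ u, φ u ≤ ψ u) : MomDom ν Z ψ := fun k T hk hT =>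
  (h k T hk hT).trans (integral_mono ((hφ.bddMeas.excess k T).integrable _)
    ((hψ.bddMeas.excess k T).integrable _) fun u => excess_mono (by
      rw [abs_of_nonneg (hφ.nonneg u), abs_of_nonneg (hψ.nonneg u)]; exact hle u))

/-- Z - E(Z) is the average of 2Z and -2E(Z), and Jensen's inequality bounds the excess of 2E(Z) by
the mean excess of 2Z. Centering thus costs a factor 2 in the tail function. -/
theorem MomDom.centered {Z : Ω → ℝ} (h : MomDom ν Z φ) (bZ : BddMeas Z) :
    MomDom ν (fun ω => Z ω - ∫ ω', Z ω' ∂ν) fun u => 2 * φ u := fun k T hk hT => by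
  have b2 : BddMeas fun ω => 2 * Z ω := bZ.const_mul 2
  have hJ : excess k T (2 * ∫ ω, Z ω ∂ν) ≤ ∫ ω, excess k T (2 * Z ω) ∂ν := by
    rw [← integral_const_mul]
    exact (convexOn_excess k T).map_integral_le (continuous_excess k T).continuousOn isClosed_univ
      (by simp) (b2.integrable ν) ((b2.excess k T).integrable ν)
  have hpt : ∀ ω, excess k T (Z ω - ∫ ω', Z ω' ∂ν) ≤
      1 / 2 * excess k T (2 * Z ω) + 1 / 2 * excess k T (2 * ∫ ω', Z ω' ∂ν) := fun ω => by
    have := excess_sum_le (w := ![1 / 2, -(1 / 2)]) (x := ![2 * Z ω, 2 * ∫ ω', Z ω' ∂ν])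
      (by simp [Fin.sum_univ_two]; norm_num) hk hT
    simp only [Fin.sum_univ_two, Matrix.cons_val_zero, Matrix.cons_val_one, abs_neg] at this
    rw [abs_of_pos (by norm_num : (0 : ℝ) < 1 / 2)] at this
    convert this using 2
    ring
  calc _ ≤ ∫ ω, (1 / 2 * excess k T (2 * Z ω) + 1 / 2 * excess k T (2 * ∫ ω', Z ω' ∂ν)) ∂ν :=
        integral_mono (((bZ.sub (BddMeas.const _)).excess k T).integrable ν)
          ((((b2.excess k T).const_mul _).add (BddMeas.const _)).integrable ν) hpt
    _ = 1 / 2 * ∫ ω, excess k T (2 * Z ω) ∂ν + 1 / 2 * excess k T (2 * ∫ ω', Z ω' ∂ν) := by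
        rw [integral_add (((b2.excess k T).const_mul _).integrable ν) (integrable_const _),
          integral_const_mul]
        simp
    _ ≤ ∫ ω, excess k T (2 * Z ω) ∂ν := by linarith
    _ ≤ _ := h.two_mul k T hk hT

theorem MomDom.integral_pow_le {Z : Ω → ℝ} (h : MomDom ν Z φ) (hφ : IsTail φ) {k : ℕ}
    (hk : 1 ≤ k) : ∫ ω, |Z ω| ^ k ∂ν ≤ tailInt φ k 1 := by
  have e : ∀ x : ℝ, excess k 0 x = |x| ^ k := fun x => by
    simp [excess, zero_pow (by omega : k ≠ 0)]
  have := h k 0 hk le_rfl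
  simp only [e] at this
  rw [IsTail.tailInt_one]
  refine this.trans (le_of_eq ?_)
  congr 1; ext u; rw [abs_of_nonneg (hφ.nonneg u)]

theorem MomDom.abs_integral_le {Z : Ω → ℝ} (h : MomDom ν Z φ) (hφ : IsTail φ) :
    |∫ ω, Z ω ∂ν| ≤ ∫ u, φ u ∂unitMeasure := by
  have := h.integral_pow_le hφ le_rfl
  simp only [pow_one, IsTail.tailInt_one] at this
  exact abs_integral_le_integral_abs.trans this

theorem covInt_sum {ι : Type*} [Fintype ι] (w : ι → ℝ) {B : Ω → ℝ}
    (bB : BddMeas B) {Z : ι → Ω → ℝ} (bZ : ∀ i, BddMeas (Z i)) :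
    covInt ν B (fun ω => ∑ i, w i * Z i ω) = ∑ i, w i * covInt ν B (Z i) := by
  unfold covInt
  have e : ∀ ω, B ω * ∑ i, w i * Z i ω = ∑ i, w i * (B ω * Z i ω) := fun ω => by
    rw [Finset.mul_sum]; exact Finset.sum_congr rfl fun i _ => by ring
  simp only [e]
  rw [integral_finsetSum _ fun i _ => ((bB.mul (bZ i)).const_mul _).integrable ν,
    integral_finsetSum _ fun i _ => ((bZ i).const_mul _).integrable ν, Finset.mul_sum,
    ← Finset.sum_sub_distrib]
  refine Finset.sum_congr rfl fun i _ => ?_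
  rw [integral_const_mul, integral_const_mul]
  ring

theorem abs_covInt_sum_le {ι : Type*} [Fintype ι] {w : ι → ℝ} (hw : ∑ i, |w i| ≤ 1) {B : Ω → ℝ}
    (bB : BddMeas B) {Z : ι → Ω → ℝ} (bZ : ∀ i, BddMeas (Z i)) {K : ℝ} (hK : 0 ≤ K)
    (h : ∀ i, |covInt ν B (Z i)| ≤ K) : |covInt ν B (fun ω => ∑ i, w i * Z i ω)| ≤ K := by
  rw [covInt_sum w bB bZ]
  calc _ ≤ ∑ i, |w i * covInt ν B (Z i)| := Finset.abs_sum_le_sum_abs _ _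
    _ ≤ ∑ i, |w i| * K := Finset.sum_le_sum fun i _ => by
        rw [abs_mul]; exact mul_le_mul_of_nonneg_left (h i) (abs_nonneg _)
    _ ≤ K := by rw [← Finset.sum_mul]; exact mul_le_of_le_one_left hK hw

theorem integral_mul_sub_mean {B Z : Ω → ℝ} (bB : BddMeas B) (bZ : BddMeas Z) {m : ℝ}
    (hm : ∫ ω, Z ω ∂ν = m) : ∫ ω, B ω * (Z ω - m) ∂ν = covInt ν B Z := by
  simp only [mul_sub]
  rw [integral_sub ((bB.mul bZ).integrable ν) ((bB.mul (BddMeas.const m)).integrable ν),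
    integral_mul_const, covInt, hm]

end Domination

/-! ### Absolutely convex hulls and the dependence estimates for the centered process. -/

/-- Absolutely convex combinations of bounded level-convex functions, dominated by `ψ`. -/
structure IsHull (μ : Measure ℝ) (ψ h : ℝ → ℝ) : Prop where
  bdd : BddMeas h
  dom : MomDom μ (fun x => h x - ∫ y, h y ∂μ) ψ
  mean_le : 2 * |∫ x, h x ∂μ| ≤ ∫ u, ψ u ∂unitMeasure
  rep : ∃ (L : ℕ) (w : Fin L → ℝ) (g : Fin L → ℝ → ℝ), ∑ l, |w l| ≤ 1 ∧
    (∀ l, LevelConvex (g l)) ∧ (∀ l, BddMeas (g l)) ∧ (∀ l, MomDom μ (g l) ψ) ∧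
    h = fun x => ∑ l, w l * g l x

theorem IsHull.of_sum {μ : Measure ℝ} [IsProbabilityMeasure μ] {φ : ℝ → ℝ} (hφ : IsTail φ)
    {L : ℕ} {w : Fin L → ℝ} {g : Fin L → ℝ → ℝ} (hw : ∑ l, |w l| ≤ 1)
    (hg : ∀ l, LevelConvex (g l)) (bg : ∀ l, BddMeas (g l)) (hd : ∀ l, MomDom μ (g l) φ) :
    IsHull μ (fun u => 2 * φ u) fun x => ∑ l, w l * g l x where
  bdd := BddMeas.sum fun l _ => (bg l).const_mul _
  dom := (MomDom.sum hw bg hd).centered (BddMeas.sum fun l _ => (bg l).const_mul _)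
  mean_le := by
    rw [integral_const_mul]
    have := (MomDom.sum hw bg hd).abs_integral_le hφ
    linarith
  rep := ⟨L, w, g, hw, hg, bg, fun l => (hd l).mono hφ hφ.two_mul fun u => by
    have := hφ.nonneg u; linarith, rfl⟩

/-- The centered process `h(ω_k) - E h(ω_k)` on the path space. -/
noncomputable def pathVar (μ : Measure ℝ) (h : ℝ → ℝ) (k : ℤ) (ω : ℤ → ℝ) : ℝ :=
  h (ω k) - ∫ x, h x ∂μ

section PathVar

set_option linter.unusedSectionVars false

variable {ν : Measure (ℤ → ℝ)} [IsProbabilityMeasure ν] {μ : Measure ℝ} [IsProbabilityMeasure μ]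
  {a : ℕ → ℝ} {ψ h : ℝ → ℝ}

theorem IsHull.bdd_pathVar (hh : IsHull μ ψ h) (k : ℤ) : BddMeas (pathVar μ h k) :=
  (hh.bdd.comp (measurable_coord k)).sub (BddMeas.const _)

theorem IsHull.measurable_pathVar (hh : IsHull μ ψ h) {i k : ℤ} (hik : i ≤ k) :
    Measurable[pastPath k] (pathVar μ h i) :=
  ((hh.bdd.1.comp (measurable_pastPath hik)).sub_const _)

theorem IsHull.momDom_pathVar (hh : IsHull μ ψ h) (hm : PathMixing ν μ a) (k : ℤ) :
    MomDom ν (pathVar μ h k) ψ :=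
  hm.momDom (hh.bdd.1.sub_const _) hh.dom k

theorem IsHull.integral_pathVar (hh : IsHull μ ψ h) (hm : PathMixing ν μ a) (k : ℤ) :
    ∫ ω, pathVar μ h k ω ∂ν = 0 := by
  have := hm.integral_comp (f := fun x => h x - ∫ y, h y ∂μ) (hh.bdd.1.sub_const _) k
  refine this.trans ?_
  rw [integral_sub (hh.bdd.integrable μ) (integrable_const _)]
  simp

theorem IsHull.integral_mul_pathVar (hh : IsHull μ ψ h) (hm : PathMixing ν μ a) {B : (ℤ → ℝ) → ℝ}
    (bB : BddMeas B) (k : ℤ) :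
    ∫ ω, B ω * pathVar μ h k ω ∂ν = covInt ν B (fun ω => h (ω k)) :=
  integral_mul_sub_mean bB (hh.bdd.comp (measurable_coord k)) (hm.integral_comp hh.bdd.1 k)

theorem IsHull.abs_covInt_le (hh : IsHull μ ψ h) {B : (ℤ → ℝ) → ℝ} (bB : BddMeas B) {k : ℤ} {K : ℝ}
    (hK : 0 ≤ K)
    (h1 : ∀ g : ℝ → ℝ, LevelConvex g → BddMeas g → MomDom μ g ψ →
      |covInt ν B (fun ω => g (ω k))| ≤ K) :
    |covInt ν B (fun ω => h (ω k))| ≤ K := by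
  obtain ⟨L, w, g, hw, hg, bg, hd, rfl⟩ := hh.rep
  exact abs_covInt_sum_le hw bB (Z := fun l ω => g l (ω k))
    (fun l => (bg l).comp (measurable_coord k)) hK fun l => h1 _ (hg l) (bg l) (hd l)

theorem IsHull.abs_covInt_mul_le (hh : IsHull μ ψ h) {B : (ℤ → ℝ) → ℝ} (bB : BddMeas B) {k k' : ℤ}
    {K : ℝ} (hK : 0 ≤ K)
    (h1 : ∀ g g' : ℝ → ℝ, LevelConvex g → BddMeas g → MomDom μ g ψ → LevelConvex g' →
      BddMeas g' → MomDom μ g' ψ → |covInt ν B (fun ω => g (ω k) * g' (ω k'))| ≤ K) :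
    |covInt ν B (fun ω => h (ω k) * h (ω k'))| ≤ K := by
  obtain ⟨L, w, g, hw, hg, bg, hd, rfl⟩ := hh.rep
  have hw2 : ∑ p : Fin L × Fin L, |w p.1 * w p.2| ≤ 1 := by
    rw [Fintype.sum_prod_type]
    simp only [abs_mul, ← Finset.mul_sum, ← Finset.sum_mul]
    exact mul_le_one₀ hw (Finset.sum_nonneg fun _ _ => abs_nonneg _) hw
  have := abs_covInt_sum_le hw2 bB (Z := fun p ω => g p.1 (ω k) * g p.2 (ω k'))
    (fun p => ((bg _).comp (measurable_coord k)).mul ((bg _).comp (measurable_coord k'))) hK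
    (fun p => h1 _ _ (hg _) (bg _) (hd _) (hg _) (bg _) (hd _))
  refine (le_of_eq ?_).trans this
  congr 2; ext ω
  rw [Finset.sum_mul_sum, Fintype.sum_prod_type]
  exact Finset.sum_congr rfl fun i _ => Finset.sum_congr rfl fun j _ => by ring

/-- Expanding (h(ω_k) - p)(h(ω_k') - p), where p is the mean, leaves the uncentered pair and p times
two single covariances; 2|p| is at most ∫ψ. -/
theorem IsHull.abs_integral_mul_pair_le (hh : IsHull μ ψ h)
    {B : (ℤ → ℝ) → ℝ} (bB : BddMeas B) {k k' : ℤ} {K K₁ : ℝ}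
    (h1 : |covInt ν B (fun ω => h (ω k) * h (ω k'))| ≤ K)
    (h2 : |covInt ν B (fun ω => h (ω k))| ≤ K₁) (h3 : |covInt ν B (fun ω => h (ω k'))| ≤ K₁)
    {m : ℝ} (hcm : ∫ ω, pathVar μ h k ω * pathVar μ h k' ω ∂ν = m) :
    |∫ ω, B ω * (pathVar μ h k ω * pathVar μ h k' ω - m) ∂ν| ≤
      K + (∫ u, ψ u ∂unitMeasure) * K₁ := by
  rw [integral_mul_sub_mean bB ((hh.bdd_pathVar k).mul (hh.bdd_pathVar k')) hcm]
  have bk := hh.bdd.comp (measurable_coord k)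
  have bk' := hh.bdd.comp (measurable_coord k')
  set p := ∫ x, h x ∂μ
  have e : covInt ν B (fun ω => pathVar μ h k ω * pathVar μ h k' ω) =
      covInt ν B (fun ω => h (ω k) * h (ω k')) - p * covInt ν B (fun ω => h (ω k))
        - p * covInt ν B (fun ω => h (ω k')) := by
    have := covInt_sum (ν := ν) ![1, -p, -p, 1] bB
      (Z := ![fun ω => h (ω k) * h (ω k'), fun ω => h (ω k), fun ω => h (ω k'), fun _ => p * p])
      (by
        intro i
        fin_cases i
        exacts [bk.mul bk', bk, bk', BddMeas.const _])
    simp only [Fin.sum_univ_four, Matrix.cons_val] at this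
    have h0 : covInt ν B (fun _ => p * p) = 0 := by
      simp [covInt, integral_mul_const]
    rw [h0] at this
    rw [show (fun ω => pathVar μ h k ω * pathVar μ h k' ω) = fun ω => 1 * (h (ω k) * h (ω k'))
      + -p * h (ω k) + -p * h (ω k') + 1 * (p * p) from by
        ext ω; simp only [pathVar]; ring, this]
    ring
  rw [e]
  have hp := hh.mean_le
  have hK₁ : 0 ≤ K₁ := (abs_nonneg _).trans h2
  refine (abs_sub _ _).trans ((add_le_add_left (abs_sub _ _) _).trans ?_)
  rw [abs_mul, abs_mul]
  have q1 := mul_le_mul_of_nonneg_left h2 (abs_nonneg p)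
  have q2 := mul_le_mul_of_nonneg_left h3 (abs_nonneg p)
  have q3 := mul_le_mul_of_nonneg_right hp hK₁
  linarith

theorem IsHull.one_le (hh : IsHull μ ψ h) (hm : PathMixing ν μ a) (hψ : IsTail ψ) (k : ℤ) {i : ℕ}
    (hi : 1 ≤ i) {B : (ℤ → ℝ) → ℝ} (hB : Measurable[pastPath k] B) {c : ℝ} (hc : 0 ≤ c)
    (hBc : ∀ ω, |B ω| ≤ c) :
    |∫ ω, B ω * pathVar μ h (k + i) ω ∂ν| ≤ c * (102 * tailInt ψ 1 (a i)) := by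
  have bB : BddMeas B := ⟨hB.mono (pastPath_le k) le_rfl, c, hBc⟩
  have h0 := hψ.tailInt_nonneg 1 (a i)
  rw [hh.integral_mul_pathVar hm bB]
  exact hh.abs_covInt_le bB (by positivity) fun g hg bg hd =>
    hm.abs_cov_one hψ hi hB hc hBc hg bg hd

theorem IsHull.two_le (hh : IsHull μ ψ h) (hm : PathMixing ν μ a) (hψ : IsTail ψ) (k : ℤ) {i : ℕ}
    (hi : 1 ≤ i) {B N : (ℤ → ℝ) → ℝ} (hB : Measurable[pastPath k] B) {c : ℝ} (hc : 0 ≤ c)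
    (bB : BddMeas B) (bN : BddMeas N) (hN : MomDom ν N ψ) (hBc : ∀ ω, |B ω| ≤ c * |N ω|) :
    |∫ ω, B ω * pathVar μ h (k + i) ω ∂ν| ≤ c * (102 * tailInt ψ 2 (a i)) := by
  have h0 := hψ.tailInt_nonneg 2 (a i)
  rw [hh.integral_mul_pathVar hm bB]
  exact hh.abs_covInt_le bB (by positivity) fun g hg bg hd =>
    hm.abs_cov_two hψ hi hB hc bB bN hBc hN hg bg hd

theorem IsHull.three_le (hh : IsHull μ ψ h) (hm : PathMixing ν μ a) (hψ : IsTail ψ) (k : ℤ) {i : ℕ}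
    (hi : 1 ≤ i) {B N N' : (ℤ → ℝ) → ℝ} (hB : Measurable[pastPath k] B) {c : ℝ} (hc : 0 ≤ c)
    (bB : BddMeas B) (bN : BddMeas N) (hN : MomDom ν N ψ) (bN' : BddMeas N') (hN' : MomDom ν N' ψ)
    (hBc : ∀ ω, |B ω| ≤ c * (|N ω| * |N' ω|)) :
    |∫ ω, B ω * pathVar μ h (k + i) ω ∂ν| ≤ c * (102 * tailInt ψ 3 (a i)) := by
  have h0 := hψ.tailInt_nonneg 3 (a i)
  rw [hh.integral_mul_pathVar hm bB]
  exact hh.abs_covInt_le bB (by positivity) fun g hg bg hd =>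
    hm.abs_cov_three hψ hi hB hc bB bN bN' hBc hN hN' hg bg hd

theorem IsHull.abs_cov_le (hh : IsHull μ ψ h) (hm : PathMixing ν μ a) (hψ : IsTail ψ) (k : ℤ)
    (l : ℕ) :
    |∫ ω, pathVar μ h k ω * pathVar μ h (k + l) ω ∂ν| ≤ 102 * tailInt ψ 2 (a l) := by
  rcases Nat.eq_zero_or_pos l with rfl | hl
  · have h1 := (hh.momDom_pathVar hm k).integral_pow_le hψ one_le_two
    have h0 := hψ.tailInt_nonneg 2 1
    -- Lag zero is the second moment, which is consistent with the general form because a_0 = 1.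
    simp only [Nat.cast_zero, add_zero, hm.zero, ← pow_two, sq_abs] at h1 ⊢
    rw [abs_of_nonneg (integral_nonneg fun _ => sq_nonneg _)]
    linarith
  · have := hh.two_le hm hψ k hl (hh.measurable_pathVar le_rfl) zero_le_one (hh.bdd_pathVar k)
      (hh.bdd_pathVar k) (hh.momDom_pathVar hm k) (fun ω => by rw [one_mul])
    rwa [one_mul] at this

theorem IsHull.pair_two_le (hh : IsHull μ ψ h) (hm : PathMixing ν μ a) (hψ : IsTail ψ) (k : ℤ)
    {i : ℕ} (hi : 1 ≤ i) (l : ℕ) {B : (ℤ → ℝ) → ℝ} (hB : Measurable[pastPath k] B) {c : ℝ}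
    (hc : 0 ≤ c) (hBc : ∀ ω, |B ω| ≤ c) {m : ℝ}
    (hcm : ∫ ω, pathVar μ h (k + i) ω * pathVar μ h (k + i + l) ω ∂ν = m) :
    |∫ ω, B ω * (pathVar μ h (k + i) ω * pathVar μ h (k + i + l) ω - m) ∂ν| ≤
      c * (204 * tailInt ψ 2 (a i)) := by
  have bB : BddMeas B := ⟨hB.mono (pastPath_le k) le_rfl, c, hBc⟩
  have h0 := hψ.tailInt_nonneg 1 (a i)
  have h0' := hψ.tailInt_nonneg 2 (a i)
  have c1 : ∀ j : ℕ, |covInt ν B (fun ω => h (ω (k + (i + j : ℕ))))| ≤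
      c * (102 * tailInt ψ 1 (a i)) := fun j =>
    hh.abs_covInt_le bB (by positivity) fun g hg bg hd =>
      (hm.abs_cov_one hψ (by omega) hB hc hBc hg bg hd).trans (by
        have := hψ.tailInt_mono 1 (hm.anti (Nat.le_add_right i j))
        gcongr)
  have c2 := c1 0
  have c3 := c1 l
  rw [add_zero] at c2
  rw [Nat.cast_add, ← add_assoc] at c3
  have := hh.abs_integral_mul_pair_le bB (K := c * (102 * tailInt ψ 2 (a i)))
    (hh.abs_covInt_mul_le bB (by positivity) fun g g' hg bg hd hg' bg' hd' =>
      hm.abs_cov_pair_two hψ hi l hB hc hBc hg bg hd hg' bg' hd') c2 c3 hcm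
  refine this.trans ?_
  -- The product of ∫ψ with the first order bound is absorbed in second order, doubling 102 to 204.
  have h1 := mul_le_mul_of_nonneg_left (hψ.tailInt_mul_le 1 (a i)) hc
  norm_num at h1
  linarith

/-- The larger of the two gaps is exploited. If i ≥ l, the pair is separated from the past. If l ≥
i, the variable at k + i joins the past, only the last variable is decoupled, and the centering
constant m is bounded as a covariance of lag l. -/
theorem IsHull.pair_three_le (hh : IsHull μ ψ h) (hm : PathMixing ν μ a) (hψ : IsTail ψ) (k : ℤ)
    {i : ℕ} (hi : 1 ≤ i) (l : ℕ) {B : (ℤ → ℝ) → ℝ} (hB : Measurable[pastPath k] B) {c : ℝ}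
    (hc : 0 ≤ c) (hBc : ∀ ω, |B ω| ≤ c * |pathVar μ h k ω|) {m : ℝ}
    (hcm : ∫ ω, pathVar μ h (k + i) ω * pathVar μ h (k + i + l) ω ∂ν = m) :
    |∫ ω, B ω * (pathVar μ h (k + i) ω * pathVar μ h (k + i + l) ω - m) ∂ν| ≤
      c * (204 * tailInt ψ 3 (a (max i l))) := by
  have bN := hh.bdd_pathVar k
  have hN := hh.momDom_pathVar hm k
  have bB : BddMeas B := by
    obtain ⟨C, hC⟩ := bN.2
    exact ⟨hB.mono (pastPath_le k) le_rfl, c * C, fun ω => (hBc ω).trans (by gcongr; exact hC ω)⟩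
  rcases le_total l i with hl | hl
  · rw [max_eq_left hl]
    have h0 := hψ.tailInt_nonneg 2 (a i)
    have h0' := hψ.tailInt_nonneg 3 (a i)
    have c1 : ∀ j : ℕ, |covInt ν B (fun ω => h (ω (k + (i + j : ℕ))))| ≤
        c * (102 * tailInt ψ 2 (a i)) := fun j =>
      hh.abs_covInt_le bB (by positivity) fun g hg bg hd =>
        (hm.abs_cov_two hψ (by omega) hB hc bB bN hBc hN hg bg hd).trans (by
          have := hψ.tailInt_mono 2 (hm.anti (Nat.le_add_right i j))
          gcongr)
    have c2 := c1 0
    have c3 := c1 l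
    rw [add_zero] at c2
    rw [Nat.cast_add, ← add_assoc] at c3
    have := hh.abs_integral_mul_pair_le bB (K := c * (102 * tailInt ψ 3 (a i)))
      (hh.abs_covInt_mul_le bB (by positivity) fun g g' hg bg hd hg' bg' hd' =>
        hm.abs_cov_pair_three hψ hi l hB hc bB bN hBc hN hg bg hd hg' bg' hd') c2 c3 hcm
    refine this.trans ?_
    have h1 := mul_le_mul_of_nonneg_left (hψ.tailInt_mul_le 2 (a i)) hc
    norm_num at h1
    linarith
  · rw [max_eq_right hl]
    have bi := hh.bdd_pathVar (k + i)
    have hki : k ≤ k + i := by omega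
    have t1 := hh.three_le hm hψ (k + i) (i := l) (by omega) (N := pathVar μ h k)
      (N' := pathVar μ h (k + i)) (B := fun ω => B ω * pathVar μ h (k + i) ω)
      ((hB.mono (pastPath_mono hki) le_rfl).mul (hh.measurable_pathVar le_rfl)) hc (bB.mul bi) bN hN
      bi (hh.momDom_pathVar hm _) (fun ω => by
        rw [abs_mul, ← mul_assoc]
        exact mul_le_mul_of_nonneg_right (hBc ω) (abs_nonneg _))
    have t2 := hh.abs_cov_le hm hψ (k + i) l
    rw [hcm] at t2
    have t3 : |∫ ω, B ω ∂ν| ≤ c * ∫ u, ψ u ∂unitMeasure := by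
      have := hN.integral_pow_le hψ le_rfl
      simp only [pow_one, IsTail.tailInt_one] at this
      refine abs_integral_le_integral_abs.trans ((integral_mono (bB.abs.integrable ν)
        ((bN.abs.const_mul c).integrable ν) hBc).trans ?_)
      rw [integral_const_mul]
      gcongr
    have e : ∫ ω, B ω * (pathVar μ h (k + i) ω * pathVar μ h (k + i + l) ω - m) ∂ν =
        ∫ ω, B ω * pathVar μ h (k + i) ω * pathVar μ h (k + i + l) ω ∂ν - (∫ ω, B ω ∂ν) * m := by
      rw [← integral_mul_const, ← integral_sub
        (((bB.mul bi).mul (hh.bdd_pathVar _)).integrable ν) ((bB.mul (BddMeas.const m)).integrable ν)]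
      congr 1; ext ω; ring
    rw [e]
    refine (abs_sub _ _).trans ((add_le_add t1 (le_of_eq (abs_mul _ _))).trans ?_)
    have hI : 0 ≤ ∫ u, ψ u ∂unitMeasure := integral_nonneg hψ.nonneg
    have t4 := mul_le_mul t3 t2 (abs_nonneg _) (by positivity)
    have h1 := mul_le_mul_of_nonneg_left (hψ.tailInt_mul_le 2 (a l)) hc
    norm_num at h1
    linarith

end PathVar

/-! ### Rescaling by the level and the verification of the weak dependence bounds. -/

/-- The rescaled path variables, set to zero after time `n`. -/
noncomputable def scaledVar (μ : Measure ℝ) (h : ℝ → ℝ) (lam : ℝ) (n j : ℕ) (ω : ℤ → ℝ) : ℝ :=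
  if j ≤ n then pathVar μ h j ω / lam else 0

theorem scaledVar_of_le (μ : Measure ℝ) (h : ℝ → ℝ) (lam : ℝ) {n j : ℕ} (hj : j ≤ n) :
    scaledVar μ h lam n j = fun ω => pathVar μ h j ω / lam := by
  ext ω; simp [scaledVar, hj]

theorem scaledVar_of_lt (μ : Measure ℝ) (h : ℝ → ℝ) (lam : ℝ) {n j : ℕ} (hj : n < j) :
    scaledVar μ h lam n j = fun _ => 0 := by
  ext ω; simp [scaledVar, not_le.2 hj]

section Scaled

variable {ν : Measure (ℤ → ℝ)} [IsProbabilityMeasure ν] {μ : Measure ℝ} [IsProbabilityMeasure μ]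
  {a : ℕ → ℝ} {ψ h : ℝ → ℝ}

theorem lagCov_scaledVar_of_le (ν : Measure (ℤ → ℝ)) (μ : Measure ℝ) (h : ℝ → ℝ) (lam : ℝ)
    {n j l : ℕ} (hj : j + l ≤ n) :
    lagCov ν (scaledVar μ h lam n) j l =
      (∫ ω, pathVar μ h j ω * pathVar μ h (j + l) ω ∂ν) / lam ^ 2 := by
  unfold lagCov
  rw [scaledVar_of_le μ h lam (by omega : j ≤ n), scaledVar_of_le μ h lam hj, ← integral_div]
  congr 1; ext ω; push_cast; ring

theorem lagCov_scaledVar_of_lt (ν : Measure (ℤ → ℝ)) (μ : Measure ℝ) (h : ℝ → ℝ) (lam : ℝ)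
    {n j l : ℕ} (hj : n < j + l) : lagCov ν (scaledVar μ h lam n) j l = 0 := by
  unfold lagCov
  rw [scaledVar_of_lt μ h lam hj]
  simp

theorem abs_integral_mul_scaledVar_le (ν : Measure (ℤ → ℝ)) (μ : Measure ℝ) (h : ℝ → ℝ) {lam : ℝ}
    {n j i l : ℕ} (B : (ℤ → ℝ) → ℝ) {K : ℝ} (hK : 0 ≤ K)
    (hb : j + i + l ≤ n → |∫ ω, B ω * (pathVar μ h (j + i) ω * pathVar μ h (j + i + l) ω -
      ∫ ω', pathVar μ h (j + i) ω' * pathVar μ h (j + i + l) ω' ∂ν) ∂ν| ≤ lam ^ 2 * K)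
    (hlam : 0 < lam) :
    |∫ ω, B ω * (scaledVar μ h lam n (j + i) ω * scaledVar μ h lam n (j + i + l) ω -
      lagCov ν (scaledVar μ h lam n) (j + i) l) ∂ν| ≤ K := by
  by_cases hn : j + i + l ≤ n
  · rw [lagCov_scaledVar_of_le ν μ h lam hn, scaledVar_of_le μ h lam (by omega : j + i ≤ n),
      scaledVar_of_le μ h lam hn]
    have := hb hn
    push_cast
    rw [show (∫ ω, B ω * (pathVar μ h (j + i) ω / lam * (pathVar μ h (j + i + l) ω / lam) -
        (∫ ω, pathVar μ h (j + i) ω * pathVar μ h (j + i + l) ω ∂ν) / lam ^ 2) ∂ν) =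
        (∫ ω, B ω * (pathVar μ h (j + i) ω * pathVar μ h (j + i + l) ω -
        ∫ ω', pathVar μ h (j + i) ω' * pathVar μ h (j + i + l) ω' ∂ν) ∂ν) / lam ^ 2 by
      refine Eq.trans ?_ (integral_div _ _); congr 1; ext ω; ring, abs_div, abs_of_pos (by positivity : 0 < lam ^ 2)]
    rw [div_le_iff₀ (by positivity)]
    linarith
  · rw [lagCov_scaledVar_of_lt ν μ h lam (not_le.1 hn), scaledVar_of_lt μ h lam (not_le.1 hn)]
    simpa using hK

theorem IsHull.weakDep (hh : IsHull μ ψ h) (hm : PathMixing ν μ a) (hψ : IsTail ψ) {M : ℝ}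
    (hM : ∀ x, |h x| ≤ M) {lam : ℝ} (hlam : 0 < lam) (n : ℕ) :
    WeakDep ν (fun j : ℕ => pastPath j) (scaledVar μ h lam n) (2 * M / lam)
      (fun i => 102 * tailInt ψ 1 (a i) / lam) (fun i => 204 * tailInt ψ 2 (a i) / lam ^ 2)
      (fun i => 204 * tailInt ψ 3 (a i) / lam ^ 3) where
  mono := fun i j hij => pastPath_mono (by exact_mod_cast hij)
  le := fun j => pastPath_le j
  adapted := fun j => by
    rcases le_or_gt j n with hj | hj
    · rw [scaledVar_of_le _ _ _ hj]; exact (hh.measurable_pathVar le_rfl).div_const _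
    · rw [scaledVar_of_lt _ _ _ hj]; exact measurable_const
  bound := fun j ω => by
    have hm' : |∫ x, h x ∂μ| ≤ M := by
      have := norm_integral_le_of_norm_le_const (μ := μ) (f := h) (C := M)
        (Eventually.of_forall hM)
      simpa using this
    have hM0 : 0 ≤ M := (abs_nonneg _).trans hm'
    rcases le_or_gt j n with hj | hj
    · rw [scaledVar_of_le _ _ _ hj, abs_div, abs_of_pos hlam]
      have : |pathVar μ h j ω| ≤ 2 * M := (abs_sub _ _).trans (by linarith [hM (ω j)])
      gcongr
    · rw [scaledVar_of_lt _ _ _ hj, abs_zero]; positivity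
  centered := fun j => by
    rcases le_or_gt j n with hj | hj
    · rw [scaledVar_of_le _ _ _ hj, integral_div, hh.integral_pathVar hm, zero_div]
    · rw [scaledVar_of_lt _ _ _ hj, integral_zero]
  one_le := fun j i hi B hB c hc => by
    have hc0 : 0 ≤ c := (abs_nonneg _).trans (hc 0)
    have h0 := hψ.tailInt_nonneg 1 (a i)
    rcases le_or_gt (j + i) n with hj | hj
    · rw [scaledVar_of_le _ _ _ hj]
      simp only [mul_div_assoc']
      rw [integral_div, abs_div, abs_of_pos hlam]
      gcongr
      simpa using hh.one_le hm hψ j hi hB hc0 hc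
    · rw [scaledVar_of_lt _ _ _ hj]
      simp only [mul_zero, integral_zero, abs_zero]
      positivity
  three_le := fun j i hi B hB c hc0 hc => by
    have h0 := hψ.tailInt_nonneg 3 (a i)
    rcases le_or_gt (j + i) n with hj | hj
    · rw [scaledVar_of_le _ _ _ (by omega : j ≤ n)] at hc
      rw [scaledVar_of_le _ _ _ hj]
      have bX := hh.bdd_pathVar (j : ℤ)
      have hBc : ∀ ω, |B ω| ≤ c / lam ^ 2 * (|pathVar μ h j ω| * |pathVar μ h j ω|) := fun ω => by
        refine (hc ω).trans (le_of_eq ?_)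
        rw [abs_div, abs_of_pos hlam]; ring
      have bB : BddMeas B := by
        obtain ⟨C, hC⟩ := ((bX.abs.mul bX.abs).const_mul (c / lam ^ 2)).2
        exact ⟨hB.mono (pastPath_le j) le_rfl, C, fun ω => (hBc ω).trans ((le_abs_self _).trans (hC ω))⟩
      have := hh.three_le hm hψ j hi hB (by positivity) bB bX (hh.momDom_pathVar hm _) bX
        (hh.momDom_pathVar hm _) hBc
      simp only [mul_div_assoc']
      rw [integral_div, abs_div, abs_of_pos hlam, div_le_iff₀ hlam]
      push_cast
      refine this.trans ?_
      rw [div_mul_eq_mul_div, div_mul_eq_mul_div, div_le_div_iff₀ (by positivity) (by positivity)]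
      have : 0 ≤ c * tailInt ψ 3 (a i) * lam ^ 3 := by positivity
      linear_combination 102 * this
    · rw [scaledVar_of_lt _ _ _ hj]
      simp only [mul_zero, integral_zero, abs_zero]
      positivity
  pair_two_le := fun j i hi l B hB c hc => by
    have hc0 : 0 ≤ c := (abs_nonneg _).trans (hc 0)
    have h0 := hψ.tailInt_nonneg 2 (a i)
    refine abs_integral_mul_scaledVar_le ν μ h B (by positivity) (fun _ => ?_) hlam
    refine (hh.pair_two_le hm hψ j hi l hB hc0 hc rfl).trans (le_of_eq ?_)
    field_simp
  pair_three_le := fun j i hi l B hB c hc0 hc => by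
    have h0 := hψ.tailInt_nonneg 3 (a (max i l))
    refine abs_integral_mul_scaledVar_le ν μ h B (by positivity) (fun hn => ?_) hlam
    rw [scaledVar_of_le _ _ _ (by omega : j ≤ n)] at hc
    refine (hh.pair_three_le hm hψ j hi l hB (c := c / lam) (by positivity) (fun ω => ?_) rfl).trans
      (le_of_eq ?_)
    · refine (hc ω).trans (le_of_eq ?_)
      rw [abs_div, abs_of_pos hlam]; ring
    · field_simp
  cov_le := fun j l => by
    have h0 := hψ.tailInt_nonneg 2 (a l)
    rcases le_or_gt (j + l) n with hj | hj
    · rw [lagCov_scaledVar_of_le _ _ _ _ hj, abs_div, abs_of_pos (by positivity : 0 < lam ^ 2)]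
      gcongr
      exact (hh.abs_cov_le hm hψ j l).trans (by linarith)
    · rw [lagCov_scaledVar_of_lt _ _ _ _ hj, abs_zero]; positivity
  moment_le := fun j => by
    have h0 := hψ.tailInt_nonneg 3 (a 0)
    rcases le_or_gt j n with hj | hj
    · rw [scaledVar_of_le _ _ _ hj]
      simp only [abs_div, abs_of_pos hlam, div_pow]
      rw [integral_div]
      gcongr
      rw [hm.zero] at h0 ⊢
      exact ((hh.momDom_pathVar hm j).integral_pow_le hψ (by norm_num)).trans (by linarith)
    · rw [scaledVar_of_lt _ _ _ hj]
      simp only [abs_zero]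
      norm_num
      positivity

end Scaled

/-! ### Reduction of the step error to three dimensionless quantities. -/

/-- `∑_{i < q} ∫_0^{a_i} ψ^k`. -/
noncomputable def sumInt (ψ : ℝ → ℝ) (k : ℕ) (a : ℕ → ℝ) (q : ℕ) : ℝ :=
  ∑ i ∈ Finset.range q, tailInt ψ k (a i)

/-- `∑_{i, l < q} ∫_0^{min (a_i, a_l)} ψ^k`. -/
noncomputable def dblInt (ψ : ℝ → ℝ) (k : ℕ) (a : ℕ → ℝ) (q : ℕ) : ℝ :=
  ∑ i ∈ Finset.range q, ∑ l ∈ Finset.range q, tailInt ψ k (a (max i l))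

/-- `∑_{l < n} ∫_0^{min (a_q, a_l)} ψ^k`. -/
noncomputable def farInt (ψ : ℝ → ℝ) (k : ℕ) (a : ℕ → ℝ) (q n : ℕ) : ℝ :=
  ∑ l ∈ Finset.range n, tailInt ψ k (a (max q l))

section Numeric

variable {ψ : ℝ → ℝ} {a : ℕ → ℝ}

namespace IsTail

/-- Chebyshev's association for the two nonincreasing truncated powers; the product of the
indicators cuts at the smaller endpoint. Summed over indices, it turns products of single sums into
the double sum. -/
theorem tailInt_mul_tailInt_le (h : IsTail ψ) (j k : ℕ) (x y : ℝ) :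
    tailInt ψ j x * tailInt ψ k y ≤ tailInt ψ (j + k) (min x y) := by
  have anti : ∀ (k : ℕ) (x : ℝ), Antitone ((Set.Iio x).indicator (fun u => ψ u ^ k)) := by
    intro k x u v huv
    by_cases hv : v ∈ Set.Iio x
    · rw [Set.indicator_of_mem hv,
        Set.indicator_of_mem (show u ∈ Set.Iio x from lt_of_le_of_lt huv hv)]
      exact pow_le_pow_left₀ (h.nonneg v) (h.anti huv) k
    · rw [Set.indicator_of_notMem hv]
      exact Set.indicator_nonneg (fun u _ => pow_nonneg (h.nonneg u) k) u
  refine (integral_mul_integral_le_of_monovary (h.bdd_indicator j x) (h.bdd_indicator k y)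
    fun u v => ?_).trans (le_of_eq ?_)
  · rcases le_total u v with huv | huv
    · exact mul_nonneg (sub_nonneg.2 (anti j x huv)) (sub_nonneg.2 (anti k y huv))
    · exact mul_nonneg_of_nonpos_of_nonpos (sub_nonpos.2 (anti j x huv))
        (sub_nonpos.2 (anti k y huv))
  · unfold tailInt
    congr 1; ext u
    simp only [Set.indicator_apply, Set.mem_Iio, lt_min_iff]
    by_cases h1 : u < x <;> by_cases h2 : u < y <;> simp [h1, h2, pow_add]

theorem tailInt_succ_le (h : IsTail ψ) {m : ℝ} (hm : ∀ u, ψ u ≤ m) (k : ℕ) (x : ℝ) :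
    tailInt ψ (k + 1) x ≤ m * tailInt ψ k x := by
  unfold tailInt
  rw [← integral_const_mul]
  refine integral_mono ((h.bdd_indicator _ x).integrable _)
    (((h.bdd_indicator k x).const_mul m).integrable _) fun u => ?_
  by_cases hu : u ∈ Set.Iio x
  · simp only [Set.indicator_of_mem hu]
    rw [pow_succ, mul_comm]
    exact mul_le_mul_of_nonneg_right (hm u) (pow_nonneg (h.nonneg u) k)
  · simp only [Set.indicator_of_notMem hu, mul_zero, le_refl]

theorem tailInt_zero_le (h : IsTail ψ) (x : ℝ) : tailInt ψ 0 x ≤ 1 := by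
  have : ∫ _, (1 : ℝ) ∂unitMeasure = 1 := by simp
  rw [← this]
  refine integral_mono ((h.bdd_indicator _ x).integrable _) (integrable_const _) fun u => ?_
  by_cases hu : u ∈ Set.Iio x
  · simp [Set.indicator_of_mem hu]
  · simp [Set.indicator_of_notMem hu]

theorem tailInt_le_pow (h : IsTail ψ) {m : ℝ} (hm : ∀ u, ψ u ≤ m) (k : ℕ) (x : ℝ) :
    tailInt ψ k x ≤ m ^ k := by
  have hm0 : 0 ≤ m := (h.nonneg 0).trans (hm 0)
  induction k with
  | zero => simpa using h.tailInt_zero_le x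
  | succ k ih =>
    refine (h.tailInt_succ_le hm k x).trans ?_
    rw [pow_succ']
    gcongr

theorem sumInt_nonneg (h : IsTail ψ) (k : ℕ) (a : ℕ → ℝ) (q : ℕ) : 0 ≤ sumInt ψ k a q :=
  Finset.sum_nonneg fun _ _ => h.tailInt_nonneg _ _

theorem dblInt_nonneg (h : IsTail ψ) (k : ℕ) (a : ℕ → ℝ) (q : ℕ) : 0 ≤ dblInt ψ k a q :=
  Finset.sum_nonneg fun _ _ => Finset.sum_nonneg fun _ _ => h.tailInt_nonneg _ _

theorem farInt_nonneg (h : IsTail ψ) (k : ℕ) (a : ℕ → ℝ) (q n : ℕ) : 0 ≤ farInt ψ k a q n :=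
  Finset.sum_nonneg fun _ _ => h.tailInt_nonneg _ _

theorem sumInt_mul_sumInt_le (h : IsTail ψ) (ha : Antitone a) (j k q : ℕ) :
    sumInt ψ j a q * sumInt ψ k a q ≤ dblInt ψ (j + k) a q := by
  unfold sumInt dblInt
  rw [Finset.sum_mul_sum]
  refine Finset.sum_le_sum fun i _ => Finset.sum_le_sum fun l _ => ?_
  rw [ha.map_max]
  exact h.tailInt_mul_tailInt_le j k _ _

theorem dblInt_succ_le (h : IsTail ψ) {m : ℝ} (hm : ∀ u, ψ u ≤ m) (k q : ℕ) :
    dblInt ψ (k + 1) a q ≤ m * dblInt ψ k a q := by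
  unfold dblInt
  simp only [Finset.mul_sum]
  exact Finset.sum_le_sum fun i _ => Finset.sum_le_sum fun l _ => h.tailInt_succ_le hm k _

theorem sumInt_le_pow (h : IsTail ψ) {m : ℝ} (hm : ∀ u, ψ u ≤ m) (k q : ℕ) :
    sumInt ψ k a q ≤ q * m ^ k := by
  refine (Finset.sum_le_card_nsmul _ _ _ fun i _ => h.tailInt_le_pow hm k (a i)).trans ?_
  simp

theorem sumInt_le_dblInt (h : IsTail ψ) (k : ℕ) {q : ℕ} (hq : 1 ≤ q) :
    sumInt ψ k a q ≤ dblInt ψ k a q := by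
  refine Finset.sum_le_sum fun i _ => ?_
  have := Finset.single_le_sum (f := fun l => tailInt ψ k (a (max i l)))
    (fun l _ => h.tailInt_nonneg _ _) (Finset.mem_range.2 (by omega : 0 < q))
  simpa using this

theorem tailInt_le_sumInt (h : IsTail ψ) (k : ℕ) {i q : ℕ} (hq : i < q) :
    tailInt ψ k (a i) ≤ sumInt ψ k a q :=
  Finset.single_le_sum (f := fun l => tailInt ψ k (a l))
    (fun _ _ => h.tailInt_nonneg _ _) (Finset.mem_range.2 hq)

theorem mul_tailInt_le_farInt (h : IsTail ψ) (k : ℕ) {q n : ℕ} (hqn : q ≤ n) :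
    q * tailInt ψ k (a q) ≤ farInt ψ k a q n := by
  calc (q : ℝ) * tailInt ψ k (a q) = ∑ l ∈ Finset.range q, tailInt ψ k (a (max q l)) := by
        rw [Finset.sum_congr rfl fun _ hl => by
          rw [max_eq_left (Finset.mem_range.1 hl).le]]
        simp
    _ ≤ _ := Finset.sum_le_sum_of_subset_of_nonneg (Finset.range_mono hqn)
        fun _ _ _ => h.tailInt_nonneg _ _

theorem sum_Ico_tailInt_le_farInt (h : IsTail ψ) (k q n : ℕ) :
    ∑ l ∈ Finset.Ico q n, tailInt ψ k (a l) ≤ farInt ψ k a q n := by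
  calc _ = ∑ l ∈ Finset.Ico q n, tailInt ψ k (a (max q l)) :=
        Finset.sum_congr rfl fun _ hl => by rw [max_eq_right (Finset.mem_Ico.1 hl).1]
    _ ≤ _ := Finset.sum_le_sum_of_subset_of_nonneg
        (fun _ hl => Finset.mem_range.2 (Finset.mem_Ico.1 hl).2) fun _ _ _ => h.tailInt_nonneg _ _

theorem sum_range_succ_tailInt_le (h : IsTail ψ) (ha : Antitone a) (k q : ℕ) :
    ∑ l ∈ Finset.range q, tailInt ψ k (a (l + 1)) ≤ sumInt ψ k a q :=
  Finset.sum_le_sum fun l _ => h.tailInt_mono k (ha (Nat.le_succ l))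

theorem sumInt_le_add (h : IsTail ψ) (k : ℕ) {q n : ℕ} (hqn : q ≤ n) :
    sumInt ψ k a n ≤ sumInt ψ k a q + farInt ψ k a q n := by
  unfold sumInt
  rw [← Finset.sum_range_add_sum_Ico _ hqn]
  exact add_le_add_right (h.sum_Ico_tailInt_le_farInt k q n) _

end IsTail

/-- The dimensionless error of one step. -/
noncomputable def unitError (ψ : ℝ → ℝ) (a : ℕ → ℝ) (lam : ℝ) (q n : ℕ) : ℝ :=
  dblInt ψ 3 a q / lam ^ 3 + farInt ψ 2 a q n / lam ^ 2 + tailInt ψ 1 (a q) / lam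

/-- Here s₁, s₂ are scaled single sums of orders 1 and 2, a₃ the scaled double sum of order 3, a₂
and a₁ the far terms, and r = M/lam. The smallness q r ≤ 1 compensates the factor q + 1 coming from
the window of quadratic forms, and a₂ ≤ 1 makes the far terms subquadratic. -/
theorem error_arith {s₁ s₂ a₁ a₂ a₃ r q g : ℝ} (hs₂ : 0 ≤ s₂) (ha₁ : 0 ≤ a₁)
    (ha₂ : 0 ≤ a₂) (ha₃ : 0 ≤ a₃) (hr : 0 ≤ r) (hq : 1 ≤ q) (hg : 0 ≤ g) (h1 : s₁ * s₂ ≤ a₃)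
    (h2 : s₂ ^ 2 ≤ 2 * r * a₃) (h3 : s₁ ≤ 2 * (q * r)) (h4 : s₂ ≤ 4 * (q * r) * r)
    (h5 : q * r ≤ 1) (h6 : a₂ ≤ 1) :
    204 * a₃ + (g + 1) * (612 * (s₂ + a₂)) ^ 2 + 204 * a₃ + 102 * a₁ +
      612 * (s₂ + a₂) * (102 * s₁) + 408 * a₃ + 408 * a₂ +
      612 * (s₂ + a₂) * ((q + 1) * (204 * s₂)) + 204 * a₂ ≤
      3000000 * (g + 1) * (a₃ + a₂ + a₁) := by
  have hr1 : r ≤ 1 := by nlinarith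
  have e1 : s₂ ^ 2 ≤ 2 * a₃ := by nlinarith
  have e2 : a₂ ^ 2 ≤ a₂ := by nlinarith
  have e3 : (s₂ + a₂) ^ 2 ≤ 4 * a₃ + 2 * a₂ := by nlinarith [sq_nonneg (s₂ - a₂)]
  have e4 : a₂ * s₁ ≤ 2 * a₂ := by nlinarith
  have e5 : q * s₂ ^ 2 ≤ 2 * a₃ := by
    nlinarith [mul_le_mul_of_nonneg_left h2 (by linarith : 0 ≤ q),
      mul_le_mul_of_nonneg_right h5 ha₃]
  have e6 : q * s₂ ≤ 4 := by
    have hqr : 0 ≤ q * r := by positivity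
    nlinarith [mul_le_mul_of_nonneg_left h4 (by linarith : 0 ≤ q), mul_le_mul h5 h5 hqr zero_le_one]
  have e7 : q * s₂ * a₂ ≤ 4 * a₂ := mul_le_mul_of_nonneg_right e6 ha₂
  have e8 : s₂ ^ 2 + s₂ * a₂ ≤ q * s₂ ^ 2 + q * s₂ * a₂ := by
    nlinarith [mul_nonneg (sub_nonneg.2 hq) (sq_nonneg s₂),
      mul_nonneg (sub_nonneg.2 hq) (mul_nonneg hs₂ ha₂)]
  have e9 : (s₂ + a₂) * ((q + 1) * s₂) ≤ 4 * a₃ + 8 * a₂ := by nlinarith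
  have e10 := mul_le_mul_of_nonneg_left e3 (by linarith : 0 ≤ g + 1)
  nlinarith [mul_nonneg hg ha₁, mul_nonneg hg ha₂, mul_nonneg hg ha₃]

theorem stepError_le (hψ : IsTail ψ) (ha : Antitone a) {M lam : ℝ} (hM : ∀ u, ψ u ≤ 2 * M)
    (hlam : 0 < lam) {q n : ℕ} (hq : 1 ≤ q) (hqn : q ≤ n) (hqM : q * M ≤ lam)
    (hfar : farInt ψ 2 a q n ≤ lam ^ 2) {κ₁ κ₂ κ₃ : ℕ → ℝ}
    (h₁ : κ₁ = fun i => 102 * tailInt ψ 1 (a i) / lam)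
    (h₂ : κ₂ = fun i => 204 * tailInt ψ 2 (a i) / lam ^ 2)
    (h₃ : κ₃ = fun i => 204 * tailInt ψ 3 (a i) / lam ^ 3) {D : ℝ}
    (hD : D = 612 * (sumInt ψ 2 a q / lam ^ 2 + farInt ψ 2 a q n / lam ^ 2)) :
    κ₂ 0 + 2 * ∑ l ∈ Finset.range n, κ₂ (l + 1) ≤ D ∧
      stepError κ₁ κ₂ κ₃ n q D ≤ 3000000 * (gaussFourth + 1) * unitError ψ a lam q n := by
  have hM0 : 0 ≤ M := by linarith [hψ.nonneg 0, hM 0]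
  have n1 := hψ.sumInt_nonneg 1 a q
  have n2 := hψ.sumInt_nonneg 2 a q
  have n3 := hψ.dblInt_nonneg 3 a q
  have n4 := hψ.farInt_nonneg 2 a q n
  have n5 := hψ.tailInt_nonneg 1 (a q)
  have s3 := (hψ.tailInt_le_sumInt (a := a) 3 (by omega : 0 < q))
  have s3' := hψ.sumInt_le_dblInt (a := a) 3 hq
  have sum₁ : ∑ i ∈ Finset.range q, κ₁ (i + 1) ≤ 102 * (sumInt ψ 1 a q / lam) := by
    rw [h₁, ← Finset.sum_div, ← Finset.mul_sum, mul_div_assoc]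
    have := hψ.sum_range_succ_tailInt_le ha 1 q
    gcongr
  have sum₂ : ∀ q, ∑ i ∈ Finset.range q, κ₂ (i + 1) ≤ 204 * (sumInt ψ 2 a q / lam ^ 2) := by
    intro q
    rw [h₂, ← Finset.sum_div, ← Finset.mul_sum, mul_div_assoc]
    have := hψ.sum_range_succ_tailInt_le ha 2 q
    gcongr
  have sum₃ : ∑ i ∈ Finset.range q, κ₃ (i + 1) ≤ 204 * (dblInt ψ 3 a q / lam ^ 3) := by
    rw [h₃, ← Finset.sum_div, ← Finset.mul_sum, mul_div_assoc]
    have := (hψ.sum_range_succ_tailInt_le ha 3 q).trans s3'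
    gcongr
  have dbl₃ : ∑ i ∈ Finset.range q, ∑ l ∈ Finset.range q, κ₃ (max (i + 1) (l + 1)) ≤
      204 * (dblInt ψ 3 a q / lam ^ 3) := by
    rw [h₃]
    simp only [← Finset.sum_div, ← Finset.mul_sum]
    rw [mul_div_assoc]
    have : ∑ i ∈ Finset.range q, ∑ l ∈ Finset.range q, tailInt ψ 3 (a (max (i + 1) (l + 1))) ≤
        dblInt ψ 3 a q := Finset.sum_le_sum fun i _ => Finset.sum_le_sum fun l _ =>
      hψ.tailInt_mono 3 (ha (max_le_max (Nat.le_succ i) (Nat.le_succ l)))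
    gcongr
  have far₂ : ∑ l ∈ Finset.Ico q n, κ₂ (l + 1) ≤ 204 * (farInt ψ 2 a q n / lam ^ 2) := by
    rw [h₂, ← Finset.sum_div, ← Finset.mul_sum, mul_div_assoc]
    have : ∑ l ∈ Finset.Ico q n, tailInt ψ 2 (a (l + 1)) ≤ farInt ψ 2 a q n :=
      (Finset.sum_le_sum fun l _ => hψ.tailInt_mono 2 (ha (Nat.le_succ l))).trans
        (hψ.sum_Ico_tailInt_le_farInt 2 q n)
    gcongr
  have last₂ : (q + 1) * κ₂ (q + 1) ≤ 408 * (farInt ψ 2 a q n / lam ^ 2) := by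
    rw [h₂]
    have h := hψ.mul_tailInt_le_farInt (a := a) 2 hqn
    have h' := hψ.tailInt_mono 2 (ha (Nat.le_succ q))
    have h0 := hψ.tailInt_nonneg 2 (a q)
    have hq' : (1 : ℝ) ≤ q := by exact_mod_cast hq
    have : (q + 1) * tailInt ψ 2 (a (q + 1)) ≤ 2 * farInt ψ 2 a q n :=
      (mul_le_mul_of_nonneg_left h' (by positivity)).trans (by nlinarith)
    calc _ = 204 * ((q + 1) * tailInt ψ 2 (a (q + 1))) / lam ^ 2 := by ring
      _ ≤ 204 * (2 * farInt ψ 2 a q n) / lam ^ 2 := by gcongr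
      _ = _ := by ring
  have last₁ : κ₁ (q + 1) ≤ 102 * (tailInt ψ 1 (a q) / lam) := by
    rw [h₁]
    simp only [mul_div_assoc]
    have := hψ.tailInt_mono 1 (ha (Nat.le_succ q))
    gcongr
  have first₃ : κ₃ 0 ≤ 204 * (dblInt ψ 3 a q / lam ^ 3) := by
    rw [h₃]
    simp only [mul_div_assoc]
    have := s3.trans s3'
    gcongr
  have hD0 : 0 ≤ D := by rw [hD]; positivity
  constructor
  -- The constant 612 is 3 · 204: one share for lag zero and two for the doubled sum over positive
  -- lags.
  · have t1 := hψ.tailInt_le_sumInt (a := a) 2 (by omega : 0 < n)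
    have t2 := sum₂ n
    have t3 : κ₂ 0 ≤ 204 * (sumInt ψ 2 a n / lam ^ 2) := by
      rw [h₂]; simp only [mul_div_assoc]; gcongr
    have t4 : sumInt ψ 2 a n / lam ^ 2 ≤ sumInt ψ 2 a q / lam ^ 2 + farInt ψ 2 a q n / lam ^ 2 := by
      rw [← add_div]
      have := hψ.sumInt_le_add (a := a) 2 hqn
      gcongr
    rw [hD]
    linarith
  · unfold stepError unitError
    have hE := error_arith (s₁ := sumInt ψ 1 a q / lam) (s₂ := sumInt ψ 2 a q / lam ^ 2)
      (a₁ := tailInt ψ 1 (a q) / lam) (a₂ := farInt ψ 2 a q n / lam ^ 2)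
      (a₃ := dblInt ψ 3 a q / lam ^ 3) (r := M / lam) (q := q) (g := gaussFourth)
      (by positivity) (by positivity) (by positivity) (by positivity) (by positivity)
      (by exact_mod_cast hq) gaussFourth_nonneg ?_ ?_ ?_ ?_ ?_ ?_
    · rw [← hD] at hE
      rw [Finset.sum_add_distrib, ← Finset.mul_sum]
      have hd1 := mul_le_mul_of_nonneg_left sum₁ hD0
      have hd2 := mul_le_mul_of_nonneg_left (mul_le_mul_of_nonneg_left (sum₂ q)
        (by positivity : (0 : ℝ) ≤ q + 1)) hD0
      linarith
    · rw [div_mul_div_comm, ← pow_succ']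
      have := hψ.sumInt_mul_sumInt_le ha 1 2 q
      norm_num at this ⊢
      gcongr
    · have h1 := hψ.sumInt_mul_sumInt_le ha 2 2 q
      have h2 := hψ.dblInt_succ_le (a := a) hM 3 q
      have h3 : sumInt ψ 2 a q ^ 2 ≤ 2 * M * dblInt ψ 3 a q := by rw [pow_two]; exact h1.trans h2
      rw [div_pow, div_le_iff₀ (by positivity)]
      refine h3.trans (le_of_eq ?_)
      field_simp
    · have := hψ.sumInt_le_pow (a := a) hM 1 q
      rw [div_le_iff₀ hlam]
      refine this.trans (le_of_eq ?_)
      field_simp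
    · have := hψ.sumInt_le_pow (a := a) hM 2 q
      rw [div_le_iff₀ (by positivity)]
      refine this.trans (le_of_eq ?_)
      field_simp
      ring
    · rw [mul_div_assoc', div_le_one hlam]; exact hqM
    · rwa [div_le_one (by positivity)]

end Numeric

/-- Fewer than q variables, each of size at most 2M/lam with qM ≤ lam, cannot sum to 2. -/
theorem IsHull.real_exists_two_le_eq_zero {ν : Measure (ℤ → ℝ)} [IsProbabilityMeasure ν]
    {μ : Measure ℝ} [IsProbabilityMeasure μ] {a : ℕ → ℝ} {ψ h : ℝ → ℝ} (hh : IsHull μ ψ h)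
    (hm : PathMixing ν μ a) (hψ : IsTail ψ) {M lam : ℝ} (hM : ∀ x, |h x| ≤ M) (hlam : 0 < lam)
    {q n : ℕ} (hqM : q * M ≤ lam) (hnq : n < q) :
    ν.real {ω | ∃ k ≤ n, 2 ≤ |sumTo (scaledVar μ h lam n) k ω|} = 0 := by
  have hM0 : 0 ≤ M := (abs_nonneg _).trans (hM 0)
  have hw := hh.weakDep hm hψ hM hlam n
  have : {ω | ∃ k ≤ n, 2 ≤ |sumTo (scaledVar μ h lam n) k ω|} = ∅ := by
    ext ω
    simp only [Set.mem_ofPred_eq, Set.mem_empty_iff_false, iff_false, not_exists, not_and, not_le]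
    intro k hk
    have h1 : |sumTo (scaledVar μ h lam n) k ω| ≤ k * (2 * M / lam) := by
      refine (Finset.abs_sum_le_sum_abs _ _).trans ((Finset.sum_le_card_nsmul _ _ _
        fun i _ => hw.bound _ ω).trans ?_)
      simp
    have hk' : (k : ℝ) + 1 ≤ q := by exact_mod_cast (by omega : k + 1 ≤ q)
    have h2 : k * (2 * M / lam) < 2 := by
      rw [mul_div_assoc', div_lt_iff₀ hlam]
      rcases hM0.eq_or_lt with h0 | h0
      · rw [← h0]; simpa using hlam
      · nlinarith
    exact h1.trans_lt h2
  rw [this, measureReal_empty]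

/-- The maximal inequality for the truncated process. -/
theorem IsHull.real_exists_two_le {ν : Measure (ℤ → ℝ)} [IsProbabilityMeasure ν] {μ : Measure ℝ}
    [IsProbabilityMeasure μ] {a : ℕ → ℝ} {ψ h : ℝ → ℝ} (hh : IsHull μ ψ h) (hm : PathMixing ν μ a)
    (hψ : IsTail ψ) {F : ℕ → ℝ → ℝ} {K : ℝ} (hF : IsSmoothCutoff F K) {M η lam : ℝ}
    (hM : ∀ x, |h x| ≤ M) (hψM : ∀ u, ψ u ≤ 2 * M) (hη1 : η ≤ 1)
    (hηK : K * (2 * η) + K * (3 * (2 * η) ^ 2) ≤ 1 / 4) (hlam : 0 < lam) {q n : ℕ} (hq : 1 ≤ q) (hqn : q ≤ n)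
    (hqM : q * M ≤ η * lam) {V : ℝ} (hV : 0 < V)
    (hvar : ∫ ω, sumTo (scaledVar μ h lam n) n ω ^ 2 ∂ν ≤ V) :
    ν.real {ω | ∃ k ≤ n, 2 ≤ |sumTo (scaledVar μ h lam n) k ω|} ≤ 8 * Real.exp (-(1 / (2 * V))) +
      12000000 * (K + 1) * (gaussFourth + 1) * (n * unitError ψ a lam q n) := by
  have hK := hF.pos
  have hg := gaussFourth_nonneg
  have hM0 : 0 ≤ M := (abs_nonneg _).trans (hM 0)
  have hw := hh.weakDep hm hψ hM hlam n
  have hE : 0 ≤ unitError ψ a lam q n := by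
    have := hψ.dblInt_nonneg 3 a q
    have := hψ.farInt_nonneg 2 a q n
    have := hψ.tailInt_nonneg 1 (a q)
    unfold unitError; positivity
  have hexp : 0 ≤ 8 * Real.exp (-(1 / (2 * V))) := by positivity
  have hq' : (1 : ℝ) ≤ q := by exact_mod_cast hq
  -- If the far covariances exceed lam², the error term is at least 1 and the bound is trivial;
  -- otherwise the normalization a₂ ≤ 1 required by the arithmetic holds.
  rcases lt_or_ge (lam ^ 2) (farInt ψ 2 a q n) with hbig | hfar
  · refine measureReal_le_one.trans ?_
    have h1 : 1 ≤ unitError ψ a lam q n := by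
      have := hψ.dblInt_nonneg 3 a q
      have := hψ.tailInt_nonneg 1 (a q)
      have h2 : 1 ≤ farInt ψ 2 a q n / lam ^ 2 := (one_le_div (by positivity)).2 hbig.le
      have h3 : 0 ≤ dblInt ψ 3 a q / lam ^ 3 := by positivity
      have h4 : 0 ≤ tailInt ψ 1 (a q) / lam := by positivity
      unfold unitError; linarith
    have h2 : (1 : ℝ) ≤ n := by exact_mod_cast hq.trans hqn
    have h3 : 1 ≤ n * unitError ψ a lam q n := one_le_mul_of_one_le_of_one_le h2 h1
    have h4 : 1 ≤ 12000000 * (K + 1) * (gaussFourth + 1) := by nlinarith [mul_nonneg hK.le hg]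
    have h5 := one_le_mul_of_one_le_of_one_le h4 h3
    linarith
  obtain ⟨hD, hS⟩ := stepError_le hψ hm.anti hψM hlam hq hqn
    (hqM.trans (mul_le_of_le_one_left hlam.le hη1)) hfar rfl rfl rfl rfl
  have hC : q * (2 * M / lam) ≤ 2 * η := by
    rw [mul_div_assoc', div_le_iff₀ hlam]; linarith
  have hC0 : 0 ≤ q * (2 * M / lam) := by positivity
  have hsmall : K * (q * (2 * M / lam)) + K * (3 * (q * (2 * M / lam)) ^ 2) ≤ 1 / 4 :=
    le_trans (by gcongr) hηK
  refine (hw.real_exists_two_le hF hq hqn (fun j hj ω => by rw [scaledVar_of_lt _ _ _ hj]) hD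
    hsmall hV hvar).trans ?_
  have h1 := mul_le_mul_of_nonneg_left hS (by positivity : 0 ≤ 4 * n * K)
  have h2 : 0 ≤ n * unitError ψ a lam q n := by positivity
  have h3 : 0 ≤ (gaussFourth + 1) * (n * unitError ψ a lam q n) := by positivity
  linarith

/-! ### The variance of the truncated sum and the resulting exponential term. -/

/-- `c_0 + 2 ∑_{1 ≤ l ≤ k} c_l`. -/
def covSeries (c : ℕ → ℝ) (k : ℕ) : ℝ := c 0 + 2 * ∑ l ∈ Finset.range k, c (l + 1)

/-- Adding the variable of index k to the k preceding ones increases the second moment by c_0 +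
2(c_1 + ... + c_k). -/
theorem integral_sum_sq {Ω : Type*} [MeasurableSpace Ω] {P : Measure Ω} {X : ℕ → Ω → ℝ}
    (hint : ∀ i j, Integrable (fun ω => X i ω * X j ω) P) {c : ℕ → ℝ}
    (hc : ∀ j l, ∫ ω, X j ω * X (j + l) ω ∂P = c l) (n : ℕ) :
    ∫ ω, (∑ j ∈ Finset.range n, X j ω) ^ 2 ∂P = ∑ k ∈ Finset.range n, covSeries c k := by
  have hsq : ∀ n, Integrable (fun ω => (∑ j ∈ Finset.range n, X j ω) ^ 2) P := fun n => by
    simp only [pow_two, Finset.sum_mul_sum]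
    exact integrable_finsetSum _ fun i _ => integrable_finsetSum _ fun j _ => hint i j
  induction n with
  | zero => simp
  | succ n ih =>
    have e : ∀ ω, (∑ j ∈ Finset.range (n + 1), X j ω) ^ 2 = (∑ j ∈ Finset.range n, X j ω) ^ 2 +
        (X n ω * X (n + 0) ω + 2 * ∑ j ∈ Finset.range n, X j ω * X n ω) := fun ω => by
      rw [Finset.sum_range_succ, ← Finset.sum_mul]; simp only [add_zero]; ring
    have i2 : Integrable (fun ω => ∑ j ∈ Finset.range n, X j ω * X n ω) P :=
      integrable_finsetSum _ fun j _ => hint j n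
    simp only [e]
    rw [integral_add (hsq n) ((hint _ _).fun_add (i2.const_mul 2)),
      integral_add (hint _ _) (i2.const_mul 2), ih, Finset.sum_range_succ, hc, integral_const_mul,
      integral_finsetSum _ fun j _ => hint j n]
    unfold covSeries
    congr 3
    rw [← Finset.sum_range_reflect]
    refine Finset.sum_congr rfl fun j hj => ?_
    have hj' := Finset.mem_range.1 hj
    have := hc (n - 1 - j) (j + 1)
    rwa [show n - 1 - j + (j + 1) = n by omega] at this

theorem abs_covSeries_sub_le (c : ℕ → ℝ) {k q : ℕ} (hkq : k ≤ q) :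
    |covSeries c q - covSeries c k| ≤ 2 * ∑ l ∈ Finset.Ico k q, |c (l + 1)| := by
  have : covSeries c q - covSeries c k = 2 * ∑ l ∈ Finset.Ico k q, c (l + 1) := by
    unfold covSeries
    rw [← Finset.sum_range_add_sum_Ico _ hkq]; ring
  rw [this, abs_mul, abs_two]
  gcongr
  exact Finset.abs_sum_le_sum_abs _ _

section Variance

variable {ψ : ℝ → ℝ} {a c : ℕ → ℝ}

/-- Each partial series is compared with the one at q, then with s. For k < q the missing lags,
summed over k, form a double sum; for k ≥ q the surplus lags are far terms. -/
theorem sum_covSeries_le (hψ : IsTail ψ) (ha : Antitone a) {B : ℝ} (hB : 0 ≤ B)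
    (hc : ∀ l, |c l| ≤ B * tailInt ψ 2 (a l)) {q n : ℕ} {s τ : ℝ}
    (hs : |covSeries c q - s| ≤ τ) :
    ∑ k ∈ Finset.range n, covSeries c k ≤
      n * s + n * τ + 2 * B * (dblInt ψ 2 a q + n * farInt ψ 2 a q n) := by
  have hc' : ∀ l, |c (l + 1)| ≤ B * tailInt ψ 2 (a l) := fun l => (hc _).trans (by
    have := hψ.tailInt_mono 2 (ha (Nat.le_succ l))
    gcongr)
  let g : ℕ → ℝ := fun k => ∑ l ∈ Finset.range q, tailInt ψ 2 (a (max k l))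
  have hg : ∀ k, 0 ≤ g k := fun k => Finset.sum_nonneg fun _ _ => hψ.tailInt_nonneg _ _
  have hstep : ∀ k ∈ Finset.range n, covSeries c k ≤
      s + τ + 2 * B * ((if k < q then g k else 0) + farInt ψ 2 a q n) := by
    intro k hk
    have hk' := Finset.mem_range.1 hk
    have hfar := hψ.farInt_nonneg 2 a q n
    have hs' := (abs_le.1 hs).2
    rcases lt_or_ge k q with hkq | hkq
    · rw [if_pos hkq]
      have h1 := (abs_le.1 (abs_covSeries_sub_le c hkq.le)).1
      have h2 : ∑ l ∈ Finset.Ico k q, |c (l + 1)| ≤ B * g k := by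
        refine (Finset.sum_le_sum fun l _ => hc' l).trans ?_
        rw [← Finset.mul_sum]
        refine mul_le_mul_of_nonneg_left ?_ hB
        calc _ = ∑ l ∈ Finset.Ico k q, tailInt ψ 2 (a (max k l)) :=
              Finset.sum_congr rfl fun _ hl => by rw [max_eq_right (Finset.mem_Ico.1 hl).1]
          _ ≤ _ := Finset.sum_le_sum_of_subset_of_nonneg
              (fun _ hl => Finset.mem_range.2 (Finset.mem_Ico.1 hl).2)
              fun _ _ _ => hψ.tailInt_nonneg _ _
      have := mul_nonneg hB hfar
      linarith
    · rw [if_neg (not_lt.2 hkq), zero_add]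
      have h1 := (abs_le.1 (abs_covSeries_sub_le c hkq)).2
      have h2 : ∑ l ∈ Finset.Ico q k, |c (l + 1)| ≤ B * farInt ψ 2 a q n := by
        refine (Finset.sum_le_sum fun l _ => hc' l).trans ?_
        rw [← Finset.mul_sum]
        refine mul_le_mul_of_nonneg_left ?_ hB
        exact (Finset.sum_le_sum_of_subset_of_nonneg (Finset.Ico_subset_Ico_right hk'.le)
          fun _ _ _ => hψ.tailInt_nonneg _ _).trans (hψ.sum_Ico_tailInt_le_farInt 2 q n)
      linarith
  have hd : ∑ k ∈ Finset.range n, (if k < q then g k else 0) ≤ dblInt ψ 2 a q := by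
    rw [← Finset.sum_filter]
    exact Finset.sum_le_sum_of_subset_of_nonneg
      (fun k hk => Finset.mem_range.2 (Finset.mem_filter.1 hk).2) fun k _ _ => hg k
  refine (Finset.sum_le_sum hstep).trans ?_
  simp only [Finset.sum_add_distrib, ← Finset.mul_sum, Finset.sum_const, Finset.card_range,
    nsmul_eq_mul]
  have := mul_le_mul_of_nonneg_left hd (by positivity : 0 ≤ 2 * B)
  linarith

theorem dblInt_eq_integral (hψ : IsTail ψ) (ha : Antitone a) (k q : ℕ) :
    dblInt ψ k a q =
      ∫ u, ψ u ^ k * (∑ i ∈ Finset.range q, (Set.Iio (a i)).indicator 1 u) ^ 2 ∂unitMeasure := by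
  unfold dblInt tailInt
  simp only [← integral_finsetSum _ fun l _ => (hψ.bdd_indicator k _).integrable unitMeasure]
  rw [← integral_finsetSum _ fun i _ =>
    (BddMeas.sum fun l _ => hψ.bdd_indicator k _).integrable unitMeasure]
  congr 1; ext u
  rw [pow_two, Finset.sum_mul_sum, Finset.mul_sum]
  refine Finset.sum_congr rfl fun i _ => ?_
  rw [Finset.mul_sum]
  refine Finset.sum_congr rfl fun l _ => ?_
  rw [ha.map_max]
  simp only [Set.indicator_apply, Set.mem_Iio, lt_min_iff]
  by_cases h1 : u < a i <;> by_cases h2 : u < a l <;> simp [h1, h2]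

/-- With b(u) the number of i < q such that u < a_i, the integrand is (ψb)². Either ψb ≤ T, or T ≤
qψ and one more factor of ψ can be bought at the price q/T. -/
theorem dblInt_two_le (hψ : IsTail ψ) (ha : Antitone a) (q : ℕ) {T : ℝ} (hT : 0 < T) :
    dblInt ψ 2 a q ≤ T ^ 2 + q / T * dblInt ψ 3 a q := by
  let b : ℝ → ℝ := fun u => ∑ i ∈ Finset.range q, (Set.Iio (a i)).indicator 1 u
  have hb : BddMeas b := BddMeas.sum fun i _ => BddMeas.indicator measurableSet_Iio
  have hb0 : ∀ u, 0 ≤ b u := fun u => Finset.sum_nonneg fun i _ =>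
    Set.indicator_nonneg (fun _ _ => zero_le_one) _
  have hbq : ∀ u, b u ≤ q := fun u => by
    refine (Finset.sum_le_card_nsmul _ _ 1 fun i _ => ?_).trans (by simp)
    exact Set.indicator_le_self' (fun _ _ => zero_le_one) u
  have bk : ∀ k, BddMeas fun u => ψ u ^ k * b u ^ 2 := fun k => (hψ.bddMeas.pow k).mul (hb.pow 2)
  rw [dblInt_eq_integral hψ ha, dblInt_eq_integral hψ ha, ← integral_const_mul]
  have e : T ^ 2 = ∫ _, T ^ 2 ∂unitMeasure := by simp
  rw [e, ← integral_add (integrable_const _) (((bk 3).const_mul _).integrable _)]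
  refine integral_mono ((bk 2).integrable _)
    (((BddMeas.const _).add ((bk 3).const_mul _)).integrable _) fun u => ?_
  change ψ u ^ 2 * b u ^ 2 ≤ T ^ 2 + q / T * (ψ u ^ 3 * b u ^ 2)
  have h0 := hψ.nonneg u
  rcases le_total (ψ u * b u) T with h | h
  · have h1 : (ψ u * b u) ^ 2 ≤ T ^ 2 := pow_le_pow_left₀ (mul_nonneg h0 (hb0 u)) h 2
    have h2 : 0 ≤ q / T * (ψ u ^ 3 * b u ^ 2) := by positivity
    nlinarith
  · have h1 : T * (ψ u ^ 2 * b u ^ 2) ≤ q * (ψ u ^ 3 * b u ^ 2) := by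
      have h3 : T ≤ q * ψ u := h.trans (by nlinarith [hbq u])
      calc T * (ψ u ^ 2 * b u ^ 2) ≤ q * ψ u * (ψ u ^ 2 * b u ^ 2) := by gcongr
        _ = _ := by ring
    have h2 : ψ u ^ 2 * b u ^ 2 ≤ q / T * (ψ u ^ 3 * b u ^ 2) := by
      rw [div_mul_eq_mul_div, le_div_iff₀ hT]; linarith
    have := sq_nonneg T
    linarith

end Variance

theorem exp_neg_one_div_le {w : ℝ} (hw : 0 < w) : Real.exp (-(1 / w)) ≤ 2 * w ^ 2 := by
  have h := Real.quadratic_le_exp_of_nonneg (by positivity : 0 ≤ 1 / w)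
  have h1 : 1 / (2 * w ^ 2) ≤ Real.exp (1 / w) := by
    have : (1 / w) ^ 2 / 2 = 1 / (2 * w ^ 2) := by field_simp
    have h2 : 0 ≤ 1 / w := by positivity
    linarith
  rw [Real.exp_neg]
  calc (Real.exp (1 / w))⁻¹ ≤ (1 / (2 * w ^ 2))⁻¹ := by gcongr
    _ = 2 * w ^ 2 := by simp

/-- The scaled variance is at most z + W s² with z = nσ²/lam² and s³ = x. Either z dominates and the
exponential has the announced form, or the exponential is bounded by a constant times s⁴ ≤ s³ = x.
-/
theorem IsHull.real_exists_two_le_of_variance {ν : Measure (ℤ → ℝ)} [IsProbabilityMeasure ν]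
    {μ : Measure ℝ} [IsProbabilityMeasure μ] {a : ℕ → ℝ} {ψ h : ℝ → ℝ} (hh : IsHull μ ψ h)
    (hm : PathMixing ν μ a) (hψ : IsTail ψ) {F : ℕ → ℝ → ℝ} {K : ℝ} (hF : IsSmoothCutoff F K)
    {M η lam : ℝ} (hM : ∀ x, |h x| ≤ M) (hψM : ∀ u, ψ u ≤ 2 * M) (hη1 : η ≤ 1)
    (hηK : K * (2 * η) + K * (3 * (2 * η) ^ 2) ≤ 1 / 4) (hlam : 0 < lam) {q n : ℕ} (hq : 1 ≤ q)
    (hqM : q * M ≤ η * lam) {c : ℕ → ℝ}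
    (hc : ∀ (k : ℤ) (l : ℕ), ∫ ω, pathVar μ h k ω * pathVar μ h (k + l) ω ∂ν = c l)
    {σ τ x C₁ : ℝ} (hσ : |covSeries c q - σ ^ 2| ≤ τ) (hx : 0 < x) (hC₁ : 0 ≤ C₁)
    (hxE : n * unitError ψ a lam q n ≤ C₁ * x) (hxτ : n * τ ≤ C₁ * x * lam ^ 2) :
    ν.real {ω | ∃ k ≤ n, 2 ≤ |sumTo (scaledVar μ h lam n) k ω|} ≤
      (if σ = 0 then 0 else 8 * Real.exp (-(lam ^ 2 / (4 * n * σ ^ 2)))) +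
      (12000000 * (K + 1) * (gaussFourth + 1) * C₁ + 256 * (409 * (1 + C₁)) ^ 2 + 1) * x := by
  have hK := hF.pos
  have hg := gaussFourth_nonneg
  have hif : 0 ≤ (if σ = 0 then 0 else 8 * Real.exp (-(lam ^ 2 / (4 * n * σ ^ 2)))) := by
    split_ifs <;> positivity
  have hlamη : q * M ≤ lam := hqM.trans (mul_le_of_le_one_left hlam.le hη1)
  rcases lt_or_ge n q with hnq | hqn
  · rw [hh.real_exists_two_le_eq_zero hm hψ hM hlam hlamη hnq]
    positivity
  -- For x > 1 the summand 1 · x on the right already exceeds 1; from here on x ≤ 1, so powers of s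
  -- are ordered.
  rcases lt_or_ge 1 x with hx1 | hx1
  · refine measureReal_le_one.trans ?_
    have : 0 ≤ (12000000 * (K + 1) * (gaussFourth + 1) * C₁ + 256 * (409 * (1 + C₁)) ^ 2) * x := by
      positivity
    linarith
  have hn : (1 : ℝ) ≤ n := by exact_mod_cast hq.trans hqn
  set s : ℝ := x ^ (1 / 3 : ℝ) with hs
  have hs0 : 0 < s := Real.rpow_pos_of_pos hx _
  have hs3 : s ^ 3 = x := by
    rw [hs, ← Real.rpow_natCast, ← Real.rpow_mul hx.le]; norm_num
  have hs1 : s ≤ 1 := Real.rpow_le_one hx.le hx1 (by norm_num)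
  set W : ℝ := 409 * (1 + C₁) with hW
  have hW0 : 0 < W := by positivity
  set z : ℝ := n * σ ^ 2 / lam ^ 2 with hz
  have hz0 : 0 ≤ z := by positivity
  have n1 := hψ.dblInt_nonneg 3 a q
  have n2 := hψ.farInt_nonneg 2 a q n
  have n3 := hψ.tailInt_nonneg 1 (a q)
  have hvar : ∫ ω, sumTo (scaledVar μ h lam n) n ω ^ 2 ∂ν ≤ z + W * s ^ 2 := by
    have e : ∫ ω, sumTo (scaledVar μ h lam n) n ω ^ 2 ∂ν =
        (∑ k ∈ Finset.range n, covSeries c k) / lam ^ 2 := by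
      rw [← integral_sum_sq (P := ν) (X := fun (j : ℕ) => pathVar μ h ((j : ℤ) + 1))
        (fun i j => ((hh.bdd_pathVar _).mul (hh.bdd_pathVar _)).integrable ν)
        (fun j l => by
          rw [← hc (j + 1) l]; congr 1; ext ω; push_cast; rw [add_right_comm]) n, ← integral_div]
      congr 1; ext ω
      rw [← div_pow, Finset.sum_div]
      congr 1
      refine Finset.sum_congr rfl fun j hj => ?_
      rw [scaledVar_of_le _ _ _ (by have := Finset.mem_range.1 hj; omega : j + 1 ≤ n)]
      push_cast; rfl
    have h1 := sum_covSeries_le (n := n) hψ hm.anti (by norm_num : (0 : ℝ) ≤ 102)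
      (fun l => by rw [← hc 0 l]; exact hh.abs_cov_le hm hψ 0 l) hσ
    -- With T = s lam both sides of the interpolation are of order s² lam², because q ≤ n and n
    -- times the cubic double sum is at most C₁ s³ lam³.
    have h2 := dblInt_two_le hψ hm.anti q (mul_pos hs0 hlam)
    have h3 : dblInt ψ 3 a q / lam ^ 3 * n ≤ C₁ * x := by
      refine le_trans ?_ hxE
      unfold unitError
      rw [mul_comm]
      have : 0 ≤ farInt ψ 2 a q n / lam ^ 2 + tailInt ψ 1 (a q) / lam := by positivity
      gcongr; linarith
    have h4 : n * farInt ψ 2 a q n ≤ C₁ * x * lam ^ 2 := by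
      rw [← div_le_iff₀ (by positivity), mul_div_assoc]
      refine le_trans ?_ hxE
      unfold unitError
      have h5 : 0 ≤ dblInt ψ 3 a q / lam ^ 3 := by positivity
      have h6 : 0 ≤ tailInt ψ 1 (a q) / lam := by positivity
      gcongr; linarith
    have h5 : q / (s * lam) * dblInt ψ 3 a q ≤ C₁ * s ^ 2 * lam ^ 2 := by
      have hqn' : (q : ℝ) ≤ n := by exact_mod_cast hqn
      have h6 : n * dblInt ψ 3 a q ≤ C₁ * s ^ 3 * lam ^ 3 := by
        rw [div_mul_eq_mul_div, div_le_iff₀ (by positivity)] at h3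
        rw [hs3]; linarith
      rw [div_mul_eq_mul_div, div_le_iff₀ (by positivity)]
      calc q * dblInt ψ 3 a q ≤ n * dblInt ψ 3 a q := by gcongr
        _ ≤ _ := h6
        _ = _ := by ring
    have h7 : x ≤ s ^ 2 := by rw [← hs3]; exact pow_le_pow_of_le_one hs0.le hs1 (by norm_num)
    have h8 : C₁ * x * lam ^ 2 ≤ C₁ * s ^ 2 * lam ^ 2 := by gcongr
    rw [e, div_le_iff₀ (by positivity), add_mul, hz, div_mul_cancel₀ _ (by positivity)]
    have h9 : 0 ≤ C₁ * s ^ 2 * lam ^ 2 := by positivity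
    have h10 : 0 ≤ s ^ 2 * lam ^ 2 := by positivity
    rw [hW]
    nlinarith
  have key : ∀ V : ℝ, 0 < V → z + W * s ^ 2 ≤ V →
      ν.real {ω | ∃ k ≤ n, 2 ≤ |sumTo (scaledVar μ h lam n) k ω|} ≤
      8 * Real.exp (-(1 / (2 * V))) + 12000000 * (K + 1) * (gaussFourth + 1) * C₁ * x := by
    intro V hV hVz
    refine (hh.real_exists_two_le hm hψ hF hM hψM hη1 hηK hlam hq hqn hqM hV
      (hvar.trans hVz)).trans ?_
    rw [mul_assoc _ C₁]
    gcongr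
  -- The variance bound V is taken as twice the larger term. In the second case 8 · 2 · (4Ws²)² =
  -- 256 W² s⁴.
  rcases le_or_gt (W * s ^ 2) z with hcase | hcase
  · have hzpos : 0 < z := lt_of_lt_of_le (by positivity) hcase
    have hσ0 : σ ≠ 0 := fun h0 => by rw [hz, h0] at hzpos; simp at hzpos
    have := key (2 * z) (by positivity) (by linarith)
    rw [if_neg hσ0]
    have e : 1 / (2 * (2 * z)) = lam ^ 2 / (4 * n * σ ^ 2) := by
      rw [hz]; field_simp; norm_num
    rw [e] at this
    have : 0 ≤ (256 * W ^ 2 + 1) * x := by positivity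
    linarith
  · have h1 := key (2 * (W * s ^ 2)) (by positivity) (by linarith)
    have h2 := exp_neg_one_div_le (by positivity : 0 < 2 * (2 * (W * s ^ 2)))
    have h3 : s ^ 4 ≤ x := by rw [← hs3]; exact pow_le_pow_of_le_one hs0.le hs1 (by norm_num)
    have h4 : W ^ 2 * s ^ 4 ≤ W ^ 2 * x := by gcongr
    linarith

/-! ### Quantile functions and truncated quantiles. -/

section Quantile

variable {Ω : Type*} [MeasurableSpace Ω]

/-- The infimum is attained: {X > t} is the increasing union of {X > t + 1/(n+1)}, so the tail
inequality passes to the limit from the right. -/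
theorem upperQuantile_le_iff (μ : Measure Ω) (X : Ω → ℝ) (u : ℝ) (t : ℝ≥0) :
    upperQuantile μ X u ≤ t ↔ μ {ω | (t : ℝ) < X ω} ≤ ENNReal.ofReal u := by
  refine ⟨fun h => ?_, fun h => iInf₂_le t h⟩
  have e : {ω | (t : ℝ) < X ω} = ⋃ n : ℕ, {ω | (t : ℝ) + 1 / (n + 1) < X ω} := by
    ext ω
    simp only [Set.mem_ofPred_eq, Set.mem_iUnion]
    constructor
    · intro hω
      obtain ⟨n, hn⟩ := exists_nat_one_div_lt (sub_pos.2 hω)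
      exact ⟨n, by linarith⟩
    · rintro ⟨n, hn⟩
      have : (0 : ℝ) < 1 / (n + 1) := by positivity
      linarith
  have hmono : Monotone fun n : ℕ => {ω | (t : ℝ) + 1 / (n + 1) < X ω} := by
    intro m n hmn ω hω
    simp only [Set.mem_ofPred_eq] at hω ⊢
    have : (1 : ℝ) / (n + 1) ≤ 1 / (m + 1) := by gcongr
    linarith
  rw [e, hmono.measure_iUnion]
  refine iSup_le fun n => ?_
  have hlt : upperQuantile μ X u < ((t + 1 / (n + 1) : ℝ≥0) : ℝ≥0∞) := by
    refine h.trans_lt ?_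
    exact_mod_cast lt_add_of_pos_right t (by positivity)
  unfold upperQuantile at hlt
  rw [iInf_lt_iff] at hlt
  obtain ⟨t', ht'⟩ := hlt
  rw [iInf_lt_iff] at ht'
  obtain ⟨h1, h2⟩ := ht'
  refine (measure_mono fun ω hω => ?_).trans h1
  simp only [Set.mem_ofPred_eq] at hω ⊢
  have h3 : (t' : ℝ) < t + 1 / (n + 1) := by
    have : t' < t + 1 / (n + 1) := by exact_mod_cast h2
    exact_mod_cast this
  linarith

theorem upperQuantile_anti (μ : Measure Ω) (X : Ω → ℝ) : Antitone (upperQuantile μ X) :=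
  fun _ _ h => le_iInf₂ fun t ht => iInf₂_le t (ht.trans (ENNReal.ofReal_le_ofReal h))

theorem upperQuantile_ne_top {μ : Measure Ω} [IsFiniteMeasure μ] {X : Ω → ℝ} (hX : Measurable X)
    {u : ℝ} (hu : 0 < u) : upperQuantile μ X u ≠ ∞ := by
  have hanti : Antitone fun n : ℕ => {ω | (n : ℝ) < X ω} := by
    intro m n hmn ω hω
    simp only [Set.mem_ofPred_eq] at hω ⊢
    exact lt_of_le_of_lt (by exact_mod_cast hmn) hω
  have h := tendsto_measure_iInter_atTop (μ := μ) (s := fun n : ℕ => {ω | (n : ℝ) < X ω})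
    (fun n => (measurableSet_lt measurable_const hX).nullMeasurableSet) hanti
    ⟨0, measure_ne_top _ _⟩
  have he : ⋂ n : ℕ, {ω | (n : ℝ) < X ω} = ∅ := by
    ext ω
    simp only [Set.mem_iInter, Set.mem_ofPred_eq, Set.mem_empty_iff_false, iff_false, not_forall,
      not_lt]
    exact exists_nat_ge (X ω)
  rw [he, measure_empty] at h
  obtain ⟨n, hn⟩ := (h.eventually (ge_mem_nhds (ENNReal.ofReal_pos.2 hu))).exists
  have := (upperQuantile_le_iff μ X u (n : ℝ≥0)).2 (by simpa using hn)
  exact ne_top_of_le_ne_top ENNReal.coe_ne_top this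

/-- Nonincreasing extended functions which are finite on `(0, ∞)`. -/
structure QuantileLike (Q : ℝ → ℝ≥0∞) : Prop where
  anti : Antitone Q
  ne_top : ∀ u, 0 < u → Q u ≠ ∞

theorem le_unitMeasure_of_forall {p : ℝ≥0∞} (hp : p ≤ 1) {E : Set ℝ}
    (h : ∀ u, 0 < u → ENNReal.ofReal u < p → u ∈ E) : p ≤ unitMeasure E := by
  have hpt : p ≠ ∞ := ne_top_of_le_ne_top ENNReal.one_ne_top hp
  have hp1 : p.toReal ≤ 1 := by simpa using ENNReal.toReal_mono ENNReal.one_ne_top hp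
  calc p = volume (Set.Ioo 0 p.toReal) := by
        rw [Real.volume_Ioo, sub_zero, ENNReal.ofReal_toReal hpt]
    _ = unitMeasure (Set.Ioo 0 p.toReal) := by
        rw [unitMeasure, Measure.restrict_apply measurableSet_Ioo, Set.inter_eq_left.2]
        exact fun u hu => ⟨hu.1.le, hu.2.le.trans hp1⟩
    _ ≤ unitMeasure E := measure_mono fun u hu =>
        h u hu.1 ((ENNReal.ofReal_lt_iff_lt_toReal hu.1.le hpt).2 hu.2)

theorem ae_unitMeasure : ∀ᵐ u ∂unitMeasure, 0 < u ∧ u < 1 := by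
  have : ∀ᵐ u ∂unitMeasure, (u ≠ 0 ∧ u ≠ 1) ∧ u ∈ Set.Icc (0 : ℝ) 1 :=
    ((ae_restrict_of_ae (Measure.ae_ne _ _)).and (ae_restrict_of_ae (Measure.ae_ne _ _))).and
      (ae_restrict_mem measurableSet_Icc)
  filter_upwards [this] with u hu
  exact ⟨lt_of_le_of_ne hu.2.1 (Ne.symm hu.1.1), lt_of_le_of_ne hu.2.2 hu.1.2⟩

/-- The real quantile function truncated at level `M`. -/
noncomputable def truncQ (Q : ℝ → ℝ≥0∞) (M u : ℝ) : ℝ := (min (Q u) (ENNReal.ofReal M)).toReal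

theorem truncQ_eq {Q : ℝ → ℝ≥0∞} (hQ : QuantileLike Q) {M u : ℝ} (hM : 0 ≤ M) (hu : 0 < u) :
    truncQ Q M u = min (Q u).toReal M := by
  unfold truncQ
  rw [ENNReal.toReal_min (hQ.ne_top u hu) ENNReal.ofReal_ne_top, ENNReal.toReal_ofReal hM]

theorem truncQ_le {Q : ℝ → ℝ≥0∞} {M : ℝ} (hM : 0 ≤ M) (u : ℝ) : truncQ Q M u ≤ M :=
  (ENNReal.toReal_mono ENNReal.ofReal_ne_top (min_le_right _ _)).trans
    (ENNReal.toReal_ofReal hM).le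

theorem ofReal_truncQ_le (Q : ℝ → ℝ≥0∞) (M u : ℝ) : ENNReal.ofReal (truncQ Q M u) ≤ Q u := by
  unfold truncQ
  rw [ENNReal.ofReal_toReal (ne_top_of_le_ne_top ENNReal.ofReal_ne_top (min_le_right _ _))]
  exact min_le_left _ _

theorem isTail_truncQ {Q : ℝ → ℝ≥0∞} (hQ : Antitone Q) {M : ℝ} (hM : 0 ≤ M) :
    IsTail (truncQ Q M) :=
  ⟨fun _ _ h => ENNReal.toReal_mono
    (ne_top_of_le_ne_top ENNReal.ofReal_ne_top (min_le_right _ _)) (min_le_min (hQ h) le_rfl),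
    fun _ => ENNReal.toReal_nonneg, M, truncQ_le hM⟩

/-- If u is less than the probability that |g| > t, then the quantile of |g| at u exceeds t, hence
so does Q(u). The tail of |g| is thus at most the Lebesgue measure of {Q > t}. -/
theorem measure_lt_abs_le {μ : Measure Ω} [IsProbabilityMeasure μ] {Q : ℝ → ℝ≥0∞} {g : Ω → ℝ}
    (hg : ∀ u ∈ Set.Icc (0 : ℝ) 1, upperQuantile μ (fun x => |g x|) u ≤ Q u) {t : ℝ} (ht : 0 ≤ t)
    {E : Set ℝ} (hE : ∀ u, 0 < u → ENNReal.ofReal t < Q u → u ∈ E) :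
    μ {x | t < |g x|} ≤ unitMeasure E := by
  refine le_unitMeasure_of_forall prob_le_one fun u hu0 hu => hE u hu0 ?_
  have hu1 : u ≤ 1 := by
    have := (hu.trans_le prob_le_one).le
    simpa using this
  refine lt_of_lt_of_le ?_ (hg u ⟨hu0.le, hu1⟩)
  by_contra hle
  have := (upperQuantile_le_iff μ (fun x => |g x|) u t.toNNReal).1 (not_lt.1 hle)
  rw [Real.coe_toNNReal _ ht] at this
  exact absurd hu (not_lt.2 this)

end Quantile

/-! ### Excess domination for unbounded functions. -/

section ExcessDomination

variable {Ω : Type*} [MeasurableSpace Ω] {ν : Measure Ω}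

/-- Domination of excess moments for possibly unbounded functions. -/
def LMomDom (ν : Measure Ω) (Z : Ω → ℝ) (W : ℝ → ℝ) : Prop :=
  ∀ (k : ℕ) (T : ℝ), 1 ≤ k → 0 ≤ T →
    ∫⁻ ω, ENNReal.ofReal (excess k T (Z ω)) ∂ν ≤
      ∫⁻ u, ENNReal.ofReal (excess k T (W u)) ∂unitMeasure

/-- Layer cake: the excess exceeds t > 0 exactly when |x| exceeds (T^k + t)^{1/k}, so tail
domination at every level gives domination of all excess moments. -/
theorem LMomDom.of_tail {Z : Ω → ℝ} (mZ : Measurable Z) {W : ℝ → ℝ} (mW : Measurable W)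
    (h : ∀ t, 0 ≤ t → ν {ω | t < |Z ω|} ≤ unitMeasure {u | t < |W u|}) : LMomDom ν Z W := by
  intro k T hk hT
  rw [lintegral_eq_lintegral_meas_lt ν (Eventually.of_forall fun _ => excess_nonneg _ _ _)
      ((measurable_excess k T).comp mZ).aemeasurable,
    lintegral_eq_lintegral_meas_lt unitMeasure
      (Eventually.of_forall fun _ => excess_nonneg _ _ _)
      ((measurable_excess k T).comp mW).aemeasurable]
  refine setLIntegral_mono' measurableSet_Ioi fun t ht => ?_
  have ht' : 0 < t := ht
  have hTt : 0 ≤ T ^ k + t := by positivity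
  set r := (T ^ k + t) ^ ((k : ℝ)⁻¹) with hr
  have hr0 : 0 ≤ r := Real.rpow_nonneg hTt _
  have hrk : r ^ k = T ^ k + t := Real.rpow_inv_natCast_pow hTt (by omega)
  have key : ∀ x : ℝ, t < excess k T x ↔ r < |x| := by
    intro x
    unfold excess
    rw [lt_max_iff, or_iff_left (by linarith : ¬ t < 0)]
    constructor
    · intro hx
      by_contra hle
      have := pow_le_pow_left₀ (abs_nonneg x) (not_lt.1 hle) k
      linarith
    · intro hx
      have := pow_lt_pow_left₀ hx hr0 (by omega : k ≠ 0)
      linarith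
  simp only [key]
  exact h r hr0

theorem LMomDom.sum {ι : Type*} [Fintype ι] {w : ι → ℝ} {Z : ι → Ω → ℝ} (hw : ∑ i, |w i| ≤ 1)
    (mZ : ∀ i, Measurable (Z i)) {W : ℝ → ℝ} (h : ∀ i, LMomDom ν (Z i) W) :
    LMomDom ν (fun ω => ∑ i, w i * Z i ω) W := fun k T hk hT => by
  calc ∫⁻ ω, ENNReal.ofReal (excess k T (∑ i, w i * Z i ω)) ∂ν
      ≤ ∫⁻ ω, ∑ i, ENNReal.ofReal |w i| * ENNReal.ofReal (excess k T (Z i ω)) ∂ν := by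
        refine lintegral_mono fun ω => (ENNReal.ofReal_le_ofReal (excess_sum_le hw hk hT)).trans ?_
        rw [ENNReal.ofReal_sum_of_nonneg fun i _ => mul_nonneg (abs_nonneg _) (excess_nonneg _ _ _)]
        exact Finset.sum_le_sum fun i _ => (ENNReal.ofReal_mul (abs_nonneg _)).le
    _ = ∑ i, ENNReal.ofReal |w i| * ∫⁻ ω, ENNReal.ofReal (excess k T (Z i ω)) ∂ν := by
        have hm : ∀ i, Measurable fun ω => ENNReal.ofReal (excess k T (Z i ω)) := fun i =>
          ((measurable_excess k T).comp (mZ i)).ennreal_ofReal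
        rw [lintegral_finsetSum _ fun i _ => (hm i).const_mul _]
        exact Finset.sum_congr rfl fun i _ => lintegral_const_mul _ (hm i)
    _ ≤ ∑ i, ENNReal.ofReal |w i| * ∫⁻ u, ENNReal.ofReal (excess k T (W u)) ∂unitMeasure :=
        Finset.sum_le_sum fun i _ => mul_le_mul_right (h i k T hk hT) _
    _ ≤ _ := by
        rw [← Finset.sum_mul, ← ENNReal.ofReal_sum_of_nonneg fun i _ => abs_nonneg _]
        exact mul_le_of_le_one_left' (ENNReal.ofReal_le_one.2 hw)

/-- Fatou's lemma. No integrability of the dominating function is needed, which is why the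
comparison is stated with lower integrals. -/
theorem LMomDom.of_tendsto {Z : ℕ → Ω → ℝ} (mZ : ∀ j, Measurable (Z j)) {W : ℝ → ℝ}
    (h : ∀ j, LMomDom ν (Z j) W) {Y : Ω → ℝ}
    (hY : ∀ᵐ ω ∂ν, Tendsto (fun j => Z j ω) atTop (𝓝 (Y ω))) : LMomDom ν Y W := by
  intro k T hk hT
  calc ∫⁻ ω, ENNReal.ofReal (excess k T (Y ω)) ∂ν
      = ∫⁻ ω, liminf (fun j => ENNReal.ofReal (excess k T (Z j ω))) atTop ∂ν := by
        refine lintegral_congr_ae (hY.mono fun ω hω => ?_)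
        exact (((ENNReal.continuous_ofReal.comp (continuous_excess k T)).tendsto _).comp
          hω).liminf_eq.symm
    _ ≤ liminf (fun j => ∫⁻ ω, ENNReal.ofReal (excess k T (Z j ω)) ∂ν) atTop :=
        lintegral_liminf_le fun j => ((measurable_excess k T).comp (mZ j)).ennreal_ofReal
    _ ≤ liminf (fun _ : ℕ => ∫⁻ u, ENNReal.ofReal (excess k T (W u)) ∂unitMeasure) atTop :=
        liminf_le_liminf (Eventually.of_forall fun j => h j k T hk hT)
    _ = _ := liminf_const _

theorem LMomDom.integrable_excess {Z : Ω → ℝ} {W : ℝ → ℝ} (h : LMomDom ν Z W)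
    (mZ : AEMeasurable Z ν) {k : ℕ} {T : ℝ} (hk : 1 ≤ k) (hT : 0 ≤ T)
    (hW : Integrable (fun u => excess k T (W u)) unitMeasure) :
    Integrable (fun ω => excess k T (Z ω)) ν ∧
      ∫ ω, excess k T (Z ω) ∂ν ≤ ∫ u, excess k T (W u) ∂unitMeasure := by
  have nZ : 0 ≤ᵐ[ν] fun ω => excess k T (Z ω) := Eventually.of_forall fun _ => excess_nonneg _ _ _
  have nW : 0 ≤ᵐ[unitMeasure] fun u => excess k T (W u) :=
    Eventually.of_forall fun _ => excess_nonneg _ _ _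
  have hfin := h k T hk hT
  rw [← ofReal_integral_eq_lintegral_ofReal hW nW] at hfin
  have hm : AEStronglyMeasurable (fun ω => excess k T (Z ω)) ν :=
    ((measurable_excess k T).comp_aemeasurable mZ).aestronglyMeasurable
  have hi : Integrable (fun ω => excess k T (Z ω)) ν :=
    ⟨hm, (hasFiniteIntegral_iff_ofReal nZ).2 (hfin.trans_lt ENNReal.ofReal_lt_top)⟩
  refine ⟨hi, ?_⟩
  rw [← ofReal_integral_eq_lintegral_ofReal hi nZ] at hfin
  exact (ENNReal.ofReal_le_ofReal_iff (integral_nonneg fun _ => excess_nonneg _ _ _)).1 hfin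

theorem excess_zero_right (k : ℕ) (hk : 1 ≤ k) (x : ℝ) : excess k 0 x = |x| ^ k := by
  simp [excess, zero_pow (by omega : k ≠ 0)]

theorem integrable_excess_of_pow {W : Ω → ℝ} (mW : AEMeasurable W ν) {k : ℕ} {T : ℝ} (hT : 0 ≤ T)
    (hW : Integrable (fun ω => |W ω| ^ k) ν) : Integrable (fun ω => excess k T (W ω)) ν :=
  hW.mono' ((measurable_excess k T).comp_aemeasurable mW).aestronglyMeasurable
    (Eventually.of_forall fun ω => by
      rw [Real.norm_of_nonneg (excess_nonneg _ _ _)]; exact excess_le_pow hT _)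

theorem LMomDom.integrable_pow {Z : Ω → ℝ} {W : ℝ → ℝ} (h : LMomDom ν Z W)
    (mZ : AEMeasurable Z ν) {k : ℕ} (hk : 1 ≤ k)
    (hW : Integrable (fun u => |W u| ^ k) unitMeasure) :
    Integrable (fun ω => |Z ω| ^ k) ν ∧ ∫ ω, |Z ω| ^ k ∂ν ≤ ∫ u, |W u| ^ k ∂unitMeasure := by
  have := h.integrable_excess mZ hk le_rfl (by simpa only [excess_zero_right k hk] using hW)
  simpa only [excess_zero_right k hk] using this

theorem LMomDom.momDom [IsProbabilityMeasure ν] {Z : Ω → ℝ} {W : ℝ → ℝ} (h : LMomDom ν Z W)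
    (bZ : BddMeas Z) (bW : BddMeas W) : MomDom ν Z W := fun k T hk hT =>
  (h.integrable_excess bZ.1.aemeasurable hk hT ((bW.excess k T).integrable _)).2

end ExcessDomination

/-! ### Domination in the closed class and approximation in mean square. -/

section MonClass

set_option linter.unusedSectionVars false

variable {μ : Measure ℝ} [IsProbabilityMeasure μ] {Q : ℝ → ℝ≥0∞} {g f : ℝ → ℝ}

theorem levelConvex_of_mem_monClass (hg : g ∈ monClass Q μ) : LevelConvex g := by
  obtain ⟨⟨I, -, hI, hm | hm, h0⟩, -⟩ := hg
  · exact LevelConvex.of_monotoneOn hI hm h0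
  · exact LevelConvex.of_antitoneOn hI hm h0

theorem measurable_toReal (hQ : QuantileLike Q) : Measurable fun u => (Q u).toReal :=
  hQ.anti.measurable.ennreal_toReal

theorem lMomDom_of_mem_monClass (hQ : QuantileLike Q) (hg : g ∈ monClass Q μ) :
    LMomDom μ g fun u => (Q u).toReal := by
  refine LMomDom.of_tail (levelConvex_of_mem_monClass hg).measurable (measurable_toReal hQ)
    fun t ht => measure_lt_abs_le hg.2 ht fun u hu htu => ?_
  simp only [Set.mem_ofPred_eq, abs_of_nonneg ENNReal.toReal_nonneg]
  exact (ENNReal.ofReal_lt_iff_lt_toReal ht (hQ.ne_top u hu)).1 htu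

theorem bddMeas_clip (hg : Measurable g) {M : ℝ} (hM : 0 ≤ M) : BddMeas fun x => clip M (g x) :=
  ⟨(measurable_clip M).comp hg, M, fun x => by rw [abs_clip hM]; exact min_le_right _ _⟩

/-- Clipping commutes with tail comparison below level M, and at or above M both tails are empty. -/
theorem momDom_clip_of_mem_monClass (hQ : QuantileLike Q) (hg : g ∈ monClass Q μ) {M : ℝ}
    (hM : 0 ≤ M) : MomDom μ (fun x => clip M (g x)) (truncQ Q M) := by
  have bg := bddMeas_clip (levelConvex_of_mem_monClass hg).measurable hM
  have ht := isTail_truncQ hQ.anti hM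
  refine LMomDom.momDom (LMomDom.of_tail bg.1 ht.bddMeas.1 fun t ht0 => ?_) bg ht.bddMeas
  simp only [abs_clip hM, abs_of_nonneg (ht.nonneg _)]
  rcases lt_or_ge t M with htM | htM
  · simp only [lt_min_iff, htM, and_true]
    refine measure_lt_abs_le hg.2 ht0 fun u hu htu => ?_
    rw [Set.mem_ofPred_eq, truncQ_eq hQ hM hu]
    exact lt_min ((ENNReal.ofReal_lt_iff_lt_toReal ht0 (hQ.ne_top u hu)).1 htu) htM
  · simp [not_lt.2 htM]

theorem measurable_of_mem_monHull {h : ℝ → ℝ} (hh : h ∈ monHull Q μ) : Measurable h := by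
  obtain ⟨L, a, g, -, hg, rfl⟩ := hh
  exact Finset.measurable_sum _ fun l _ =>
    (levelConvex_of_mem_monClass (hg l)).measurable.const_mul _

theorem lMomDom_of_mem_monHull (hQ : QuantileLike Q) {h : ℝ → ℝ} (hh : h ∈ monHull Q μ) :
    LMomDom μ h fun u => (Q u).toReal := by
  obtain ⟨L, a, g, ha, hg, rfl⟩ := hh
  exact LMomDom.sum ha (fun l => (levelConvex_of_mem_monClass (hg l)).measurable)
    fun l => lMomDom_of_mem_monClass hQ (hg l)

/-- L¹ approximants converge almost everywhere along a subsequence, and domination passes to the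
limit. -/
theorem lMomDom_of_mem_closedClass (hQ : QuantileLike Q) (hf : f ∈ closedClass Q μ) :
    LMomDom μ f fun u => (Q u).toReal := by
  have hε : ∀ j : ℕ, ∃ h ∈ monHull Q μ, eLpNorm (f - h) 1 μ < ((j : ℝ≥0∞) + 1)⁻¹ := fun j =>
    hf.2 _ (ENNReal.inv_pos.2 (by simp))
  choose h hh hlt using hε
  have ht : Tendsto (fun j => eLpNorm (h j - f) 1 μ) atTop (𝓝 0) := by
    refine tendsto_of_tendsto_of_tendsto_of_le_of_le tendsto_const_nhds
      (ENNReal.tendsto_inv_nat_nhds_zero.comp (tendsto_add_atTop_nat 1)) (fun _ => zero_le)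
      fun j => ?_
    rw [eLpNorm_sub_comm]
    simpa using (hlt j).le
  have hm := tendstoInMeasure_of_tendsto_eLpNorm one_ne_zero
    (fun j => (measurable_of_mem_monHull (hh j)).aestronglyMeasurable) hf.1.1 ht
  obtain ⟨ns, -, hns⟩ := hm.exists_seq_tendsto_ae
  exact LMomDom.of_tendsto (fun j => measurable_of_mem_monHull (hh (ns j)))
    (fun j => lMomDom_of_mem_monHull hQ (hh (ns j))) hns

/-- If |x - y| > 2T, the larger of |x| and |y| is above T, so its square is at most 4/3 of its
excess over T/2, and (x - y)² is at most four times that square. -/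
theorem sub_sq_le_excess {x y T : ℝ} (hT : 0 ≤ T) :
    (x - y) ^ 2 ≤ 2 * T * |x - y| + 6 * (excess 2 (T / 2) x + excess 2 (T / 2) y) := by
  have n1 := excess_nonneg 2 (T / 2) x
  have n2 := excess_nonneg 2 (T / 2) y
  rcases le_total |x - y| (2 * T) with h | h
  · have := mul_le_mul_of_nonneg_right h (abs_nonneg (x - y))
    rw [← pow_two, sq_abs] at this
    linarith
  · have h1 := abs_sub x y
    have p1 := le_max_left (|x| ^ 2 - (T / 2) ^ 2) 0
    have p2 := le_max_left (|y| ^ 2 - (T / 2) ^ 2) 0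
    change _ ≤ excess 2 (T / 2) x at p1
    change _ ≤ excess 2 (T / 2) y at p2
    have h0 := mul_nonneg (by linarith : 0 ≤ 2 * T) (abs_nonneg (x - y))
    have hx := abs_nonneg x
    have hy := abs_nonneg y
    rw [← sq_abs (x - y)]
    have h2 : |x - y| ^ 2 ≤ (|x| + |y|) ^ 2 := pow_le_pow_left₀ (abs_nonneg _) h1 2
    rcases le_total |x| |y| with hxy | hxy
    · nlinarith
    · nlinarith

theorem tendsto_integral_excess {W : ℝ → ℝ} (mW : Measurable W)
    (hW : Integrable (fun u => |W u| ^ 2) unitMeasure) :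
    Tendsto (fun T : ℕ => ∫ u, excess 2 ((T : ℝ) / 2) (W u) ∂unitMeasure) atTop (𝓝 0) := by
  have : Tendsto (fun T : ℕ => ∫ u, excess 2 ((T : ℝ) / 2) (W u) ∂unitMeasure) atTop
      (𝓝 (∫ _, (0 : ℝ) ∂unitMeasure)) := by
    refine tendsto_integral_of_dominated_convergence (fun u => |W u| ^ 2)
      (fun T => ((measurable_excess 2 _).comp mW).aestronglyMeasurable) hW
      (fun T => Eventually.of_forall fun u => ?_) (Eventually.of_forall fun u => ?_)
    · rw [Real.norm_of_nonneg (excess_nonneg _ _ _)]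
      exact excess_le_pow (by positivity) _
    · refine tendsto_const_nhds.congr' ?_
      filter_upwards [eventually_ge_atTop (Nat.ceil (2 * |W u|))] with T hT
      have h1 : 2 * |W u| ≤ T := Nat.ceil_le.1 hT
      have h2 : |W u| ^ 2 ≤ ((T : ℝ) / 2) ^ 2 := pow_le_pow_left₀ (abs_nonneg _) (by linarith) 2
      exact (max_eq_right (by linarith)).symm
  simpa using this

/-- Approximation in L¹ becomes approximation in L² because the squares of all functions of the
class are uniformly integrable, being dominated by Q². A level T making the excess small is fixed
first, and the L¹ precision is then chosen according to T. -/
theorem exists_monHull_approx (hQ : QuantileLike Q)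
    (hQ2 : Integrable (fun u => |(Q u).toReal| ^ 2) unitMeasure) (hf : f ∈ closedClass Q μ)
    {ε : ℝ} (hε : 0 < ε) :
    ∃ h ∈ monHull Q μ, ∫ x, |f x - h x| ∂μ ≤ ε ∧ ∫ x, (f x - h x) ^ 2 ∂μ ≤ ε := by
  have mf : AEMeasurable f μ := hf.1.1.aemeasurable
  have df := lMomDom_of_mem_closedClass hQ hf
  obtain ⟨T, hT⟩ := ((tendsto_integral_excess (measurable_toReal hQ) hQ2).eventually
    (gt_mem_nhds (by positivity : 0 < ε / 24))).exists
  have hT0 : (0 : ℝ) ≤ T := Nat.cast_nonneg T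
  set η : ℝ := min ε (ε / (4 * (T + 1))) with hη
  have hη0 : 0 < η := lt_min hε (by positivity)
  obtain ⟨h, hh, hlt⟩ := hf.2 (ENNReal.ofReal η) (ENNReal.ofReal_pos.2 hη0)
  have mh := measurable_of_mem_monHull hh
  have dh := lMomDom_of_mem_monHull hQ hh
  have ih : Integrable h μ := by
    have := (dh.integrable_pow mh.aemeasurable one_le_two hQ2).1
    simp only [sq_abs] at this
    exact ((memLp_two_iff_integrable_sq mh.aestronglyMeasurable).2 this).integrable one_le_two
  have if' : Integrable f μ := memLp_one_iff_integrable.1 hf.1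
  have i1 : Integrable (fun x => |f x - h x|) μ := (if'.sub_fun ih).abs
  have hL1 : ∫ x, |f x - h x| ∂μ ≤ η := by
    rw [eLpNorm_one_eq_lintegral_enorm] at hlt
    have e : ∫⁻ x, ‖(f - h) x‖ₑ ∂μ = ENNReal.ofReal (∫ x, |f x - h x| ∂μ) := by
      rw [ofReal_integral_eq_lintegral_ofReal i1 (Eventually.of_forall fun _ => abs_nonneg _)]
      refine lintegral_congr fun x => ?_
      rw [Pi.sub_apply, Real.enorm_eq_ofReal_abs]
    rw [e] at hlt
    exact ((ENNReal.ofReal_le_ofReal_iff hη0.le).1 hlt.le)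
  refine ⟨h, hh, hL1.trans (min_le_left _ _), ?_⟩
  have hT2 : (0 : ℝ) ≤ T / 2 := by positivity
  have iW := integrable_excess_of_pow (measurable_toReal hQ).aemeasurable hT2 hQ2
  obtain ⟨e1, e1'⟩ := df.integrable_excess mf one_le_two hT2 iW
  obtain ⟨e2, e2'⟩ := dh.integrable_excess mh.aemeasurable one_le_two hT2 iW
  have hb : Integrable (fun x => 2 * (T : ℝ) * |f x - h x| +
      6 * (excess 2 (T / 2) (f x) + excess 2 (T / 2) (h x))) μ :=
    (i1.const_mul _).fun_add ((e1.fun_add e2).const_mul 6)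
  calc ∫ x, (f x - h x) ^ 2 ∂μ ≤ ∫ x, (2 * (T : ℝ) * |f x - h x| +
        6 * (excess 2 (T / 2) (f x) + excess 2 (T / 2) (h x))) ∂μ :=
        integral_mono_of_nonneg (Eventually.of_forall fun _ => sq_nonneg _) hb
          (Eventually.of_forall fun x => sub_sq_le_excess hT0)
    _ = 2 * (T : ℝ) * ∫ x, |f x - h x| ∂μ +
        6 * (∫ x, excess 2 (T / 2) (f x) ∂μ + ∫ x, excess 2 (T / 2) (h x) ∂μ) := by
        rw [integral_add (i1.const_mul _) ((e1.fun_add e2).const_mul 6), integral_const_mul,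
          integral_const_mul, integral_add e1 e2]
    _ ≤ 2 * T * (ε / (4 * (T + 1))) + 6 * (ε / 24 + ε / 24) := by
        have := hL1.trans (min_le_right _ _)
        gcongr
        · exact e1'.trans hT.le
        · exact e2'.trans hT.le
    _ ≤ ε := by
        have : 2 * T * (ε / (4 * (T + 1))) ≤ ε / 2 := by
          rw [mul_div_assoc', div_le_div_iff₀ (by positivity) (by positivity)]
          nlinarith
        linarith

end MonClass

/-! ### Covariances under a coupling, and the effect of truncation on them. -/

/-- `ρ` is a law on the plane with both marginals equal to `μ`. -/
structure IsCoupling (μ : Measure ℝ) (ρ : Measure (ℝ × ℝ)) : Prop where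
  fst : MeasurePreserving Prod.fst ρ μ
  snd : MeasurePreserving Prod.snd ρ μ

theorem MeasureTheory.MeasurePreserving.integral_comp_ae {Ω Ω' : Type*} [MeasurableSpace Ω]
    [MeasurableSpace Ω'] {P : Measure Ω} {μ : Measure Ω'} {U : Ω → Ω'}
    (hU : MeasurePreserving U P μ) {g : Ω' → ℝ} (hg : AEStronglyMeasurable g μ) :
    ∫ ω, g (U ω) ∂P = ∫ x, g x ∂μ := by
  rw [← hU.map_eq] at hg ⊢
  exact (integral_map hU.measurable.aemeasurable hg).symm

theorem MeasureTheory.MeasurePreserving.integrable_comp_fun {Ω Ω' : Type*} [MeasurableSpace Ω]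
    [MeasurableSpace Ω'] {P : Measure Ω} {μ : Measure Ω'} {U : Ω → Ω'}
    (hU : MeasurePreserving U P μ) {g : Ω' → ℝ} (hg : Integrable g μ) :
    Integrable (fun ω => g (U ω)) P := by
  rw [← hU.map_eq] at hg
  exact hg.comp_measurable hU.measurable

theorem abs_mul_sub_clip_mul_clip_le {M : ℝ} (hM : 0 ≤ M) (x y : ℝ) :
    |x * y - clip M x * clip M y| ≤ excess 2 M x + excess 2 M y := by
  have h := abs_mul_sub_clip_mul (B := 1) (g := x) (g' := y) zero_le_one hM hM
  have e : clip 1 1 = 1 := by simp [clip]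
  rw [e, one_mul, one_mul, abs_one, min_self, one_mul, one_mul] at h
  rw [h]
  have := mul_sub_min_mul_le (abs_nonneg x) (abs_nonneg y) hM
  rwa [excess_abs, excess_abs] at this

section Clipping

set_option linter.unusedSectionVars false

variable {μ : Measure ℝ} [IsProbabilityMeasure μ] {ρ : Measure (ℝ × ℝ)}

/-- The individual functions are clipped, not their sum. The error for each pair is at most two
marginal excesses, and the weights of the pairs add up to at most 1. -/
theorem abs_integral_mul_sub_clip_le (hρ : IsCoupling μ ρ) {L : ℕ} {a : Fin L → ℝ}
    {g : Fin L → ℝ → ℝ} (ha : ∑ l, |a l| ≤ 1) (mg : ∀ l, Measurable (g l)) {M E : ℝ} (hM : 0 ≤ M)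
    (hi : ∀ l, Integrable (fun x => |g l x| ^ 2) μ)
    (hE : ∀ l, ∫ x, excess 2 M (g l x) ∂μ ≤ E) (hE0 : 0 ≤ E) :
    |(∫ p, (∑ l, a l * g l p.1) * (∑ l, a l * g l p.2) ∂ρ) -
      ∫ p, (∑ l, a l * clip M (g l p.1)) * (∑ l, a l * clip M (g l p.2)) ∂ρ| ≤ 2 * E := by
  have ie : ∀ l, Integrable (fun x => excess 2 M (g l x)) μ := fun l =>
    integrable_excess_of_pow (mg l).aemeasurable hM (hi l)
  have i1 : ∀ l, Integrable (fun p : ℝ × ℝ => excess 2 M (g l p.1)) ρ := fun l =>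
    hρ.fst.integrable_comp_fun (ie l)
  have i2 : ∀ l, Integrable (fun p : ℝ × ℝ => excess 2 M (g l p.2)) ρ := fun l =>
    hρ.snd.integrable_comp_fun (ie l)
  have m2 : ∀ l, MemLp (g l) 2 μ := fun l =>
    (memLp_two_iff_integrable_sq (mg l).aestronglyMeasurable).2 (by simpa only [sq_abs] using hi l)
  have mm : MemLp (fun x => ∑ l, a l * g l x) 2 μ :=
    memLp_finsetSum _ fun l _ => (m2 l).const_mul (a l)
  have ip : Integrable (fun p : ℝ × ℝ => (∑ l, a l * g l p.1) * (∑ l, a l * g l p.2)) ρ :=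
    (mm.comp_measurePreserving hρ.fst).integrable_mul (mm.comp_measurePreserving hρ.snd)
  have : IsProbabilityMeasure ρ := by
    have := hρ.fst.measure_preimage (s := Set.univ) MeasurableSet.univ.nullMeasurableSet
    exact ⟨by simpa using this⟩
  have bc : BddMeas fun x => ∑ l, a l * clip M (g l x) :=
    BddMeas.sum fun l _ => (bddMeas_clip (mg l) hM).const_mul _
  have ic : Integrable (fun p : ℝ × ℝ => (∑ l, a l * clip M (g l p.1)) *
      (∑ l, a l * clip M (g l p.2))) ρ :=
    ((bc.comp measurable_fst).mul (bc.comp measurable_snd)).integrable ρ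
  have ib : Integrable (fun p : ℝ × ℝ => ∑ l, ∑ l', |a l| * |a l'| *
      (excess 2 M (g l p.1) + excess 2 M (g l' p.2))) ρ :=
    integrable_finsetSum _ fun l _ => integrable_finsetSum _ fun l' _ =>
      ((i1 l).fun_add (i2 l')).const_mul _
  rw [← integral_sub ip ic]
  calc _ ≤ ∫ p : ℝ × ℝ, ∑ l, ∑ l', |a l| * |a l'| *
          (excess 2 M (g l p.1) + excess 2 M (g l' p.2)) ∂ρ := by
        refine abs_integral_le_integral_abs.trans (integral_mono (ip.sub_fun ic).abs ib fun p => ?_)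
        have e : (∑ l, a l * g l p.1) * (∑ l, a l * g l p.2) -
            (∑ l, a l * clip M (g l p.1)) * (∑ l, a l * clip M (g l p.2)) =
            ∑ l, ∑ l', a l * a l' *
              (g l p.1 * g l' p.2 - clip M (g l p.1) * clip M (g l' p.2)) := by
          rw [Finset.sum_mul_sum, Finset.sum_mul_sum, ← Finset.sum_sub_distrib]
          refine Finset.sum_congr rfl fun l _ => ?_
          rw [← Finset.sum_sub_distrib]
          exact Finset.sum_congr rfl fun l' _ => by ring
        simp only [e]
        refine (Finset.abs_sum_le_sum_abs _ _).trans (Finset.sum_le_sum fun l _ =>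
          (Finset.abs_sum_le_sum_abs _ _).trans (Finset.sum_le_sum fun l' _ => ?_))
        rw [abs_mul, abs_mul]
        exact mul_le_mul_of_nonneg_left (abs_mul_sub_clip_mul_clip_le hM _ _) (by positivity)
    _ = ∑ l, ∑ l', |a l| * |a l'| *
          (∫ x, excess 2 M (g l x) ∂μ + ∫ x, excess 2 M (g l' x) ∂μ) := by
        rw [integral_finsetSum _ fun l _ => integrable_finsetSum _ fun l' _ =>
          ((i1 l).fun_add (i2 l')).const_mul _]
        refine Finset.sum_congr rfl fun l _ => ?_
        rw [integral_finsetSum _ fun l' _ => ((i1 l).fun_add (i2 l')).const_mul _]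
        refine Finset.sum_congr rfl fun l' _ => ?_
        rw [integral_const_mul, integral_add (i1 l) (i2 l'),
          hρ.fst.integral_comp_ae (ie l).1, hρ.snd.integral_comp_ae (ie l').1]
    _ ≤ ∑ l, ∑ l', |a l| * |a l'| * (E + E) :=
        Finset.sum_le_sum fun l _ => Finset.sum_le_sum fun l' _ =>
          mul_le_mul_of_nonneg_left (add_le_add (hE l) (hE l')) (by positivity)
    _ = (∑ l, |a l|) * (∑ l, |a l|) * (2 * E) := by
        rw [Finset.sum_mul_sum, Finset.sum_mul]
        refine Finset.sum_congr rfl fun l _ => ?_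
        rw [Finset.sum_mul]
        exact Finset.sum_congr rfl fun l' _ => by ring
    _ ≤ _ := mul_le_of_le_one_left (by positivity)
        (mul_le_one₀ ha (Finset.sum_nonneg fun _ _ => abs_nonneg _) ha)

theorem integral_abs_sub_clip_le {L : ℕ} {a : Fin L → ℝ}
    {g : Fin L → ℝ → ℝ} (ha : ∑ l, |a l| ≤ 1) {M E : ℝ} (hM : 0 ≤ M)
    (hi : ∀ l, Integrable (fun x => excess 1 M (g l x)) μ)
    (hE : ∀ l, ∫ x, excess 1 M (g l x) ∂μ ≤ E) (hE0 : 0 ≤ E) :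
    ∫ x, |(∑ l, a l * g l x) - ∑ l, a l * clip M (g l x)| ∂μ ≤ E := by
  have ib : Integrable (fun x => ∑ l, |a l| * excess 1 M (g l x)) μ :=
    integrable_finsetSum _ fun l _ => (hi l).const_mul _
  calc _ ≤ ∫ x, ∑ l, |a l| * excess 1 M (g l x) ∂μ := by
        refine integral_mono_of_nonneg (Eventually.of_forall fun _ => abs_nonneg _) ib
          (Eventually.of_forall fun x => ?_)
        simp only
        rw [← Finset.sum_sub_distrib]
        refine (Finset.abs_sum_le_sum_abs _ _).trans (Finset.sum_le_sum fun l _ => ?_)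
        rw [← mul_sub, abs_mul]
        refine mul_le_mul_of_nonneg_left ?_ (abs_nonneg _)
        rw [abs_sub_clip hM, excess, pow_one, pow_one]
    _ = ∑ l, |a l| * ∫ x, excess 1 M (g l x) ∂μ := by
        rw [integral_finsetSum _ fun l _ => (hi l).const_mul _]
        simp only [integral_const_mul]
    _ ≤ ∑ l, |a l| * E :=
        Finset.sum_le_sum fun l _ => mul_le_mul_of_nonneg_left (hE l) (abs_nonneg _)
    _ ≤ E := by rw [← Finset.sum_mul]; exact mul_le_of_le_one_left hE0 ha

/-- The difference of the two products is split by bilinearity, and each piece is bounded by the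
weighted inequality |xy| ≤ x²/(2s) + s y²/2; the parameter s is later balanced against the precision
d. -/
theorem abs_integral_mul_sub_le (hρ : IsCoupling μ ρ) {f h : ℝ → ℝ} (hf : MemLp f 2 μ)
    (hh : MemLp h 2 μ) {A d s : ℝ} (hs : 0 < s) (hfA : ∫ x, f x ^ 2 ∂μ ≤ A)
    (hhA : ∫ x, h x ^ 2 ∂μ ≤ A) (hd : ∫ x, (f x - h x) ^ 2 ∂μ ≤ d) :
    |∫ p, f p.1 * f p.2 ∂ρ - ∫ p, h p.1 * h p.2 ∂ρ| ≤ d / s + s * A := by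
  have if1 := hf.comp_measurePreserving hρ.fst
  have if2 := hf.comp_measurePreserving hρ.snd
  have ih1 := hh.comp_measurePreserving hρ.fst
  have ih2 := hh.comp_measurePreserving hρ.snd
  have iff : Integrable (fun p : ℝ × ℝ => f p.1 * f p.2) ρ := if1.integrable_mul if2
  have ihh : Integrable (fun p : ℝ × ℝ => h p.1 * h p.2) ρ := ih1.integrable_mul ih2
  have sd : Integrable (fun x => (f x - h x) ^ 2) μ := (hf.sub hh).integrable_sq
  have sf : Integrable (fun x => f x ^ 2) μ := hf.integrable_sq
  have sh : Integrable (fun x => h x ^ 2) μ := hh.integrable_sq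
  have j1 := hρ.fst.integrable_comp_fun sd
  have j2 := hρ.snd.integrable_comp_fun sd
  have j3 := hρ.snd.integrable_comp_fun sf
  have j4 := hρ.fst.integrable_comp_fun sh
  have ij := ((j1.fun_add j2).const_mul (1 / (2 * s))).fun_add ((j3.fun_add j4).const_mul (s / 2))
  rw [← integral_sub iff ihh]
  calc _ ≤ ∫ p : ℝ × ℝ, (1 / (2 * s) * ((f p.1 - h p.1) ^ 2 + (f p.2 - h p.2) ^ 2) +
          s / 2 * (f p.2 ^ 2 + h p.1 ^ 2)) ∂ρ := by
        refine abs_integral_le_integral_abs.trans (integral_mono (iff.sub_fun ihh).abs ij fun p => ?_)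
        have key : ∀ x y : ℝ, |x * y| ≤ 1 / (2 * s) * x ^ 2 + s / 2 * y ^ 2 := fun x y => by
          have e : 1 / (2 * s) * x ^ 2 + s / 2 * y ^ 2 - |x * y| =
              1 / (2 * s) * (|x| - s * |y|) ^ 2 := by
            rw [abs_mul, ← sq_abs x, ← sq_abs y]; field_simp; ring
          have : 0 ≤ 1 / (2 * s) * (|x| - s * |y|) ^ 2 := by positivity
          linarith
        have k1 := key (f p.1 - h p.1) (f p.2)
        have k2 := key (f p.2 - h p.2) (h p.1)
        have e : f p.1 * f p.2 - h p.1 * h p.2 =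
          (f p.1 - h p.1) * f p.2 + (f p.2 - h p.2) * h p.1 := by ring
        simp only [e]
        refine (abs_add_le _ _).trans ?_
        linarith
    _ = 1 / (2 * s) * (∫ x, (f x - h x) ^ 2 ∂μ + ∫ x, (f x - h x) ^ 2 ∂μ) +
          s / 2 * (∫ x, f x ^ 2 ∂μ + ∫ x, h x ^ 2 ∂μ) := by
        rw [integral_add ((j1.fun_add j2).const_mul _) ((j3.fun_add j4).const_mul _),
          integral_const_mul, integral_const_mul, integral_add j1 j2, integral_add j3 j4,
          hρ.fst.integral_comp_ae (g := fun x => (f x - h x) ^ 2) sd.1,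
          hρ.snd.integral_comp_ae (g := fun x => (f x - h x) ^ 2) sd.1,
          hρ.snd.integral_comp_ae (g := fun x => f x ^ 2) sf.1,
          hρ.fst.integral_comp_ae (g := fun x => h x ^ 2) sh.1]
    _ ≤ 1 / (2 * s) * (d + d) + s / 2 * (A + A) := by gcongr
    _ = _ := by field_simp; ring

end Clipping

/-- The covariance of `f(U)` and `f(V)` when `(U, V)` has law `ρ` and `U`, `V` have law `μ`. -/
noncomputable def couplingCov (μ : Measure ℝ) (ρ : Measure (ℝ × ℝ)) (f : ℝ → ℝ) : ℝ :=
  ∫ p, f p.1 * f p.2 ∂ρ - (∫ x, f x ∂μ) ^ 2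

theorem isCoupling_prod (μ : Measure ℝ) [IsProbabilityMeasure μ] : IsCoupling μ (μ.prod μ) :=
  ⟨measurePreserving_fst, measurePreserving_snd⟩

/-- Approximation of the elements of the closed class by truncated combinations. -/
theorem exists_isHull_approx {μ : Measure ℝ} [IsProbabilityMeasure μ] {Q : ℝ → ℝ≥0∞} {f : ℝ → ℝ}
    (hQ : QuantileLike Q) (hQ2 : Integrable (fun u => |(Q u).toReal| ^ 2) unitMeasure)
    (hf : f ∈ closedClass Q μ) {M ε : ℝ} (hM : 0 ≤ M) (hε : 0 < ε) :
    ∃ h : ℝ → ℝ, IsHull μ (fun u => 2 * truncQ Q M u) h ∧ (∀ x, |h x| ≤ M) ∧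
      ∫ x, |f x - h x| ∂μ ≤ ∫ u, excess 1 M (Q u).toReal ∂unitMeasure + ε ∧
      ∀ ρ, IsCoupling μ ρ → |couplingCov μ ρ f - couplingCov μ ρ h| ≤
        4 * ∫ u, excess 2 M (Q u).toReal ∂unitMeasure + ε := by
  have mf : AEMeasurable f μ := hf.1.1.aemeasurable
  have df := lMomDom_of_mem_closedClass hQ hf
  set A := ∫ u, |(Q u).toReal| ^ 2 ∂unitMeasure with hA
  have hA0 : 0 ≤ A := integral_nonneg fun _ => by positivity
  set s := ε / (4 * (A + 1)) with hs
  have hs0 : 0 < s := by positivity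
  obtain ⟨h₀, hh₀, happ1, happ2⟩ := exists_monHull_approx hQ hQ2 hf
    (lt_min hε (by positivity : 0 < s * (ε / 4)))
  have d₀ := lMomDom_of_mem_monHull hQ hh₀
  have m₀ := measurable_of_mem_monHull hh₀
  obtain ⟨L, a, g, ha, hg, e₀⟩ := hh₀
  have mg : ∀ l, Measurable (g l) := fun l => (levelConvex_of_mem_monClass (hg l)).measurable
  have dg := fun l => lMomDom_of_mem_monClass hQ (hg l)
  have mQ := measurable_toReal hQ
  have iQ1 : Integrable (fun u => |(Q u).toReal| ^ 1) unitMeasure := by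
    simp only [pow_one]
    have := (memLp_two_iff_integrable_sq mQ.aestronglyMeasurable).2
      (by simpa only [sq_abs] using hQ2)
    exact (this.integrable one_le_two).abs
  have iE1 := integrable_excess_of_pow (T := M) mQ.aemeasurable hM iQ1
  have iE2 := integrable_excess_of_pow (T := M) mQ.aemeasurable hM hQ2
  have g1 := fun l => (dg l).integrable_excess (mg l).aemeasurable le_rfl hM iE1
  have g2 := fun l => (dg l).integrable_excess (mg l).aemeasurable one_le_two hM iE2
  have gsq := fun l => ((dg l).integrable_pow (mg l).aemeasurable one_le_two hQ2).1
  have nE : ∀ k, 0 ≤ ∫ u, excess k M (Q u).toReal ∂unitMeasure := fun k =>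
    integral_nonneg fun _ => excess_nonneg _ _ _
  have lf : MemLp f 2 μ := (memLp_two_iff_integrable_sq hf.1.1).2
    (by simpa only [sq_abs] using (df.integrable_pow mf one_le_two hQ2).1)
  have l₀ : MemLp h₀ 2 μ := (memLp_two_iff_integrable_sq m₀.aestronglyMeasurable).2
    (by simpa only [sq_abs] using (d₀.integrable_pow m₀.aemeasurable one_le_two hQ2).1)
  have sf : ∫ x, f x ^ 2 ∂μ ≤ A := by
    simpa only [hA, sq_abs] using (df.integrable_pow mf one_le_two hQ2).2
  have s₀ : ∫ x, h₀ x ^ 2 ∂μ ≤ A := by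
    simpa only [hA, sq_abs] using (d₀.integrable_pow m₀.aemeasurable one_le_two hQ2).2
  have bc : BddMeas fun x => ∑ l, a l * clip M (g l x) :=
    BddMeas.sum fun l _ => (bddMeas_clip (mg l) hM).const_mul _
  refine ⟨fun x => ∑ l, a l * clip M (g l x), IsHull.of_sum (isTail_truncQ hQ.anti hM) ha
    (fun l => (levelConvex_of_mem_monClass (hg l)).clip hM) (fun l => bddMeas_clip (mg l) hM)
    (fun l => momDom_clip_of_mem_monClass hQ (hg l) hM), fun x => ?_, ?_, fun ρ hρ => ?_⟩
  · refine (Finset.abs_sum_le_sum_abs _ _).trans ?_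
    calc _ ≤ ∑ l, |a l| * M := Finset.sum_le_sum fun l _ => by
          rw [abs_mul, abs_clip hM]
          exact mul_le_mul_of_nonneg_left (min_le_right _ _) (abs_nonneg _)
      _ ≤ M := by rw [← Finset.sum_mul]; exact mul_le_of_le_one_left hM ha
  · have h1 := integral_abs_sub_clip_le ha hM (fun l => (g1 l).1) (fun l => (g1 l).2) (nE 1)
    have i1 : Integrable (fun x => f x - h₀ x) μ :=
      (lf.integrable one_le_two).sub_fun (l₀.integrable one_le_two)
    have i2 : Integrable (fun x => h₀ x - ∑ l, a l * clip M (g l x)) μ :=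
      (l₀.integrable one_le_two).sub_fun (bc.integrable μ)
    rw [e₀] at i1 i2 happ1
    calc _ ≤ ∫ x, (|f x - ∑ l, a l * g l x| +
            |(∑ l, a l * g l x) - ∑ l, a l * clip M (g l x)|) ∂μ := by
          refine integral_mono_of_nonneg (Eventually.of_forall fun _ => abs_nonneg _)
            (i1.abs.fun_add i2.abs) (Eventually.of_forall fun x => abs_sub_le _ _ _)
      _ ≤ _ := by
          rw [integral_add i1.abs i2.abs]
          have := happ1.trans (min_le_left _ _)
          linarith
  · have key : ∀ ρ, IsCoupling μ ρ → |∫ p, f p.1 * f p.2 ∂ρ -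
        ∫ p, (∑ l, a l * clip M (g l p.1)) * (∑ l, a l * clip M (g l p.2)) ∂ρ| ≤
        2 * ∫ u, excess 2 M (Q u).toReal ∂unitMeasure + ε / 2 := fun ρ hρ => by
      have h1 := abs_integral_mul_sub_le hρ lf l₀ hs0 sf s₀ (happ2.trans (min_le_right _ _))
      have h2 := abs_integral_mul_sub_clip_le hρ ha mg hM gsq (fun l => (g2 l).2) (nE 2)
      have h3 : s * (ε / 4) / s + s * A ≤ ε / 2 := by
        have : s * A ≤ ε / 4 := by
          rw [hs, div_mul_eq_mul_div, div_le_div_iff₀ (by positivity) (by positivity)]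
          nlinarith
        rw [mul_div_cancel_left₀ _ hs0.ne']
        linarith
      rw [e₀] at h1
      refine (abs_sub_le _ _ _).trans ((add_le_add h1 h2).trans ?_)
      linarith
    -- The squared mean is the integral of the product under the independent coupling, so the same
    -- estimate serves for both parts of the covariance; 4 = 2 + 2.
    have k1 := key ρ hρ
    have k2 := key _ (isCoupling_prod μ)
    rw [integral_prod_mul f f, integral_prod_mul (fun x => ∑ l, a l * clip M (g l x))
      (fun x => ∑ l, a l * clip M (g l x)), ← pow_two, ← pow_two] at k2
    unfold couplingCov
    rw [abs_le] at k1 k2 ⊢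
    constructor <;> linarith [k1.1, k1.2, k2.1, k2.2]

/-! ### From the dependence coefficients to a mixing law on the path space. -/

/-- The mixing rate `min(α(i), 1)` as a real number. -/
noncomputable def mixRate {Ω : Type*} [MeasurableSpace Ω] (P : Measure Ω) (Y δ : ℤ → Ω → ℝ)
    (i : ℕ) : ℝ := (min (alphaCoef P Y δ 2 i) 1).toReal

/-- The law of the whole process. -/
noncomputable def processLaw {Ω : Type*} [MeasurableSpace Ω] (P : Measure Ω) (Y : ℤ → Ω → ℝ) :
    Measure (ℤ → ℝ) := P.map fun ω i => Y i ω

/-- The law of `(Y_0, Y_l)`. -/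
noncomputable def pairLaw {Ω : Type*} [MeasurableSpace Ω] (P : Measure Ω) (Y : ℤ → Ω → ℝ)
    (l : ℕ) : Measure (ℝ × ℝ) := P.map fun ω => (Y 0 ω, Y l ω)

/-- Since B is measurable for the past, Z may be replaced by its conditional expectation, and the
covariance is the integral of B against the centered conditional expectation. -/
theorem abs_covInt_le_condExp {Ω : Type*} {m mΩ : MeasurableSpace Ω} {P : Measure Ω}
    [IsProbabilityMeasure P] (hm : m ≤ mΩ) {B Z : Ω → ℝ}
    (hB : Measurable[m] B) {c : ℝ} (hc : ∀ ω, |B ω| ≤ c) (bZ : BddMeas Z) :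
    ENNReal.ofReal |covInt P B Z| ≤ ENNReal.ofReal c * eLpNorm (centered P (P[Z | m])) 1 P := by
  have bB : BddMeas B := ⟨hB.mono hm le_rfl, c, hc⟩
  have hI : Integrable (fun ω => P[Z | m] ω - ∫ ω', Z ω' ∂P) P :=
    integrable_condExp.sub_fun (integrable_const _)
  have e1 : ∫ ω, B ω * P[Z | m] ω ∂P = ∫ ω, B ω * Z ω ∂P := by
    have h := condExp_mul_of_stronglyMeasurable_left (μ := P) (m := m) (f := B) (g := Z)
      hB.stronglyMeasurable ((bB.mul bZ).integrable P) (bZ.integrable P)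
    rw [← integral_condExp hm (f := fun ω => B ω * Z ω)]
    exact integral_congr_ae (h.mono fun ω hω => hω.symm)
  have iB : Integrable (fun ω => B ω * P[Z | m] ω) P :=
    integrable_condExp.bdd_mul bB.1.aestronglyMeasurable (Eventually.of_forall hc)
  have e2 : covInt P B Z = ∫ ω, B ω * (P[Z | m] ω - ∫ ω', Z ω' ∂P) ∂P := by
    simp only [mul_sub]
    rw [integral_sub iB ((bB.mul (BddMeas.const _)).integrable P), e1, integral_mul_const, covInt]
  have e3 : centered P (P[Z | m]) = fun ω => P[Z | m] ω - ∫ ω', Z ω' ∂P := by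
    ext ω; rw [centered, integral_condExp hm]
  have hc0 : 0 ≤ c := by
    obtain ⟨ω⟩ := P.nonempty_of_neZero
    exact (abs_nonneg _).trans (hc ω)
  have e4 : |covInt P B Z| ≤ c * ∫ ω, |P[Z | m] ω - ∫ ω', Z ω' ∂P| ∂P := by
    rw [e2, ← integral_const_mul]
    refine abs_integral_le_integral_abs.trans (integral_mono_of_nonneg
      (Eventually.of_forall fun _ => abs_nonneg _) (hI.abs.const_mul c)
      (Eventually.of_forall fun ω => ?_))
    simp only [abs_mul]
    exact mul_le_mul_of_nonneg_right (hc ω) (abs_nonneg _)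
  refine (ENNReal.ofReal_le_ofReal e4).trans ?_
  rw [ENNReal.ofReal_mul hc0, e3, eLpNorm_one_eq_lintegral_enorm,
    ofReal_integral_eq_lintegral_ofReal hI.abs (Eventually.of_forall fun _ => abs_nonneg _)]
  simp only [Real.enorm_eq_ofReal_abs, le_refl]

section Mixing

set_option linter.unusedSectionVars false

variable {Ω : Type*} [mΩ : MeasurableSpace Ω] {P : Measure Ω} [IsProbabilityMeasure P]
  {Y δ : ℤ → Ω → ℝ}

theorem alphaCoef_zero (k : ℕ) : alphaCoef P Y δ k 0 = 1 := if_pos rfl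

theorem alphaCoef_anti {i j k : ℕ} (hi : 1 ≤ i) (hij : i ≤ j) :
    alphaCoef P Y δ k j ≤ alphaCoef P Y δ k i := by
  unfold alphaCoef
  rw [if_neg (by omega), if_neg (by omega)]
  refine iSup₂_mono fun l hl => iSup₂_le fun t ht => ?_
  exact le_iSup₂_of_le t ⟨ht.1, fun j' => le_trans (by exact_mod_cast hij) (ht.2 j')⟩ le_rfl

theorem depCoef_le_alphaCoef {i k l : ℕ} (hi : 1 ≤ i) (hl : 1 ≤ l) (hlk : l ≤ k) {t : Fin l → ℤ}
    (ht : Monotone t) (hit : ∀ j, (i : ℤ) ≤ t j) :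
    depCoef (pastSigma Y δ 0) P (fun j => Y (t j)) ≤ alphaCoef P Y δ k i := by
  unfold alphaCoef
  rw [if_neg (by omega)]
  exact le_iSup₂_of_le l ⟨hl, hlk⟩ (le_iSup₂_of_le t ⟨ht, hit⟩ le_rfl)

theorem pastSigma_le (hY : ∀ i, Measurable (Y i)) (hδ : ∀ i, Measurable (δ i)) (n : ℤ) :
    pastSigma Y δ n ≤ mΩ :=
  iSup₂_le fun k _ => ((hY k).prodMk (hδ k)).comap_le

/-- Shifting the process by k turns the path past at time k into events of F_0. By stationarity,
coefficients defined at time 0 therefore control every time k. -/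
theorem measurable_shift_path (Y δ : ℤ → Ω → ℝ) (k : ℤ) :
    @Measurable Ω (ℤ → ℝ) (pastSigma Y δ 0) (pastPath k) fun ω j => Y (j - k) ω := by
  rw [measurable_iff_comap_le, MeasurableSpace.comap_iSup]
  refine iSup_le fun i => ?_
  rw [MeasurableSpace.comap_iSup]
  refine iSup_le fun hi => ?_
  rw [MeasurableSpace.comap_comp]
  refine le_iSup₂_of_le (i - k) (by omega) ?_
  exact Measurable.comap_le (measurable_fst.comp (comap_measurable _))

/-- Covariances of centered products of indicators with bounded functions of the past. -/
theorem abs_covInt_prod_le (hY : ∀ i, Measurable (Y i)) (hδ : ∀ i, Measurable (δ i))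
    {B : Ω → ℝ} (hB : Measurable[pastSigma Y δ 0] B) {c : ℝ} (hc : ∀ ω, |B ω| ≤ c) {i l : ℕ}
    (hi : 1 ≤ i) (hα : alphaCoef P Y δ 2 i ≤ 1) (hl : 1 ≤ l) (hl2 : l ≤ 2) {t : Fin l → ℤ}
    (ht : Monotone t) (hit : ∀ j, (i : ℤ) ≤ t j) (x : Fin l → ℝ) :
    |covInt P B (fun ω => ∏ j, ((Set.Iic (x j)).indicator 1 (Y (t j) ω) -
      ∫ ω', (Set.Iic (x j)).indicator (1 : ℝ → ℝ) (Y (t j) ω') ∂P))| ≤ c * mixRate P Y δ i := by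
  have hc0 : 0 ≤ c := by
    obtain ⟨ω⟩ := P.nonempty_of_neZero
    exact (abs_nonneg _).trans (hc ω)
  set Z : Ω → ℝ := fun ω => ∏ j, ((Set.Iic (x j)).indicator 1 (Y (t j) ω) -
      ∫ ω', (Set.Iic (x j)).indicator (1 : ℝ → ℝ) (Y (t j) ω') ∂P) with hZ
  have bf : ∀ j, BddMeas fun ω => (Set.Iic (x j)).indicator (1 : ℝ → ℝ) (Y (t j) ω) -
      ∫ ω', (Set.Iic (x j)).indicator (1 : ℝ → ℝ) (Y (t j) ω') ∂P := fun j =>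
    ((BddMeas.indicator measurableSet_Iic).comp (hY _)).sub (BddMeas.const _)
  have bZ : BddMeas Z := by
    have : ∀ s : Finset (Fin l), BddMeas fun ω => ∏ j ∈ s,
        ((Set.Iic (x j)).indicator (1 : ℝ → ℝ) (Y (t j) ω) -
        ∫ ω', (Set.Iic (x j)).indicator (1 : ℝ → ℝ) (Y (t j) ω') ∂P) := fun s => by
      classical
      induction s using Finset.induction_on with
      | empty => simpa using BddMeas.const 1
      | insert j s hj ih =>
        simp only [Finset.prod_insert hj]
        exact (bf j).mul ih
    exact this Finset.univ
  have h1 := abs_covInt_le_condExp (P := P) (pastSigma_le hY hδ 0) hB hc bZ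
  have h2 : eLpNorm (centered P (P[Z | pastSigma Y δ 0])) 1 P ≤ alphaCoef P Y δ 2 i := by
    refine le_trans ?_ (depCoef_le_alphaCoef hi hl hl2 ht hit)
    refine le_trans (le_of_eq ?_) (le_iSup _ x)
    have e : Z = fun ω => ∏ j, centered P
        (Set.indicator {ω' | Y (t j) ω' ≤ x j} (fun _ => (1 : ℝ))) ω := by
      ext ω
      rw [hZ]
      refine Finset.prod_congr rfl fun j _ => ?_
      rfl
    rw [e]
  have h3 := h1.trans (mul_le_mul_right h2 _)
  have h4 : alphaCoef P Y δ 2 i = ENNReal.ofReal (mixRate P Y δ i) := by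
    rw [mixRate, min_eq_left hα,
      ENNReal.ofReal_toReal (ne_top_of_le_ne_top ENNReal.one_ne_top hα)]
  rw [h4, ← ENNReal.ofReal_mul hc0] at h3
  exact (ENNReal.ofReal_le_ofReal_iff (mul_nonneg hc0 ENNReal.toReal_nonneg)).1 h3

theorem covInt_sub_const {B Z : Ω → ℝ} (bB : BddMeas B) (bZ : BddMeas Z) (p : ℝ) :
    covInt P B (fun ω => Z ω - p) = covInt P B Z := by
  have := covInt_sum (ν := P) ![1, -p] bB (Z := ![Z, fun _ => 1]) (by
    intro i
    fin_cases i
    exacts [bZ, BddMeas.const 1])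
  simp only [Fin.sum_univ_two, Matrix.cons_val_zero, Matrix.cons_val_one] at this
  rw [show (fun ω => Z ω - p) = fun ω => 1 * Z ω + -p * 1 by ext ω; ring, this]
  simp [covInt]

/-- The product AA' equals its centered version (A - p)(A' - p') plus p'A + pA' and a constant, so
three coefficients of order at most two suffice. When α(i) > 1 the rate is cut at 1 and the trivial
bound 2c applies; the constant 6 leaves room in both cases. -/
theorem abs_covInt_indicator_le (hY : ∀ i, Measurable (Y i)) (hδ : ∀ i, Measurable (δ i))
    {B : Ω → ℝ} (hB : Measurable[pastSigma Y δ 0] B) {c : ℝ} (hc : ∀ ω, |B ω| ≤ c) {i : ℕ}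
    (hi : 1 ≤ i) (l : ℕ) (x y : ℝ) :
    |covInt P B (fun ω => (Set.Iic x).indicator 1 (Y i ω) *
      (Set.Iic y).indicator 1 (Y (i + l) ω))| ≤ c * (6 * mixRate P Y δ i) := by
  have hc0 : 0 ≤ c := by
    obtain ⟨ω⟩ := P.nonempty_of_neZero
    exact (abs_nonneg _).trans (hc ω)
  have bB : BddMeas B := ⟨hB.mono (pastSigma_le hY hδ 0) le_rfl, c, hc⟩
  set A : Ω → ℝ := fun ω => (Set.Iic x).indicator 1 (Y i ω) with hA
  set A' : Ω → ℝ := fun ω => (Set.Iic y).indicator 1 (Y (i + l) ω) with hA'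
  have bA : BddMeas A := (BddMeas.indicator measurableSet_Iic).comp (hY _)
  have bA' : BddMeas A' := (BddMeas.indicator measurableSet_Iic).comp (hY _)
  have A01 : ∀ ω, 0 ≤ A ω ∧ A ω ≤ 1 := fun ω =>
    ⟨Set.indicator_nonneg (fun _ _ => zero_le_one) _,
      Set.indicator_le_self' (fun _ _ => zero_le_one) _⟩
  have A01' : ∀ ω, 0 ≤ A' ω ∧ A' ω ≤ 1 := fun ω =>
    ⟨Set.indicator_nonneg (fun _ _ => zero_le_one) _,
      Set.indicator_le_self' (fun _ _ => zero_le_one) _⟩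
  have unit : ∀ {W : Ω → ℝ}, BddMeas W → (∀ ω, 0 ≤ W ω ∧ W ω ≤ 1) →
      0 ≤ ∫ ω, W ω ∂P ∧ ∫ ω, W ω ∂P ≤ 1 := fun bW h =>
    ⟨integral_nonneg fun ω => (h ω).1, by
      have := integral_mono (bW.integrable P) (integrable_const (1 : ℝ)) fun ω => (h ω).2
      simpa using this⟩
  rcases le_or_gt (alphaCoef P Y δ 2 i) 1 with hα | hα
  · set a := mixRate P Y δ i with ha
    have ha0 : 0 ≤ a := ENNReal.toReal_nonneg
    obtain ⟨p0, p1⟩ := unit bA A01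
    obtain ⟨p0', p1'⟩ := unit bA' A01'
    set p := ∫ ω, A ω ∂P with hp
    set p' := ∫ ω, A' ω ∂P with hp'
    have c1 : |covInt P B A| ≤ c * a := by
      have := abs_covInt_prod_le hY hδ hB hc hi hα le_rfl one_le_two (t := fun _ => (i : ℤ))
        monotone_const (fun _ => le_rfl) fun _ => x
      simp only [Finset.univ_unique, Finset.prod_const, Finset.card_singleton, pow_one] at this
      rwa [covInt_sub_const bB bA] at this
    have c2 : |covInt P B A'| ≤ c * a := by
      have := abs_covInt_prod_le hY hδ hB hc hi hα le_rfl one_le_two (t := fun _ => (i : ℤ) + l)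
        monotone_const (fun _ => by omega) fun _ => y
      simp only [Finset.univ_unique, Finset.prod_const, Finset.card_singleton, pow_one] at this
      rwa [covInt_sub_const bB bA'] at this
    have c3 : |covInt P B fun ω => (A ω - p) * (A' ω - p')| ≤ c * a := by
      have := abs_covInt_prod_le hY hδ hB hc hi hα one_le_two le_rfl (t := ![(i : ℤ), (i : ℤ) + l])
        (by
          rw [Fin.monotone_iff_le_succ]
          intro j
          fin_cases j
          simp)
        (fun j => by fin_cases j <;> simp) ![x, y]
      simpa only [Fin.prod_univ_two, Matrix.cons_val_zero, Matrix.cons_val_one] using this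
    have e : covInt P B (fun ω => A ω * A' ω) =
        covInt P B (fun ω => (A ω - p) * (A' ω - p')) + p' * covInt P B A + p * covInt P B A' := by
      have := covInt_sum (ν := P) ![1, p', p] bB
        (Z := ![fun ω => (A ω - p) * (A' ω - p'), A, A']) (by
          intro i
          fin_cases i
          exacts [(bA.sub (BddMeas.const _)).mul (bA'.sub (BddMeas.const _)), bA, bA'])
      simp only [Fin.sum_univ_three, Matrix.cons_val, one_mul] at this
      rw [← this, ← covInt_sub_const (P := P) bB (bA.mul bA') (-(p * p'))]
      congr 1; ext ω; ring
    rw [e]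
    refine (abs_add_le _ _).trans ((add_le_add_left (abs_add_le _ _) _).trans ?_)
    rw [abs_mul, abs_mul, abs_of_nonneg p0, abs_of_nonneg p0']
    have hca := mul_nonneg hc0 ha0
    have q1 := mul_le_of_le_one_left (abs_nonneg (covInt P B A)) p1'
    have q2 := mul_le_of_le_one_left (abs_nonneg (covInt P B A')) p1
    linarith
  · have ha : mixRate P Y δ i = 1 := by rw [mixRate, min_eq_right hα.le, ENNReal.toReal_one]
    have A01m : ∀ ω, 0 ≤ A ω * A' ω ∧ A ω * A' ω ≤ 1 := fun ω =>
      ⟨mul_nonneg (A01 ω).1 (A01' ω).1, mul_le_one₀ (A01 ω).2 (A01' ω).1 (A01' ω).2⟩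
    obtain ⟨r0, r1⟩ := unit (bA.mul bA') A01m
    have t1 : |∫ ω, B ω * (A ω * A' ω) ∂P| ≤ c := by
      have := norm_integral_le_of_norm_le_const (μ := P) (f := fun ω => B ω * (A ω * A' ω)) (C := c)
        (Eventually.of_forall fun ω => by
          rw [Real.norm_eq_abs, abs_mul, abs_of_nonneg (A01m ω).1]
          exact (mul_le_of_le_one_right (abs_nonneg _) (A01m ω).2).trans (hc ω))
      simpa using this
    have t2 : |∫ ω, B ω ∂P| ≤ c := by
      have := norm_integral_le_of_norm_le_const (μ := P) (f := B) (C := c)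
        (Eventually.of_forall hc)
      simpa using this
    rw [ha]
    unfold covInt
    refine (abs_sub _ _).trans ?_
    rw [abs_mul, abs_of_nonneg r0]
    have := mul_le_of_le_one_right (abs_nonneg (∫ ω, B ω ∂P)) r1
    linarith

theorem mixRate_anti : Antitone (mixRate P Y δ) := by
  intro i j hij
  refine ENNReal.toReal_mono (ne_top_of_le_ne_top ENNReal.one_ne_top (min_le_right _ _)) ?_
  rcases Nat.eq_zero_or_pos i with rfl | hi
  · rw [alphaCoef_zero, min_self]; exact min_le_right _ _
  · exact min_le_min (alphaCoef_anti hi hij) le_rfl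

theorem measurable_path (hY : ∀ i, Measurable (Y i)) : Measurable fun ω (i : ℤ) => Y i ω :=
  measurable_pi_lambda _ hY

theorem processLaw_eq (hst : IsStrictlyStationary P Y) (k : ℤ) :
    processLaw P Y = P.map fun ω i => Y (i - k) ω := by
  simpa only [sub_eq_add_neg] using! (hst (-k)).symm

theorem map_eq_map_zero (hY : ∀ i, Measurable (Y i)) (hst : IsStrictlyStationary P Y) (k : ℤ) :
    P.map (Y k) = P.map (Y 0) := by
  have h := congrArg (fun ν => ν.map fun ω : ℤ → ℝ => ω 0) (hst k)
  rw [Measure.map_map (measurable_coord 0) (measurable_pi_lambda _ fun i => hY _),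
    Measure.map_map (measurable_coord 0) (measurable_path hY)] at h
  simpa [Function.comp_def] using h

theorem pathMixing (hY : ∀ i, Measurable (Y i)) (hδ : ∀ i, Measurable (δ i))
    (hst : IsStrictlyStationary P Y) :
    PathMixing (processLaw P Y) (P.map (Y 0)) (mixRate P Y δ) where
  anti := mixRate_anti
  nonneg := fun _ => ENNReal.toReal_nonneg
  zero := by rw [mixRate, alphaCoef_zero, min_self, ENNReal.toReal_one]
  marginal := fun k => by
    rw [processLaw, Measure.map_map (measurable_coord k) (measurable_path hY)]
    exact map_eq_map_zero hY hst k
  mix := fun k i l hi B hB c hc x y => by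
    have mθ : Measurable fun ω (j : ℤ) => Y (j - k) ω := measurable_pi_lambda _ fun j => hY _
    have mB : Measurable B := hB.mono (pastPath_le k) le_rfl
    have mZ : Measurable fun ω : ℤ → ℝ => (Set.Iic x).indicator (1 : ℝ → ℝ) (ω (k + i)) *
        (Set.Iic y).indicator (1 : ℝ → ℝ) (ω (k + i + l)) :=
      ((measurable_one.indicator measurableSet_Iic).comp (measurable_coord _)).mul
        ((measurable_one.indicator measurableSet_Iic).comp (measurable_coord _))
    -- The function of the path past at k is pulled back along the shifted process, so that the base
    -- time becomes 0.
    have := abs_covInt_indicator_le (P := P) hY hδ (hB.comp (measurable_shift_path Y δ k))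
      (fun ω => hc _) hi l x y
    convert this using 2
    rw [processLaw_eq hst k]
    have mBZ : Measurable fun ω : ℤ → ℝ => B ω * ((Set.Iic x).indicator (1 : ℝ → ℝ) (ω (k + i)) *
        (Set.Iic y).indicator (1 : ℝ → ℝ) (ω (k + i + l))) := mB.mul mZ
    unfold covInt
    beta_reduce
    rw [integral_map mθ.aemeasurable mBZ.aestronglyMeasurable,
      integral_map mθ.aemeasurable mB.aestronglyMeasurable,
      integral_map mθ.aemeasurable mZ.aestronglyMeasurable]
    have e1 : k + i - k = (i : ℤ) := by ring
    have e2 : k + i + l - k = (i : ℤ) + l := by ring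
    simp only [e1, e2, Function.comp_apply]

theorem isCoupling_pairLaw (hY : ∀ i, Measurable (Y i)) (hst : IsStrictlyStationary P Y) (l : ℕ) :
    IsCoupling (P.map (Y 0)) (pairLaw P Y l) where
  fst := ⟨measurable_fst, by
    rw [pairLaw, Measure.map_map measurable_fst ((hY 0).prodMk (hY l))]; rfl⟩
  snd := ⟨measurable_snd, by
    rw [pairLaw, Measure.map_map measurable_snd ((hY 0).prodMk (hY l))]
    exact map_eq_map_zero hY hst l⟩

theorem map_pair_eq (hY : ∀ i, Measurable (Y i)) (hst : IsStrictlyStationary P Y) (k : ℤ) (l : ℕ) :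
    P.map (fun ω => (Y k ω, Y (k + l) ω)) = pairLaw P Y l := by
  have h := congrArg (fun ν => ν.map fun ω : ℤ → ℝ => (ω 0, ω l)) (hst k)
  rw [Measure.map_map ((measurable_coord 0).prodMk (measurable_coord l))
    (measurable_pi_lambda _ fun i => hY _),
    Measure.map_map ((measurable_coord 0).prodMk (measurable_coord l)) (measurable_path hY)] at h
  simpa [Function.comp_def, pairLaw, add_comm] using h

/-- Covariances of a function of the process. -/
theorem integral_XVar_mul (hY : ∀ i, Measurable (Y i)) (hst : IsStrictlyStationary P Y)
    {f : ℝ → ℝ} (hf : MemLp f 2 (P.map (Y 0))) (k : ℤ) (l : ℕ) :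
    Integrable (fun ω => XVar P Y f k ω * XVar P Y f (k + l) ω) P ∧
      ∫ ω, XVar P Y f k ω * XVar P Y f (k + l) ω ∂P =
        couplingCov (P.map (Y 0)) (pairLaw P Y l) f := by
  have hmp : ∀ k, MeasurePreserving (Y k) P (P.map (Y 0)) := fun k =>
    ⟨hY k, map_eq_map_zero hY hst k⟩
  have hm : ∀ k, ∫ ω, f (Y k ω) ∂P = ∫ x, f x ∂P.map (Y 0) := fun k =>
    (hmp k).integral_comp_ae hf.1
  have lf : ∀ k, MemLp (fun ω => f (Y k ω)) 2 P := fun k => hf.comp_measurePreserving (hmp k)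
  have i1 : ∀ k, Integrable (fun ω => f (Y k ω)) P := fun k => (lf k).integrable one_le_two
  have i2 : ∀ k k', Integrable (fun ω => f (Y k ω) * f (Y k' ω)) P := fun k k' =>
    (lf k).integrable_mul (lf k')
  set m := ∫ x, f x ∂P.map (Y 0) with hm'
  have e : ∀ ω, XVar P Y f k ω * XVar P Y f (k + l) ω =
      f (Y k ω) * f (Y (k + l) ω) - m * f (Y k ω) - m * f (Y (k + l) ω) + m * m := fun ω => by
    simp only [XVar, centered, hm]; ring
  simp only [e]
  have j1 := (i2 k (k + l)).sub_fun ((i1 k).const_mul m)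
  have j2 := j1.sub_fun ((i1 (k + l)).const_mul m)
  refine ⟨j2.fun_add (integrable_const _), ?_⟩
  rw [integral_add j2 (integrable_const _), integral_sub j1 ((i1 _).const_mul m),
    integral_sub (i2 _ _) ((i1 _).const_mul m), integral_const_mul, integral_const_mul, hm, hm]
  have hρ := isCoupling_pairLaw hY hst l
  have hmeas : AEStronglyMeasurable (fun p : ℝ × ℝ => f p.1 * f p.2)
      (P.map fun ω => (Y k ω, Y (k + l) ω)) := by
    rw [map_pair_eq hY hst]
    exact (hf.comp_measurePreserving hρ.fst).1.mul (hf.comp_measurePreserving hρ.snd).1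
  have e2 : ∫ ω, f (Y k ω) * f (Y (k + l) ω) ∂P = ∫ p, f p.1 * f p.2 ∂pairLaw P Y l := by
    rw [← map_pair_eq hY hst k l, integral_map ((hY _).prodMk (hY _)).aemeasurable hmeas]
  rw [e2, couplingCov]
  simp only [integral_const, probReal_univ, smul_eq_mul, one_mul]
  ring

theorem integral_pathVar_mul (hY : ∀ i, Measurable (Y i)) (hst : IsStrictlyStationary P Y)
    {h : ℝ → ℝ} (bh : BddMeas h) (k : ℤ) (l : ℕ) :
    ∫ ω, pathVar (P.map (Y 0)) h k ω * pathVar (P.map (Y 0)) h (k + l) ω ∂processLaw P Y =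
      couplingCov (P.map (Y 0)) (pairLaw P Y l) h := by
  have : IsProbabilityMeasure (P.map (Y 0)) :=
    Measure.isProbabilityMeasure_map (hY 0).aemeasurable
  have hf : MemLp h 2 (P.map (Y 0)) := by
    obtain ⟨C, hC⟩ := bh.2
    exact MemLp.of_bound bh.1.aestronglyMeasurable C (Eventually.of_forall hC)
  rw [← (integral_XVar_mul hY hst hf k l).2]
  have mp : ∀ k, Measurable (pathVar (P.map (Y 0)) h k) := fun k =>
    (bh.1.comp (measurable_coord k)).sub_const _
  have mpp : Measurable fun ω : ℤ → ℝ =>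
      pathVar (P.map (Y 0)) h k ω * pathVar (P.map (Y 0)) h (k + l) ω := (mp _).mul (mp _)
  rw [processLaw, integral_map (measurable_path hY).aemeasurable mpp.aestronglyMeasurable]
  have hm : ∀ k, ∫ ω, h (Y k ω) ∂P = ∫ x, h x ∂P.map (Y 0) := fun k => by
    rw [← map_eq_map_zero hY hst k, integral_map (hY k).aemeasurable bh.1.aestronglyMeasurable]
  simp only [pathVar, XVar, centered, hm]

end Mixing

/-! ### The threshold where R crosses a level, and pointwise bounds by the integrand of `M3`. -/

section Threshold

set_option linter.unusedSectionVars false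

variable {Ω : Type*} [mΩ : MeasurableSpace Ω] {P : Measure Ω} {Y δ : ℤ → Ω → ℝ} {Q : ℝ → ℝ≥0∞}

/-- For u < 1, cutting the coefficient at 1 does not affect comparison with u. -/
theorem alphaCoef_le_iff {u : ℝ} (hu0 : 0 ≤ u) (hu1 : u < 1) (p : ℕ) :
    alphaCoef P Y δ 2 p ≤ ENNReal.ofReal u ↔ mixRate P Y δ p ≤ u := by
  have hfin : min (alphaCoef P Y δ 2 p) 1 ≠ ∞ :=
    ne_top_of_le_ne_top ENNReal.one_ne_top (min_le_right _ _)
  have h1 : ENNReal.ofReal u < 1 := by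
    rw [← ENNReal.ofReal_one]; exact (ENNReal.ofReal_lt_ofReal_iff one_pos).2 hu1
  rw [mixRate, ← ENNReal.le_ofReal_iff_toReal_le hfin hu0, min_le_iff, or_iff_left (not_le.2 h1)]

theorem le_alphaInv {u : ℝ} (hu0 : 0 ≤ u) (hu1 : u < 1) {x : ℝ≥0∞}
    (h : ∀ p : ℕ, mixRate P Y δ p ≤ u → x ≤ p) : x ≤ alphaInv P Y δ u :=
  le_iInf₂ fun p hp => h p ((alphaCoef_le_iff hu0 hu1 p).1 hp)

theorem mixRate_zero : mixRate P Y δ 0 = 1 := by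
  rw [mixRate, alphaCoef, if_pos rfl, min_self, ENNReal.toReal_one]

theorem mixRate_le_one (i : ℕ) : mixRate P Y δ i ≤ 1 := by
  have := ENNReal.toReal_mono ENNReal.one_ne_top (min_le_right (alphaCoef P Y δ 2 i) 1)
  simpa [mixRate] using this

theorem one_le_alphaInv {u : ℝ} (hu0 : 0 ≤ u) (hu1 : u < 1) : 1 ≤ alphaInv P Y δ u :=
  le_alphaInv hu0 hu1 fun p hp => by
    have : p ≠ 0 := fun h => by rw [h, mixRate_zero] at hp; linarith
    exact_mod_cast Nat.one_le_iff_ne_zero.2 this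

theorem alphaInv_anti : Antitone (alphaInv P Y δ) := fun _ _ h =>
  le_iInf₂ fun p hp => iInf₂_le p (hp.trans (ENNReal.ofReal_le_ofReal h))

theorem RFun_anti (hQ : Antitone Q) : Antitone (RFun P Y δ Q) := fun _ _ h =>
  mul_le_mul' (alphaInv_anti h) (max_le_max (hQ h) le_rfl)

/-- The number of `i < n` with `u < a_i`. -/
noncomputable def countLt (a : ℕ → ℝ) (n : ℕ) (u : ℝ) : ℝ :=
  ∑ i ∈ Finset.range n, (Set.Iio (a i)).indicator 1 u

theorem countLt_nonneg (a : ℕ → ℝ) (n : ℕ) (u : ℝ) : 0 ≤ countLt a n u :=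
  Finset.sum_nonneg fun _ _ => Set.indicator_nonneg (fun _ _ => zero_le_one) _

theorem countLt_le (a : ℕ → ℝ) (n : ℕ) (u : ℝ) : countLt a n u ≤ n := by
  refine (Finset.sum_le_card_nsmul _ _ 1 fun i _ => ?_).trans (by simp)
  exact Set.indicator_le_self' (fun _ _ => zero_le_one) u

theorem measurable_countLt (a : ℕ → ℝ) (n : ℕ) : Measurable (countLt a n) :=
  Finset.measurable_sum _ fun _ _ => measurable_one.indicator measurableSet_Iio

theorem countLt_le_of_le {a : ℕ → ℝ} (ha : Antitone a) {u : ℝ} {p : ℕ} (hp : a p ≤ u) (n : ℕ) :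
    countLt a n u ≤ p := by
  have h0 : ∀ i, p ≤ i → (Set.Iio (a i)).indicator (1 : ℝ → ℝ) u = 0 := fun i hi =>
    Set.indicator_of_notMem (by simpa using (ha hi).trans hp) _
  rcases le_total n p with h | h
  · exact (countLt_le a n u).trans (by exact_mod_cast h)
  · have e : countLt a n u = countLt a p u := by
      unfold countLt
      rw [← Finset.sum_range_add_sum_Ico _ h, Finset.sum_eq_zero (s := Finset.Ico p n) fun i hi =>
        h0 i (Finset.mem_Ico.1 hi).1, add_zero]
    rw [e]; exact countLt_le a p u

/-- The rates are nonincreasing, so all indices with u < a_i precede any p with a_p ≤ u, and there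
are at most p of them. Sums over lags thereby become factors α⁻¹(u) under the integral. -/
theorem ofReal_countLt_le [IsProbabilityMeasure P] {u : ℝ} (hu0 : 0 ≤ u) (hu1 : u < 1) (n : ℕ) :
    ENNReal.ofReal (countLt (mixRate P Y δ) n u) ≤ alphaInv P Y δ u :=
  le_alphaInv hu0 hu1 fun p hp => by
    have := ENNReal.ofReal_le_ofReal (countLt_le_of_le mixRate_anti hp n)
    simpa using this

/-- The threshold at which `R` crosses the level `θ`. -/
structure IsThreshold (P : Measure Ω) (Y δ : ℤ → Ω → ℝ) (Q : ℝ → ℝ≥0∞) (θ v : ℝ) (q : ℕ) :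
    Prop where
  nonneg : 0 ≤ v
  lt_one : v < 1
  one_le : 1 ≤ q
  rate_le : mixRate P Y δ q ≤ v
  lt_of_lt : ∀ u, 0 < u → u < v → ENNReal.ofReal θ < RFun P Y δ Q u
  le_of_lt : ∀ u, v < u → u < 1 → RFun P Y δ Q u ≤ ENNReal.ofReal θ
  le_alphaInv : ∀ u, 0 < u → u < v → (q : ℝ≥0∞) ≤ alphaInv P Y δ u
  quantile_le : ∀ u, v < u → u < 1 → (Q u) ≤ ENNReal.ofReal (θ / q)

/-- Take v as the infimum of the points of (0, 1) where R ≤ θ, and q as the first index whose rate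
is at most v. If there is no such point, R exceeds θ on all of (0, 1), a case treated separately. -/
theorem exists_isThreshold [IsProbabilityMeasure P] (hQ : QuantileLike Q) {θ : ℝ} :
    (∀ u, 0 < u → u < 1 → ENNReal.ofReal θ < RFun P Y δ Q u) ∨
      ∃ v q, IsThreshold P Y δ Q θ v q := by
  classical
  by_cases hne : ∀ u, 0 < u → u < 1 → ENNReal.ofReal θ < RFun P Y δ Q u
  · exact Or.inl hne
  right
  push Not at hne
  obtain ⟨u₀, hu₀0, hu₀1, hu₀⟩ := hne
  set S : Set ℝ := {u | 0 < u ∧ u < 1 ∧ RFun P Y δ Q u ≤ ENNReal.ofReal θ} with hS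
  have hSne : S.Nonempty := ⟨u₀, hu₀0, hu₀1, hu₀⟩
  have hSbdd : BddBelow S := ⟨0, fun u hu => hu.1.le⟩
  set v := sInf S with hv
  have hv0 : 0 ≤ v := le_csInf hSne fun u hu => hu.1.le
  have hv1 : v < 1 := (csInf_le hSbdd ⟨hu₀0, hu₀1, hu₀⟩).trans_lt hu₀1
  have hlt : ∀ u, 0 < u → u < v → ENNReal.ofReal θ < RFun P Y δ Q u := fun u hu0 huv => by
    by_contra hle
    exact absurd (csInf_le hSbdd ⟨hu0, huv.trans hv1, not_lt.1 hle⟩) (not_le.2 huv)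
  have hle : ∀ u, v < u → u < 1 → RFun P Y δ Q u ≤ ENNReal.ofReal θ := fun u hvu _ => by
    obtain ⟨s, hs, hsu⟩ := exists_lt_of_csInf_lt hSne hvu
    exact (RFun_anti hQ.anti hsu.le).trans hs.2.2
  -- To the right of v one has α⁻¹ ≤ R ≤ θ, so a fixed index, the ceiling of θ, has rate at most u
  -- for every u > v, hence at most v.
  have hex : ∃ p, mixRate P Y δ p ≤ v := by
    refine ⟨⌈θ⌉₊, le_of_forall_gt_imp_ge_of_dense fun u hvu => ?_⟩
    rcases lt_or_ge u 1 with hu1 | hu1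
    · have h1 : alphaInv P Y δ u < (⌈θ⌉₊ : ℝ≥0∞) + 1 := by
        have h2 : alphaInv P Y δ u ≤ RFun P Y δ Q u := le_mul_of_one_le_right' (le_max_right _ _)
        have h3 : ENNReal.ofReal θ ≤ (⌈θ⌉₊ : ℝ≥0∞) := by
          have := ENNReal.ofReal_le_ofReal (Nat.le_ceil θ)
          simpa using this
        refine (h2.trans ((hle u hvu hu1).trans h3)).trans_lt ?_
        exact ENNReal.lt_add_right (ENNReal.natCast_ne_top _) one_ne_zero
      unfold alphaInv at h1
      rw [iInf_lt_iff] at h1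
      obtain ⟨p, hp⟩ := h1
      rw [iInf_lt_iff] at hp
      obtain ⟨hp1, hp2⟩ := hp
      have hp3 : p ≤ ⌈θ⌉₊ := by
        have : p < ⌈θ⌉₊ + 1 := by exact_mod_cast hp2
        omega
      exact (mixRate_anti hp3).trans ((alphaCoef_le_iff (hv0.trans hvu.le) hu1 p).1 hp1)
    · exact (mixRate_le_one _).trans hu1
  set q := Nat.find hex with hq
  have hq1 : 1 ≤ q := by
    rw [Nat.one_le_iff_ne_zero]
    intro h0
    have := Nat.find_spec hex
    rw [← hq, h0, mixRate_zero] at this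
    linarith
  have hprev : v < mixRate P Y δ (q - 1) := not_le.1 (Nat.find_min hex (by omega))
  refine ⟨v, q, hv0, hv1, hq1, Nat.find_spec hex, hlt, hle, fun u hu0 huv => ?_,
    fun u hvu hu1 => ?_⟩
  · exact le_alphaInv hu0.le (huv.trans hv1) fun p hp => by
      exact_mod_cast Nat.find_min' hex (hp.trans huv.le)
  -- By minimality of q the rate at q - 1 is greater than v. At a point w between v and this rate,
  -- with w < u, α⁻¹(w) ≥ q, so qQ(u) ≤ R(w) ≤ θ.
  · obtain ⟨w, hvw, hw⟩ := exists_between (lt_min hvu hprev)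
    have hwu := hw.trans_le (min_le_left _ _)
    have hwq := hw.trans_le (min_le_right _ _)
    have h1 : (q : ℝ≥0∞) ≤ alphaInv P Y δ w := le_alphaInv (hv0.trans hvw.le) (hwu.trans hu1)
      fun p hp => by
        have : q ≤ p := by
          by_contra hlt
          have := mixRate_anti (P := P) (Y := Y) (δ := δ) (by omega : p ≤ q - 1)
          linarith
        exact_mod_cast this
    have h2 : Q u * q ≤ ENNReal.ofReal θ := by
      rw [mul_comm]
      exact (mul_le_mul' h1 ((hQ.anti hwu.le).trans (le_max_left _ _))).trans
        (hle w hvw (hwu.trans hu1))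
    have hq0 : (0 : ℝ) < q := by exact_mod_cast hq1
    rw [ENNReal.ofReal_div_of_pos hq0, ENNReal.ofReal_natCast]
    exact (ENNReal.le_div_iff_mul_le (Or.inl (by exact_mod_cast hq0.ne'))
      (Or.inl (ENNReal.natCast_ne_top _))).2 h2

/-- The integrand of `M3`. -/
noncomputable def majorant (P : Measure Ω) (Y δ : ℤ → Ω → ℝ) (Q : ℝ → ℝ≥0∞) (lam u : ℝ) : ℝ≥0∞ :=
  Q u * RFun P Y δ Q u * min (RFun P Y δ Q u) (ENNReal.ofReal lam)

theorem sq_mul_alphaInv_le (u : ℝ) : Q u * Q u * alphaInv P Y δ u ≤ Q u * RFun P Y δ Q u := by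
  rw [mul_assoc, mul_comm (Q u) (alphaInv P Y δ u)]
  exact mul_le_mul' le_rfl (mul_le_mul' le_rfl (le_max_left _ _))

theorem mul_sq_mul_alphaInv_le {θ lam u : ℝ} (hθ : θ ≤ lam)
    (hu : ENNReal.ofReal θ < RFun P Y δ Q u) :
    ENNReal.ofReal θ * (Q u * Q u * alphaInv P Y δ u) ≤ majorant P Y δ Q lam u := by
  rw [mul_comm]
  exact mul_le_mul' (sq_mul_alphaInv_le u) (le_min hu.le (ENNReal.ofReal_le_ofReal hθ))

theorem sq_mul_quantile_le {θ lam u : ℝ} (hθ : θ ≤ lam)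
    (hu : ENNReal.ofReal θ < RFun P Y δ Q u) :
    ENNReal.ofReal θ ^ 2 * Q u ≤ majorant P Y δ Q lam u := by
  rw [mul_comm, pow_two, ← mul_assoc]
  exact mul_le_mul' (mul_le_mul' le_rfl hu.le) (le_min hu.le (ENNReal.ofReal_le_ofReal hθ))

/-- To the left of v, the truncation level θ/q and the count b ≤ q give φb ≤ θ, and θ²Q is at most
the integrand because R > θ. To the right, φb ≤ R ≤ θ ≤ lam, so the integrand is QR², which
dominates φ(φb)². -/
theorem IsThreshold.truncQ_cube_le [IsProbabilityMeasure P] {θ v lam : ℝ} {q : ℕ}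
    (h : IsThreshold P Y δ Q θ v q) (hθ0 : 0 < θ) (hθ : θ ≤ lam) {u : ℝ} (hu0 : 0 < u) (hu1 : u < 1)
    (huv : u ≠ v) :
    ENNReal.ofReal (truncQ Q (θ / q) u ^ 3 * countLt (mixRate P Y δ) q u ^ 2) ≤
      majorant P Y δ Q lam u := by
  set φ := truncQ Q (θ / q) u with hφ
  set b := countLt (mixRate P Y δ) q u with hb
  have hφ0 : 0 ≤ φ := ENNReal.toReal_nonneg
  have hb0 : 0 ≤ b := countLt_nonneg _ _ _
  have hφQ : ENNReal.ofReal φ ≤ Q u := ofReal_truncQ_le Q _ u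
  have hq : (0 : ℝ) < q := by exact_mod_cast h.one_le
  rcases lt_or_gt_of_ne huv with hlt | hgt
  · have hM : φ ≤ θ / q := truncQ_le (by positivity) u
    have hbq : b ≤ q := countLt_le _ _ _
    have h1 : φ ^ 3 * b ^ 2 ≤ θ ^ 2 * φ := by
      have h2 : φ * b ≤ θ := by
        calc φ * b ≤ θ / q * q := by gcongr
          _ = θ := by field_simp
      have h3 : (φ * b) ^ 2 ≤ θ ^ 2 := pow_le_pow_left₀ (by positivity) h2 2
      calc φ ^ 3 * b ^ 2 = (φ * b) ^ 2 * φ := by ring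
        _ ≤ θ ^ 2 * φ := by gcongr
    refine (ENNReal.ofReal_le_ofReal h1).trans ?_
    rw [ENNReal.ofReal_mul (by positivity), ENNReal.ofReal_pow hθ0.le]
    exact (mul_le_mul' le_rfl hφQ).trans (sq_mul_quantile_le hθ (h.lt_of_lt u hu0 hlt))
  · have hR := h.le_of_lt u hgt hu1
    have hmin : min (RFun P Y δ Q u) (ENNReal.ofReal lam) = RFun P Y δ Q u :=
      min_eq_left (hR.trans (ENNReal.ofReal_le_ofReal hθ))
    have hbA : ENNReal.ofReal b ≤ alphaInv P Y δ u := ofReal_countLt_le hu0.le hu1 q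
    have hbφ : ENNReal.ofReal b * ENNReal.ofReal φ ≤ RFun P Y δ Q u :=
      mul_le_mul' hbA (hφQ.trans (le_max_left _ _))
    rw [majorant, hmin]
    calc ENNReal.ofReal (φ ^ 3 * b ^ 2) = ENNReal.ofReal φ * (ENNReal.ofReal b * ENNReal.ofReal φ) *
          (ENNReal.ofReal b * ENNReal.ofReal φ) := by
          rw [← ENNReal.ofReal_mul hb0, ← ENNReal.ofReal_mul hφ0,
            ← ENNReal.ofReal_mul (by positivity)]
          congr 1; ring
      _ ≤ _ := mul_le_mul' (mul_le_mul' hφQ hbφ) hbφ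

end Threshold

/-! ### Integral bounds by `M2` and `M3`. -/

theorem integral_le_toReal_lintegral {F : ℝ → ℝ} (mF : AEStronglyMeasurable F unitMeasure)
    (hF : ∀ u, 0 ≤ F u) {G : ℝ → ℝ≥0∞} (h : ∀ᵐ u ∂unitMeasure, ENNReal.ofReal (F u) ≤ G u)
    (hG : ∫⁻ u, G u ∂unitMeasure ≠ ∞) :
    Integrable F unitMeasure ∧ ∫ u, F u ∂unitMeasure ≤ (∫⁻ u, G u ∂unitMeasure).toReal := by
  have h1 := lintegral_mono_ae h
  have nF : 0 ≤ᵐ[unitMeasure] F := Eventually.of_forall hF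
  refine ⟨⟨mF, (hasFiniteIntegral_iff_ofReal nF).2 (h1.trans_lt hG.lt_top)⟩, ?_⟩
  rw [integral_eq_lintegral_of_nonneg_ae nF mF]
  exact ENNReal.toReal_mono hG h1

/-- `∫_0^a Q(u)² du`. -/
noncomputable def sqTail (Q : ℝ → ℝ≥0∞) (a : ℝ) : ℝ :=
  ∫ u, (Set.Iio a).indicator (fun u => (Q u).toReal ^ 2) u ∂unitMeasure

section IntegralBounds

set_option linter.unusedSectionVars false

variable {Ω : Type*} [mΩ : MeasurableSpace Ω] {P : Measure Ω} [IsProbabilityMeasure P]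
  {Y δ : ℤ → Ω → ℝ} {Q : ℝ → ℝ≥0∞}

theorem M3_eq (lam : ℝ) : M3 P Y δ Q lam = ∫⁻ u, majorant P Y δ Q lam u ∂unitMeasure := rfl

theorem M2_eq : M2 P Y δ Q = ∫⁻ u, Q u * RFun P Y δ Q u ∂unitMeasure :=
  lintegral_congr fun _ => mul_comm _ _

/-- The factor R ∧ lam is at most lam, so `M3` is at most lam times `M2`. -/
theorem M3_ne_top (h2 : M2 P Y δ Q ≠ ∞) (lam : ℝ) : M3 P Y δ Q lam ≠ ∞ := by
  refine ne_top_of_le_ne_top (ENNReal.mul_ne_top h2 (ENNReal.ofReal_ne_top (r := lam))) ?_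
  rw [M2_eq, M3_eq, ← lintegral_mul_const' _ _ ENNReal.ofReal_ne_top]
  exact lintegral_mono fun u => mul_le_mul' le_rfl (min_le_right _ _)

theorem ofReal_sq_mul_le (hQ : QuantileLike Q) {u b : ℝ} (hu : 0 < u)
    (hb : ENNReal.ofReal b ≤ alphaInv P Y δ u) :
    ENNReal.ofReal ((Q u).toReal ^ 2 * b) ≤ Q u * Q u * alphaInv P Y δ u := by
  rw [ENNReal.ofReal_mul (by positivity), ENNReal.ofReal_pow ENNReal.toReal_nonneg,
    ENNReal.ofReal_toReal (hQ.ne_top u hu), pow_two]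
  exact mul_le_mul' le_rfl hb

theorem integral_sq_mul_le (hQ : QuantileLike Q) (h2 : M2 P Y δ Q ≠ ∞) {b : ℝ → ℝ}
    (mb : Measurable b) (hb0 : ∀ u, 0 ≤ b u)
    (hb : ∀ u, 0 < u → u < 1 → ENNReal.ofReal (b u) ≤ alphaInv P Y δ u) :
    Integrable (fun u => (Q u).toReal ^ 2 * b u) unitMeasure ∧
      ∫ u, (Q u).toReal ^ 2 * b u ∂unitMeasure ≤ (M2 P Y δ Q).toReal := by
  rw [M2_eq] at h2 ⊢
  refine integral_le_toReal_lintegral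
    (((measurable_toReal hQ).pow_const 2).mul mb).aestronglyMeasurable
    (fun u => mul_nonneg (by positivity) (hb0 u)) ?_ h2
  filter_upwards [ae_unitMeasure] with u hu
  exact (ofReal_sq_mul_le hQ hu.1 (hb u hu.1 hu.2)).trans (sq_mul_alphaInv_le u)

theorem integrable_quantile_sq (hQ : QuantileLike Q) (h2 : M2 P Y δ Q ≠ ∞) :
    Integrable (fun u => |(Q u).toReal| ^ 2) unitMeasure := by
  have := (integral_sq_mul_le hQ h2 (b := fun _ => 1) measurable_const (fun _ => zero_le_one)
    fun u hu0 hu1 => by simpa using one_le_alphaInv hu0.le hu1).1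
  simpa using this

theorem sum_sqTail (hQ : QuantileLike Q) (h2 : M2 P Y δ Q ≠ ∞) (a : ℕ → ℝ) (s : Finset ℕ) :
    ∑ l ∈ s, sqTail Q (a l) =
      ∫ u, (Q u).toReal ^ 2 * ∑ l ∈ s, (Set.Iio (a l)).indicator 1 u ∂unitMeasure := by
  have hi := integrable_quantile_sq hQ h2
  simp only [sq_abs] at hi
  unfold sqTail
  rw [← integral_finsetSum _ fun l _ => hi.indicator measurableSet_Iio]
  congr 1; ext u
  rw [Finset.mul_sum]
  refine Finset.sum_congr rfl fun l _ => ?_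
  by_cases hu : u ∈ Set.Iio (a l) <;> simp [hu]

theorem sqTail_nonneg (a : ℝ) : 0 ≤ sqTail Q a :=
  integral_nonneg fun _ => Set.indicator_nonneg (fun _ _ => by positivity) _

/-- Exchanging sum and integral produces Q² times the number of rates above u, hence at most Q² α⁻¹
≤ Q R. -/
theorem sum_sqTail_le (hQ : QuantileLike Q) (h2 : M2 P Y δ Q ≠ ∞) (n : ℕ) :
    ∑ l ∈ Finset.range n, sqTail Q (mixRate P Y δ l) ≤ (M2 P Y δ Q).toReal := by
  rw [sum_sqTail hQ h2]
  exact (integral_sq_mul_le hQ h2 (measurable_countLt _ n) (countLt_nonneg _ n)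
    fun u hu0 hu1 => ofReal_countLt_le hu0.le hu1 n).2

theorem tailInt_two_truncQ_le (hQ : QuantileLike Q) (h2 : M2 P Y δ Q ≠ ∞) {M : ℝ} (hM : 0 ≤ M)
    (a : ℝ) : tailInt (truncQ Q M) 2 a ≤ sqTail Q a := by
  have hi := integrable_quantile_sq hQ h2
  simp only [sq_abs] at hi
  refine integral_mono_ae (((isTail_truncQ hQ.anti hM).bdd_indicator 2 a).integrable _)
    (hi.indicator measurableSet_Iio) ?_
  filter_upwards [ae_unitMeasure] with u hu
  refine Set.indicator_le_indicator ?_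
  rw [truncQ_eq hQ hM hu.1]
  exact pow_le_pow_left₀ (le_min ENNReal.toReal_nonneg hM) (min_le_left _ _) 2

theorem tailInt_const_mul (ψ : ℝ → ℝ) (r : ℝ) (k : ℕ) (a : ℝ) :
    tailInt (fun u => r * ψ u) k a = r ^ k * tailInt ψ k a := by
  unfold tailInt
  rw [← integral_const_mul]
  congr 1; ext u
  by_cases hu : u ∈ Set.Iio a <;> simp [hu, mul_pow]

theorem dblInt_const_mul (ψ : ℝ → ℝ) (r : ℝ) (k : ℕ) (a : ℕ → ℝ) (q : ℕ) :
    dblInt (fun u => r * ψ u) k a q = r ^ k * dblInt ψ k a q := by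
  simp only [dblInt, tailInt_const_mul, Finset.mul_sum]

theorem farInt_const_mul (ψ : ℝ → ℝ) (r : ℝ) (k : ℕ) (a : ℕ → ℝ) (q n : ℕ) :
    farInt (fun u => r * ψ u) k a q n = r ^ k * farInt ψ k a q n := by
  simp only [farInt, tailInt_const_mul, Finset.mul_sum]

theorem mul_integral_quantile_le_of_forall (hQ : QuantileLike Q) {θ lam : ℝ} (hθ0 : 0 < θ)
    (hθ : θ ≤ lam) (hG : M3 P Y δ Q lam ≠ ∞)
    (hR : ∀ u, 0 < u → u < 1 → ENNReal.ofReal θ < RFun P Y δ Q u) :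
    θ ^ 2 * ∫ u, (Q u).toReal ∂unitMeasure ≤ (M3 P Y δ Q lam).toReal := by
  rw [← integral_const_mul]
  refine (integral_le_toReal_lintegral ((measurable_toReal hQ).const_mul _).aestronglyMeasurable
    (fun u => mul_nonneg (by positivity) ENNReal.toReal_nonneg) ?_ hG).2
  filter_upwards [ae_unitMeasure] with u hu
  rw [ENNReal.ofReal_mul (by positivity), ENNReal.ofReal_pow hθ0.le,
    ENNReal.ofReal_toReal (hQ.ne_top u hu.1)]
  exact sq_mul_quantile_le hθ (hR u hu.1 hu.2)

namespace IsThreshold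

variable {θ v lam : ℝ} {q : ℕ}

/-- The function is supported to the left of v, where R > θ gives θ Q² α⁻¹ ≤ Q R (R ∧ lam). -/
theorem mul_integral_sq_le (h : IsThreshold P Y δ Q θ v q) (hQ : QuantileLike Q) (hθ0 : 0 < θ)
    (hθ : θ ≤ lam) (hG : M3 P Y δ Q lam ≠ ∞) {F b : ℝ → ℝ} (mF : Measurable F)
    (hF : ∀ u, 0 ≤ F u) (h0 : ∀ u, v < u → u < 1 → F u = 0)
    (hb : ∀ u, 0 < u → u < v → ENNReal.ofReal (b u) ≤ alphaInv P Y δ u)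
    (hFb : ∀ u, 0 < u → u < v → F u ≤ (Q u).toReal ^ 2 * b u) :
    θ * ∫ u, F u ∂unitMeasure ≤ (M3 P Y δ Q lam).toReal := by
  rw [← integral_const_mul]
  refine (integral_le_toReal_lintegral (mF.const_mul θ).aestronglyMeasurable
    (fun u => mul_nonneg hθ0.le (hF u)) ?_ hG).2
  have hne : ∀ᵐ u ∂unitMeasure, u ≠ v := ae_restrict_of_ae (Measure.ae_ne _ _)
  filter_upwards [ae_unitMeasure, hne] with u hu huv
  rcases lt_or_gt_of_ne huv with hlt | hgt
  · rw [ENNReal.ofReal_mul hθ0.le]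
    exact (mul_le_mul' le_rfl ((ENNReal.ofReal_le_ofReal (hFb u hu.1 hlt)).trans
      (ofReal_sq_mul_le hQ hu.1 (hb u hu.1 hlt)))).trans
      (mul_sq_mul_alphaInv_le hθ (h.lt_of_lt u hu.1 hlt))
  · simp [h0 u hgt hu.2]

theorem sq_mul_integral_le (h : IsThreshold P Y δ Q θ v q) (hQ : QuantileLike Q) (hθ0 : 0 < θ)
    (hθ : θ ≤ lam) (hG : M3 P Y δ Q lam ≠ ∞) {F : ℝ → ℝ} (mF : Measurable F)
    (hF : ∀ u, 0 ≤ F u) (h0 : ∀ u, v < u → u < 1 → F u = 0)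
    (hFb : ∀ u, 0 < u → u < v → F u ≤ (Q u).toReal) :
    θ ^ 2 * ∫ u, F u ∂unitMeasure ≤ (M3 P Y δ Q lam).toReal := by
  rw [← integral_const_mul]
  refine (integral_le_toReal_lintegral (mF.const_mul _).aestronglyMeasurable
    (fun u => mul_nonneg (by positivity) (hF u)) ?_ hG).2
  have hne : ∀ᵐ u ∂unitMeasure, u ≠ v := ae_restrict_of_ae (Measure.ae_ne _ _)
  filter_upwards [ae_unitMeasure, hne] with u hu huv
  rcases lt_or_gt_of_ne huv with hlt | hgt
  · rw [ENNReal.ofReal_mul (by positivity), ENNReal.ofReal_pow hθ0.le]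
    refine (mul_le_mul' le_rfl (ENNReal.ofReal_le_ofReal (hFb u hu.1 hlt))).trans ?_
    rw [ENNReal.ofReal_toReal (hQ.ne_top u hu.1)]
    exact sq_mul_quantile_le hθ (h.lt_of_lt u hu.1 hlt)
  · simp [h0 u hgt hu.2]

theorem rate_le_of_le (h : IsThreshold P Y δ Q θ v q) {l : ℕ} (hl : q ≤ l) :
    mixRate P Y δ l ≤ v := (mixRate_anti hl).trans h.rate_le

theorem toReal_quantile_le (h : IsThreshold P Y δ Q θ v q) (hθ0 : 0 < θ) {u : ℝ} (hu : v < u)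
    (hu1 : u < 1) : (Q u).toReal ≤ θ / q := by
  have := ENNReal.toReal_mono ENNReal.ofReal_ne_top (h.quantile_le u hu hu1)
  rwa [ENNReal.toReal_ofReal (by positivity)] at this

theorem excess_eq_zero (h : IsThreshold P Y δ Q θ v q) (hθ0 : 0 < θ) (k : ℕ) {u : ℝ} (hu : v < u)
    (hu1 : u < 1) : excess k (θ / q) (Q u).toReal = 0 := by
  unfold excess
  rw [abs_of_nonneg ENNReal.toReal_nonneg]
  exact max_eq_right (sub_nonpos.2 (pow_le_pow_left₀ ENNReal.toReal_nonneg
    (h.toReal_quantile_le hθ0 hu hu1) k))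

variable (h : IsThreshold P Y δ Q θ v q) (hQ : QuantileLike Q) (hθ0 : 0 < θ)
    (hθ : θ ≤ lam) (hG : M3 P Y δ Q lam ≠ ∞)

theorem truncQ_le_toReal (hQ : QuantileLike Q) {M u : ℝ} (hM : 0 ≤ M) (hu : 0 < u) :
    truncQ Q M u ≤ (Q u).toReal := by
  rw [truncQ_eq hQ hM hu]; exact min_le_left _ _

include h hQ hθ0 hθ hG

theorem dblInt_le : dblInt (truncQ Q (θ / q)) 3 (mixRate P Y δ) q ≤ (M3 P Y δ Q lam).toReal := by
  have ht := isTail_truncQ hQ.anti (M := θ / q) (by positivity)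
  rw [dblInt_eq_integral ht mixRate_anti]
  refine (integral_le_toReal_lintegral ((ht.bddMeas.1.pow_const 3).mul
    ((measurable_countLt _ q).pow_const 2)).aestronglyMeasurable
    (fun u => mul_nonneg (pow_nonneg (ht.nonneg u) 3) (sq_nonneg _)) ?_ hG).2
  have hne : ∀ᵐ u ∂unitMeasure, u ≠ v := ae_restrict_of_ae (Measure.ae_ne _ _)
  filter_upwards [ae_unitMeasure, hne] with u hu huv
  exact h.truncQ_cube_le hθ0 hθ hu.1 hu.2 huv

/-- Every rate of index at least q is at most v, so the whole sum is supported to the left of the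
threshold. -/
theorem mul_sum_sqTail_le (h2 : M2 P Y δ Q ≠ ∞) (N : ℕ) :
    θ * ∑ l ∈ Finset.range N, sqTail Q (mixRate P Y δ (max q l)) ≤ (M3 P Y δ Q lam).toReal := by
  rw [sum_sqTail hQ h2 (fun l => mixRate P Y δ (max q l))]
  have mI : Measurable fun u => ∑ l ∈ Finset.range N,
      (Set.Iio (mixRate P Y δ (max q l))).indicator (1 : ℝ → ℝ) u :=
    Finset.measurable_sum _ fun _ _ => measurable_one.indicator measurableSet_Iio
  refine h.mul_integral_sq_le hQ hθ0 hθ hG (((measurable_toReal hQ).pow_const 2).mul mI)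
    (b := countLt (mixRate P Y δ) N)
    (fun u => mul_nonneg (by positivity) (Finset.sum_nonneg fun _ _ =>
      Set.indicator_nonneg (fun _ _ => zero_le_one) _)) (fun u hu _ => ?_)
    (fun u hu0 hu => ofReal_countLt_le hu0.le (hu.trans h.lt_one) N) fun u _ _ => ?_
  · rw [Finset.sum_eq_zero fun l _ => Set.indicator_of_notMem (by
      simpa using (h.rate_le_of_le (le_max_left q l)).trans hu.le) _, mul_zero]
  · refine mul_le_mul_of_nonneg_left (Finset.sum_le_sum fun l _ => ?_) (by positivity)
    exact Set.indicator_le_indicator_of_subset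
      (Set.Iio_subset_Iio (mixRate_anti (le_max_right q l))) (fun _ => zero_le_one) u

theorem mul_farInt_le (h2 : M2 P Y δ Q ≠ ∞) (n : ℕ) :
    θ * farInt (truncQ Q (θ / q)) 2 (mixRate P Y δ) q n ≤ (M3 P Y δ Q lam).toReal := by
  refine le_trans ?_ (h.mul_sum_sqTail_le hQ hθ0 hθ hG h2 n)
  refine mul_le_mul_of_nonneg_left (Finset.sum_le_sum fun l _ => ?_) hθ0.le
  exact tailInt_two_truncQ_le hQ h2 (by positivity) _

theorem sq_mul_tailInt_le :
    θ ^ 2 * tailInt (truncQ Q (θ / q)) 1 (mixRate P Y δ q) ≤ (M3 P Y δ Q lam).toReal := by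
  have ht := isTail_truncQ hQ.anti (M := θ / q) (by positivity)
  refine h.sq_mul_integral_le hQ hθ0 hθ hG (ht.bdd_indicator 1 _).1
    (fun u => Set.indicator_nonneg (fun u _ => pow_nonneg (ht.nonneg u) 1) u) (fun u hu _ => ?_)
    fun u hu0 _ => ?_
  · exact Set.indicator_of_notMem (by simpa using h.rate_le.trans hu.le) _
  · refine (Set.indicator_le_self' (fun _ _ => pow_nonneg (ht.nonneg _) 1) u).trans ?_
    rw [pow_one]
    exact truncQ_le_toReal hQ (by positivity) hu0

theorem sq_mul_excess_le :
    θ ^ 2 * ∫ u, excess 1 (θ / q) (Q u).toReal ∂unitMeasure ≤ (M3 P Y δ Q lam).toReal := by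
  refine h.sq_mul_integral_le hQ hθ0 hθ hG ((measurable_excess 1 _).comp (measurable_toReal hQ))
    (fun u => excess_nonneg _ _ _) (fun u hu hu1 => h.excess_eq_zero hθ0 1 hu hu1) fun u _ _ => ?_
  have := excess_le_pow (k := 1) (T := θ / q) (by positivity) (Q u).toReal
  rwa [pow_one, abs_of_nonneg ENNReal.toReal_nonneg] at this

/-- To the right of v the quantile is below θ/q, so there is no excess; to the left, q is at most
α⁻¹. This absorbs the q covariances altered by truncation. -/
theorem mul_excess_le :
    θ * (q * ∫ u, excess 2 (θ / q) (Q u).toReal ∂unitMeasure) ≤ (M3 P Y δ Q lam).toReal := by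
  rw [← integral_const_mul]
  refine h.mul_integral_sq_le hQ hθ0 hθ hG
    (((measurable_excess 2 _).comp (measurable_toReal hQ)).const_mul _) (b := fun _ => q)
    (fun u => mul_nonneg (Nat.cast_nonneg _) (excess_nonneg _ _ _))
    (fun u hu hu1 => by rw [h.excess_eq_zero hθ0 2 hu hu1, mul_zero])
    (fun u hu0 hu => by simpa using h.le_alphaInv u hu0 hu) fun u _ _ => ?_
  rw [mul_comm]
  refine mul_le_mul_of_nonneg_right ?_ (Nat.cast_nonneg _)
  have := excess_le_pow (k := 2) (T := θ / q) (by positivity) (Q u).toReal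
  rwa [sq_abs] at this

/-- Centering doubled the tail function, which costs 2³, 2² and 2 in orders three, two and one; 14 =
8 + 4 + 2. Replacing θ by η lam costs at most η⁻². -/
theorem unitError_le (h2 : M2 P Y δ Q ≠ ∞) (n : ℕ) {η : ℝ} (hη0 : 0 < η) (hη1 : η ≤ 1)
    (hlam : 0 < lam) (e : θ = η * lam) :
    unitError (fun u => 2 * truncQ Q (θ / q) u) (mixRate P Y δ) lam q n ≤
      14 / η ^ 2 * ((M3 P Y δ Q lam).toReal / lam ^ 3) := by
  have h1 := h.dblInt_le hQ hθ0 hθ hG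
  have h3 := h.mul_farInt_le hQ hθ0 hθ hG h2 n
  have h4 := h.sq_mul_tailInt_le hQ hθ0 hθ hG
  have h0 : 0 ≤ (M3 P Y δ Q lam).toReal := ENNReal.toReal_nonneg
  set m := (M3 P Y δ Q lam).toReal
  set A := dblInt (truncQ Q (θ / q)) 3 (mixRate P Y δ) q
  set B := farInt (truncQ Q (θ / q)) 2 (mixRate P Y δ) q n
  set D := tailInt (truncQ Q (θ / q)) 1 (mixRate P Y δ q)
  have hη2 : η ^ 2 ≤ 1 := pow_le_one₀ hη0.le hη1
  have h3' : η ^ 2 * (lam * B) ≤ m := by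
    have : η ^ 2 * (lam * B) = η * (θ * B) := by rw [e]; ring
    rw [this]
    exact (mul_le_mul_of_nonneg_left h3 hη0.le).trans (mul_le_of_le_one_left h0 hη1)
  have h4' : η ^ 2 * (lam ^ 2 * D) ≤ m := by
    rw [e, mul_pow, mul_assoc] at h4; exact h4
  have h1' : η ^ 2 * A ≤ m :=
    (mul_le_mul_of_nonneg_left h1 (by positivity)).trans (mul_le_of_le_one_left h0 hη2)
  rw [unitError, dblInt_const_mul, farInt_const_mul, tailInt_const_mul]
  have e1 : 2 ^ 3 * A / lam ^ 3 + 2 ^ 2 * B / lam ^ 2 + 2 ^ 1 * D / lam =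
      (8 * A + 4 * (lam * B) + 2 * (lam ^ 2 * D)) / lam ^ 3 := by
    field_simp; ring
  have e2 : 14 / η ^ 2 * (m / lam ^ 3) = 14 * m / η ^ 2 / lam ^ 3 := by ring
  rw [e1, e2]
  gcongr
  rw [le_div_iff₀ (by positivity)]
  linarith

end IsThreshold

end IntegralBounds

/-! ### Covariances of the untruncated process and convergence of their series. -/

section Covariances

set_option linter.unusedSectionVars false

variable {Ω : Type*} [mΩ : MeasurableSpace Ω] {P : Measure Ω} [IsProbabilityMeasure P]
  {Y δ : ℤ → Ω → ℝ} {Q : ℝ → ℝ≥0∞} {f : ℝ → ℝ}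

theorem memLp_two_of_mem_closedClass {μ : Measure ℝ} [IsProbabilityMeasure μ]
    (hQ : QuantileLike Q) (hQ2 : Integrable (fun u => |(Q u).toReal| ^ 2) unitMeasure)
    (hf : f ∈ closedClass Q μ) : MemLp f 2 μ := by
  have := ((lMomDom_of_mem_closedClass hQ hf).integrable_pow hf.1.1.aemeasurable one_le_two hQ2).1
  simp only [sq_abs] at this
  exact (memLp_two_iff_integrable_sq hf.1.1).2 this

/-- The bound holds for truncated approximants, with 408 = 102 · 2² because of the doubled tail
function, and the approximation error vanishes as the truncation level tends to infinity. -/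
theorem abs_couplingCov_le (hY : ∀ i, Measurable (Y i)) (hδ : ∀ i, Measurable (δ i))
    (hst : IsStrictlyStationary P Y) (hQ : QuantileLike Q) (h2 : M2 P Y δ Q ≠ ∞)
    (hf : f ∈ closedClass Q (P.map (Y 0))) (l : ℕ) :
    |couplingCov (P.map (Y 0)) (pairLaw P Y l) f| ≤ 408 * sqTail Q (mixRate P Y δ l) := by
  have : IsProbabilityMeasure (P.map (Y 0)) :=
    Measure.isProbabilityMeasure_map (hY 0).aemeasurable
  have : IsProbabilityMeasure (processLaw P Y) :=
    Measure.isProbabilityMeasure_map (measurable_path hY).aemeasurable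
  have hQ2 := integrable_quantile_sq hQ h2
  have key : ∀ T : ℕ, |couplingCov (P.map (Y 0)) (pairLaw P Y l) f| ≤
      408 * sqTail Q (mixRate P Y δ l) +
        (4 * ∫ u, excess 2 ((T : ℝ) / 2) (Q u).toReal ∂unitMeasure + 1 / ((T : ℝ) + 1)) := by
    intro T
    have hT : (0 : ℝ) ≤ (T : ℝ) / 2 := by positivity
    obtain ⟨h, hh, -, -, hcov⟩ := exists_isHull_approx hQ hQ2 hf hT
      (ε := 1 / ((T : ℝ) + 1)) (by positivity)
    have h1 := hcov _ (isCoupling_pairLaw hY hst l)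
    have h3 := hh.abs_cov_le (pathMixing hY hδ hst) (isTail_truncQ hQ.anti hT).two_mul 0 l
    rw [integral_pathVar_mul hY hst hh.bdd, tailInt_const_mul] at h3
    have h4 := tailInt_two_truncQ_le hQ h2 hT (mixRate P Y δ l)
    have h5 := abs_sub_abs_le_abs_sub (couplingCov (P.map (Y 0)) (pairLaw P Y l) f)
      (couplingCov (P.map (Y 0)) (pairLaw P Y l) h)
    linarith
  have ht : Tendsto (fun T : ℕ => 408 * sqTail Q (mixRate P Y δ l) +
      (4 * ∫ u, excess 2 ((T : ℝ) / 2) (Q u).toReal ∂unitMeasure + 1 / ((T : ℝ) + 1))) atTop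
      (𝓝 (408 * sqTail Q (mixRate P Y δ l) + (4 * 0 + 0))) :=
    (((tendsto_integral_excess (measurable_toReal hQ) hQ2).const_mul 4).add
      tendsto_one_div_add_atTop_nhds_zero_nat).const_add _
  have := ge_of_tendsto' ht key
  linarith

/-- The covariance sequence is absolutely summable and its series is nonnegative. -/
theorem exists_tendsto_covSeries (hY : ∀ i, Measurable (Y i)) (hδ : ∀ i, Measurable (δ i))
    (hst : IsStrictlyStationary P Y) (hQ : QuantileLike Q) (h2 : M2 P Y δ Q ≠ ∞)
    (hf : f ∈ closedClass Q (P.map (Y 0))) :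
    ∃ σ, 0 ≤ σ ∧ Tendsto
      (covSeries fun l => couplingCov (P.map (Y 0)) (pairLaw P Y l) f) atTop (𝓝 (σ ^ 2)) := by
  have : IsProbabilityMeasure (P.map (Y 0)) :=
    Measure.isProbabilityMeasure_map (hY 0).aemeasurable
  set c : ℕ → ℝ := fun l => couplingCov (P.map (Y 0)) (pairLaw P Y l) f with hc
  have hsum : Summable c := by
    refine Summable.of_norm (summable_of_sum_range_le (c := 408 * (M2 P Y δ Q).toReal)
      (fun _ => norm_nonneg _) fun n => ?_)
    refine (Finset.sum_le_sum fun l _ => abs_couplingCov_le hY hδ hst hQ h2 hf l).trans ?_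
    rw [← Finset.mul_sum]
    exact mul_le_mul_of_nonneg_left (sum_sqTail_le hQ h2 n) (by norm_num)
  have ht : Tendsto (covSeries c) atTop (𝓝 (c 0 + 2 * ∑' l, c (l + 1))) :=
    ((((summable_nat_add_iff 1).2 hsum).hasSum.tendsto_sum_nat).const_mul 2).const_add _
  have hf2 := memLp_two_of_mem_closedClass hQ (integrable_quantile_sq hQ h2) hf
  have hX := fun (k : ℤ) (l : ℕ) => integral_XVar_mul hY hst hf2 k l
  have hint : ∀ i j : ℕ, Integrable (fun ω => XVar P Y f i ω * XVar P Y f j ω) P := by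
    intro i j
    rcases le_total i j with hij | hij
    · have := (hX i (j - i)).1
      rwa [Nat.cast_sub hij, add_sub_cancel] at this
    · have := (hX j (i - j)).1
      rw [Nat.cast_sub hij, add_sub_cancel] at this
      exact this.congr (Eventually.of_forall fun ω => mul_comm _ _)
  -- The Cesàro means of the partial series are E(S_n²)/n, so the limit is nonnegative.
  have hnn : 0 ≤ c 0 + 2 * ∑' l, c (l + 1) := by
    refine ge_of_tendsto' ht.cesaro fun n => mul_nonneg (by positivity) ?_
    rw [← integral_sum_sq (X := fun j => XVar P Y f j) hint (c := c) (fun j l => by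
      have := (hX j l).2
      simpa using this)]
    exact integral_nonneg fun _ => sq_nonneg _
  refine ⟨√(c 0 + 2 * ∑' l, c (l + 1)), Real.sqrt_nonneg _, ?_⟩
  rwa [Real.sq_sqrt hnn]

theorem abs_covSeries_sub_limit_le {c : ℕ → ℝ} {s T : ℝ} (ht : Tendsto (covSeries c) atTop (𝓝 s))
    {q : ℕ} (hT : ∀ N, ∑ l ∈ Finset.Ico q N, |c (l + 1)| ≤ T) :
    |covSeries c q - s| ≤ 2 * T := by
  refine le_of_tendsto (ht.const_sub (covSeries c q)).abs ?_
  filter_upwards [eventually_ge_atTop q] with N hN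
  rw [abs_sub_comm]
  exact (abs_covSeries_sub_le c hN).trans (by linarith [hT N])

/-- The missing lags all exceed q, so their rates lie below v, where the square tails sum to at most
`M3`/θ; 816 = 2 · 408. -/
theorem IsThreshold.abs_covSeries_sub_le (hY : ∀ i, Measurable (Y i)) (hδ : ∀ i, Measurable (δ i))
    (hst : IsStrictlyStationary P Y) (hQ : QuantileLike Q) (h2 : M2 P Y δ Q ≠ ∞)
    (hf : f ∈ closedClass Q (P.map (Y 0))) {θ v lam s : ℝ} {q : ℕ}
    (h : IsThreshold P Y δ Q θ v q) (hθ0 : 0 < θ) (hθ : θ ≤ lam)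
    (ht : Tendsto (covSeries fun l => couplingCov (P.map (Y 0)) (pairLaw P Y l) f) atTop (𝓝 s)) :
    |covSeries (fun l => couplingCov (P.map (Y 0)) (pairLaw P Y l) f) q - s| ≤
      816 * ((M3 P Y δ Q lam).toReal / θ) := by
  refine (abs_covSeries_sub_limit_le ht
    (T := 408 * ((M3 P Y δ Q lam).toReal / θ)) fun N => ?_).trans (le_of_eq (by ring))
  have h1 := h.mul_sum_sqTail_le hQ hθ0 hθ (M3_ne_top h2 lam) h2 (N + 1)
  rw [mul_comm, ← le_div_iff₀ hθ0] at h1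
  calc ∑ l ∈ Finset.Ico q N, |couplingCov (P.map (Y 0)) (pairLaw P Y (l + 1)) f|
      ≤ ∑ l ∈ Finset.Ico q N, 408 * sqTail Q (mixRate P Y δ (max q (l + 1))) :=
        Finset.sum_le_sum fun l hl => by
          rw [max_eq_right (by have := (Finset.mem_Ico.1 hl).1; omega)]
          exact abs_couplingCov_le hY hδ hst hQ h2 hf (l + 1)
    _ ≤ ∑ l ∈ Finset.range N, 408 * sqTail Q (mixRate P Y δ (max q (l + 1))) :=
        Finset.sum_le_sum_of_subset_of_nonneg
          (fun l hl => Finset.mem_range.2 (Finset.mem_Ico.1 hl).2)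
          fun l _ _ => mul_nonneg (by norm_num) (sqTail_nonneg _)
    _ ≤ ∑ l ∈ Finset.range (N + 1), 408 * sqTail Q (mixRate P Y δ (max q l)) := by
        rw [Finset.sum_range_succ' _ N]
        exact le_add_of_nonneg_right (mul_nonneg (by norm_num) (sqTail_nonneg _))
    _ ≤ _ := by
        rw [← Finset.mul_sum]
        gcongr

end Covariances

/-! ### Assembling the maximal inequality. -/

section MaximalInequality

set_option linter.unusedSectionVars false

variable {Ω : Type*} [mΩ : MeasurableSpace Ω] {P : Measure Ω} [IsProbabilityMeasure P]
  {Y δ : ℤ → Ω → ℝ} {Q : ℝ → ℝ≥0∞} {f : ℝ → ℝ}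

theorem partialSum_eq_sumTo (k : ℕ) :
    partialSum P Y f k = sumTo (fun j => XVar P Y f j) k := by
  ext ω
  unfold partialSum sumTo
  rw [Finset.range_eq_Ico, Finset.sum_Ico_add' (fun j : ℕ => XVar P Y f j ω) 0 k 1, zero_add]
  rfl

theorem integral_abs_XVar_sub_le (hY : ∀ i, Measurable (Y i)) (hst : IsStrictlyStationary P Y)
    {h : ℝ → ℝ} (hf : Integrable f (P.map (Y 0))) (hh : Integrable h (P.map (Y 0))) (i : ℤ) :
    Integrable (fun ω => |XVar P Y f i ω - pathVar (P.map (Y 0)) h i fun j => Y j ω|) P ∧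
      ∫ ω, |XVar P Y f i ω - pathVar (P.map (Y 0)) h i fun j => Y j ω| ∂P ≤
        2 * ∫ x, |f x - h x| ∂P.map (Y 0) := by
  have hmp : MeasurePreserving (Y i) P (P.map (Y 0)) := ⟨hY i, map_eq_map_zero hY hst i⟩
  set μ := P.map (Y 0)
  have hd : Integrable (fun x => f x - h x) μ := hf.sub_fun hh
  have e : ∀ ω, XVar P Y f i ω - pathVar μ h i (fun j => Y j ω) =
      (f (Y i ω) - h (Y i ω)) - ∫ x, (f x - h x) ∂μ := fun ω => by
    unfold XVar centered pathVar
    rw [hmp.integral_comp_ae hf.1, integral_sub hf hh]; ring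
  have i1 : Integrable (fun ω => f (Y i ω) - h (Y i ω)) P := hmp.integrable_comp_fun hd
  have i2 : Integrable (fun ω => (f (Y i ω) - h (Y i ω)) - ∫ x, (f x - h x) ∂μ) P :=
    i1.sub_fun (integrable_const _)
  simp only [e]
  refine ⟨i2.abs, ?_⟩
  calc ∫ ω, |(f (Y i ω) - h (Y i ω)) - ∫ x, (f x - h x) ∂μ| ∂P
      ≤ ∫ ω, (|f (Y i ω) - h (Y i ω)| + ∫ x, |f x - h x| ∂μ) ∂P :=
        integral_mono i2.abs (i1.abs.fun_add (integrable_const _)) fun ω =>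
          (abs_sub _ _).trans (add_le_add le_rfl abs_integral_le_integral_abs)
    _ = 2 * ∫ x, |f x - h x| ∂μ := by
        rw [integral_add i1.abs (integrable_const _), integral_const, probReal_univ, one_smul,
          hmp.integral_comp_ae (g := fun x => |f x - h x|) hd.abs.1]
        ring

/-- Comparison of the maximum of the partial sums with that of an approximating process. -/
theorem real_sup_le_add (hY : ∀ i, Measurable (Y i)) (hst : IsStrictlyStationary P Y)
    {h : ℝ → ℝ} (hf : Integrable f (P.map (Y 0))) (hh : Integrable h (P.map (Y 0)))
    {n : ℕ} (hn : 1 ≤ n) {lam : ℝ} (hlam : 0 < lam) :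
    P.real {ω | 5 * lam ≤ (Finset.Icc 1 n).sup' (Finset.nonempty_Icc.2 hn)
        (fun k => |partialSum P Y f k ω|)} ≤
      (processLaw P Y).real
        {ω | ∃ k ≤ n, 2 ≤ |sumTo (scaledVar (P.map (Y 0)) h lam n) k ω|} +
      n * (∫ x, |f x - h x| ∂P.map (Y 0)) / lam := by
  have : IsProbabilityMeasure (processLaw P Y) :=
    Measure.isProbabilityMeasure_map (measurable_path hY).aemeasurable
  set μ := P.map (Y 0) with hμ
  set A : Set (ℤ → ℝ) := {ω | ∃ k ≤ n, 2 ≤ |sumTo (scaledVar μ h lam n) k ω|} with hA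
  set D : Ω → ℝ := fun ω => ∑ i ∈ Finset.range n,
    |XVar P Y f (i + 1 : ℕ) ω - pathVar μ h (i + 1 : ℕ) fun j => Y j ω| with hD
  have hD1 := fun i : ℕ => integral_abs_XVar_sub_le hY hst hf hh ((i + 1 : ℕ) : ℤ)
  have iD : Integrable D P := integrable_finsetSum _ fun i _ => (hD1 i).1
  have hDle : ∫ ω, D ω ∂P ≤ n * (2 * ∫ x, |f x - h x| ∂μ) := by
    rw [hD, integral_finsetSum _ fun i _ => (hD1 i).1]
    refine (Finset.sum_le_sum fun i _ => (hD1 i).2).trans (le_of_eq ?_)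
    rw [Finset.sum_const, Finset.card_range, nsmul_eq_mul]
  -- Split 5 lam as 2 lam + 3 lam: either the approximating sums reach 2 lam, or the cumulated
  -- approximation error reaches 3 lam. In the second case Markov's inequality gives 2/3 of the
  -- stated term.
  have hsub : {ω | 5 * lam ≤ (Finset.Icc 1 n).sup' (Finset.nonempty_Icc.2 hn)
        (fun k => |partialSum P Y f k ω|)} ⊆
      ((fun ω (i : ℤ) => Y i ω) ⁻¹' A) ∪ {ω | 3 * lam ≤ D ω} := by
    intro ω hω
    rw [Set.mem_ofPred_eq, Finset.le_sup'_iff] at hω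
    obtain ⟨k, hk, hle⟩ := hω
    have hkn := (Finset.mem_Icc.1 hk).2
    rw [partialSum_eq_sumTo] at hle
    set U := ∑ i ∈ Finset.range k, pathVar μ h (i + 1 : ℕ) fun j => Y j ω with hU
    have e : sumTo (scaledVar μ h lam n) k (fun j => Y j ω) = U / lam := by
      unfold sumTo
      rw [hU, Finset.sum_div]
      refine Finset.sum_congr rfl fun i hi => ?_
      rw [scaledVar_of_le _ _ _ (by have := Finset.mem_range.1 hi; omega : i + 1 ≤ n)]
    by_cases hlt : 2 * lam ≤ |U|
    · left
      refine ⟨k, hkn, ?_⟩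
      rw [e, abs_div, abs_of_pos hlam, le_div_iff₀ hlam]
      exact hlt
    · right
      have h1 : |sumTo (fun j => XVar P Y f j) k ω - U| ≤ D ω := by
        unfold sumTo
        rw [hU, ← Finset.sum_sub_distrib]
        refine (Finset.abs_sum_le_sum_abs _ _).trans ?_
        exact Finset.sum_le_sum_of_subset_of_nonneg (Finset.range_subset_range.2 hkn)
          fun _ _ _ => abs_nonneg _
      have h2 := abs_sub_abs_le_abs_sub (sumTo (fun j => XVar P Y f j) k ω) U
      rw [Set.mem_ofPred_eq]
      push Not at hlt
      linarith
  have hmark := mul_meas_ge_le_integral_of_nonneg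
    (Eventually.of_forall fun ω => Finset.sum_nonneg fun _ _ => abs_nonneg _) iD (3 * lam)
  have hpath : P.real ((fun ω (i : ℤ) => Y i ω) ⁻¹' A) ≤ (processLaw P Y).real A :=
    ENNReal.toReal_mono (measure_ne_top _ _)
      (Measure.le_map_apply (measurable_path hY).aemeasurable A)
  have hd0 : 0 ≤ ∫ x, |f x - h x| ∂μ := integral_nonneg fun _ => abs_nonneg _
  refine (measureReal_mono hsub).trans ((measureReal_union_le _ _).trans (add_le_add hpath ?_))
  rw [le_div_iff₀ hlam]
  have h0 : 0 ≤ n * ∫ x, |f x - h x| ∂μ := by positivity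
  linarith

theorem abs_covSeries_sub_covSeries_le {c d : ℕ → ℝ} {r : ℝ} (h : ∀ l, |c l - d l| ≤ r) (q : ℕ) :
    |covSeries c q - covSeries d q| ≤ (1 + 2 * q) * r := by
  have e : covSeries c q - covSeries d q =
      (c 0 - d 0) + 2 * ∑ l ∈ Finset.range q, (c (l + 1) - d (l + 1)) := by
    unfold covSeries
    rw [Finset.sum_sub_distrib]; ring
  have h1 : |∑ l ∈ Finset.range q, (c (l + 1) - d (l + 1))| ≤ q * r := by
    refine (Finset.abs_sum_le_sum_abs _ _).trans ((Finset.sum_le_sum fun l _ => h (l + 1)).trans ?_)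
    simp
  rw [e]
  refine (abs_add_le _ _).trans ?_
  rw [abs_mul, abs_two]
  linarith [h 0]

/-- The inverse square of the truncation ratio attached to a cutoff bound. -/
noncomputable def ratioConst (K : ℝ) : ℝ := 1000 * (64 * (K + 1)) ^ 2

/-- The constant in front of the cubic term of the maximal inequality. -/
noncomputable def maximalConst (K : ℝ) : ℝ :=
  12000000 * (K + 1) * (gaussFourth + 1) * ratioConst K + 256 * (409 * (1 + ratioConst K)) ^ 2 +
    1 + ratioConst K

theorem maximalConst_pos {K : ℝ} (hK : 0 < K) : 0 < maximalConst K := by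
  have := gaussFourth_nonneg
  unfold maximalConst ratioConst
  positivity

/-- The process is truncated at M = η lam / q. The slack y pays for the arbitrarily small
approximation error ε in the closure and keeps the total error x positive; it is removed afterwards.
-/
theorem IsThreshold.real_sup_le (hY : ∀ i, Measurable (Y i)) (hδ : ∀ i, Measurable (δ i))
    (hst : IsStrictlyStationary P Y) (hQ : QuantileLike Q) (h2 : M2 P Y δ Q ≠ ∞)
    (hf : f ∈ closedClass Q (P.map (Y 0))) {F : ℕ → ℝ → ℝ} {K : ℝ} (hF : IsSmoothCutoff F K)
    {σ : ℝ} (ht : Tendsto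
      (covSeries fun l => couplingCov (P.map (Y 0)) (pairLaw P Y l) f) atTop (𝓝 (σ ^ 2)))
    {n : ℕ} (hn : 1 ≤ n) {lam : ℝ} (hlam : 0 < lam) {η v : ℝ} {q : ℕ}
    (hη : η = (64 * (K + 1))⁻¹) (h : IsThreshold P Y δ Q (η * lam) v q) {y : ℝ} (hy : 0 < y) :
    P.real {ω | 5 * lam ≤ (Finset.Icc 1 n).sup' (Finset.nonempty_Icc.2 hn)
        (fun k => |partialSum P Y f k ω|)} ≤
      (if σ = 0 then 0 else 8 * Real.exp (-(lam ^ 2 / (4 * n * σ ^ 2)))) +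
      maximalConst K * (n * ((M3 P Y δ Q lam).toReal / lam ^ 3) + y) := by
  have hK := hF.pos
  have hη0 : 0 < η := by rw [hη]; positivity
  have hη1 : η ≤ 1 := by
    rw [hη]; exact inv_le_one_of_one_le₀ (by linarith)
  have hKη : K * η ≤ 1 / 64 := by
    rw [hη, ← div_eq_mul_inv, div_le_div_iff₀ (by positivity) (by norm_num)]; linarith
  have hη64 : η ≤ 1 / 64 := by
    rw [hη, inv_le_comm₀ (by positivity) (by norm_num)]; linarith
  -- This is the smallness condition that keeps the correctors below 1/4, and the reason for η =
  -- 1/(64(K + 1)).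
  have hηK : K * (2 * η) + K * (3 * (2 * η) ^ 2) ≤ 1 / 4 := by nlinarith
  have hC : ratioConst K = 1000 / η ^ 2 := by rw [ratioConst, hη]; field_simp
  have hθ0 : 0 < η * lam := mul_pos hη0 hlam
  have hθ : η * lam ≤ lam := mul_le_of_le_one_left hlam.le hη1
  have hG := M3_ne_top h2 lam
  have hq : (1 : ℝ) ≤ q := by exact_mod_cast h.one_le
  have hn' : (1 : ℝ) ≤ n := by exact_mod_cast hn
  have : IsProbabilityMeasure (P.map (Y 0)) :=
    Measure.isProbabilityMeasure_map (hY 0).aemeasurable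
  have : IsProbabilityMeasure (processLaw P Y) :=
    Measure.isProbabilityMeasure_map (measurable_path hY).aemeasurable
  set m := (M3 P Y δ Q lam).toReal with hm
  have hm0 : 0 ≤ m := ENNReal.toReal_nonneg
  set M := η * lam / q with hM
  have hM0 : 0 ≤ M := by positivity
  -- The two entries bound the contribution of ε to the variance, where up to 3q copies occur for
  -- each of the n terms, and to the L¹ distance.
  set ε := min (y * lam ^ 2 / (3 * n * q)) (y * lam / n) with hε
  have hε0 : 0 < ε := lt_min (by positivity) (by positivity)
  have hε1 : 3 * n * q * ε ≤ y * lam ^ 2 := by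
    have := min_le_left (y * lam ^ 2 / (3 * n * q)) (y * lam / n)
    rw [← hε, le_div_iff₀ (by positivity)] at this
    linarith
  have hε2 : n * ε ≤ y * lam := by
    have := min_le_right (y * lam ^ 2 / (3 * n * q)) (y * lam / n)
    rw [← hε, le_div_iff₀ (by positivity)] at this
    linarith
  obtain ⟨g, hg, hgM, hg1, hgcov⟩ :=
    exists_isHull_approx hQ (integrable_quantile_sq hQ h2) hf hM0 hε0
  have hE1 := h.sq_mul_excess_le hQ hθ0 hθ hG
  have hE2 := h.mul_excess_le hQ hθ0 hθ hG
  set E1 := ∫ u, excess 1 M (Q u).toReal ∂unitMeasure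
  set E2 := ∫ u, excess 2 M (Q u).toReal ∂unitMeasure with hE2d
  have hE20 : 0 ≤ E2 := integral_nonneg fun _ => excess_nonneg _ _ _
  have hcov := fun l => hgcov _ (isCoupling_pairLaw hY hst l)
  have hσ := h.abs_covSeries_sub_le hY hδ hst hQ h2 hf hθ0 hθ ht
  -- Truncation changes each covariance by at most 4 E2 + ε, and 1 + 2q ≤ 3q of them occur; 828 =
  -- 816 + 3 · 4.
  have hσ' : |covSeries (fun l => couplingCov (P.map (Y 0)) (pairLaw P Y l) g) q - σ ^ 2| ≤
      828 * (m / (η * lam)) + 3 * q * ε := by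
    have h1 := abs_covSeries_sub_covSeries_le hcov q
    have h3 := abs_sub_le (covSeries (fun l => couplingCov (P.map (Y 0)) (pairLaw P Y l) g) q)
      (covSeries (fun l => couplingCov (P.map (Y 0)) (pairLaw P Y l) f) q) (σ ^ 2)
    rw [abs_sub_comm (covSeries (fun l => couplingCov (P.map (Y 0)) (pairLaw P Y l) g) q)
      (covSeries (fun l => couplingCov (P.map (Y 0)) (pairLaw P Y l) f) q)] at h3
    have h4 : (1 + 2 * (q : ℝ)) * (4 * E2 + ε) ≤ 3 * q * (4 * E2 + ε) := by
      refine mul_le_mul_of_nonneg_right (by linarith) (by positivity)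
    have h5 : q * E2 ≤ m / (η * lam) := by
      rw [le_div_iff₀ hθ0]; linarith
    linarith
  set x := n * (m / lam ^ 3) + y with hx
  have hm3 : 0 ≤ n * (m / lam ^ 3) := by positivity
  have hx0 : 0 < x := by positivity
  have hη2 : η ^ 2 ≤ η := by nlinarith
  have hη2' : η ^ 2 ≤ 1 := hη2.trans hη1
  have hC1 : 1000 ≤ ratioConst K := by
    rw [hC, le_div_iff₀ (by positivity)]; linarith
  have hA := hg.real_exists_two_le_of_variance (n := n) (lam := lam) (pathMixing hY hδ hst)
    (isTail_truncQ hQ.anti hM0).two_mul hF hgM (fun u => by linarith [truncQ_le (Q := Q) hM0 u])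
    hη1 hηK hlam h.one_le (by rw [hM]; field_simp; rfl)
    (fun k l => integral_pathVar_mul hY hst hg.bdd k l) (C₁ := ratioConst K) hσ' hx0
    (by linarith) (by
      have h1 := h.unitError_le hQ hθ0 hθ hG h2 n hη0 hη1 hlam rfl
      have h3 : 14 / η ^ 2 ≤ ratioConst K := by
        rw [hC]; gcongr; norm_num
      calc n * unitError (fun u => 2 * truncQ Q M u) (mixRate P Y δ) lam q n
          ≤ n * (14 / η ^ 2 * (m / lam ^ 3)) := by gcongr
        _ = 14 / η ^ 2 * (n * (m / lam ^ 3)) := by ring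
        _ ≤ ratioConst K * x := by
          refine mul_le_mul h3 (by linarith) (by positivity) (by linarith)) (by
      have h1 : 828 / η ≤ ratioConst K := by
        rw [hC]; gcongr; norm_num
      calc n * (828 * (m / (η * lam)) + 3 * q * ε)
          = 828 / η * (n * (m / lam ^ 3)) * lam ^ 2 + 3 * n * q * ε := by field_simp
        _ ≤ ratioConst K * (n * (m / lam ^ 3)) * lam ^ 2 + y * lam ^ 2 := by gcongr
        _ ≤ ratioConst K * (n * (m / lam ^ 3)) * lam ^ 2 + ratioConst K * (y * lam ^ 2) := by
          have h3 : y * lam ^ 2 ≤ ratioConst K * (y * lam ^ 2) :=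
            le_mul_of_one_le_left (by positivity) (by linarith)
          linarith
        _ = ratioConst K * x * lam ^ 2 := by rw [hx]; ring)
  have hB : n * (∫ z, |f z - g z| ∂P.map (Y 0)) / lam ≤ ratioConst K * x := by
    have h1 : n * (∫ z, |f z - g z| ∂P.map (Y 0)) ≤ n * (m / (η * lam) ^ 2 + ε) := by
      gcongr
      refine hg1.trans (add_le_add ?_ le_rfl)
      rw [le_div_iff₀ (by positivity)]; linarith
    rw [div_le_iff₀ hlam]
    have h3 : 1 / η ^ 2 ≤ ratioConst K := by
      rw [hC]; gcongr; norm_num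
    calc n * (∫ z, |f z - g z| ∂P.map (Y 0)) ≤ n * (m / (η * lam) ^ 2 + ε) := h1
      _ = 1 / η ^ 2 * (n * (m / lam ^ 3)) * lam + n * ε := by field_simp
      _ ≤ ratioConst K * (n * (m / lam ^ 3)) * lam + y * lam := by gcongr
      _ ≤ ratioConst K * (n * (m / lam ^ 3)) * lam + ratioConst K * (y * lam) := by
          have h4 : y * lam ≤ ratioConst K * (y * lam) :=
            le_mul_of_one_le_left (by positivity) (by linarith)
          linarith
      _ = ratioConst K * x * lam := by rw [hx]; ring
  refine (real_sup_le_add hY hst (memLp_one_iff_integrable.1 hf.1) (hg.bdd.integrable _) hn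
    hlam).trans ((add_le_add hA hB).trans (le_of_eq ?_))
  rw [maximalConst]; ring

/-- Without a crossing point, R > θ everywhere gives θ² Q ≤ Q R (R ∧ lam), so the crude bound n
E|f(Y_0)|/lam obtained by comparison with the zero process is already of the right order. -/
theorem real_sup_le_of_forall_lt (hY : ∀ i, Measurable (Y i))
    (hst : IsStrictlyStationary P Y) (hQ : QuantileLike Q) (h2 : M2 P Y δ Q ≠ ∞)
    (hf : f ∈ closedClass Q (P.map (Y 0))) {n : ℕ} (hn : 1 ≤ n) {lam θ : ℝ} (hlam : 0 < lam)
    (hθ0 : 0 < θ) (hθ : θ ≤ lam)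
    (hR : ∀ u, 0 < u → u < 1 → ENNReal.ofReal θ < RFun P Y δ Q u) :
    P.real {ω | 5 * lam ≤ (Finset.Icc 1 n).sup' (Finset.nonempty_Icc.2 hn)
        (fun k => |partialSum P Y f k ω|)} ≤
      n * ((M3 P Y δ Q lam).toReal / θ ^ 2) / lam := by
  have : IsProbabilityMeasure (P.map (Y 0)) :=
    Measure.isProbabilityMeasure_map (hY 0).aemeasurable
  have hQ2 := integrable_quantile_sq hQ h2
  simp only [sq_abs] at hQ2
  have hQ1 : Integrable (fun u => |(Q u).toReal| ^ 1) unitMeasure := by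
    simp only [pow_one]
    exact (((memLp_two_iff_integrable_sq (measurable_toReal hQ).aestronglyMeasurable).2
      hQ2).integrable one_le_two).abs
  have h1 := real_sup_le_add hY hst (h := fun _ => 0) (memLp_one_iff_integrable.1 hf.1)
    (integrable_const 0) hn hlam
  have hempty : {ω : ℤ → ℝ | ∃ k ≤ n,
      2 ≤ |sumTo (scaledVar (P.map (Y 0)) (fun _ => 0) lam n) k ω|} = ∅ := by
    ext ω; simp [sumTo, scaledVar, pathVar]
  rw [hempty, measureReal_empty, zero_add] at h1
  refine h1.trans ?_
  have h3 := ((lMomDom_of_mem_closedClass hQ hf).integrable_pow hf.1.1.aemeasurable le_rfl hQ1).2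
  simp only [pow_one, abs_of_nonneg ENNReal.toReal_nonneg] at h3
  have h4 := mul_integral_quantile_le_of_forall hQ hθ0 hθ (M3_ne_top h2 lam) hR
  simp only [sub_zero]
  gcongr
  refine h3.trans ?_
  rw [le_div_iff₀ (by positivity)]; linarith

theorem real_sup_le (hY : ∀ i, Measurable (Y i)) (hδ : ∀ i, Measurable (δ i))
    (hst : IsStrictlyStationary P Y) (hQ : QuantileLike Q) (h2 : M2 P Y δ Q ≠ ∞)
    (hf : f ∈ closedClass Q (P.map (Y 0))) {F : ℕ → ℝ → ℝ} {K : ℝ} (hF : IsSmoothCutoff F K)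
    {σ : ℝ} (ht : Tendsto
      (covSeries fun l => couplingCov (P.map (Y 0)) (pairLaw P Y l) f) atTop (𝓝 (σ ^ 2)))
    {n : ℕ} (hn : 1 ≤ n) {lam : ℝ} (hlam : 0 < lam) :
    P.real {ω | 5 * lam ≤ (Finset.Icc 1 n).sup' (Finset.nonempty_Icc.2 hn)
        (fun k => |partialSum P Y f k ω|)} ≤
      (if σ = 0 then 0 else 8 * Real.exp (-(lam ^ 2 / (4 * n * σ ^ 2)))) +
      maximalConst K * (n * ((M3 P Y δ Q lam).toReal / lam ^ 3)) := by
  have hK := hF.pos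
  have hg := gaussFourth_nonneg
  have hC := maximalConst_pos hK
  have hη0 : (0 : ℝ) < (64 * (K + 1))⁻¹ := by positivity
  have hη1 : (64 * (K + 1))⁻¹ ≤ (1 : ℝ) := inv_le_one_of_one_le₀ (by linarith)
  rcases exists_isThreshold (P := P) (Y := Y) (δ := δ) hQ (θ := (64 * (K + 1))⁻¹ * lam) with
    hR | ⟨v, q, h⟩
  · refine (real_sup_le_of_forall_lt hY hst hQ h2 hf hn hlam (mul_pos hη0 hlam)
      (mul_le_of_le_one_left hlam.le hη1) hR).trans ?_
    have hif : 0 ≤ (if σ = 0 then 0 else 8 * Real.exp (-(lam ^ 2 / (4 * n * σ ^ 2)))) := by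
      split_ifs <;> positivity
    have hm : 0 ≤ n * ((M3 P Y δ Q lam).toReal / lam ^ 3) := by positivity
    have hle : (64 * (K + 1)) ^ 2 ≤ maximalConst K := by
      unfold maximalConst ratioConst
      have h1 : 0 ≤ 12000000 * (K + 1) * (gaussFourth + 1) * (1000 * (64 * (K + 1)) ^ 2) := by
        positivity
      have h3 : 0 ≤ 256 * (409 * (1 + 1000 * (64 * (K + 1)) ^ 2)) ^ 2 := by positivity
      have h4 : 0 ≤ (64 * (K + 1)) ^ 2 := by positivity
      linarith
    calc n * ((M3 P Y δ Q lam).toReal / ((64 * (K + 1))⁻¹ * lam) ^ 2) / lam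
        = (64 * (K + 1)) ^ 2 * (n * ((M3 P Y δ Q lam).toReal / lam ^ 3)) := by field_simp
      _ ≤ maximalConst K * (n * ((M3 P Y δ Q lam).toReal / lam ^ 3)) := by gcongr
      _ ≤ _ := le_add_of_nonneg_left hif
  -- The slack is scaled by the constant in front of it and then sent to zero.
  · refine le_of_forall_pos_le_add fun y hy => ?_
    refine (h.real_sup_le hY hδ hst hQ h2 hf hF ht hn hlam rfl (y := y / maximalConst K)
      (by positivity)).trans (le_of_eq ?_)
    field_simp
    ring

theorem measure_sup_le (hY : ∀ i, Measurable (Y i)) (hδ : ∀ i, Measurable (δ i))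
    (hst : IsStrictlyStationary P Y) (hQ : QuantileLike Q) (h2 : M2 P Y δ Q ≠ ∞)
    (hf : f ∈ closedClass Q (P.map (Y 0))) {F : ℕ → ℝ → ℝ} {K : ℝ} (hF : IsSmoothCutoff F K)
    {σ : ℝ} (ht : Tendsto
      (covSeries fun l => couplingCov (P.map (Y 0)) (pairLaw P Y l) f) atTop (𝓝 (σ ^ 2)))
    {n : ℕ} (hn : 1 ≤ n) {lam : ℝ} (hlam : 0 < lam) :
    P {ω | 5 * lam ≤ (Finset.Icc 1 n).sup' (Finset.nonempty_Icc.2 hn)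
        (fun k => |partialSum P Y f k ω|)} ≤
      (if σ = 0 then 0
        else ENNReal.ofReal (8 * Real.exp (-(lam ^ 2 / (4 * n * σ ^ 2))))) +
      ENNReal.ofReal (maximalConst K * n / lam ^ 3) * M3 P Y δ Q lam := by
  have hC := maximalConst_pos hF.pos
  rw [← ofReal_measureReal, ← ENNReal.ofReal_toReal (M3_ne_top h2 lam)]
  refine (ENNReal.ofReal_le_ofReal (real_sup_le hY hδ hst hQ h2 hf hF ht hn hlam)).trans ?_
  refine ENNReal.ofReal_add_le.trans (add_le_add (le_of_eq ?_) (le_of_eq ?_))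
  · split_ifs <;> simp
  · rw [← ENNReal.ofReal_mul (by positivity)]
    congr 1; ring

end MaximalInequality

/-! ### Reduction to a quantile function that is nonincreasing on the whole line. -/

section Congruence

variable {Q Q' : ℝ → ℝ≥0∞} {Ω : Type*} [MeasurableSpace Ω] {P : Measure Ω} {Y δ : ℤ → Ω → ℝ}

theorem monClass_congr (h : ∀ u ∈ Set.Icc (0 : ℝ) 1, Q u = Q' u) (μ : Measure ℝ) :
    monClass Q μ = monClass Q' μ := by
  ext g
  refine and_congr_right fun _ => forall₂_congr fun u hu => ?_
  rw [h u hu]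

theorem closedClass_congr (h : ∀ u ∈ Set.Icc (0 : ℝ) 1, Q u = Q' u) (μ : Measure ℝ) :
    closedClass Q μ = closedClass Q' μ := by
  unfold closedClass monHull
  rw [monClass_congr h]

theorem RFun_congr {u : ℝ} (h : Q u = Q' u) : RFun P Y δ Q u = RFun P Y δ Q' u := by
  unfold RFun; rw [h]

theorem M2_congr (h : ∀ u ∈ Set.Icc (0 : ℝ) 1, Q u = Q' u) : M2 P Y δ Q = M2 P Y δ Q' :=
  setLIntegral_congr_fun measurableSet_Icc fun u hu => by
    simp only [RFun_congr (h u hu), h u hu]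

theorem M3_congr (h : ∀ u ∈ Set.Icc (0 : ℝ) 1, Q u = Q' u) (lam : ℝ) :
    M3 P Y δ Q lam = M3 P Y δ Q' lam :=
  setLIntegral_congr_fun measurableSet_Icc fun u hu => by
    simp only [RFun_congr (h u hu), h u hu]

theorem IsQuantileFunction.exists_quantileLike (hQ : IsQuantileFunction Q) :
    ∃ Q', QuantileLike Q' ∧ ∀ u ∈ Set.Icc (0 : ℝ) 1, Q u = Q' u := by
  obtain ⟨ν, hν, -, h⟩ := hQ
  exact ⟨upperQuantile ν fun x => x, ⟨upperQuantile_anti _ _,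
    fun _ hu => upperQuantile_ne_top measurable_id hu⟩, h⟩

end Congruence

theorem mainTheorem5 :
    ∃ c₁ c₂ c₃ c₄ : ℝ, 0 < c₁ ∧ 0 < c₂ ∧ 0 < c₃ ∧ 0 < c₄ ∧
      ∀ (Ω : Type*) [MeasurableSpace Ω] (P : Measure Ω) [IsProbabilityMeasure P]
        (Y δ : ℤ → Ω → ℝ)
        (_ : ∀ i, Measurable (Y i)) (_ : ∀ i, Measurable (δ i))
        (_ : IsStrictlyStationary P Y)
        (_ : ∀ i, P.map (δ i) = (volume : Measure ℝ).restrict (Set.Icc 0 1))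
        (_ : iIndepFun δ P)
        (_ : IndepFun (fun ω (i : ℤ) => Y i ω) (fun ω (i : ℤ) => δ i ω) P)
        (Q : ℝ → ℝ≥0∞) (_ : IsQuantileFunction Q)
        (_ : ∫⁻ u in Set.Icc (0 : ℝ) 1, Q u < ∞)
        (f : ℝ → ℝ) (_ : f ∈ closedClass Q (P.map (Y 0)))
        (_ : M2 P Y δ Q < ∞),
        (∀ k : ℕ, Integrable (fun ω => XVar P Y f 0 ω * XVar P Y f (k : ℤ) ω) P) ∧
        ∃ σ : ℝ, 0 ≤ σ ∧
          Tendsto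
            (fun N : ℕ => (∫ ω, XVar P Y f 0 ω ^ 2 ∂P) +
              2 * ∑ k ∈ Finset.Icc 1 N, ∫ ω, XVar P Y f 0 ω * XVar P Y f (k : ℤ) ω ∂P)
            atTop (𝓝 (σ ^ 2)) ∧
          ∀ (n : ℕ) (hn : 1 ≤ n) (lam : ℝ), 0 < lam →
            P {ω | 5 * lam ≤ (Finset.Icc 1 n).sup' (Finset.nonempty_Icc.2 hn)
                (fun k => |partialSum P Y f k ω|)} ≤
              (if σ = 0 then 0
                else ENNReal.ofReal (c₁ * Real.exp (-(lam ^ 2 / (c₂ * n * σ ^ 2))))) +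
              ENNReal.ofReal (c₃ * n / lam ^ 3) * M3 P Y δ Q lam +
              ENNReal.ofReal (c₄ * n * σ ^ 3 / lam ^ 3) := by
  obtain ⟨F, K, hF⟩ := exists_isSmoothCutoff
  -- The values 8 and 4 come from the stopped Lindeberg bound with V = 2nσ²/lam²; the cutoff, and
  -- with it K, is fixed once for all processes, so the constants are universal.
  refine ⟨8, 4, maximalConst K, 1, by norm_num, by norm_num, maximalConst_pos hF.pos, one_pos, ?_⟩
  intro Ω _ P _ Y δ hY hδ hst _ _ _ Q hQ _ f hf h2
  -- Q is prescribed only on [0, 1]; the full upper quantile of its law agrees with it there and is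
  -- nonincreasing on the line and finite on (0, ∞).
  obtain ⟨Q', hQ', hQQ'⟩ := hQ.exists_quantileLike
  rw [closedClass_congr hQQ'] at hf
  rw [M2_congr hQQ'] at h2
  have : IsProbabilityMeasure (P.map (Y 0)) :=
    Measure.isProbabilityMeasure_map (hY 0).aemeasurable
  have hf2 := memLp_two_of_mem_closedClass hQ' (integrable_quantile_sq hQ' h2.ne) hf
  have hX := fun k : ℕ => integral_XVar_mul hY hst hf2 0 k
  simp only [zero_add] at hX
  refine ⟨fun k => (hX k).1, ?_⟩
  obtain ⟨σ, hσ, ht⟩ := exists_tendsto_covSeries hY hδ hst hQ' h2.ne hf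
  refine ⟨σ, hσ, ht.congr fun N => ?_, fun n hn lam hlam => ?_⟩
  · have h0 := (hX 0).2
    simp only [Nat.cast_zero, ← pow_two] at h0
    simp only [(hX _).2, h0]
    unfold covSeries
    rw [Finset.range_eq_Ico, Finset.sum_Ico_add'
      (fun k : ℕ => couplingCov (P.map (Y 0)) (pairLaw P Y k) f) 0 N 1, zero_add]
    rfl
  · rw [M3_congr hQQ']
    -- The inequality holds without the σ³ term, so any positive c₄ will do.
    exact (measure_sup_le hY hδ hst hQ' h2.ne hf hF ht hn hlam).trans le_self_add
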